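/- **Setting.** Let $M$ be a compact smooth manifold with boundary, of dimension $n\ge1$, with boundary defining function $x$ (smooth on $M$, $x>0$ on the interior $M^\circ$, $x=0$ and $dx\ne0$ on $\partial M$), let $r=1/x$, and let $g$ be a Riemannian metric on $M^\circ$ such that $(M^\circ,g)$ is asymptotically conic: near every point of $\partial M$ there are smooth coordinates $(x,y_1,\dots,y_{n-1})$ on $M$ ("adapted coordinates") in which $g=\frac{dx^2}{x^4}+\frac{h(x,y,dy)}{x^2}$, with $h$ smooth up to the boundary and restricting to a metric on $\partial M$. Let $dg$ be the Riemannian measure, $D=-i\partial$, and let derivatives act in the sense of distributions on $M^\circ$. Fix $c>0$ such that $\{x\le c\}$ is covered by adapted coordinate systems, and a finite family of generators, all smooth up to the boundary as vector fields on $M$: * angular vector fields $Y_a$ on $M$, with $Y_a x=0$, which span $\ker dx$ at every point of $\{x\le c\}$; * interior vector fields $Z_b$ on $M$, which vanish on $\{x\le c\}$ and span the tangent space at every point of $\{x>c\}$; * a vector field $R$ on $M$ with $R=x\partial_x$ (in adapted coordinates) on $\{x\le c\}$. The module $\mathcal N$ is generated by the identity, the $Y_a$ and the $Z_b$. For $\gamma\in\mathbb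 R$, the module $\mathcal M_\gamma$ is generated by the identity, the $Y_a$, the $Z_b$ and $iR-\gamma/x$, which equals $r(D_r-\gamma)$ on $\{x\le c\}$. For $s\in\mathbb N_0$ and $\ell\in\mathbb R$, let $H^{s,\ell}$ be the weighted Sobolev space of those $v$ for which $Sv\in x^{\ell}L^2(M^\circ,dg)$ for every composition $S$ of at most $s$ of the scattering vector fields $xY_a,\ xZ_b,\ xR$, with the corresponding Hilbert norm. For $\kappa,k\in\mathbb N_0$ let $$H^{s,\ell;\kappa,k}_{\mathcal M_\gamma}=\{u: ABu\in H^{s,\ell}\},\qquad \|u\|^2_{H^{s,\ell;\kappa,k}_{\mathcal M_\gamma}}=\sum_{A,B}\|ABu\|_{H^{s,\ell}}^2,$$ where $A$ runs over the compositions of at most $\kappa$ of the above generators of $\mathcal M_\gamma$ (other than the identity) and $B$ over those of at most $k$ of the above generators of $\mathcal N$ (other than the identity). **Corollary 2.7.** Let $p\ge1$, $s\in\mathbb N_0$, $\kappa\ge1$ and $k\ge (n-1)/2$ be integers, let $\gamma_1,\dots,\gamma_{p+1}\in\mathbb R$ and $\ell_1,\dots,\ell_p\in\mathbb R$, and put $$\ell=\ell_1+\dots+\ell_p+\frac{(p-1)n}{2}-\kappa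 .$$ Then pointwise multiplication is a bounded multilinear map $$H^{s,\ell_1;\kappa,k}_{\mathcal M_{\gamma_1}}\times\cdots\times H^{s,\ell_p;\kappa,k}_{\mathcal M_{\gamma_p}}\longrightarrow H^{s,\ell;\kappa,k}_{\mathcal M_{\gamma_{p+1}}}:$$ there is a constant $C$ such that for all $u_j\in H^{s,\ell_j;\kappa,k}_{\mathcal M_{\gamma_j}}$ the pointwise product $u_1\cdots u_p$ lies in $H^{s,\ell;\kappa,k}_{\mathcal M_{\gamma_{p+1}}}$ and $$\|u_1\cdots u_p\|_{H^{s,\ell;\kappa,k}_{\mathcal M_{\gamma_{p+1}}}}\le C\prod_{j=1}^p\|u_j\|_{H^{s,\ell_j;\kappa,k}_{\mathcal M_{\gamma_j}}} .$$ -/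

import Mathlib

open scoped Manifold ContDiff NNReal ENNReal BigOperators
open MeasureTheory

namespace ScatteringProduct

noncomputable section

variable {n : ℕ} [NeZero n] {M : Type*} [TopologicalSpace M]
  [ChartedSpace (EuclideanHalfSpace n) M]

/-! ### Asymptotically conic manifolds -/

/-- A tangent vector at every point of `M`. -/
abbrev VField (n : ℕ) [NeZero n] (M : Type*) [TopologicalSpace M]
    [ChartedSpace (EuclideanHalfSpace n) M] : Type _ :=
  ∀ p : M, TangentSpace (𝓡∂ n) p

/-- A bilinear form on every tangent space of `M`. A scattering metric blows up at the boundary;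
only the values at interior points are ever used. -/
abbrev BilinField (n : ℕ) [NeZero n] (M : Type*) [TopologicalSpace M]
    [ChartedSpace (EuclideanHalfSpace n) M] : Type _ :=
  ∀ p : M, TangentSpace (𝓡∂ n) p →L[ℝ] TangentSpace (𝓡∂ n) p →L[ℝ] ℝ

/-- The coordinate vector field `∂_i` of the chart `φ` at a point `p` of its domain. The coordinates
are numbered `0, …, n - 1`, and `EuclideanHalfSpace n` is the half space on which coordinate `0` is
nonnegative. -/
def coordVec (φ : OpenPartialHomeomorph M (EuclideanHalfSpace n)) (i : Fin n) : VField n M :=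
  fun p => (mfderiv (𝓡∂ n) (𝓡∂ n) φ.symm (φ p) (EuclideanSpace.single i (1 : ℝ)) :
    EuclideanSpace ℝ (Fin n))

/-- The coefficients `g_{ij}` of a metric in the chart `φ`. -/
def gram (g : BilinField n M) (φ : OpenPartialHomeomorph M (EuclideanHalfSpace n)) (p : M) :
    Matrix (Fin n) (Fin n) ℝ :=
  Matrix.of fun i j => g p (coordVec φ i p) (coordVec φ j p)

/-- The derivative `V f` of a real function along a vector field. -/
def realDeriv (V : VField n M) (f : M → ℝ) (p : M) : ℝ :=
  mfderiv (𝓡∂ n) 𝓘(ℝ, ℝ) f p (V p)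

/-- The derivative `V f` of a complex function along a vector field. -/
def vderiv (V : VField n M) (f : M → ℂ) (p : M) : ℂ :=
  mfderiv (𝓡∂ n) 𝓘(ℝ, ℂ) f p (V p)

/-- `V` is smooth on `M`, up to the boundary. -/
def IsSmoothVField [IsManifold (𝓡∂ n) ∞ M] (V : VField n M) : Prop :=
  ContMDiff (𝓡∂ n) (𝓡∂ n).tangent ∞ (fun p => (⟨p, V p⟩ : TangentBundle (𝓡∂ n) M))

/-- `x` is a boundary defining function: smooth, positive in the interior, and vanishing to exactly
first order at the boundary. -/
structure IsBoundaryDefining (n : ℕ) [NeZero n] {M : Type*} [TopologicalSpace M]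
    [ChartedSpace (EuclideanHalfSpace n) M] (x : M → ℝ) : Prop where
  smooth : ContMDiff (𝓡∂ n) 𝓘(ℝ, ℝ) ∞ x
  pos : ∀ p ∈ (𝓡∂ n).interior M, 0 < x p
  eq_zero : ∀ p ∈ (𝓡∂ n).boundary M, x p = 0
  simple : ∀ p ∈ (𝓡∂ n).boundary M, mfderiv (𝓡∂ n) 𝓘(ℝ, ℝ) x p ≠ 0

/-- `g` is a smooth Riemannian metric on the interior of `M`. -/
structure IsInteriorMetric (g : BilinField n M) : Prop where
  symm : ∀ p ∈ (𝓡∂ n).interior M, ∀ v w, g p v w = g p w v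
  pos : ∀ p ∈ (𝓡∂ n).interior M, ∀ v, v ≠ 0 → 0 < g p v v
  smooth : ∀ φ ∈ IsManifold.maximalAtlas (𝓡∂ n) ∞ M, ∀ i j,
    ContMDiffOn (𝓡∂ n) 𝓘(ℝ, ℝ) ∞ (fun p => gram g φ p i j) (φ.source ∩ (𝓡∂ n).interior M)

/-- `φ` is an adapted coordinate system `(x, y_1, …, y_{n-1})`: its coordinate `0` is the boundary
defining function `x`, and on its domain
`g = dx² / x⁴ + h(x, y, dy) / x²`, with `h = ∑ h_{ij} dy_i dy_j` smooth up to the boundary and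
restricting to a metric on the boundary. -/
structure IsAdaptedChart (x : M → ℝ) (g : BilinField n M)
    (φ : OpenPartialHomeomorph M (EuclideanHalfSpace n)) : Prop where
  mem_atlas : φ ∈ IsManifold.maximalAtlas (𝓡∂ n) ∞ M
  coord_zero : ∀ p ∈ φ.source, (φ p).val 0 = x p
  metric_form : ∃ h : M → Matrix (Fin n) (Fin n) ℝ,
    (∀ i j, ContMDiffOn (𝓡∂ n) 𝓘(ℝ, ℝ) ∞ (fun p => h p i j) φ.source) ∧
    (∀ p ∈ φ.source, x p = 0 → ∀ v : Fin n → ℝ, v 0 = 0 → v ≠ 0 →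
      0 < ∑ i, ∑ j, h p i j * v i * v j) ∧
    (∀ p ∈ φ.source, 0 < x p →
      gram g φ p 0 0 = 1 / x p ^ 4 ∧
      (∀ j, j ≠ 0 → gram g φ p 0 j = 0) ∧
      (∀ i j, i ≠ 0 → j ≠ 0 → gram g φ p i j = h p i j / x p ^ 2))

/-- The interior of `M`, with the metric `g`, is an asymptotically conic manifold, with boundary
defining function `x` (so that `g = dr² + r² h(1/r, y, dy)` near infinity, where `r = 1/x`). -/
structure IsAsymptoticallyConic (x : M → ℝ) (g : BilinField n M) : Prop where
  boundaryDefining : IsBoundaryDefining n x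
  metric : IsInteriorMetric g
  adapted : ∀ p ∈ (𝓡∂ n).boundary M, ∃ φ, IsAdaptedChart x g φ ∧ p ∈ φ.source

/-- A smooth partition of unity subordinate to the domains of the preferred charts. -/
def chartPartition (n : ℕ) [NeZero n] (M : Type*) [TopologicalSpace M]
    [ChartedSpace (EuclideanHalfSpace n) M] [IsManifold (𝓡∂ n) ∞ M] [CompactSpace M] [T2Space M] :
    SmoothPartitionOfUnity M (𝓡∂ n) M Set.univ :=
  (SmoothPartitionOfUnity.exists_isSubordinate_chartAt_source (𝓡∂ n) M).choose

/-- The Riemannian measure `dg`, assembled with a partition of unity `∑ ρ_q = 1` from the local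
expressions `ρ_q √(det g_{ij}) dz_0 ⋯ dz_{n-1}` in charts. The boundary is a null set. -/
def riemannianMeasure [IsManifold (𝓡∂ n) ∞ M] [CompactSpace M] [T2Space M] [MeasurableSpace M]
    (g : BilinField n M) : Measure M :=
  Measure.sum fun q : M =>
    (((volume : Measure (EuclideanSpace ℝ (Fin n))).restrict
      (extChartAt (𝓡∂ n) q).target).withDensity fun z =>
        ENNReal.ofReal (chartPartition n M q ((extChartAt (𝓡∂ n) q).symm z) *
          √ (gram g (chartAt (EuclideanHalfSpace n) q) ((extChartAt (𝓡∂ n) q).symm z)).det)).map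
      (extChartAt (𝓡∂ n) q).symm

/-! ### Differential operators acting on distributions -/

/-- Test functions: smooth, with compact support in the interior (`M` itself is compact). -/
def IsTest (φ : M → ℂ) : Prop :=
  ContMDiff (𝓡∂ n) 𝓘(ℝ, ℂ) ∞ φ ∧ tsupport φ ⊆ (𝓡∂ n).interior M

/-- `P u = f` in the sense of distributions on the interior of `M`, for a differential operator `P`,
given by its action on smooth functions: `∫ f φ dμ = ∫ u (Pᵗ φ) dμ` for all test functions `φ`.
The test function `η = Pᵗ φ` is the one characterized by `∫ φ (P ψ) dμ = ∫ η ψ dμ` for all test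
functions `ψ`. -/
def IsWeakAction [MeasurableSpace M] (μ : Measure M) (P : (M → ℂ) → M → ℂ) (u f : M → ℂ) : Prop :=
  LocallyIntegrableOn u ((𝓡∂ n).interior M) μ ∧
  LocallyIntegrableOn f ((𝓡∂ n).interior M) μ ∧
  ∀ φ η : M → ℂ, IsTest (n := n) φ → IsTest (n := n) η →
    (∀ ψ : M → ℂ, IsTest (n := n) ψ → ∫ p, φ p * P ψ p ∂μ = ∫ p, η p * ψ p ∂μ) →
    ∫ p, f p * φ p ∂μ = ∫ p, u p * η p ∂μ

/-! ### The modules and their generators -/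

/-- A choice of generators of the modules, relative to a collar `{x ≤ c}` of the boundary:
finitely many purely angular vector fields, finitely many vector fields vanishing on `{x ≤ c}`,
and a radial vector field which is `x ∂_x` on the collar. -/
structure Generators [IsManifold (𝓡∂ n) ∞ M] (x : M → ℝ) (g : BilinField n M) where
  /-- the collar is `{x ≤ c}` -/
  c : ℝ
  c_pos : 0 < c
  collar : ∀ p, x p ≤ c → ∃ φ, IsAdaptedChart x g φ ∧ p ∈ φ.source
  /-- number of angular fields -/
  numAngular : ℕ
  /-- number of interior fields -/
  numInterior : ℕ
  angular : Fin numAngular → VField n M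
  interior : Fin numInterior → VField n M
  radial : VField n M
  angular_smooth : ∀ a, IsSmoothVField (angular a)
  interior_smooth : ∀ b, IsSmoothVField (interior b)
  radial_smooth : IsSmoothVField radial
  angular_tangent : ∀ a p, realDeriv (angular a) x p = 0
  angular_span : ∀ p, x p ≤ c → ∀ v : TangentSpace (𝓡∂ n) p,
    mfderiv (𝓡∂ n) 𝓘(ℝ, ℝ) x p v = 0 → v ∈ Submodule.span ℝ (Set.range fun a => angular a p)
  interior_supp : ∀ b p, x p ≤ c → interior b p = 0
  interior_span : ∀ p, c < x p → Submodule.span ℝ (Set.range fun b => interior b p) = ⊤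
  radial_eq : ∀ φ, IsAdaptedChart x g φ → ∀ p ∈ φ.source, x p ≤ c →
    radial p = x p • coordVec φ 0 p

namespace Generators

variable [IsManifold (𝓡∂ n) ∞ M] {x : M → ℝ} {g : BilinField n M}

/-- Labels of the generators of the small module `𝒩` (other than the identity). -/
abbrev NIdx (G : Generators x g) : Type := Fin G.numAngular ⊕ Fin G.numInterior

/-- Labels of the generators of `ℳ_γ` (other than the identity): those of `𝒩`, and `none` for the
radial one. -/
abbrev MIdx (G : Generators x g) : Type := Option G.NIdx

/-- All the generating vector fields; near the boundary they generate the b-vector fields. -/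
def field (G : Generators x g) : G.MIdx → VField n M
  | none => G.radial
  | some (.inl a) => G.angular a
  | some (.inr b) => G.interior b

/-- The generators of `𝒩`. -/
def opN (G : Generators x g) (i : G.NIdx) (u : M → ℂ) : M → ℂ :=
  vderiv (G.field (some i)) u

/-- The generators of `ℳ_γ`: those of `𝒩` and `r (D_r - γ) = - x D_x - γ / x`, where
`D = - i ∂`. -/
def opM (G : Generators x g) (γ : ℝ) : G.MIdx → (M → ℂ) → M → ℂ
  | none => fun u p => Complex.I * vderiv G.radial u p - ((γ / x p : ℝ) : ℂ) * u p
  | some i => G.opN i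

/-- Generators of the scattering vector fields: `x` times generators of the b-vector fields. -/
def opSc (G : Generators x g) (i : G.MIdx) (u : M → ℂ) : M → ℂ :=
  fun p => (x p : ℂ) * vderiv (G.field i) u p

end Generators

/-! ### Weighted Sobolev spaces with module regularity -/

/-- The composition `P_{w 0} ∘ P_{w 1} ∘ ⋯ ∘ P_{w (m-1)}`. -/
def compWord {ι : Type} (P : ι → (M → ℂ) → M → ℂ) {m : ℕ} (w : Fin m → ι) (u : M → ℂ) : M → ℂ :=
  (List.ofFn w).foldr P u

/-- The norm of `P u` in `x^ℓ L²(μ)`, where `P` acts in the sense of distributions; it is `∞` if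
`P u` does not belong to that space. -/
def weakNorm [MeasurableSpace M] (μ : Measure M) (x : M → ℝ) (ℓ : ℝ) (P : (M → ℂ) → M → ℂ)
    (u : M → ℂ) : ℝ≥0∞ :=
  ⨅ (f : M → ℂ) (_ : IsWeakAction (n := n) μ P u f),
    eLpNorm (fun p => ((x p ^ (-ℓ) : ℝ) : ℂ) * f p) 2 μ

variable [IsManifold (𝓡∂ n) ∞ M] [CompactSpace M] [T2Space M] [MeasurableSpace M]
  {x : M → ℝ} {g : BilinField n M}

/-- The norm of `H^{s,ℓ;κ,k}_{ℳ_γ}`, with value `∞` off the space: the square root of the sum of the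
squares of the `H^{s,ℓ}` norms of `A_{w₁} B_{w₂} u`, over compositions `A_{w₁}` of at most `κ`
generators of `ℳ_γ` and compositions `B_{w₂}` of at most `k` generators of `𝒩`. The `H^{s,ℓ}` norm
of a distribution `v`, for an integer `s ≥ 0`, is the square root of the sum of the squares of the
`x^ℓ L²(dg)` norms of `S_{w₀} v`, over compositions `S_{w₀}` of at most `s` generators of the
scattering vector fields. -/
def moduleNorm (G : Generators x g) (s : ℕ) (ℓ : ℝ) (κ k : ℕ) (γ : ℝ) (u : M → ℂ) : ℝ≥0∞ :=
  (∑ a : Fin (s + 1), ∑ w₀ : Fin a → G.MIdx,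
    ∑ b : Fin (κ + 1), ∑ w₁ : Fin b → G.MIdx,
      ∑ d : Fin (k + 1), ∑ w₂ : Fin d → G.NIdx,
        weakNorm (n := n) (riemannianMeasure g) x ℓ
          (fun ψ => compWord G.opSc w₀ (compWord (G.opM γ) w₁ (compWord G.opN w₂ ψ))) u ^ 2)
    ^ (1 / 2 : ℝ)

/-- `u ∈ H^{s,ℓ;κ,k}_{ℳ_γ}`. -/
def MemModule (G : Generators x g) (s : ℕ) (ℓ : ℝ) (κ k : ℕ) (γ : ℝ) (u : M → ℂ) : Prop :=
  moduleNorm G s ℓ κ k γ u < ⊤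

end

end ScatteringProduct

/-!
# Products in spaces of module regularity on asymptotically conic manifolds

The module `ℳ_γ` differs from `ℳ_0` by a conjugation with an oscillation: multiplication by
`e ^ (-iγ/x)` turns the generator `r (D_r - γ)` into `r D_r`. In the coordinates `t = - log x` and `y`
near the boundary, and in ordinary coordinates elsewhere, the generating fields span the coordinate
fields with coefficients smooth up to the boundary (`LocalModel`, `exists_localModel`), and the
Riemannian density is comparable to `x ^ (-n)`. Hence, multiplied by the function
`x ^ (-ℓ - n/2) e ^ (-iγ/x)` (`twist`), an element of `H^{s,ℓ;κ,k}_{ℳ_γ}` becomes a function of `(t, y)`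
with derivatives in `L²(dt dy)`: up to `κ + k` tangential ones, one of which may be replaced by `∂_t`
(`LocalModel.exists_weakSobolev`).

The analytic core is a bilinear estimate `‖F G‖ ≤ C ‖F‖ ‖G‖` in `L²(ℝⁿ)`, where `F` has `a` derivatives,
at most one of them along `t`, and `G` has `b` tangential ones only, with `a ≥ 1` and
`2 (a + b) ≥ n + 1` (`exists_bilinear_schwartz`, `exists_bilinear_weak`). On the Fourier side it is the
boundedness of the convolution of the reciprocal weights, that is, the convergence of the integral of
`⟨η⟩^{-2(a+b-1)} (⟨η⟩² + τ²)⁻¹` (`lintegral_tailSymbol_lt_top`). If the generators applied to a product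
are distributed among the two factors, the orders left add up to at least `κ + k ≥ (n + 1) / 2`, and
one of the factors has a letter of `ℳ_γ` left for the derivative `∂_t`; so each term is bounded, with
the weight `ℓ₁ + ℓ₂ + n / 2` (`exists_product_bound`).

The algebra consists of ordering compositions. The generators are closed under commutators up to
coefficients smooth up to the boundary (`exists_commutator`, `lOp_commutator`,
`lOp_sOp_commutator`): the singular term `γ / x` does no harm, because the radial field does not occur
in commutators near the boundary and the angular fields annihilate `x`. Therefore the span of the
ordered words is stable under further generators (`large_mul_mem_wordSpan`,
`small_mul_mem_wordSpan`). The Leibniz rule in the sense of distributions (`weakAct_field_mul`), in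
which the parameters `γ` of the factors add up, distributes a word over a product
(`splitsProduct_of_orderedWord`), and gives `exists_moduleBound_mul` and, by induction on the number of
factors, `exists_moduleBound_prod` in the module of parameter `γ₁ + ⋯ + γ_p`. Since `x` times a
generator of `ℳ_{γ'}` is in the module `ℳ_γ`, the passage to the parameter `γ_{p+1}` costs the weight
`x ^ κ` (`exists_moduleBound_change`); this is the loss in the exponent of the theorem.

Operators are linear maps on test functions (`TestOp`), so that compositions, commutators and ordered
words are identities in a ring, and they act on functions through their formal transposes (`WeakAct`).
-/

set_option linter.unusedSectionVars false

open scoped Manifold ContDiff NNReal ENNReal BigOperators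
open MeasureTheory

namespace ScatteringProduct

/-! ### Ordered words in a ring with a coefficient subring -/

section Words

variable {R ι ν : Type*} [Ring R]

/-- Ordered products: `m` letters among the `σ i`, then `a` letters among the `L i`, then `b` letters
among the `L (j i)`. -/
inductive OrderedWord (L σ : ι → R) (j : ν → ι) : ℕ → ℕ → ℕ → R → Prop
  | one : OrderedWord L σ j 0 0 0 1
  | small (i : ν) {b : ℕ} {w : R} :
      OrderedWord L σ j 0 0 b w → OrderedWord L σ j 0 0 (b + 1) (L (j i) * w)
  | large (i : ι) {a b : ℕ} {w : R} :
      OrderedWord L σ j 0 a b w → OrderedWord L σ j 0 (a + 1) b (L i * w)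
  | scat (i : ι) {m a b : ℕ} {w : R} :
      OrderedWord L σ j m a b w → OrderedWord L σ j (m + 1) a b (σ i * w)

/-- The left `A`-span of the ordered words with at most `m`, `a`, `b` letters of the three kinds. -/
def wordSpan (A : Subring R) (L σ : ι → R) (j : ν → ι) (m a b : ℕ) : AddSubgroup R :=
  AddSubgroup.closure {x | ∃ c ∈ A, ∃ m' ≤ m, ∃ a' ≤ a, ∃ b' ≤ b, ∃ w,
    OrderedWord L σ j m' a' b' w ∧ x = c * w}

/-- The left `A`-span of the identity and of the `L i`. -/
def linSpan (A : Subring R) (L : ι → R) : AddSubgroup R :=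
  AddSubgroup.closure ({x | x ∈ A} ∪ {x | ∃ c ∈ A, ∃ i, x = c * L i})

variable {A : Subring R} {L σ : ι → R} {j : ν → ι}

theorem wordSpan_mono {m a b m' a' b' : ℕ} (hm : m ≤ m') (ha : a ≤ a') (hb : b ≤ b') :
    wordSpan A L σ j m a b ≤ wordSpan A L σ j m' a' b' := by
  apply AddSubgroup.closure_mono
  rintro x ⟨c, hc, m₁, h₁, a₁, h₂, b₁, h₃, w, hw, rfl⟩
  exact ⟨c, hc, m₁, h₁.trans hm, a₁, h₂.trans ha, b₁, h₃.trans hb, w, hw, rfl⟩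

theorem OrderedWord.mem_wordSpan {m a b : ℕ} {w : R} (hw : OrderedWord L σ j m a b w) :
    w ∈ wordSpan A L σ j m a b :=
  AddSubgroup.subset_closure
    ⟨1, A.one_mem, m, le_rfl, a, le_rfl, b, le_rfl, w, hw, (one_mul w).symm⟩

theorem coeff_mul_mem_wordSpan {m a b : ℕ} {c x : R} (hc : c ∈ A)
    (hx : x ∈ wordSpan A L σ j m a b) : c * x ∈ wordSpan A L σ j m a b := by
  induction hx using AddSubgroup.closure_induction with
  | mem x hx =>
    obtain ⟨d, hd, m₁, h₁, a₁, h₂, b₁, h₃, w, hw, rfl⟩ := hx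
    exact AddSubgroup.subset_closure
      ⟨c * d, A.mul_mem hc hd, m₁, h₁, a₁, h₂, b₁, h₃, w, hw, (mul_assoc _ _ _).symm⟩
  | zero => simp
  | add x y _ _ hx hy => rw [mul_add]; exact add_mem hx hy
  | neg x _ hx => rw [mul_neg]; exact neg_mem hx

/-- To multiply the span by an operator that commutes with coefficients up to coefficients, it is
enough to multiply words. -/
theorem mul_mem_wordSpan_of_word {m a b m' a' b' : ℕ} {P : R}
    (hP : ∀ c ∈ A, P * c - c * P ∈ A) (hm : m ≤ m') (ha : a ≤ a') (hb : b ≤ b')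
    (h : ∀ m₁ ≤ m, ∀ a₁ ≤ a, ∀ b₁ ≤ b, ∀ w, OrderedWord L σ j m₁ a₁ b₁ w →
      P * w ∈ wordSpan A L σ j m' a' b') {x : R} (hx : x ∈ wordSpan A L σ j m a b) :
    P * x ∈ wordSpan A L σ j m' a' b' := by
  induction hx using AddSubgroup.closure_induction with
  | mem x hx =>
    obtain ⟨d, hd, m₁, h₁, a₁, h₂, b₁, h₃, w, hw, rfl⟩ := hx
    have : P * (d * w) = d * (P * w) + (P * d - d * P) * w := by noncomm_ring
    rw [this]
    exact add_mem (coeff_mul_mem_wordSpan hd (h m₁ h₁ a₁ h₂ b₁ h₃ w hw))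
      (coeff_mul_mem_wordSpan (hP d hd)
        (wordSpan_mono (h₁.trans hm) (h₂.trans ha) (h₃.trans hb) hw.mem_wordSpan))
  | zero => simp
  | add x y _ _ hx hy => rw [mul_add]; exact add_mem hx hy
  | neg x _ hx => rw [mul_neg]; exact neg_mem hx

theorem scat_mul_mem_wordSpan (hσA : ∀ i, ∀ c ∈ A, σ i * c - c * σ i ∈ A) (i : ι) {m a b : ℕ}
    {x : R} (hx : x ∈ wordSpan A L σ j m a b) : σ i * x ∈ wordSpan A L σ j (m + 1) a b :=
  mul_mem_wordSpan_of_word (hσA i) (Nat.le_succ m) le_rfl le_rfl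
    (fun _ h₁ _ h₂ _ h₃ _ hw =>
      wordSpan_mono (Nat.succ_le_succ h₁) h₂ h₃ (OrderedWord.scat i hw).mem_wordSpan) hx

/-- If the letters `P i` map `w` into the span, so do the combinations of the `P i` and the
identity. -/
theorem linSpan_mul_mem_wordSpan {m a b m' a' b' : ℕ} {P : ι → R} {y w : R}
    (hy : y ∈ linSpan A P) (hw : w ∈ wordSpan A L σ j m' a' b')
    (hP : ∀ i, P i * w ∈ wordSpan A L σ j m a b) (hm : m' ≤ m) (ha : a' ≤ a) (hb : b' ≤ b) :
    y * w ∈ wordSpan A L σ j m a b := by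
  induction hy using AddSubgroup.closure_induction with
  | mem y hy =>
    rcases hy with hy | ⟨c, hc, i, rfl⟩
    · exact coeff_mul_mem_wordSpan hy (wordSpan_mono hm ha hb hw)
    · rw [mul_assoc]; exact coeff_mul_mem_wordSpan hc (hP i)
  | zero => simp
  | add y z _ _ hy hz => rw [add_mul]; exact add_mem hy hz
  | neg y _ hy => rw [neg_mul]; exact neg_mem hy

variable (hLA : ∀ i, ∀ c ∈ A, L i * c - c * L i ∈ A)
  (hσA : ∀ i, ∀ c ∈ A, σ i * c - c * σ i ∈ A)
  (hLL : ∀ i k, L i * L k - L k * L i ∈ linSpan A L)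
  (hLσ : ∀ i k, L i * σ k - σ k * L i ∈ linSpan A σ)

include hLA hσA hLσ in
/-- The span of words is stable under the generators `L i`, at the cost of one such letter. -/
theorem large_mul_mem_wordSpan (i : ι) {m a b : ℕ} {x : R} (hx : x ∈ wordSpan A L σ j m a b) :
    L i * x ∈ wordSpan A L σ j m (a + 1) b := by
  refine mul_mem_wordSpan_of_word (hLA i) le_rfl (Nat.le_succ a) le_rfl ?_ hx
  intro m₁ h₁ a₁ h₂ b₁ h₃ w hw
  refine wordSpan_mono h₁ (Nat.succ_le_succ h₂) h₃ ?_
  clear h₁ h₂ h₃ hx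
  induction m₁ generalizing w with
  | zero => exact (OrderedWord.large i hw).mem_wordSpan
  | succ m₁ ih =>
    cases hw with
    | @scat k _ _ _ w hw =>
      have : L i * (σ k * w) = σ k * (L i * w) + (L i * σ k - σ k * L i) * w := by noncomm_ring
      rw [this]
      refine add_mem (scat_mul_mem_wordSpan hσA k (ih w hw)) ?_
      exact linSpan_mul_mem_wordSpan (hLσ i k) hw.mem_wordSpan
        (fun l => wordSpan_mono le_rfl (Nat.le_succ _) le_rfl
          (scat_mul_mem_wordSpan hσA l hw.mem_wordSpan))
        (Nat.le_succ _) (Nat.le_succ _) le_rfl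

include hLA hσA hLL hLσ in
/-- The span of words is stable under the generators `L (j i)`, at the cost of one such letter. -/
theorem small_mul_mem_wordSpan (i : ν) {m a b : ℕ} {x : R} (hx : x ∈ wordSpan A L σ j m a b) :
    L (j i) * x ∈ wordSpan A L σ j m a (b + 1) := by
  refine mul_mem_wordSpan_of_word (hLA _) le_rfl le_rfl (Nat.le_succ b) ?_ hx
  intro m₁ h₁ a₁ h₂ b₁ h₃ w hw
  refine wordSpan_mono h₁ h₂ (Nat.succ_le_succ h₃) ?_
  clear h₁ h₂ h₃ hx
  induction hw with
  | one => exact (OrderedWord.small i OrderedWord.one).mem_wordSpan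
  | small k hw _ => exact (OrderedWord.small i (OrderedWord.small k hw)).mem_wordSpan
  | @large k a b w hw ih =>
    have : L (j i) * (L k * w) = L k * (L (j i) * w) + (L (j i) * L k - L k * L (j i)) * w := by
      noncomm_ring
    rw [this]
    refine add_mem (large_mul_mem_wordSpan hLA hσA hLσ k ih) ?_
    exact linSpan_mul_mem_wordSpan (hLL _ k) hw.mem_wordSpan
      (fun l => wordSpan_mono le_rfl le_rfl (Nat.le_succ _)
        (large_mul_mem_wordSpan hLA hσA hLσ l hw.mem_wordSpan))
      le_rfl (Nat.le_succ _) (Nat.le_succ _)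
  | @scat k m a b w hw ih =>
    have : L (j i) * (σ k * w) = σ k * (L (j i) * w) + (L (j i) * σ k - σ k * L (j i)) * w := by
      noncomm_ring
    rw [this]
    refine add_mem (scat_mul_mem_wordSpan hσA k ih) ?_
    exact linSpan_mul_mem_wordSpan (hLσ _ k) hw.mem_wordSpan
      (fun l => wordSpan_mono le_rfl le_rfl (Nat.le_succ _)
        (scat_mul_mem_wordSpan hσA l hw.mem_wordSpan))
      (Nat.le_succ _) le_rfl (Nat.le_succ _)

end Words

/-! ### A bilinear estimate for anisotropic Sobolev norms -/

/-- The coordinate space of an `n`-dimensional manifold. -/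
abbrev Euc (n : ℕ) : Type := EuclideanSpace ℝ (Fin n)

/-- The `i`-th vector of the standard basis. -/
noncomputable abbrev stdVec {n : ℕ} (i : Fin n) : Euc n := EuclideanSpace.single i (1 : ℝ)

theorem eLpNorm_two_sq {α F : Type*} [MeasurableSpace α] [NormedAddCommGroup F] (μ : Measure α)
    (f : α → F) : eLpNorm f 2 μ ^ 2 = ∫⁻ x, ‖f x‖ₑ ^ 2 ∂μ := by
  have h := eLpNorm_nnreal_pow_eq_lintegral (μ := μ) (f := f) (p := 2) (by norm_num)
  have h2 : ((2 : ℝ≥0) : ℝ) = ((2 : ℕ) : ℝ) := by norm_num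
  simpa only [h2, ENNReal.rpow_natCast, ENNReal.coe_ofNat] using h

theorem lintegral_mul_sq_le {α : Type*} [MeasurableSpace α] (μ : Measure α) {u v : α → ℝ≥0∞}
    (hu : AEMeasurable u μ) (hv : AEMeasurable v μ) :
    (∫⁻ x, u x * v x ∂μ) ^ 2 ≤ (∫⁻ x, u x ^ 2 ∂μ) * ∫⁻ x, v x ^ 2 ∂μ := by
  have h := ENNReal.lintegral_mul_le_Lp_mul_Lq μ Real.HolderConjugate.two_two hu hv
  calc (∫⁻ x, u x * v x ∂μ) ^ 2
      ≤ ((∫⁻ x, u x ^ (2 : ℝ) ∂μ) ^ (1 / 2 : ℝ) * (∫⁻ x, v x ^ (2 : ℝ) ∂μ) ^ (1 / 2 : ℝ)) ^ 2 := by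
        gcongr; exact h
    _ = _ := by
        rw [mul_pow, ← ENNReal.rpow_natCast, ← ENNReal.rpow_natCast, ← ENNReal.rpow_mul,
          ← ENNReal.rpow_mul]
        norm_num

/-- The convolution of two functions in weighted `L²` spaces is in `L²`, if the convolution of the
reciprocals of the squares of the weights is bounded. -/
theorem lintegral_convolution_sq_le {E : Type*} [NormedAddCommGroup E] [MeasurableSpace E]
    [BorelSpace E] [SecondCountableTopology E] (μ : Measure E) [SFinite μ] [μ.IsAddLeftInvariant]
    {a b : E → ℝ≥0∞} (ha : Measurable a) (hb : Measurable b) {p q : E → ℝ≥0}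
    (hp : Measurable p) (hq : Measurable q) (hp0 : ∀ z, p z ≠ 0) (hq0 : ∀ z, q z ≠ 0) {K : ℝ≥0∞}
    (hK : ∀ ξ, ∫⁻ ζ, ((p ζ * q (ξ - ζ) : ℝ≥0) : ℝ≥0∞)⁻¹ ^ 2 ∂μ ≤ K) [μ.IsAddRightInvariant] :
    ∫⁻ ξ, (∫⁻ ζ, a ζ * b (ξ - ζ) ∂μ) ^ 2 ∂μ ≤
      K * ((∫⁻ ζ, (p ζ * a ζ) ^ 2 ∂μ) * ∫⁻ ζ, (q ζ * b ζ) ^ 2 ∂μ) := by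
  have key : ∀ ξ, (∫⁻ ζ, a ζ * b (ξ - ζ) ∂μ) ^ 2 ≤
      K * ∫⁻ ζ, (p ζ * a ζ) ^ 2 * (q (ξ - ζ) * b (ξ - ζ)) ^ 2 ∂μ := by
    intro ξ
    have h1 : ∀ ζ, a ζ * b (ξ - ζ) =
        ((p ζ * a ζ) * (q (ξ - ζ) * b (ξ - ζ))) * ((p ζ * q (ξ - ζ) : ℝ≥0) : ℝ≥0∞)⁻¹ := by
      intro ζ
      have h0 : ((p ζ * q (ξ - ζ) : ℝ≥0) : ℝ≥0∞) ≠ 0 := by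
        simpa using ⟨hp0 ζ, hq0 (ξ - ζ)⟩
      calc a ζ * b (ξ - ζ) = a ζ * b (ξ - ζ) *
            (((p ζ * q (ξ - ζ) : ℝ≥0) : ℝ≥0∞) * ((p ζ * q (ξ - ζ) : ℝ≥0) : ℝ≥0∞)⁻¹) := by
            rw [ENNReal.mul_inv_cancel h0 ENNReal.coe_ne_top, mul_one]
        _ = _ := by push_cast; ring
    simp_rw [h1]
    refine (lintegral_mul_sq_le μ (by fun_prop) (by fun_prop)).trans ?_
    rw [mul_comm K]
    simp_rw [mul_pow]
    gcongr
    simpa only [mul_pow] using hK ξ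
  calc ∫⁻ ξ, (∫⁻ ζ, a ζ * b (ξ - ζ) ∂μ) ^ 2 ∂μ
      ≤ ∫⁻ ξ, K * ∫⁻ ζ, (p ζ * a ζ) ^ 2 * (q (ξ - ζ) * b (ξ - ζ)) ^ 2 ∂μ ∂μ :=
        lintegral_mono key
    _ = K * ∫⁻ ξ, ∫⁻ ζ, (p ζ * a ζ) ^ 2 * (q (ξ - ζ) * b (ξ - ζ)) ^ 2 ∂μ ∂μ := by
        rw [lintegral_const_mul]
        exact Measurable.lintegral_prod_right (by fun_prop)
    _ = K * ∫⁻ ζ, ∫⁻ ξ, (p ζ * a ζ) ^ 2 * (q (ξ - ζ) * b (ξ - ζ)) ^ 2 ∂μ ∂μ := by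
        rw [lintegral_lintegral_swap]
        fun_prop
    _ = K * ∫⁻ ζ, (p ζ * a ζ) ^ 2 * ∫⁻ ξ, (q ξ * b ξ) ^ 2 ∂μ ∂μ := by
        congr 2 with ζ
        rw [lintegral_const_mul _ (by fun_prop)]
        congr 1
        exact lintegral_sub_right_eq_self (μ := μ) (fun ξ => (q ξ * b ξ) ^ 2) ζ
    _ = _ := by rw [lintegral_mul_const _ (by fun_prop)]

section Schwartz

open SchwartzMap FourierTransform LineDeriv

variable {n : ℕ}

theorem eLpNorm_fourier_eq (f : 𝓢(Euc n, ℂ)) :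
    eLpNorm (𝓕 f : 𝓢(Euc n, ℂ)) 2 volume = eLpNorm f 2 volume := by
  have h := SchwartzMap.norm_fourier_toL2_eq f
  rw [SchwartzMap.norm_toLp, SchwartzMap.norm_toLp] at h
  exact (ENNReal.toReal_eq_toReal_iff' ((𝓕 f : 𝓢(Euc n, ℂ)).memLp 2 volume).2.ne
    (f.memLp 2 volume).2.ne).1 h

theorem eLpNorm_fourierInv_eq (f : 𝓢(Euc n, ℂ)) :
    eLpNorm (𝓕⁻ f : 𝓢(Euc n, ℂ)) 2 volume = eLpNorm f 2 volume := by
  rw [← eLpNorm_fourier_eq (𝓕⁻ f), fourier_fourierInv_eq]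

/-- By Plancherel, the `L²` norm of a product of Schwartz functions is bounded by weighted `L²` norms
on the Fourier side. -/
theorem lintegral_mul_schwartz_le (f g : 𝓢(Euc n, ℂ)) {p q : Euc n → ℝ≥0}
    (hp : Measurable p) (hq : Measurable q) (hp0 : ∀ z, p z ≠ 0) (hq0 : ∀ z, q z ≠ 0) {K : ℝ≥0∞}
    (hK : ∀ ξ, ∫⁻ ζ, ((p ζ * q (ξ - ζ) : ℝ≥0) : ℝ≥0∞)⁻¹ ^ 2 ≤ K) :
    ∫⁻ z, ‖f z * g z‖ₑ ^ 2 ≤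
      K * ((∫⁻ ζ, (p ζ * ‖(𝓕⁻ f : 𝓢(Euc n, ℂ)) ζ‖ₑ) ^ 2) *
        ∫⁻ ζ, (q ζ * ‖(𝓕⁻ g : 𝓢(Euc n, ℂ)) ζ‖ₑ) ^ 2) := by
  set a : 𝓢(Euc n, ℂ) := 𝓕⁻ f with ha
  set b : 𝓢(Euc n, ℂ) := 𝓕⁻ g with hb
  set h : 𝓢(Euc n, ℂ) := SchwartzMap.convolution (ContinuousLinearMap.mul ℂ ℂ) a b with hh
  have h1 : ∀ z, f z * g z = (𝓕 h : 𝓢(Euc n, ℂ)) z := by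
    intro z
    rw [hh, SchwartzMap.fourier_convolution, SchwartzMap.pairing_apply_apply, ha, hb,
      fourier_fourierInv_eq, fourier_fourierInv_eq]
    rfl
  simp_rw [h1]
  rw [← eLpNorm_two_sq, eLpNorm_fourier_eq, eLpNorm_two_sq]
  refine le_trans (lintegral_mono fun ξ => ?_) (lintegral_convolution_sq_le volume
    (a := fun z => ‖a z‖ₑ) (b := fun z => ‖b z‖ₑ) a.continuous.measurable.enorm
    b.continuous.measurable.enorm hp hq hp0 hq0 hK)
  gcongr
  rw [hh, SchwartzMap.convolution_apply, MeasureTheory.convolution]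
  refine (enorm_integral_le_lintegral_enorm _).trans (lintegral_mono fun ζ => ?_)
  simp [enorm_mul]

/-- Iterated coordinate derivatives of a Schwartz function; the head of the list acts first. -/
noncomputable def wordDeriv : List (Fin n) → 𝓢(Euc n, ℂ) → 𝓢(Euc n, ℂ)
  | [], f => f
  | i :: w, f => wordDeriv w (∂_{(stdVec i : Euc n)} f)

/-- Derivatives become powers of the frequency; only `2 π ≥ 1` is used of the factor. -/
theorem enorm_fourierInv_wordDeriv (w : List (Fin n)) (f : 𝓢(Euc n, ℂ)) (ζ : Euc n) :
    ((w.map fun i => ‖ζ i‖₊).prod : ℝ≥0) * ‖(𝓕⁻ f : 𝓢(Euc n, ℂ)) ζ‖ₑ ≤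
      ‖(𝓕⁻ (wordDeriv w f) : 𝓢(Euc n, ℂ)) ζ‖ₑ := by
  induction w generalizing f with
  | nil => simp [wordDeriv]
  | cons i w ih =>
    refine le_trans ?_ (ih (∂_{(stdVec i : Euc n)} f))
    have h1 : ‖ζ i‖ₑ * ‖(𝓕⁻ f : 𝓢(Euc n, ℂ)) ζ‖ₑ ≤
        ‖(𝓕⁻ (∂_{(stdVec i : Euc n)} f) : 𝓢(Euc n, ℂ)) ζ‖ₑ := by
      have ht : (fun x : Euc n => inner ℝ x (stdVec i : Euc n)).HasTemperateGrowth :=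
        ((innerSL ℝ).flip (stdVec i : Euc n)).hasTemperateGrowth
      rw [SchwartzMap.fourierInv_lineDerivOp_eq, smul_apply,
        SchwartzMap.smulLeftCLM_apply_apply ht]
      have h2 : inner ℝ ζ (stdVec i : Euc n) = ζ i := by
        simp [EuclideanSpace.inner_single_right]
      rw [h2, enorm_smul, enorm_smul]
      have h3 : (1 : ℝ≥0∞) ≤ ‖-(2 * (Real.pi : ℂ) * Complex.I)‖ₑ := by
        rw [enorm_neg, ← ofReal_norm, ENNReal.one_le_ofReal]
        simp only [norm_mul, Complex.norm_ofNat, Complex.norm_real, Complex.norm_I, mul_one]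
        rw [Real.norm_of_nonneg Real.pi_pos.le]
        linarith [Real.pi_gt_three]
      calc ‖ζ i‖ₑ * ‖(𝓕⁻ f : 𝓢(Euc n, ℂ)) ζ‖ₑ
          = 1 * (‖ζ i‖ₑ * ‖(𝓕⁻ f : 𝓢(Euc n, ℂ)) ζ‖ₑ) := (one_mul _).symm
        _ ≤ _ := by gcongr
    calc ((((i :: w).map fun i => ‖ζ i‖₊).prod : ℝ≥0) : ℝ≥0∞) * ‖(𝓕⁻ f : 𝓢(Euc n, ℂ)) ζ‖ₑ
        = ((w.map fun i => ‖ζ i‖₊).prod : ℝ≥0) * (‖ζ i‖ₑ * ‖(𝓕⁻ f : 𝓢(Euc n, ℂ)) ζ‖ₑ) := by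
          simp only [List.map_cons, List.prod_cons, ENNReal.coe_mul]
          rw [enorm_eq_nnnorm (ζ i)]; ring
      _ ≤ _ := by gcongr

theorem lintegral_fourierInv_wordDeriv_le (w : List (Fin n)) (f : 𝓢(Euc n, ℂ)) :
    ∫⁻ ζ, (((w.map fun i => ‖ζ i‖₊).prod : ℝ≥0) * ‖(𝓕⁻ f : 𝓢(Euc n, ℂ)) ζ‖ₑ) ^ 2 ≤
      eLpNorm (wordDeriv w f) 2 volume ^ 2 := by
  rw [← eLpNorm_fourierInv_eq, eLpNorm_two_sq]
  gcongr with ζ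
  exact enorm_fourierInv_wordDeriv w f ζ

end Schwartz

section Weights

variable {n : ℕ} [NeZero n]

/-- The symbol `1 + |η|²`, where `η` consists of the coordinates other than the coordinate `0`. -/
noncomputable def tangSymbol (ζ : Euc n) : ℝ≥0 := 1 + ∑ i ∈ Finset.univ.erase 0, ‖ζ i‖₊ ^ 2

theorem one_le_tangSymbol (ζ : Euc n) : 1 ≤ tangSymbol ζ := le_self_add

@[fun_prop]
theorem continuous_tangSymbol : Continuous (tangSymbol (n := n)) := by
  unfold tangSymbol; fun_prop

omit [NeZero n] in
theorem integrable_prod_rpow {θ : ℝ} (hθ : 1 / 2 < θ) :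
    Integrable (fun ζ : Euc n => ∏ i, (1 + ζ i ^ 2) ^ (-θ)) volume := by
  have h1 : Integrable (fun t : ℝ => (1 + t ^ 2) ^ (-θ)) volume := by
    have := integrable_rpow_neg_one_add_norm_sq (E := ℝ) (μ := volume) (r := 2 * θ)
      (by simp; linarith)
    refine this.congr (Filter.Eventually.of_forall fun t => ?_)
    simp only [Real.norm_eq_abs, sq_abs]
    congr 1; ring
  have h2 := Integrable.fintype_prod (𝕜 := ℝ) (ι := Fin n) (E := ℝ)
    (f := fun _ t => (1 + t ^ 2) ^ (-θ)) (μ := fun _ => volume) (fun _ => h1)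
  exact ((PiLp.volume_preserving_ofLp (Fin n)).integrable_comp
    (h2.aestronglyMeasurable)).2 h2

/-- The symbol `⟨η⟩^{-2(m-1)} (⟨η⟩² + τ²)⁻¹`, where `τ` is the coordinate `0`: the reciprocal of the
squared weight of the larger of the two frequencies in the bilinear estimate. -/
noncomputable def tailSymbol (m : ℕ) (ζ : Euc n) : ℝ≥0∞ :=
  ((tangSymbol ζ ^ (m - 1) * (tangSymbol ζ + ‖ζ 0‖₊ ^ 2) : ℝ≥0) : ℝ≥0∞)⁻¹

/-- The symbol dominates a product of one-dimensional integrable weights. The total order `2 m ≥ n + 1`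
exceeds `n` by a unit, half of which is divided among the coordinates: each gets the exponent
`1 + 1 / (2 n)`. -/
theorem prod_rpow_le_tangSymbol {m : ℕ} (hm : n + 1 ≤ 2 * m) (ζ : Euc n) :
    ∏ i, (1 + ζ i ^ 2) ^ (1 / 2 + 1 / (4 * n : ℝ)) ≤
      (tangSymbol ζ : ℝ) ^ (m - 1) * (tangSymbol ζ + ζ 0 ^ 2) := by
  set θ : ℝ := 1 / 2 + 1 / (4 * n : ℝ) with hθ
  set q : ℝ := (tangSymbol ζ : ℝ) with hq
  have hn : (1 : ℝ) ≤ n := by exact_mod_cast NeZero.one_le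
  have hθ0 : 0 ≤ θ := by positivity
  have hθ1 : θ ≤ 3 / 4 := by
    have : 1 / (4 * n : ℝ) ≤ 1 / 4 := one_div_le_one_div_of_le (by norm_num) (by linarith)
    linarith
  have hq1 : 1 ≤ q := by exact_mod_cast one_le_tangSymbol ζ
  have hqi : ∀ i ∈ Finset.univ.erase (0 : Fin n), 1 + ζ i ^ 2 ≤ q := by
    intro i hi
    have h1 : ‖ζ i‖₊ ^ 2 ≤ ∑ i ∈ Finset.univ.erase 0, ‖ζ i‖₊ ^ 2 :=
      Finset.single_le_sum (f := fun i => ‖ζ i‖₊ ^ 2) (fun _ _ => zero_le) hi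
    have h2 : (1 + ‖ζ i‖₊ ^ 2 : ℝ≥0) ≤ tangSymbol ζ := by unfold tangSymbol; gcongr
    have h3 : ((1 + ‖ζ i‖₊ ^ 2 : ℝ≥0) : ℝ) ≤ q := by exact_mod_cast h2
    simpa using h3
  rw [← Finset.mul_prod_erase _ _ (Finset.mem_univ (0 : Fin n))]
  have hcard : ((Finset.univ.erase (0 : Fin n)).card : ℝ) = n - 1 := by
    rw [Finset.card_erase_of_mem (Finset.mem_univ _), Finset.card_univ, Fintype.card_fin,
      Nat.cast_sub NeZero.one_le, Nat.cast_one]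
  have h1 : ∏ i ∈ Finset.univ.erase (0 : Fin n), (1 + ζ i ^ 2) ^ θ ≤ q ^ ((m : ℝ) - 1 + 1 / 4) := by
    calc ∏ i ∈ Finset.univ.erase (0 : Fin n), (1 + ζ i ^ 2) ^ θ
        ≤ ∏ _i ∈ Finset.univ.erase (0 : Fin n), q ^ θ := by
          refine Finset.prod_le_prod (fun i _ => by positivity) fun i hi => ?_
          exact Real.rpow_le_rpow (by positivity) (hqi i hi) hθ0
      _ = q ^ (θ * (n - 1)) := by
          rw [Finset.prod_const, ← Real.rpow_natCast, ← Real.rpow_mul (by linarith), hcard]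
      _ ≤ _ := by
          refine Real.rpow_le_rpow_of_exponent_le hq1 ?_
          have hm' : (n : ℝ) + 1 ≤ 2 * m := by exact_mod_cast hm
          have h4 : 1 / (4 * n : ℝ) * (n - 1) ≤ 1 / 4 := by
            rw [div_mul_eq_mul_div, div_le_iff₀ (by positivity)]; linarith
          rw [hθ, add_mul]; linarith
  have hq0 : 0 < q := by linarith
  have h2 : (1 + ζ 0 ^ 2) ^ θ ≤ (q + ζ 0 ^ 2) ^ (3 / 4 : ℝ) :=
    (Real.rpow_le_rpow_of_exponent_le (by nlinarith [sq_nonneg (ζ 0)]) hθ1).trans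
      (Real.rpow_le_rpow (by positivity) (by linarith) (by norm_num))
  have hm1 : 1 ≤ m := by have := NeZero.one_le (n := n); omega
  calc (1 + ζ 0 ^ 2) ^ θ * ∏ i ∈ Finset.univ.erase (0 : Fin n), (1 + ζ i ^ 2) ^ θ
      ≤ (q + ζ 0 ^ 2) ^ (3 / 4 : ℝ) * q ^ ((m : ℝ) - 1 + 1 / 4) :=
        mul_le_mul h2 h1 (Finset.prod_nonneg fun i _ => by positivity) (by positivity)
    _ = q ^ (m - 1) * ((q + ζ 0 ^ 2) ^ (3 / 4 : ℝ) * q ^ (1 / 4 : ℝ)) := by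
        rw [Real.rpow_add hq0, ← Nat.cast_pred (by omega), Real.rpow_natCast]; ring
    _ ≤ q ^ (m - 1) * ((q + ζ 0 ^ 2) ^ (3 / 4 : ℝ) * (q + ζ 0 ^ 2) ^ (1 / 4 : ℝ)) := by
        gcongr; nlinarith [sq_nonneg (ζ 0)]
    _ = _ := by
        rw [← Real.rpow_add (by positivity)]; norm_num

/-- The convolution of the reciprocal weights converges as soon as `2 m > n`. -/
theorem lintegral_tailSymbol_lt_top {m : ℕ} (hm : n + 1 ≤ 2 * m) :
    ∫⁻ ζ : Euc n, tailSymbol m ζ < ⊤ := by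
  have hn : (0 : ℝ) < n := by exact_mod_cast NeZero.pos n
  have h := (integrable_prod_rpow (n := n) (θ := 1 / 2 + 1 / (4 * n : ℝ))
    (by have : 0 < 1 / (4 * n : ℝ) := by positivity
        linarith)).lintegral_lt_top
  refine lt_of_le_of_lt (lintegral_mono fun ζ => ?_) h
  have hpos : 0 < ∏ i, (1 + ζ i ^ 2) ^ (1 / 2 + 1 / (4 * n : ℝ)) :=
    Finset.prod_pos fun i _ => by positivity
  have h1 : ∏ i, (1 + ζ i ^ 2) ^ (-(1 / 2 + 1 / (4 * n : ℝ))) =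
      (∏ i, (1 + ζ i ^ 2) ^ (1 / 2 + 1 / (4 * n : ℝ)))⁻¹ := by
    rw [← Finset.prod_inv_distrib]
    exact Finset.prod_congr rfl fun i _ => Real.rpow_neg (by positivity) _
  rw [h1, ENNReal.ofReal_inv_of_pos hpos, tailSymbol]
  refine ENNReal.inv_le_inv.2 ?_
  rw [← ENNReal.ofReal_coe_nnreal]
  refine ENNReal.ofReal_le_ofReal ?_
  simpa using prod_rpow_le_tangSymbol hm ζ

/-- The weight whose square dominates `∂_y^{≤ a}` and `∂_t ∂_y^{≤ a - 1}`, where `t` is the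
coordinate `0`. -/
noncomputable def radialWeight (a : ℕ) (ζ : Euc n) : ℝ≥0 :=
  NNReal.sqrt (tangSymbol ζ ^ (a - 1) * (tangSymbol ζ + ‖ζ 0‖₊ ^ 2))

/-- The weight whose square dominates `∂_y^{≤ b}`. -/
noncomputable def tangWeight (b : ℕ) (ζ : Euc n) : ℝ≥0 := NNReal.sqrt (tangSymbol ζ ^ b)

theorem radialWeight_ne_zero (a : ℕ) (ζ : Euc n) : radialWeight a ζ ≠ 0 := by
  have := one_le_tangSymbol ζ
  unfold radialWeight
  rw [Ne, NNReal.sqrt_eq_zero]; positivity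

theorem tangWeight_ne_zero (a : ℕ) (ζ : Euc n) : tangWeight a ζ ≠ 0 := by
  have := one_le_tangSymbol ζ
  unfold tangWeight
  rw [Ne, NNReal.sqrt_eq_zero]; positivity

theorem measurable_radialWeight (a : ℕ) : Measurable (radialWeight (n := n) a) := by
  unfold radialWeight; exact Continuous.measurable (by fun_prop)

theorem measurable_tangWeight (a : ℕ) : Measurable (tangWeight (n := n) a) := by
  unfold tangWeight; exact Continuous.measurable (by fun_prop)

/-- One of the two tangential symbols is the smaller one, and takes all the powers. The radial
variable is unaffected by the translation. -/
theorem inv_weight_sq_le {a b : ℕ} (ha : 1 ≤ a) (ζ ξ : Euc n) :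
    ((radialWeight a ζ * tangWeight b (ξ - ζ) : ℝ≥0) : ℝ≥0∞)⁻¹ ^ 2 ≤
      tailSymbol (a + b) ζ + tailSymbol (a + b) (ζ - (ξ - EuclideanSpace.single 0 (ξ 0))) := by
  have hq := one_le_tangSymbol ζ
  have hq' := one_le_tangSymbol (ξ - ζ)
  have htr : tangSymbol (ζ - (ξ - EuclideanSpace.single 0 (ξ 0))) = tangSymbol (ξ - ζ) := by
    unfold tangSymbol
    congr 1
    refine Finset.sum_congr rfl fun i hi => ?_
    have hi0 : i ≠ 0 := Finset.ne_of_mem_erase hi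
    simp only [PiLp.sub_apply, PiLp.single_apply, hi0, if_false, sub_zero]
    rw [← nnnorm_neg, neg_sub]
  have h0 : ‖(ζ - (ξ - EuclideanSpace.single 0 (ξ 0)) : Euc n) 0‖₊ = ‖ζ 0‖₊ := by simp
  have hsq : ((radialWeight a ζ * tangWeight b (ξ - ζ) : ℝ≥0) : ℝ≥0∞)⁻¹ ^ 2 =
      ((tangSymbol ζ ^ (a - 1) * (tangSymbol ζ + ‖ζ 0‖₊ ^ 2) * tangSymbol (ξ - ζ) ^ b : ℝ≥0) :
        ℝ≥0∞)⁻¹ := by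
    rw [← ENNReal.inv_pow, ← ENNReal.coe_pow, mul_pow, radialWeight, tangWeight, NNReal.sq_sqrt,
      NNReal.sq_sqrt]
  rw [hsq]
  have hab : a + b - 1 = (a - 1) + b := by omega
  rcases le_total (tangSymbol ζ) (tangSymbol (ξ - ζ)) with h | h
  · refine le_trans ?_ le_self_add
    unfold tailSymbol
    refine ENNReal.inv_le_inv.2 (ENNReal.coe_le_coe.2 ?_)
    rw [hab, pow_add]
    calc _ = tangSymbol ζ ^ (a - 1) * (tangSymbol ζ + ‖ζ 0‖₊ ^ 2) * tangSymbol ζ ^ b := by ring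
      _ ≤ _ := by gcongr
  · refine le_trans ?_ le_add_self
    unfold tailSymbol
    refine ENNReal.inv_le_inv.2 (ENNReal.coe_le_coe.2 ?_)
    rw [htr, h0, hab, pow_add]
    calc _ = tangSymbol (ξ - ζ) ^ (a - 1) * (tangSymbol (ξ - ζ) + ‖ζ 0‖₊ ^ 2) *
          tangSymbol (ξ - ζ) ^ b := by ring
      _ ≤ _ := by gcongr

theorem exists_bound_inv_weight {a b : ℕ} (ha : 1 ≤ a) (hab : n + 1 ≤ 2 * (a + b)) :
    ∃ K : ℝ≥0, ∀ ξ : Euc n,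
      ∫⁻ ζ, ((radialWeight a ζ * tangWeight b (ξ - ζ) : ℝ≥0) : ℝ≥0∞)⁻¹ ^ 2 ≤ K := by
  have h := lintegral_tailSymbol_lt_top (n := n) hab
  refine ⟨(∫⁻ ζ : Euc n, tailSymbol (a + b) ζ).toNNReal +
    (∫⁻ ζ : Euc n, tailSymbol (a + b) ζ).toNNReal, fun ξ => ?_⟩
  rw [ENNReal.coe_add, ENNReal.coe_toNNReal h.ne]
  calc _ ≤ ∫⁻ ζ : Euc n, (tailSymbol (a + b) ζ +
        tailSymbol (a + b) (ζ - (ξ - EuclideanSpace.single 0 (ξ 0)))) :=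
        lintegral_mono fun ζ => inv_weight_sq_le ha ζ ξ
    _ = _ := by
        have hm : Measurable (tailSymbol (n := n) (a + b)) := by
          unfold tailSymbol
          exact Measurable.inv (Continuous.measurable (by fun_prop))
        rw [lintegral_add_left hm, lintegral_sub_right_eq_self (μ := volume)
          (fun ζ => tailSymbol (n := n) (a + b) ζ)]

/-- Pure powers of single tangential derivatives control all tangential derivatives. -/
theorem tangSymbol_pow_le (m : ℕ) (ζ : Euc n) :
    tangSymbol ζ ^ m ≤ n ^ m * (1 + ∑ i ∈ Finset.univ.erase 0, (‖ζ i‖₊ ^ m) ^ 2) := by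
  -- the largest of the terms `1, |ζ_i|²` dominates their average
  have hcard : (1 : ℝ≥0) + (Finset.univ.erase (0 : Fin n)).card = n := by
    rw [Finset.card_erase_of_mem (Finset.mem_univ _), Finset.card_univ, Fintype.card_fin]
    have := NeZero.one_le (n := n)
    rw [← Nat.cast_one, ← Nat.cast_add]; congr 1; omega
  by_cases h : ∀ i ∈ Finset.univ.erase (0 : Fin n), ‖ζ i‖₊ ^ 2 ≤ 1
  · have h1 : tangSymbol ζ ≤ n := by
      rw [← hcard, tangSymbol]
      gcongr
      simpa using Finset.sum_le_card_nsmul _ _ 1 h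
    calc tangSymbol ζ ^ m ≤ (n : ℝ≥0) ^ m := by gcongr
      _ = n ^ m * 1 := (mul_one _).symm
      _ ≤ _ := by gcongr; exact le_self_add
  · push Not at h
    obtain ⟨i₀, hi₀, h1⟩ := h
    obtain ⟨k, hk, hmax⟩ := Finset.exists_max_image (Finset.univ.erase (0 : Fin n))
      (fun i => ‖ζ i‖₊ ^ 2) ⟨i₀, hi₀⟩
    have hk1 : 1 ≤ ‖ζ k‖₊ ^ 2 := h1.le.trans (hmax i₀ hi₀)
    have h2 : tangSymbol ζ ≤ n * ‖ζ k‖₊ ^ 2 := by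
      rw [← hcard, tangSymbol, add_mul, one_mul]
      gcongr
      simpa using Finset.sum_le_card_nsmul _ _ _ hmax
    calc tangSymbol ζ ^ m ≤ (n * ‖ζ k‖₊ ^ 2) ^ m := by gcongr
      _ = n ^ m * (‖ζ k‖₊ ^ m) ^ 2 := by ring
      _ ≤ n ^ m * ∑ i ∈ Finset.univ.erase 0, (‖ζ i‖₊ ^ m) ^ 2 := by
        gcongr
        exact Finset.single_le_sum (f := fun i => (‖ζ i‖₊ ^ m) ^ 2) (fun _ _ => zero_le) hk
      _ ≤ _ := by gcongr; exact le_add_self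

end Weights

section SchwartzBilinear

open SchwartzMap FourierTransform LineDeriv

variable {n : ℕ} [NeZero n]

/-- The words `1` and `∂_i ^ b`, where `i` is not the radial coordinate `0`. -/
def tangWords (n b : ℕ) [NeZero n] : Set (List (Fin n)) :=
  {w | w = [] ∨ ∃ i, i ≠ 0 ∧ w = List.replicate b i}

/-- The words of `tangWords n a`, together with `∂_0` and `∂_0 ∂_i ^ (a - 1)`. -/
def radialWords (n a : ℕ) [NeZero n] : Set (List (Fin n)) :=
  tangWords n a ∪ {w | w = [0] ∨ ∃ i, i ≠ 0 ∧ w = List.replicate (a - 1) i ++ [0]}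

theorem lintegral_tangSymbol_pow_le (b : ℕ) (w : List (Fin n)) (f : 𝓢(Euc n, ℂ)) {N : ℝ≥0∞}
    (h0 : eLpNorm (wordDeriv w f) 2 volume ≤ N)
    (h : ∀ i, i ≠ 0 → eLpNorm (wordDeriv (List.replicate b i ++ w) f) 2 volume ≤ N) :
    ∫⁻ ζ, (tangSymbol ζ ^ b : ℝ≥0) *
      (((w.map fun i => ‖ζ i‖₊).prod : ℝ≥0) * ‖(𝓕⁻ f : 𝓢(Euc n, ℂ)) ζ‖ₑ) ^ 2 ≤
        (n ^ b * (1 + n)) * N ^ 2 := by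
  set F : Euc n → ℝ≥0∞ := fun ζ => ‖(𝓕⁻ f : 𝓢(Euc n, ℂ)) ζ‖ₑ with hF
  have hFm : Measurable F := (𝓕⁻ f : 𝓢(Euc n, ℂ)).continuous.measurable.enorm
  have hwm : ∀ w : List (Fin n), Measurable fun ζ : Euc n => (w.map fun i => ‖ζ i‖₊).prod := by
    intro w
    induction w with
    | nil => simp
    | cons i w ih =>
      simp only [List.map_cons, List.prod_cons]
      exact Measurable.mul (Continuous.measurable (by fun_prop)) ih
  calc ∫⁻ ζ, (tangSymbol ζ ^ b : ℝ≥0) * (((w.map fun i => ‖ζ i‖₊).prod : ℝ≥0) * F ζ) ^ 2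
      ≤ ∫⁻ ζ, (n : ℝ≥0∞) ^ b * ((((w.map fun i => ‖ζ i‖₊).prod : ℝ≥0) * F ζ) ^ 2 +
          ∑ i ∈ Finset.univ.erase (0 : Fin n),
            ((((List.replicate b i ++ w).map fun i => ‖ζ i‖₊).prod : ℝ≥0) * F ζ) ^ 2) := by
        refine lintegral_mono fun ζ => ?_
        have h1 := ENNReal.coe_le_coe.2 (tangSymbol_pow_le b ζ)
        refine (mul_le_mul_left h1 _).trans (le_of_eq ?_)
        push_cast
        rw [mul_assoc, add_mul, one_mul, Finset.sum_mul]
        congr 2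
        refine Finset.sum_congr rfl fun i _ => ?_
        simp only [List.map_append, List.map_replicate, List.prod_append, List.prod_replicate,
          ENNReal.coe_mul, ENNReal.coe_pow]
        ring
    _ = (n : ℝ≥0∞) ^ b * ((∫⁻ ζ, (((w.map fun i => ‖ζ i‖₊).prod : ℝ≥0) * F ζ) ^ 2) +
          ∑ i ∈ Finset.univ.erase (0 : Fin n),
            ∫⁻ ζ, ((((List.replicate b i ++ w).map fun i => ‖ζ i‖₊).prod : ℝ≥0) * F ζ) ^ 2) := by
        have hm : ∀ w : List (Fin n), Measurable fun ζ : Euc n =>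
            (((w.map fun i => ‖ζ i‖₊).prod : ℝ≥0) * F ζ) ^ 2 :=
          fun w => ((hwm w).coe_nnreal_ennreal.mul hFm).pow_const 2
        rw [lintegral_const_mul _ ((hm w).fun_add (Finset.measurable_fun_sum _ fun i _ => hm _)),
          lintegral_add_left (hm w), lintegral_finsetSum _ fun i _ => hm _]
    _ ≤ (n : ℝ≥0∞) ^ b * (N ^ 2 + ∑ _i ∈ Finset.univ.erase (0 : Fin n), N ^ 2) := by
        gcongr with i hi
        · exact (lintegral_fourierInv_wordDeriv_le w f).trans (by gcongr)
        · refine (lintegral_fourierInv_wordDeriv_le _ f).trans ?_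
          gcongr
          exact h i (Finset.ne_of_mem_erase hi)
    _ ≤ (n : ℝ≥0∞) ^ b * (N ^ 2 + n * N ^ 2) := by
        gcongr
        rw [Finset.sum_const, nsmul_eq_mul]
        gcongr
        exact (Finset.card_le_univ _).trans (by simp)
    _ = _ := by ring

theorem lintegral_radialWeight_le {a : ℕ} (ha : 1 ≤ a) (f : 𝓢(Euc n, ℂ)) {N : ℝ≥0∞}
    (h : ∀ w ∈ radialWords n a, eLpNorm (wordDeriv w f) 2 volume ≤ N) :
    ∫⁻ ζ, (radialWeight a ζ * ‖(𝓕⁻ f : 𝓢(Euc n, ℂ)) ζ‖ₑ) ^ 2 ≤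
      (n ^ a * (1 + n) + n ^ (a - 1) * (1 + n)) * N ^ 2 := by
  have h1 := lintegral_tangSymbol_pow_le a [] f (N := N) (h _ (Or.inl (Or.inl rfl)))
    (fun i hi => h _ (Or.inl (Or.inr ⟨i, hi, by simp⟩)))
  have h2 := lintegral_tangSymbol_pow_le (a - 1) [0] f (N := N) (h _ (Or.inr (Or.inl rfl)))
    (fun i hi => h _ (Or.inr (Or.inr ⟨i, hi, rfl⟩)))
  rw [add_mul]
  refine le_trans (le_of_eq ?_) (add_le_add h1 h2)
  have hFm : Measurable fun ζ => ‖(𝓕⁻ f : 𝓢(Euc n, ℂ)) ζ‖ₑ :=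
    (𝓕⁻ f : 𝓢(Euc n, ℂ)).continuous.measurable.enorm
  have hq : Measurable (tangSymbol (n := n)) := continuous_tangSymbol.measurable
  rw [← lintegral_add_left]
  · refine lintegral_congr fun ζ => ?_
    rw [mul_pow, ← ENNReal.coe_pow, radialWeight, NNReal.sq_sqrt]
    obtain ⟨a, rfl⟩ : ∃ b, a = b + 1 := ⟨a - 1, by omega⟩
    simp only [List.map_nil, List.prod_nil, List.map_cons, List.prod_cons, mul_one,
      Nat.add_sub_cancel]
    push_cast
    ring
  · simp only [List.map_nil, List.prod_nil]
    exact ((hq.pow_const a).coe_nnreal_ennreal).mul ((measurable_const.mul hFm).pow_const 2)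

theorem lintegral_tangWeight_le {b : ℕ} (f : 𝓢(Euc n, ℂ)) {N : ℝ≥0∞}
    (h : ∀ w ∈ tangWords n b, eLpNorm (wordDeriv w f) 2 volume ≤ N) :
    ∫⁻ ζ, (tangWeight b ζ * ‖(𝓕⁻ f : 𝓢(Euc n, ℂ)) ζ‖ₑ) ^ 2 ≤ (n ^ b * (1 + n)) * N ^ 2 := by
  refine le_trans (le_of_eq ?_) (lintegral_tangSymbol_pow_le b [] f (N := N) (h _ (Or.inl rfl))
    (fun i hi => h _ (Or.inr ⟨i, hi, by simp⟩)))
  refine lintegral_congr fun ζ => ?_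
  rw [mul_pow, ← ENNReal.coe_pow, tangWeight, NNReal.sq_sqrt]
  simp

/-- The bilinear estimate for Schwartz functions. -/
theorem exists_bilinear_schwartz {a b : ℕ} (ha : 1 ≤ a) (hab : n + 1 ≤ 2 * (a + b)) :
    ∃ C : ℝ≥0, ∀ (f g : 𝓢(Euc n, ℂ)) (N N' : ℝ≥0∞),
      (∀ w ∈ radialWords n a, eLpNorm (wordDeriv w f) 2 volume ≤ N) →
      (∀ w ∈ tangWords n b, eLpNorm (wordDeriv w g) 2 volume ≤ N') →
      eLpNorm (fun z => f z * g z) 2 volume ≤ C * (N * N') := by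
  obtain ⟨K, hK⟩ := exists_bound_inv_weight (n := n) ha hab
  set D : ℝ≥0 := K * ((n ^ a * (1 + n) + n ^ (a - 1) * (1 + n)) * (n ^ b * (1 + n))) with hD
  refine ⟨NNReal.sqrt D, fun f g N N' hf hg => ?_⟩
  have h := lintegral_mul_schwartz_le f g (measurable_radialWeight a) (measurable_tangWeight b)
    (radialWeight_ne_zero a) (tangWeight_ne_zero b) hK
  have h2 : eLpNorm (fun z => f z * g z) 2 volume ^ 2 ≤ (NNReal.sqrt D * (N * N')) ^ 2 := by
    rw [eLpNorm_two_sq]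
    refine h.trans ?_
    calc _ ≤ (K : ℝ≥0∞) * (((n ^ a * (1 + n) + n ^ (a - 1) * (1 + n)) * N ^ 2) *
          ((n ^ b * (1 + n)) * N' ^ 2)) := by
          gcongr
          · exact lintegral_radialWeight_le ha f hf
          · exact lintegral_tangWeight_le g hg
      _ = _ := by
          rw [mul_pow, ← ENNReal.coe_pow, NNReal.sq_sqrt, hD]
          push_cast
          ring
  exact (ENNReal.pow_le_pow_left_iff two_ne_zero).1 h2

end SchwartzBilinear

/-! ### Weak derivatives on Euclidean space -/

section WeakDeriv

variable {n : ℕ}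

/-- `∂_i F = G` in the sense of distributions on `ℝⁿ`. -/
def WeakDeriv (i : Fin n) (F G : Euc n → ℂ) : Prop :=
  ∀ Φ : Euc n → ℂ, ContDiff ℝ ∞ Φ → HasCompactSupport Φ →
    ∫ z, F z * fderiv ℝ Φ z (stdVec i) = -∫ z, G z * Φ z

/-- `F` and its successive weak derivatives along the list `w` are in `L²`, with norm at
most `N`. -/
def WeakSobolev : List (Fin n) → (Euc n → ℂ) → ℝ≥0∞ → Prop
  | [], F, N => MemLp F 2 volume ∧ eLpNorm F 2 volume ≤ N
  | i :: w, F, N => (MemLp F 2 volume ∧ eLpNorm F 2 volume ≤ N) ∧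
      ∃ G, WeakDeriv i F G ∧ WeakSobolev w G N

theorem WeakSobolev.memLp {w : List (Fin n)} {F : Euc n → ℂ} {N : ℝ≥0∞} (h : WeakSobolev w F N) :
    MemLp F 2 volume ∧ eLpNorm F 2 volume ≤ N := by
  cases w with
  | nil => exact h
  | cons i w => exact h.1

theorem WeakSobolev.mono {w : List (Fin n)} {F : Euc n → ℂ} {N N' : ℝ≥0∞} (hN : N ≤ N')
    (h : WeakSobolev w F N) : WeakSobolev w F N' := by
  induction w generalizing F with
  | nil => exact ⟨h.1, h.2.trans hN⟩
  | cons i w ih =>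
    obtain ⟨G, hG, hw⟩ := h.2
    exact ⟨⟨h.1.1, h.1.2.trans hN⟩, G, hG, ih hw⟩

theorem MemLp_two_locallyIntegrable {F : Euc n → ℂ} (hF : MemLp F 2 volume) :
    LocallyIntegrable F volume := hF.locallyIntegrable (by norm_num)

theorem integrable_mul_of_contDiff {F Φ : Euc n → ℂ} (hF : LocallyIntegrable F volume)
    (hΦ : Continuous Φ) (hc : HasCompactSupport Φ) : Integrable (fun z => F z * Φ z) volume := by
  simpa [mul_comm] using hF.integrable_smul_left_of_hasCompactSupport hΦ hc

theorem continuous_fderiv_apply' {Φ : Euc n → ℂ} (hΦ : ContDiff ℝ ∞ Φ) (v : Euc n) :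
    Continuous fun z => fderiv ℝ Φ z v :=
  (hΦ.continuous_fderiv (by simp)).clm_apply continuous_const

theorem WeakDeriv.add {i : Fin n} {F G F' G' : Euc n → ℂ} (h : WeakDeriv i F G)
    (h' : WeakDeriv i F' G') (hF : LocallyIntegrable F volume) (hG : LocallyIntegrable G volume)
    (hF' : LocallyIntegrable F' volume) (hG' : LocallyIntegrable G' volume) :
    WeakDeriv i (F + F') (G + G') := by
  intro Φ hΦ hc
  have hd : HasCompactSupport fun z => fderiv ℝ Φ z (stdVec i) := hc.fderiv_apply ℝ _
  have hdc := continuous_fderiv_apply' hΦ (stdVec i)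
  simp only [Pi.add_apply, add_mul]
  rw [integral_add (integrable_mul_of_contDiff hF hdc hd) (integrable_mul_of_contDiff hF' hdc hd),
    integral_add (integrable_mul_of_contDiff hG hΦ.continuous hc)
      (integrable_mul_of_contDiff hG' hΦ.continuous hc), h Φ hΦ hc, h' Φ hΦ hc, neg_add]

theorem WeakSobolev.add {w : List (Fin n)} {F F' : Euc n → ℂ} {N N' : ℝ≥0∞}
    (h : WeakSobolev w F N) (h' : WeakSobolev w F' N') : WeakSobolev w (F + F') (N + N') := by
  have key : ∀ {w : List (Fin n)} {F F' : Euc n → ℂ}, WeakSobolev w F N → WeakSobolev w F' N' →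
      MemLp (F + F') 2 volume ∧ eLpNorm (F + F') 2 volume ≤ N + N' := fun h h' =>
    ⟨h.memLp.1.add h'.memLp.1, (eLpNorm_add_le h.memLp.1.1 h'.memLp.1.1 (by norm_num)).trans
      (add_le_add h.memLp.2 h'.memLp.2)⟩
  induction w generalizing F F' with
  | nil => exact key h h'
  | cons i w ih =>
    obtain ⟨G, hG, hw⟩ := h.2
    obtain ⟨G', hG', hw'⟩ := h'.2
    exact ⟨key h h', G + G', hG.add hG' (MemLp_two_locallyIntegrable h.1.1)
      (MemLp_two_locallyIntegrable hw.memLp.1) (MemLp_two_locallyIntegrable h'.1.1)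
      (MemLp_two_locallyIntegrable hw'.memLp.1), ih hw hw'⟩

/-- The product rule for a weak derivative and a smooth factor. -/
theorem WeakDeriv.smooth_mul {i : Fin n} {F G θ : Euc n → ℂ} (h : WeakDeriv i F G)
    (hF : LocallyIntegrable F volume) (hG : LocallyIntegrable G volume) (hθ : ContDiff ℝ ∞ θ) :
    WeakDeriv i (fun z => θ z * F z) (fun z => θ z * G z + fderiv ℝ θ z (stdVec i) * F z) := by
  intro Φ hΦ hc
  have hθd := continuous_fderiv_apply' hθ (stdVec i)
  have hΦd := continuous_fderiv_apply' hΦ (stdVec i)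
  have hc' : HasCompactSupport fun z => fderiv ℝ Φ z (stdVec i) := hc.fderiv_apply ℝ _
  have h1 := h (fun z => θ z * Φ z) (hθ.mul hΦ) hc.mul_left
  have h2 : ∀ z, fderiv ℝ (fun z => θ z * Φ z) z (stdVec i) =
      θ z * fderiv ℝ Φ z (stdVec i) + fderiv ℝ θ z (stdVec i) * Φ z := by
    intro z
    rw [fderiv_fun_mul (hθ.differentiable (by simp) z) (hΦ.differentiable (by simp) z)]
    simp [mul_comm]
  simp_rw [h2, mul_add] at h1
  rw [integral_add] at h1
  · have e1 : ∀ z, θ z * F z * fderiv ℝ Φ z (stdVec i) = F z * (θ z * fderiv ℝ Φ z (stdVec i)) :=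
      fun z => by ring
    have e2 : ∀ z, (θ z * G z + fderiv ℝ θ z (stdVec i) * F z) * Φ z =
        G z * (θ z * Φ z) + F z * (fderiv ℝ θ z (stdVec i) * Φ z) := fun z => by ring
    simp_rw [e1, e2]
    rw [integral_add, neg_add, ← h1]
    · ring
    · exact integrable_mul_of_contDiff hG (hθ.continuous.mul hΦ.continuous) hc.mul_left
    · exact integrable_mul_of_contDiff hF (hθd.mul hΦ.continuous) hc.mul_left
  · exact integrable_mul_of_contDiff hF (hθ.continuous.mul hΦd) hc'.mul_left
  · exact integrable_mul_of_contDiff hF (hθd.mul hΦ.continuous) hc.mul_left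

end WeakDeriv

/-! ### Mollification -/

section Mollify

open Filter Topology

variable {n : ℕ}

/-- A sequence of bump functions concentrating at the origin. -/
noncomputable def shrinkingBump (n k : ℕ) : ContDiffBump (0 : Euc n) where
  rIn := 1 / (k + 1)
  rOut := 2 / (k + 1)
  rIn_pos := by positivity
  rIn_lt_rOut := by gcongr; norm_num

/-- The convolution of a function with a smooth probability density of small support. -/
noncomputable def mollify (k : ℕ) (F : Euc n → ℂ) : Euc n → ℂ :=
  MeasureTheory.convolution ((shrinkingBump n k).normed volume) F
    (ContinuousLinearMap.lsmul ℝ ℝ) volume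

theorem tendsto_shrinkingBump_rOut :
    Tendsto (fun k => (shrinkingBump n k).rOut) atTop (𝓝 0) := by
  have := (tendsto_one_div_add_atTop_nhds_zero_nat (𝕜 := ℝ)).const_mul 2
  simpa [shrinkingBump, div_eq_mul_inv] using this

theorem contDiff_mollify (k : ℕ) {F : Euc n → ℂ} (hF : LocallyIntegrable F volume) :
    ContDiff ℝ ∞ (mollify k F) :=
  (shrinkingBump n k).hasCompactSupport_normed.contDiff_convolution_left _
    (shrinkingBump n k).contDiff_normed hF

theorem hasCompactSupport_mollify (k : ℕ) {F : Euc n → ℂ} (hF : HasCompactSupport F) :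
    HasCompactSupport (mollify k F) :=
  (shrinkingBump n k).hasCompactSupport_normed.convolution _ hF

theorem ae_tendsto_mollify {F : Euc n → ℂ} (hF : LocallyIntegrable F volume) :
    ∀ᵐ z ∂(volume : Measure (Euc n)), Tendsto (fun k => mollify k F z) atTop (𝓝 (F z)) := by
  refine ContDiffBump.ae_convolution_tendsto_right_of_locallyIntegrable (K := 2)
    tendsto_shrinkingBump_rOut (Eventually.of_forall fun k => ?_) hF
  simp only [shrinkingBump]
  exact le_of_eq (by ring)

/-- Mollification commutes with weak derivatives. -/
theorem fderiv_mollify (k : ℕ) {i : Fin n} {F G : Euc n → ℂ} (hF : LocallyIntegrable F volume)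
    (h : WeakDeriv i F G) (z : Euc n) :
    fderiv ℝ (mollify k F) z (stdVec i) = mollify k G z := by
  set ρ := (shrinkingBump n k).normed (volume : Measure (Euc n)) with hρ
  have hρs : ContDiff ℝ ∞ ρ := (shrinkingBump n k).contDiff_normed
  have hρc : HasCompactSupport ρ := (shrinkingBump n k).hasCompactSupport_normed
  have h1 := hρc.hasFDerivAt_convolution_left (ContinuousLinearMap.lsmul ℝ ℝ)
    (hρs.of_le (by simp)) hF z
  have h2 : fderiv ℝ (mollify k F) z = _ := h1.fderiv
  rw [h2]
  have hex := (hρc.fderiv ℝ).convolutionExists_left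
    (ContinuousLinearMap.precompL (Euc n) (ContinuousLinearMap.lsmul ℝ ℝ : ℝ →L[ℝ] ℂ →L[ℝ] ℂ))
    (hρs.continuous_fderiv (by simp)) hF z
  rw [MeasureTheory.convolution, ContinuousLinearMap.integral_apply hex.integrable]
  -- the test function is `t ↦ ρ (z - t)`
  have hρs' : ContDiff ℝ ∞ fun t => ((ρ (z - t) : ℝ) : ℂ) :=
    Complex.ofRealCLM.contDiff.comp (hρs.comp (contDiff_const.sub contDiff_id))
  have hc' : HasCompactSupport fun t => ((ρ (z - t) : ℝ) : ℂ) := by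
    have : HasCompactSupport fun t => ρ (z - t) := hρc.comp_homeomorph (Homeomorph.subLeft z)
    exact this.comp_left (g := fun r : ℝ => (r : ℂ)) (by simp)
  have h3 := h _ hρs' hc'
  have h4 : ∀ t, fderiv ℝ (fun t => ((ρ (z - t) : ℝ) : ℂ)) t (stdVec i) =
      -((fderiv ℝ ρ (z - t) (stdVec i) : ℝ) : ℂ) := by
    intro t
    have hd : HasFDerivAt (fun t => z - t) (-ContinuousLinearMap.id ℝ (Euc n)) t := by
      simpa using (hasFDerivAt_id t).const_sub z
    have hd2 := (Complex.ofRealCLM.hasFDerivAt (x := ρ (z - t))).comp t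
      (((hρs.differentiable (by simp)) (z - t)).hasFDerivAt.comp t hd)
    have hd3 : fderiv ℝ (fun t => ((ρ (z - t) : ℝ) : ℂ)) t = _ := hd2.fderiv
    rw [hd3]
    simp
  simp_rw [h4, mul_neg, integral_neg, neg_inj] at h3
  rw [mollify, MeasureTheory.convolution_eq_swap]
  rw [← integral_sub_left_eq_self _ _ z]
  simp only [sub_sub_cancel, ContinuousLinearMap.precompL_apply, ContinuousLinearMap.lsmul_apply,
    Complex.real_smul]
  simp_rw [mul_comm (F _)] at h3
  rw [h3]
  exact integral_congr_ae (Eventually.of_forall fun t => mul_comm _ _)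

theorem lintegral_normed_eq_one (k : ℕ) :
    ∫⁻ t, ENNReal.ofReal ((shrinkingBump n k).normed volume t) = 1 := by
  rw [← ofReal_integral_eq_lintegral_ofReal (shrinkingBump n k).integrable_normed
    (Eventually.of_forall (shrinkingBump n k).nonneg_normed), (shrinkingBump n k).integral_normed,
    ENNReal.ofReal_one]

/-- By Jensen's inequality, mollification does not increase the `L²` norm. -/
theorem eLpNorm_mollify_le (k : ℕ) {F : Euc n → ℂ} (hF : AEStronglyMeasurable F volume) :
    eLpNorm (mollify k F) 2 volume ≤ eLpNorm F 2 volume := by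
  set ρ := (shrinkingBump n k).normed (volume : Measure (Euc n)) with hρ
  have hρm : Measurable ρ := (shrinkingBump n k).contDiff_normed (n := 0).continuous.measurable
  set s : Euc n → ℝ≥0∞ := fun t => (NNReal.sqrt (ρ t).toNNReal : ℝ≥0) with hs
  have hsm : Measurable s := (NNReal.continuous_sqrt.measurable.comp
    hρm.real_toNNReal).coe_nnreal_ennreal
  have hs2 : ∀ t, s t ^ 2 = ENNReal.ofReal (ρ t) := by
    intro t
    rw [hs, ← ENNReal.coe_pow, NNReal.sq_sqrt]; rfl
  have hFz : ∀ z, AEMeasurable (fun t => ‖F (z - t)‖ₑ) volume := fun z =>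
    (hF.comp_quasiMeasurePreserving (quasiMeasurePreserving_sub_left volume z)).enorm
  refine (ENNReal.pow_le_pow_left_iff two_ne_zero).1 ?_
  rw [eLpNorm_two_sq, eLpNorm_two_sq]
  have key : ∀ z, ‖mollify k F z‖ₑ ^ 2 ≤ ∫⁻ t, ENNReal.ofReal (ρ t) * ‖F (z - t)‖ₑ ^ 2 := by
    intro z
    calc ‖mollify k F z‖ₑ ^ 2 ≤ (∫⁻ t, s t * (s t * ‖F (z - t)‖ₑ)) ^ 2 := by
          gcongr
          rw [mollify, MeasureTheory.convolution]
          refine (enorm_integral_le_lintegral_enorm _).trans (lintegral_mono fun t => ?_)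
          rw [ContinuousLinearMap.lsmul_apply, enorm_smul, ← mul_assoc, ← sq, hs2,
            Real.enorm_of_nonneg ((shrinkingBump n k).nonneg_normed t)]
      _ ≤ (∫⁻ t, s t ^ 2) * ∫⁻ t, (s t * ‖F (z - t)‖ₑ) ^ 2 :=
          lintegral_mul_sq_le _ hsm.aemeasurable (hsm.aemeasurable.mul (hFz z))
      _ = _ := by
          simp_rw [mul_pow, hs2]
          rw [lintegral_normed_eq_one, one_mul]
  have hjoint : AEMeasurable (Function.uncurry fun z t : Euc n =>
      ENNReal.ofReal (ρ t) * ‖F (z - t)‖ₑ ^ 2) (volume.prod volume) := by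
    have h1 : AEMeasurable (fun p : Euc n × Euc n => ‖F (p.1 - p.2)‖ₑ) (volume.prod volume) :=
      (hF.comp_quasiMeasurePreserving (quasiMeasurePreserving_sub volume volume)).enorm
    exact ((hρm.comp measurable_snd).ennreal_ofReal.aemeasurable).mul (h1.pow_const 2)
  calc ∫⁻ z, ‖mollify k F z‖ₑ ^ 2 ≤ ∫⁻ z, ∫⁻ t, ENNReal.ofReal (ρ t) * ‖F (z - t)‖ₑ ^ 2 :=
        lintegral_mono key
    _ = ∫⁻ t, ∫⁻ z, ENNReal.ofReal (ρ t) * ‖F (z - t)‖ₑ ^ 2 := lintegral_lintegral_swap hjoint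
    _ = ∫⁻ t, ENNReal.ofReal (ρ t) * ∫⁻ z, ‖F z‖ₑ ^ 2 := by
        refine lintegral_congr fun t => ?_
        rw [lintegral_const_mul' _ _ ENNReal.ofReal_ne_top,
          lintegral_sub_right_eq_self (fun z => ‖F z‖ₑ ^ 2) t]
    _ = ∫⁻ z, ‖F z‖ₑ ^ 2 := by
        rw [lintegral_mul_const _ hρm.ennreal_ofReal, lintegral_normed_eq_one, one_mul]

theorem mollify_sub (k : ℕ) {F G : Euc n → ℂ} (hF : LocallyIntegrable F volume)
    (hG : LocallyIntegrable G volume) : mollify k (F - G) = mollify k F - mollify k G := by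
  have h : ∀ {H : Euc n → ℂ}, LocallyIntegrable H volume →
      ConvolutionExists ((shrinkingBump n k).normed volume) H
        (ContinuousLinearMap.lsmul ℝ ℝ : ℝ →L[ℝ] ℂ →L[ℝ] ℂ) volume := fun hH =>
    (shrinkingBump n k).hasCompactSupport_normed.convolutionExists_left _
      ((shrinkingBump n k).contDiff_normed (n := 0)).continuous hH
  ext z
  simp only [mollify, MeasureTheory.convolution, Pi.sub_apply, map_sub]
  exact integral_sub (h hF z).integrable (h hG z).integrable

/-- Mollifications of a continuous function of compact support converge in `L²`, as they converge
uniformly with supports in a fixed compact set. -/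
theorem tendsto_eLpNorm_mollify_sub_of_continuous {g : Euc n → ℂ} (hg : Continuous g)
    (hc : HasCompactSupport g) :
    Tendsto (fun k => eLpNorm (mollify k g - g) 2 volume) atTop (𝓝 0) := by
  set K : Set (Euc n) := Metric.cthickening 2 (tsupport g) with hK
  have hKc : IsCompact K := hc.isCompact.cthickening
  have hout : ∀ k z, z ∉ K → mollify k g z - g z = 0 := by
    intro k z hz
    have hgz : ∀ y ∈ Metric.ball z 2, g y = g z := by
      intro y hy
      have h0 : ∀ y ∈ Metric.ball z (2 : ℝ), g y = 0 := by
        intro y hy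
        by_contra hne
        exact hz (Metric.mem_cthickening_of_dist_le z y 2 _ (subset_tsupport _ hne)
          (by rw [dist_comm]; exact (Metric.mem_ball.1 hy).le))
      rw [h0 y hy, h0 z (Metric.mem_ball_self (by norm_num))]
    have hr : (shrinkingBump n k).rOut ≤ 2 := by
      simp only [shrinkingBump]
      rw [div_le_iff₀ (by positivity)]
      have : (0 : ℝ) ≤ k := k.cast_nonneg
      linarith
    rw [sub_eq_zero]
    exact (shrinkingBump n k).normed_convolution_eq_right
      fun y hy => hgz y (Metric.ball_subset_ball hr hy)
  have hu : UniformContinuous g := hg.uniformContinuous_of_tendsto_cocompact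
    (hc.is_zero_at_infty)
  rw [ENNReal.tendsto_nhds_zero]
  intro ε hε
  have hV : volume K ^ (1 / 2 : ℝ) ≠ ⊤ := ENNReal.rpow_ne_top_of_nonneg (by norm_num)
    hKc.measure_lt_top.ne
  obtain ⟨δ, hδ0, hδ⟩ : ∃ δ : ℝ, 0 < δ ∧ ENNReal.ofReal δ * volume K ^ (1 / 2 : ℝ) ≤ ε := by
    obtain ⟨δ, hδ0, hδ⟩ := ENNReal.exists_nnreal_pos_mul_lt hV hε.ne'
    exact ⟨δ, hδ0, by simpa using hδ.le⟩
  obtain ⟨r, hr0, hr⟩ := Metric.uniformContinuous_iff.1 hu δ hδ0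
  filter_upwards [tendsto_shrinkingBump_rOut.eventually (gt_mem_nhds hr0)] with k hk
  refine le_trans ?_ hδ
  refine (ENNReal.pow_le_pow_left_iff two_ne_zero).1 ?_
  rw [eLpNorm_two_sq, mul_pow, ← ENNReal.rpow_natCast (volume K ^ (1 / 2 : ℝ)),
    ← ENNReal.rpow_mul]
  norm_num
  rw [← lintegral_indicator_const hKc.isClosed.measurableSet]
  refine lintegral_mono fun z => ?_
  by_cases hz : z ∈ K
  · rw [Set.indicator_of_mem hz]
    gcongr
    rw [← ofReal_norm, ← dist_eq_norm]
    refine ENNReal.ofReal_le_ofReal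
      ((shrinkingBump n k).dist_normed_convolution_le hg.aestronglyMeasurable fun y hy => ?_)
    exact (hr (lt_trans (Metric.mem_ball.1 hy) hk)).le
  · rw [Set.indicator_of_notMem hz]
    simp [hout k z hz]

theorem tendsto_eLpNorm_mollify_sub {F : Euc n → ℂ} (hF : MemLp F 2 volume) :
    Tendsto (fun k => eLpNorm (mollify k F - F) 2 volume) atTop (𝓝 0) := by
  rw [ENNReal.tendsto_nhds_zero]
  intro ε hε
  have hε3 : ε / 3 ≠ 0 := by simpa using hε.ne'
  obtain ⟨g, hgc, hg1, hg2, hg3⟩ := hF.exists_hasCompactSupport_eLpNorm_sub_le (by norm_num) hε3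
  have hFl := MemLp_two_locallyIntegrable hF
  have hgl := MemLp_two_locallyIntegrable hg3
  have h := (ENNReal.tendsto_nhds_zero.1 (tendsto_eLpNorm_mollify_sub_of_continuous hg2 hgc))
    (ε / 3) (pos_iff_ne_zero.2 hε3)
  filter_upwards [h] with k hk
  have hm : ∀ {H : Euc n → ℂ}, LocallyIntegrable H volume → AEStronglyMeasurable (mollify k H) volume :=
    fun hH => (contDiff_mollify k hH).continuous.aestronglyMeasurable
  have hdec : mollify k F - F = mollify k (F - g) + ((mollify k g - g) + (g - F)) := by
    rw [mollify_sub k hFl hgl]; abel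
  rw [hdec]
  calc _ ≤ eLpNorm (mollify k (F - g)) 2 volume + (eLpNorm (mollify k g - g) 2 volume +
        eLpNorm (g - F) 2 volume) := by
        refine (eLpNorm_add_le (hm (hFl.sub hgl)) ?_ (by norm_num)).trans ?_
        · exact ((hm hgl).sub hg3.1).add (hg3.1.sub hF.1)
        · gcongr
          exact eLpNorm_add_le ((hm hgl).sub hg3.1) (hg3.1.sub hF.1) (by norm_num)
    _ ≤ ε / 3 + (ε / 3 + ε / 3) := by
        gcongr
        · exact (eLpNorm_mollify_le k (hF.1.sub hg3.1)).trans hg1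
        · rw [eLpNorm_sub_comm]; exact hg1
    _ = ε := by rw [← add_assoc]; exact ENNReal.add_thirds ε

end Mollify

section WeakBilinear

open Filter Topology

variable {n : ℕ}

theorem tendsto_integral_mul_of_eLpNorm {F : Euc n → ℂ} {Fk : ℕ → Euc n → ℂ} {H : Euc n → ℂ}
    (hF : MemLp F 2 volume) (hFk : ∀ k, MemLp (Fk k) 2 volume) (hH : MemLp H 2 volume)
    (h : Tendsto (fun k => eLpNorm (Fk k - F) 2 volume) atTop (𝓝 0)) :
    Tendsto (fun k => ∫ z, Fk k z * H z) atTop (𝓝 (∫ z, F z * H z)) := by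
  refine tendsto_integral_of_L1' _ (hF.integrable_mul hH).1
    (Eventually.of_forall fun k => (hFk k).integrable_mul hH) ?_
  have h2 : Tendsto (fun k => eLpNorm (Fk k - F) 2 volume * eLpNorm H 2 volume) atTop (𝓝 0) := by
    simpa using ENNReal.Tendsto.mul_const h (Or.inr hH.2.ne)
  refine tendsto_of_tendsto_of_tendsto_of_le_of_le tendsto_const_nhds h2 (fun _ => zero_le)
    fun k => ?_
  have h3 := eLpNorm_smul_le_mul_eLpNorm (p := 2) (q := 2) (r := 1) hH.1 ((hFk k).1.sub hF.1)
  refine le_trans (le_of_eq ?_) h3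
  congr 1
  ext z
  simp [sub_mul]

theorem memLp_mollify (k : ℕ) {F : Euc n → ℂ} (hF : MemLp F 2 volume) :
    MemLp (mollify k F) 2 volume :=
  ⟨(contDiff_mollify k (MemLp_two_locallyIntegrable hF)).continuous.aestronglyMeasurable,
    (eLpNorm_mollify_le k hF.1).trans_lt hF.2⟩

/-- The product rule for functions in `L²` with a weak derivative in `L²`. -/
theorem WeakDeriv.mul {i : Fin n} {F F' G G' : Euc n → ℂ} (hF : MemLp F 2 volume)
    (hF' : MemLp F' 2 volume) (hG : MemLp G 2 volume) (hG' : MemLp G' 2 volume)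
    (h : WeakDeriv i F F') (h' : WeakDeriv i G G') :
    WeakDeriv i (fun z => F z * G z) (fun z => F z * G' z + F' z * G z) := by
  intro Φ hΦ hc
  have hFl := MemLp_two_locallyIntegrable hF
  have hk : ∀ k, ∫ z, mollify k F z * (G z * fderiv ℝ Φ z (stdVec i)) =
      -((∫ z, mollify k F z * (G' z * Φ z)) + ∫ z, mollify k F' z * (G z * Φ z)) := by
    intro k
    have hs := contDiff_mollify k hFl
    have h1 := h'.smooth_mul (MemLp_two_locallyIntegrable hG) (MemLp_two_locallyIntegrable hG')
      hs Φ hΦ hc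
    simp_rw [fderiv_mollify k hFl h] at h1
    have hm := (contDiff_mollify k (MemLp_two_locallyIntegrable hF')).continuous
    rw [← integral_add]
    · convert! h1 using 2
      · ext z; ring
      · congr 1; ext z; ring
    · have := integrable_mul_of_contDiff (MemLp_two_locallyIntegrable hG')
        (hs.continuous.mul hΦ.continuous) hc.mul_left
      refine this.congr (Eventually.of_forall fun z => ?_)
      simp only [Pi.mul_apply]; ring
    · have := integrable_mul_of_contDiff (MemLp_two_locallyIntegrable hG)
        (hm.mul hΦ.continuous) hc.mul_left
      refine this.congr (Eventually.of_forall fun z => ?_)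
      simp only [Pi.mul_apply]; ring
  have hbd : ∀ {H Ψ : Euc n → ℂ}, MemLp H 2 volume → Continuous Ψ → HasCompactSupport Ψ →
      MemLp (fun z => H z * Ψ z) 2 volume := by
    intro H Ψ hH hΨ hΨc
    have := (hΨ.memLp_top_of_hasCompactSupport hΨc (volume : Measure (Euc n))).mul' hH (r := 2)
    exact this
  have hΦd := continuous_fderiv_apply' hΦ (stdVec i)
  have hcd : HasCompactSupport fun z => fderiv ℝ Φ z (stdVec i) := hc.fderiv_apply ℝ _
  have t1 := tendsto_integral_mul_of_eLpNorm hF (fun k => memLp_mollify k hF)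
    (hbd hG hΦd hcd) (tendsto_eLpNorm_mollify_sub hF)
  have t2 := tendsto_integral_mul_of_eLpNorm hF (fun k => memLp_mollify k hF)
    (hbd hG' hΦ.continuous hc) (tendsto_eLpNorm_mollify_sub hF)
  have t3 := tendsto_integral_mul_of_eLpNorm hF' (fun k => memLp_mollify k hF')
    (hbd hG hΦ.continuous hc) (tendsto_eLpNorm_mollify_sub hF')
  simp_rw [hk] at t1
  have huniq := tendsto_nhds_unique t1 (t2.add t3).neg
  simp_rw [add_mul, mul_assoc]
  have hsum := integral_add (hF.integrable_mul (hbd hG' hΦ.continuous hc))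
    (hF'.integrable_mul (hbd hG hΦ.continuous hc))
  rw [huniq, neg_inj]
  exact hsum.symm

open SchwartzMap LineDeriv in
theorem eLpNorm_wordDeriv_mollify_le (k : ℕ) {w : List (Fin n)} {F : Euc n → ℂ} {N : ℝ≥0∞}
    (h : WeakSobolev w F N) (f : 𝓢(Euc n, ℂ)) (hf : ⇑f = mollify k F) :
    eLpNorm (wordDeriv w f) 2 volume ≤ N := by
  induction w generalizing F f with
  | nil => rw [wordDeriv, hf]; exact (eLpNorm_mollify_le k h.1.1).trans h.2
  | cons i w ih =>
    obtain ⟨G, hG, hw⟩ := h.2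
    refine ih hw (∂_{(stdVec i : Euc n)} f) ?_
    ext z
    rw [SchwartzMap.lineDerivOp_apply_eq_fderiv, hf,
      fderiv_mollify k (MemLp_two_locallyIntegrable h.1.1) hG]

variable [NeZero n]

/-- The bilinear estimate passes from Schwartz functions to compactly supported functions, by
mollification of both factors and Fatou's lemma. -/
theorem eLpNorm_mul_le_of_hasCompactSupport {a b : ℕ} {C : ℝ≥0}
    (hC : ∀ (f g : SchwartzMap (Euc n) ℂ) (N N' : ℝ≥0∞),
      (∀ w ∈ radialWords n a, eLpNorm (wordDeriv w f) 2 volume ≤ N) →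
      (∀ w ∈ tangWords n b, eLpNorm (wordDeriv w g) 2 volume ≤ N') →
      eLpNorm (fun z => f z * g z) 2 volume ≤ C * (N * N'))
    {F G : Euc n → ℂ} {N N' : ℝ≥0∞} (hF : ∀ w ∈ radialWords n a, WeakSobolev w F N)
    (hG : ∀ w ∈ tangWords n b, WeakSobolev w G N') (hFc : HasCompactSupport F)
    (hGc : HasCompactSupport G) :
    eLpNorm (fun z => F z * G z) 2 volume ≤ C * (N * N') := by
  have hF2 : MemLp F 2 volume := (hF [] (Or.inl (Or.inl rfl))).1
  have hG2 : MemLp G 2 volume := (hG [] (Or.inl rfl)).1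
  have hFl := MemLp_two_locallyIntegrable hF2
  have hGl := MemLp_two_locallyIntegrable hG2
  have hlim : ∀ᵐ z ∂(volume : Measure (Euc n)),
      Tendsto (fun k => mollify k F z * mollify k G z) atTop (𝓝 (F z * G z)) := by
    filter_upwards [ae_tendsto_mollify hFl, ae_tendsto_mollify hGl] with z h1 h2
    exact h1.mul h2
  refine (Lp.eLpNorm_lim_le_liminf_eLpNorm (fun k =>
    ((contDiff_mollify k hFl).continuous.mul
      (contDiff_mollify k hGl).continuous).aestronglyMeasurable) _ hlim).trans ?_
  refine liminf_le_of_le (by isBoundedDefault) fun c hc => ?_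
  obtain ⟨k, hk⟩ := hc.exists
  refine hk.trans ?_
  exact hC ((hasCompactSupport_mollify k hFc).toSchwartzMap (contDiff_mollify k hFl))
    ((hasCompactSupport_mollify k hGc).toSchwartzMap (contDiff_mollify k hGl)) N N'
    (fun w hw => eLpNorm_wordDeriv_mollify_le k (hF w hw) _ rfl)
    (fun w hw => eLpNorm_wordDeriv_mollify_le k (hG w hw) _ rfl)

/-- Multiplication by a bounded function of the radial coordinate `z 0` alone. -/
theorem WeakSobolev.radial_mul {θ : Euc n → ℂ} (hθ : ContDiff ℝ ∞ θ) (h1 : ∀ z, ‖θ z‖ₑ ≤ 1)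
    (htan : ∀ i, i ≠ 0 → ∀ z, fderiv ℝ θ z (stdVec i) = 0) {B : ℝ≥0}
    (hB : ∀ z, ‖fderiv ℝ θ z (stdVec 0)‖ₑ ≤ B) {i : Fin n} {t : List (Fin n)}
    (ht : t = [] ∨ t = [0]) {m : ℕ} (hi : m = 0 ∨ i ≠ 0) {F : Euc n → ℂ} {N : ℝ≥0∞}
    (h : WeakSobolev (List.replicate m i ++ t) F N) :
    WeakSobolev (List.replicate m i ++ t) (fun z => θ z * F z) ((1 + B) * N) := by
  have hle : ∀ {θ' : Euc n → ℂ} {F : Euc n → ℂ} {c : ℝ≥0∞}, (∀ z, ‖θ' z‖ₑ ≤ c) →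
      AEStronglyMeasurable F volume → eLpNorm (fun z => θ' z * F z) 2 volume ≤ c * eLpNorm F 2 volume := by
    intro θ' F c hc hFm
    refine (ENNReal.pow_le_pow_left_iff two_ne_zero).1 ?_
    rw [mul_pow, eLpNorm_two_sq, eLpNorm_two_sq]
    calc ∫⁻ z, ‖θ' z * F z‖ₑ ^ 2 ≤ ∫⁻ z, c ^ 2 * ‖F z‖ₑ ^ 2 := by
          refine lintegral_mono fun z => ?_
          rw [enorm_mul, mul_pow]
          gcongr
          exact hc z
      _ = c ^ 2 * ∫⁻ z, ‖F z‖ₑ ^ 2 := lintegral_const_mul'' _ (hFm.enorm.pow_const 2)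
  have key : ∀ {F : Euc n → ℂ}, MemLp F 2 volume ∧ eLpNorm F 2 volume ≤ N →
      MemLp (fun z => θ z * F z) 2 volume ∧ eLpNorm (fun z => θ z * F z) 2 volume ≤ (1 + B) * N := by
    intro F hF
    have h2 := hle (F := F) h1 hF.1.1
    rw [one_mul] at h2
    refine ⟨⟨hθ.continuous.aestronglyMeasurable.mul hF.1.1, h2.trans_lt hF.1.2⟩,
      h2.trans (hF.2.trans ?_)⟩
    calc N = 1 * N := (one_mul N).symm
      _ ≤ _ := by gcongr; exact le_self_add
  induction m generalizing F with
  | zero =>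
    rcases ht with rfl | rfl
    · exact key h
    · obtain ⟨G, hG, hw⟩ := h.2
      refine ⟨key h.1, _, hG.smooth_mul (MemLp_two_locallyIntegrable h.1.1)
        (MemLp_two_locallyIntegrable hw.1) hθ, ?_⟩
      have h3 : eLpNorm (fun z => fderiv ℝ θ z (stdVec 0) * F z) 2 volume ≤ B * N :=
        (hle hB h.1.1.1).trans (by gcongr; exact h.1.2)
      have h4 : eLpNorm (fun z => θ z * G z) 2 volume ≤ N := by
        have := hle (F := G) h1 hw.1.1
        rw [one_mul] at this
        exact this.trans hw.2
      have m3 : AEStronglyMeasurable (fun z => fderiv ℝ θ z (stdVec 0) * F z) volume :=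
        (continuous_fderiv_apply' hθ _).aestronglyMeasurable.mul h.1.1.1
      have h5 : eLpNorm (fun z => θ z * G z + fderiv ℝ θ z (stdVec 0) * F z) 2 volume ≤
          (1 + B) * N := by
        refine (eLpNorm_add_le (key hw).1.1 m3 (by norm_num)).trans ?_
        rw [add_mul, one_mul]
        exact add_le_add h4 h3
      have h6 : MemLp (fun z => fderiv ℝ θ z (stdVec 0) * F z) 2 volume :=
        ⟨m3, (hle hB h.1.1.1).trans_lt (ENNReal.mul_lt_top ENNReal.coe_lt_top h.1.1.2)⟩
      exact ⟨(key hw).1.add h6, h5⟩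
  | succ m ih =>
    obtain ⟨G, hG, hw⟩ := h.2
    have hi' : i ≠ 0 := hi.resolve_left (Nat.succ_ne_zero m)
    refine ⟨key h.1, fun z => θ z * G z, ?_, ih (Or.inr hi') hw⟩
    have := hG.smooth_mul (MemLp_two_locallyIntegrable h.1.1)
      (MemLp_two_locallyIntegrable hw.memLp.1) hθ
    simpa only [htan i hi', zero_mul, add_zero] using this

/-- The cutoff to `|z 0| ≤ 2 R`. -/
noncomputable def radialCutoff (n R : ℕ) [NeZero n] (z : Euc n) : ℂ :=
  ((⟨1, 2, one_pos, one_lt_two⟩ : ContDiffBump (0 : ℝ)) (z 0 / (R + 1)) : ℝ)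

/-- The radial cutoffs and their derivatives are bounded uniformly in `R`. -/
theorem exists_radialCutoff_bound (n : ℕ) [NeZero n] : ∃ B : ℝ≥0, ∀ R : ℕ,
    ContDiff ℝ ∞ (radialCutoff n R) ∧ (∀ z, ‖radialCutoff n R z‖ₑ ≤ 1) ∧
    (∀ i, i ≠ 0 → ∀ z, fderiv ℝ (radialCutoff n R) z (stdVec i) = 0) ∧
    (∀ z, ‖fderiv ℝ (radialCutoff n R) z (stdVec 0)‖ₑ ≤ B) := by
  set b : ContDiffBump (0 : ℝ) := ⟨1, 2, one_pos, one_lt_two⟩ with hb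
  have hbs : ContDiff ℝ ∞ b := b.contDiff
  have hdc : Continuous (deriv b) := hbs.continuous_deriv (by simp)
  obtain ⟨B, hB⟩ := (hdc.bounded_above_of_compact_support b.hasCompactSupport.deriv)
  refine ⟨B.toNNReal, fun R => ?_⟩
  have hR : (0 : ℝ) < R + 1 := by positivity
  have hproj : ∀ z : Euc n, HasFDerivAt (fun z : Euc n => z 0 / ((R : ℝ) + 1))
      (((R : ℝ) + 1)⁻¹ • (EuclideanSpace.proj (0 : Fin n) : Euc n →L[ℝ] ℝ)) z := by
    intro z
    have h := ((EuclideanSpace.proj (0 : Fin n) : Euc n →L[ℝ] ℝ).hasFDerivAt (x := z)).const_smul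
      (((R : ℝ) + 1)⁻¹)
    refine h.congr_of_eventuallyEq (Eventually.of_forall fun y => ?_)
    simp [div_eq_inv_mul]
  have hd : ∀ z i, fderiv ℝ (radialCutoff n R) z (stdVec i) =
      ((deriv b (z 0 / (R + 1)) * (((R : ℝ) + 1)⁻¹ * (stdVec i : Euc n) 0) : ℝ) : ℂ) := by
    intro z i
    have h1 := ((hbs.differentiable (by simp)) (z 0 / (R + 1))).hasDerivAt.comp_hasFDerivAt z
      (hproj z)
    have h2 := (Complex.ofRealCLM.hasFDerivAt (x := b (z 0 / (R + 1)))).comp z h1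
    have h3 : fderiv ℝ (radialCutoff n R) z = _ := h2.fderiv
    rw [h3]
    rfl
  refine ⟨?_, fun z => ?_, fun i hi z => ?_, fun z => ?_⟩
  · refine Complex.ofRealCLM.contDiff.comp (hbs.comp ?_)
    exact ((EuclideanSpace.proj (0 : Fin n) : Euc n →L[ℝ] ℝ).contDiff).div_const _
  · rw [← ofReal_norm, ENNReal.ofReal_le_one, radialCutoff, Complex.norm_real,
      Real.norm_of_nonneg b.nonneg]
    exact b.le_one
  · rw [hd]
    simp [hi.symm]
  · rw [hd, ← ofReal_norm, Complex.norm_real, norm_mul]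
    refine ENNReal.ofReal_le_ofReal ?_
    have h1 : ‖((R : ℝ) + 1)⁻¹ * (stdVec 0 : Euc n) 0‖ ≤ 1 := by
      simp only [stdVec, PiLp.single_apply, if_true, mul_one]
      rw [Real.norm_of_nonneg (by positivity)]
      exact inv_le_one_of_one_le₀ (by linarith [(R.cast_nonneg : (0 : ℝ) ≤ R)])
    calc _ ≤ B * 1 := mul_le_mul (hB _) h1 (norm_nonneg _) ((norm_nonneg _).trans (hB 0))
      _ = B := mul_one B

theorem hasCompactSupport_radialCutoff_mul (R : ℕ) {F : Euc n → ℂ} {r : ℝ}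
    (hF : ∀ z, F z ≠ 0 → ∀ i, i ≠ 0 → |z i| ≤ r) :
    HasCompactSupport fun z => radialCutoff n R z * F z := by
  set b : ContDiffBump (0 : ℝ) := ⟨1, 2, one_pos, one_lt_two⟩ with hb
  set r' : ℝ := max r (2 * (R + 1)) with hr'
  have hr0 : 0 ≤ r' := le_max_of_le_right (by positivity)
  refine HasCompactSupport.of_support_subset_isCompact
    (isCompact_closedBall (0 : Euc n) (√(∑ _i : Fin n, r' ^ 2))) fun z hz => ?_
  have hz1 : radialCutoff n R z ≠ 0 := left_ne_zero_of_mul hz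
  have hz2 : F z ≠ 0 := right_ne_zero_of_mul hz
  have h0 : |z 0| ≤ 2 * (R + 1) := by
    by_contra hcon
    push Not at hcon
    refine hz1 ?_
    rw [radialCutoff, Complex.ofReal_eq_zero]
    refine b.zero_of_le_dist ?_
    have hR : (0 : ℝ) < R + 1 := by positivity
    rw [dist_zero_right, Real.norm_eq_abs, abs_div, abs_of_pos hR, le_div_iff₀ hR]
    exact hcon.le
  rw [mem_closedBall_zero_iff, EuclideanSpace.norm_eq]
  refine Real.sqrt_le_sqrt (Finset.sum_le_sum fun i _ => ?_)
  rw [Real.norm_eq_abs]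
  refine pow_le_pow_left₀ (abs_nonneg _) ?_ 2
  rcases eq_or_ne i 0 with rfl | hi
  · exact h0.trans (le_max_right _ _)
  · exact (hF z hz2 i hi).trans (le_max_left _ _)

/-- The bilinear estimate for functions with weak derivatives in `L²`, whose supports are bounded in
the tangential directions. -/
theorem exists_bilinear_weak {a b : ℕ} (ha : 1 ≤ a) (hab : n + 1 ≤ 2 * (a + b)) :
    ∃ C : ℝ≥0, ∀ (F G : Euc n → ℂ) (N N' : ℝ≥0∞) (r : ℝ),
      (∀ w ∈ radialWords n a, WeakSobolev w F N) → (∀ w ∈ tangWords n b, WeakSobolev w G N') →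
      (∀ z, F z ≠ 0 → ∀ i, i ≠ 0 → |z i| ≤ r) → (∀ z, G z ≠ 0 → ∀ i, i ≠ 0 → |z i| ≤ r) →
      eLpNorm (fun z => F z * G z) 2 volume ≤ C * (N * N') := by
  obtain ⟨C, hC⟩ := exists_bilinear_schwartz (n := n) ha hab
  obtain ⟨B, hB⟩ := exists_radialCutoff_bound n
  refine ⟨C * ((1 + B) * (1 + B)), fun F G N N' r hF hG hFr hGr => ?_⟩
  have hF2 : MemLp F 2 volume := (hF [] (Or.inl (Or.inl rfl))).1
  have hG2 : MemLp G 2 volume := (hG [] (Or.inl rfl)).1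
  have hcut : ∀ R : ℕ, eLpNorm (fun z => (radialCutoff n R z * F z) * (radialCutoff n R z * G z)) 2
      volume ≤ C * (((1 + B) * N) * ((1 + B) * N')) := by
    intro R
    obtain ⟨h1, h2, h3, h4⟩ := hB R
    -- every admissible word is a power of one tangential derivative, followed by at most one `∂_0`
    have hrad : ∀ {t : List (Fin n)} {F : Euc n → ℂ} {N : ℝ≥0∞}, (t = [] ∨ t = [0]) →
        WeakSobolev t F N → WeakSobolev t (fun z => radialCutoff n R z * F z) ((1 + B) * N) := by
      intro t F N ht h
      exact WeakSobolev.radial_mul h1 h2 h3 h4 ht (i := 0) (m := 0) (Or.inl rfl) h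
    refine eLpNorm_mul_le_of_hasCompactSupport hC ?_ ?_
      (hasCompactSupport_radialCutoff_mul R hFr) (hasCompactSupport_radialCutoff_mul R hGr)
    · rintro w hw
      have hw' := hF w hw
      rcases hw with (rfl | ⟨i, hi, rfl⟩) | (rfl | ⟨i, hi, rfl⟩)
      · exact hrad (Or.inl rfl) hw'
      · simpa using WeakSobolev.radial_mul h1 h2 h3 h4 (Or.inl rfl) (m := a) (Or.inr hi)
          (by simpa using hw')
      · exact hrad (Or.inr rfl) hw'
      · exact WeakSobolev.radial_mul h1 h2 h3 h4 (Or.inr rfl) (Or.inr hi) hw'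
    · rintro w hw
      have hw' := hG w hw
      rcases hw with rfl | ⟨i, hi, rfl⟩
      · exact hrad (Or.inl rfl) hw'
      · simpa using WeakSobolev.radial_mul h1 h2 h3 h4 (Or.inl rfl) (m := b) (Or.inr hi)
          (by simpa using hw')
  have hlim : ∀ z : Euc n, Tendsto
      (fun R : ℕ => (radialCutoff n R z * F z) * (radialCutoff n R z * G z)) atTop
      (𝓝 (F z * G z)) := by
    intro z
    refine tendsto_const_nhds.congr' ?_
    filter_upwards [eventually_ge_atTop ⌈|z 0|⌉₊] with R hR
    have h1 : radialCutoff n R z = 1 := by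
      rw [radialCutoff, Complex.ofReal_eq_one]
      refine ContDiffBump.one_of_mem_closedBall _ ?_
      have hR0 : (0 : ℝ) < R + 1 := by positivity
      rw [mem_closedBall_zero_iff, Real.norm_eq_abs, abs_div, abs_of_pos hR0, div_le_one hR0]
      have := Nat.ceil_le.1 hR
      linarith
    rw [h1, one_mul, one_mul]
  refine (Lp.eLpNorm_lim_le_liminf_eLpNorm (fun R => ?_) _
    (Eventually.of_forall hlim)).trans ?_
  · have hm := (hB R).1.continuous.aestronglyMeasurable (μ := (volume : Measure (Euc n)))
    exact (hm.mul hF2.1).mul (hm.mul hG2.1)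
  · refine liminf_le_of_le (by isBoundedDefault) fun c hc => ?_
    obtain ⟨R, hR⟩ := hc.exists
    refine hR.trans ((hcut R).trans (le_of_eq ?_))
    push_cast
    ring

end WeakBilinear

/-! ### Test functions and differential operators on them -/

section TestCalculus

variable {n : ℕ} [NeZero n] {M : Type*} [TopologicalSpace M]
  [ChartedSpace (EuclideanHalfSpace n) M]

/-- Smoothness of a complex function at a point, up to the boundary. -/
abbrev SmoothAt (n : ℕ) [NeZero n] {M : Type*} [TopologicalSpace M]
    [ChartedSpace (EuclideanHalfSpace n) M] (a : M → ℂ) (p : M) : Prop :=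
  ContMDiffAt (𝓡∂ n) 𝓘(ℝ, ℂ) ∞ a p

theorem SmoothAt.mul {a b : M → ℂ} {p : M} (ha : SmoothAt n a p) (hb : SmoothAt n b p) :
    SmoothAt n (fun q => a q * b q) p :=
  (contDiff_mul (𝕜 := ℝ) (𝔸 := ℂ)).contDiffAt.comp_contMDiffAt (ContMDiffAt.prodMk_space ha hb)

theorem SmoothAt.add {a b : M → ℂ} {p : M} (ha : SmoothAt n a p) (hb : SmoothAt n b p) :
    SmoothAt n (fun q => a q + b q) p :=
  ContMDiffAt.add ha hb

theorem SmoothAt.neg {a : M → ℂ} {p : M} (ha : SmoothAt n a p) :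
    SmoothAt n (fun q => - a q) p :=
  ContMDiffAt.neg ha

theorem SmoothAt.sub {a b : M → ℂ} {p : M} (ha : SmoothAt n a p) (hb : SmoothAt n b p) :
    SmoothAt n (fun q => a q - b q) p :=
  ContMDiffAt.sub ha hb

theorem SmoothAt.const (c : ℂ) (p : M) : SmoothAt n (fun _ : M => c) p := contMDiffAt_const

theorem SmoothAt.comp {a : M → ℂ} {f : ℂ → ℂ} {p : M} (hf : ContDiffAt ℝ ∞ f (a p))
    (ha : SmoothAt n a p) : SmoothAt n (fun q => f (a q)) p :=
  hf.comp_contMDiffAt ha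

theorem SmoothAt.inv {a : M → ℂ} {p : M} (ha : SmoothAt n a p) (h : a p ≠ 0) :
    SmoothAt n (fun q => (a q)⁻¹) p :=
  SmoothAt.comp (contDiffAt_inv ℝ h) ha

theorem SmoothAt.sum {ι : Type*} {s : Finset ι} {a : ι → M → ℂ} {p : M}
    (h : ∀ i ∈ s, SmoothAt n (a i) p) : SmoothAt n (fun q => ∑ i ∈ s, a i q) p :=
  contMDiffAt_finsetSum h

theorem SmoothAt.ofReal {a : M → ℝ} {p : M} (h : ContMDiffAt (𝓡∂ n) 𝓘(ℝ, ℝ) ∞ a p) :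
    SmoothAt n (fun q => (a q : ℂ)) p :=
  Complex.ofRealCLM.contDiff.contDiffAt.comp_contMDiffAt h

theorem SmoothAt.mdifferentiableAt {a : M → ℂ} {p : M} (h : SmoothAt n a p) :
    MDifferentiableAt (𝓡∂ n) 𝓘(ℝ, ℂ) a p :=
  ContMDiffAt.mdifferentiableAt h (by simp)

theorem SmoothAt.congr {a b : M → ℂ} {p : M} (h : SmoothAt n a p) (hab : b =ᶠ[nhds p] a) :
    SmoothAt n b p :=
  ContMDiffAt.congr_of_eventuallyEq h hab

theorem vderiv_mul (V : VField n M) {a b : M → ℂ} {p : M} (ha : SmoothAt n a p)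
    (hb : SmoothAt n b p) :
    vderiv V (fun q => a q * b q) p = vderiv V a p * b p + a p * vderiv V b p := by
  have := (ha.mdifferentiableAt.hasMFDerivAt.mul hb.mdifferentiableAt.hasMFDerivAt).mfderiv
  unfold vderiv
  change (mfderiv (𝓡∂ n) 𝓘(ℝ, ℂ) (a * b) p) (V p) = _
  rw [this]
  exact (add_comm _ _).trans (congrArg₂ _ (mul_comm (b p) (vderiv V a p)) rfl)

theorem vderiv_add (V : VField n M) {a b : M → ℂ} {p : M} (ha : SmoothAt n a p)
    (hb : SmoothAt n b p) :
    vderiv V (fun q => a q + b q) p = vderiv V a p + vderiv V b p := by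
  have := (ha.mdifferentiableAt.hasMFDerivAt.add hb.mdifferentiableAt.hasMFDerivAt).mfderiv
  unfold vderiv
  change (mfderiv (𝓡∂ n) 𝓘(ℝ, ℂ) (a + b) p) (V p) = _
  rw [this]
  rfl

theorem vderiv_const (V : VField n M) (c : ℂ) (p : M) : vderiv V (fun _ => c) p = 0 := by
  unfold vderiv
  rw [mfderiv_const]
  rfl

theorem vderiv_const_mul (V : VField n M) (c : ℂ) {a : M → ℂ} {p : M} (ha : SmoothAt n a p) :
    vderiv V (fun q => c * a q) p = c * vderiv V a p := by
  rw [vderiv_mul V (SmoothAt.const c p) ha, vderiv_const, zero_mul, zero_add]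

theorem vderiv_congr (V : VField n M) {a b : M → ℂ} {p : M} (h : a =ᶠ[nhds p] b) :
    vderiv V a p = vderiv V b p := by
  unfold vderiv
  rw [h.mfderiv_eq]
  exact congrArg _ rfl

theorem vderiv_comp (V : VField n M) {a : M → ℂ} {f : ℂ → ℂ} {p : M}
    (hf : DifferentiableAt ℂ f (a p)) (ha : SmoothAt n a p) :
    vderiv V (fun q => f (a q)) p = deriv f (a p) * vderiv V a p := by
  have h1 : HasMFDerivAt 𝓘(ℝ, ℂ) 𝓘(ℝ, ℂ) f (a p) (fderiv ℝ f (a p)) :=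
    (hf.restrictScalars ℝ).hasFDerivAt.hasMFDerivAt
  have := (h1.comp p ha.mdifferentiableAt.hasMFDerivAt).mfderiv
  unfold vderiv
  change (mfderiv (𝓡∂ n) 𝓘(ℝ, ℂ) (f ∘ a) p) (V p) = _
  rw [this]
  change fderiv ℝ f (a p) _ = _
  rw [(hf.hasFDerivAt.restrictScalars ℝ).fderiv]
  exact (fderiv_eq_smul_deriv _).trans (mul_comm (vderiv V a p) _)

theorem vderiv_ofReal (V : VField n M) {a : M → ℝ} {p : M}
    (h : MDifferentiableAt (𝓡∂ n) 𝓘(ℝ, ℝ) a p) :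
    vderiv V (fun q => (a q : ℂ)) p = (realDeriv V a p : ℂ) := by
  have h1 : HasMFDerivAt 𝓘(ℝ, ℝ) 𝓘(ℝ, ℂ) (fun t : ℝ => (t : ℂ)) (a p) Complex.ofRealCLM :=
    (Complex.ofRealCLM.hasFDerivAt).hasMFDerivAt
  have := (h1.comp p h.hasMFDerivAt).mfderiv
  unfold vderiv realDeriv
  change (mfderiv (𝓡∂ n) 𝓘(ℝ, ℂ) ((fun t : ℝ => (t : ℂ)) ∘ a) p) (V p) = _
  rw [this]
  rfl

theorem vderiv_inv (V : VField n M) {a : M → ℂ} {p : M} (ha : SmoothAt n a p) (h : a p ≠ 0) :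
    vderiv V (fun q => (a q)⁻¹) p = - vderiv V a p / a p ^ 2 := by
  rw [vderiv_comp V (differentiableAt_inv h) ha, deriv_inv]
  field_simp

theorem vderiv_sum (V : VField n M) {ι : Type*} {s : Finset ι} {a : ι → M → ℂ} {p : M}
    (h : ∀ i ∈ s, SmoothAt n (a i) p) :
    vderiv V (fun q => ∑ i ∈ s, a i q) p = ∑ i ∈ s, vderiv V (a i) p := by
  classical
  induction s using Finset.induction_on with
  | empty => simpa using vderiv_const V 0 p
  | insert i s his ih =>
    simp only [Finset.sum_insert his]
    rw [vderiv_add V (h i (Finset.mem_insert_self i s))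
      (SmoothAt.sum fun j hj => h j (Finset.mem_insert_of_mem hj)),
      ih fun j hj => h j (Finset.mem_insert_of_mem hj)]

variable [IsManifold (𝓡∂ n) ∞ M]

theorem isOpen_interior : IsOpen ((𝓡∂ n).interior M) :=
  ModelWithCorners.isOpen_interior (n := ∞) (by simp)

theorem contMDiff_vderiv {V : VField n M} (hV : IsSmoothVField V) {a : M → ℂ}
    (ha : ∀ p, SmoothAt n a p) (p : M) : SmoothAt n (vderiv V a) p := by
  have h1 : ContMDiff (𝓡∂ n).tangent 𝓘(ℝ, ℂ).tangent ∞ (tangentMap (𝓡∂ n) 𝓘(ℝ, ℂ) a) :=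
    ContMDiff.contMDiff_tangentMap (n := ∞) ha (by simp)
  have h2 := (contMDiff_snd_tangentBundle_modelSpace ℂ 𝓘(ℝ, ℂ)).comp (h1.comp hV)
  exact h2 p

theorem contMDiff_realDeriv {V : VField n M} (hV : IsSmoothVField V) {a : M → ℝ}
    (ha : ContMDiff (𝓡∂ n) 𝓘(ℝ, ℝ) ∞ a) : ContMDiff (𝓡∂ n) 𝓘(ℝ, ℝ) ∞ (realDeriv V a) := by
  have h1 : ContMDiff (𝓡∂ n).tangent 𝓘(ℝ, ℝ).tangent ∞ (tangentMap (𝓡∂ n) 𝓘(ℝ, ℝ) a) :=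
    ContMDiff.contMDiff_tangentMap (n := ∞) ha (by simp)
  exact (contMDiff_snd_tangentBundle_modelSpace ℝ 𝓘(ℝ, ℝ)).comp (h1.comp hV)

variable (n M) in
/-- The space of test functions on the interior of `M`. -/
noncomputable def testSpace : Submodule ℂ (M → ℂ) where
  carrier := {φ | IsTest (n := n) φ}
  zero_mem' := ⟨contMDiff_const, by simp [tsupport_eq_empty_iff.2 rfl]⟩
  add_mem' := fun {a b} ha hb => ⟨fun p => SmoothAt.add (ha.1 p) (hb.1 p),
    (tsupport_add a b).trans (Set.union_subset ha.2 hb.2)⟩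
  smul_mem' := fun c a ha => ⟨fun p => SmoothAt.mul (SmoothAt.const c p) (ha.1 p),
    (closure_mono (Function.support_const_smul_subset c a)).trans ha.2⟩

theorem testSpace_smoothAt (φ : testSpace n M) (p : M) : SmoothAt n φ.1 p := φ.2.1 p

theorem testSpace_eq_zero (φ : testSpace n M) {p : M} (hp : p ∉ (𝓡∂ n).interior M) : φ.1 p = 0 :=
  image_eq_zero_of_notMem_tsupport fun h => hp (φ.2.2 h)

theorem isTest_mul {a φ : M → ℂ} (ha : ∀ p ∈ (𝓡∂ n).interior M, SmoothAt n a p)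
    (hφ : IsTest (n := n) φ) : IsTest (n := n) fun q => a q * φ q := by
  have hs : tsupport (fun q => a q * φ q) ⊆ tsupport φ := tsupport_mul_subset_right
  exact ⟨contMDiff_of_tsupport fun p hp => SmoothAt.mul (ha p (hφ.2 (hs hp))) (hφ.1 p),
    hs.trans hφ.2⟩

theorem tsupport_vderiv_subset (V : VField n M) (φ : M → ℂ) : tsupport (vderiv V φ) ⊆ tsupport φ := by
  refine closure_minimal (fun p hp => ?_) (isClosed_tsupport φ)
  by_contra h
  apply hp
  have h0 : φ =ᶠ[nhds p] fun _ => 0 := notMem_tsupport_iff_eventuallyEq.1 h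
  rw [vderiv_congr V h0, vderiv_const]

theorem isTest_vderiv {V : VField n M} (hV : IsSmoothVField V) {φ : M → ℂ}
    (hφ : IsTest (n := n) φ) : IsTest (n := n) (vderiv V φ) :=
  ⟨contMDiff_vderiv hV hφ.1, (tsupport_vderiv_subset V φ).trans hφ.2⟩

/-- Operators on test functions. -/
abbrev TestOp (n : ℕ) [NeZero n] (M : Type*) [TopologicalSpace M]
    [ChartedSpace (EuclideanHalfSpace n) M] [IsManifold (𝓡∂ n) ∞ M] : Type _ :=
  Module.End ℂ (testSpace n M)

/-- Functions smooth on the interior of `M`. -/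
abbrev IntSmooth (n : ℕ) [NeZero n] {M : Type*} [TopologicalSpace M]
    [ChartedSpace (EuclideanHalfSpace n) M] (a : M → ℂ) : Prop :=
  ∀ p ∈ (𝓡∂ n).interior M, SmoothAt n a p

/-- Multiplication by a function smooth on the interior. -/
noncomputable def mulOp (a : M → ℂ) (ha : IntSmooth n a) : TestOp n M where
  toFun φ := ⟨fun q => a q * φ.1 q, isTest_mul ha φ.2⟩
  map_add' φ ψ := by ext q; exact mul_add _ _ _
  map_smul' c φ := by ext q; exact mul_left_comm _ _ _

/-- Differentiation along a smooth vector field. -/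
noncomputable def fieldOp (V : VField n M) (hV : IsSmoothVField V) : TestOp n M where
  toFun φ := ⟨vderiv V φ.1, isTest_vderiv hV φ.2⟩
  map_add' φ ψ := by ext q; exact vderiv_add V (testSpace_smoothAt φ q) (testSpace_smoothAt ψ q)
  map_smul' c φ := by ext q; exact vderiv_const_mul V c (testSpace_smoothAt φ q)

@[simp] theorem mulOp_apply {a : M → ℂ} (ha : IntSmooth n a) (φ : testSpace n M) (q : M) :
    (mulOp a ha φ).1 q = a q * φ.1 q := rfl

@[simp] theorem fieldOp_apply {V : VField n M} (hV : IsSmoothVField V) (φ : testSpace n M) (q : M) :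
    (fieldOp V hV φ).1 q = vderiv V φ.1 q := rfl

/-- Two operators agree once they agree pointwise in the interior. -/
theorem testOp_ext {P Q : TestOp n M}
    (h : ∀ φ : testSpace n M, ∀ q ∈ (𝓡∂ n).interior M, (P φ).1 q = (Q φ).1 q) : P = Q := by
  ext φ q
  by_cases hq : q ∈ (𝓡∂ n).interior M
  · exact h φ q hq
  · rw [testSpace_eq_zero _ hq, testSpace_eq_zero _ hq]

variable (n M) in
/-- Multiplications by functions smooth up to the boundary. -/
noncomputable def coeffRing : Subring (TestOp n M) where
  carrier := {Q | ∃ a : M → ℂ, ∃ h : ∀ p, SmoothAt n a p, Q = mulOp a fun p _ => h p}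
  one_mem' := ⟨fun _ => 1, SmoothAt.const 1, by ext φ q; simp⟩
  zero_mem' := ⟨fun _ => 0, SmoothAt.const 0, by ext φ q; simp⟩
  mul_mem' := by
    rintro _ _ ⟨a, ha, rfl⟩ ⟨b, hb, rfl⟩
    exact ⟨fun q => a q * b q, fun p => (ha p).mul (hb p), by ext φ q; simp [mul_assoc]⟩
  add_mem' := by
    rintro _ _ ⟨a, ha, rfl⟩ ⟨b, hb, rfl⟩
    exact ⟨fun q => a q + b q, fun p => (ha p).add (hb p), by ext φ q; simp [add_mul]⟩
  neg_mem' := by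
    rintro _ ⟨a, ha, rfl⟩
    exact ⟨fun q => - a q, fun p => (ha p).neg, by ext φ q; simp⟩

theorem mulOp_mem_coeffRing {a : M → ℂ} (h : ∀ p, SmoothAt n a p) {h' : IntSmooth n a} :
    mulOp a h' ∈ coeffRing n M := ⟨a, h, rfl⟩

/-- An operator that agrees in the interior with the multiplication by a function smooth up to the
boundary is in the coefficient ring. -/
theorem mem_coeffRing_of_apply {Q : TestOp n M} {a : M → ℂ} (h : ∀ p, SmoothAt n a p)
    (hQ : ∀ φ : testSpace n M, ∀ q ∈ (𝓡∂ n).interior M, (Q φ).1 q = a q * φ.1 q) :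
    Q ∈ coeffRing n M :=
  ⟨a, h, testOp_ext fun φ q hq => hQ φ q hq⟩

end TestCalculus

/-! ### The boundary defining function and the generating fields -/

section Charts

open Filter Topology

variable {n : ℕ} [NeZero n] {M : Type*} [TopologicalSpace M]
  [ChartedSpace (EuclideanHalfSpace n) M] [IsManifold (𝓡∂ n) ∞ M]

/-- A germ of a smooth function extends to a smooth function. -/
theorem exists_smooth_extension [CompactSpace M] [T2Space M] {a : M → ℂ} {p : M}
    (ha : ∀ᶠ q in 𝓝 p, SmoothAt n a q) :
    ∃ b : M → ℂ, (∀ q, SmoothAt n b q) ∧ ∀ᶠ q in 𝓝 p, b q = a q := by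
  obtain ⟨f, -, hf⟩ := (SmoothBumpFunction.nhds_basis_tsupport (I := 𝓡∂ n) p).mem_iff.1 ha
  refine ⟨fun q => (f q : ℂ) * a q, contMDiff_of_tsupport fun q hq => ?_, ?_⟩
  · have : q ∈ tsupport f := by
      refine closure_mono (fun r hr => ?_) hq
      rw [Function.mem_support] at hr ⊢
      intro h
      simp [h] at hr
    exact SmoothAt.mul (SmoothAt.ofReal (f.contMDiff q)) (hf this)
  · filter_upwards [f.eventuallyEq_one] with q hq
    simp [hq]

theorem eventually_smoothAt_vderiv [CompactSpace M] [T2Space M] {V : VField n M}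
    (hV : IsSmoothVField V) {a : M → ℂ} {p : M} (ha : ∀ᶠ q in 𝓝 p, SmoothAt n a q) :
    ∀ᶠ q in 𝓝 p, SmoothAt n (vderiv V a) q := by
  obtain ⟨b, hb, hba⟩ := exists_smooth_extension ha
  filter_upwards [hba.eventually_nhds] with q hq
  refine (contMDiff_vderiv hV hb q).congr ?_
  filter_upwards [hq.eventually_nhds] with r hr
  exact vderiv_congr V (hr.mono fun s hs => hs.symm)

theorem mdifferentiable_of_mem_maximalAtlas {φ : OpenPartialHomeomorph M (EuclideanHalfSpace n)}
    (hφ : φ ∈ IsManifold.maximalAtlas (𝓡∂ n) ∞ M) : φ.MDifferentiable (𝓡∂ n) (𝓡∂ n) :=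
  ⟨(contMDiffOn_of_mem_maximalAtlas hφ).mdifferentiableOn (by simp),
    (contMDiffOn_symm_of_mem_maximalAtlas hφ).mdifferentiableOn (by simp)⟩

theorem hasMFDerivAt_coord (i : Fin n) (z : EuclideanHalfSpace n) :
    HasMFDerivAt (𝓡∂ n) 𝓘(ℝ, ℝ) (fun w : EuclideanHalfSpace n => w.val i) z
      (EuclideanSpace.proj i : Euc n →L[ℝ] ℝ) :=
  ((EuclideanSpace.proj i : Euc n →L[ℝ] ℝ).hasFDerivAt.hasMFDerivAt).comp z (𝓡∂ n).hasMFDerivAt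

theorem contMDiff_coord (i : Fin n) :
    ContMDiff (𝓡∂ n) 𝓘(ℝ, ℝ) ∞ (fun w : EuclideanHalfSpace n => w.val i) :=
  (EuclideanSpace.proj i : Euc n →L[ℝ] ℝ).contDiff.comp_contMDiff ((𝓡∂ n).contMDiff)

theorem contMDiffAt_chart_coord {φ : OpenPartialHomeomorph M (EuclideanHalfSpace n)}
    (hφ : φ ∈ IsManifold.maximalAtlas (𝓡∂ n) ∞ M) (i : Fin n) {p : M} (hp : p ∈ φ.source) :
    ContMDiffAt (𝓡∂ n) 𝓘(ℝ, ℝ) ∞ (fun q => (φ q).val i) p :=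
  (contMDiff_coord i (φ p)).comp p (contMDiffAt_of_mem_maximalAtlas hφ hp)

/-- The components of a vector field in a chart. -/
noncomputable def chartComponents (φ : OpenPartialHomeomorph M (EuclideanHalfSpace n))
    (V : VField n M) (p : M) : Euc n :=
  mfderiv (𝓡∂ n) (𝓡∂ n) φ p (V p)

theorem realDeriv_chart_coord {φ : OpenPartialHomeomorph M (EuclideanHalfSpace n)}
    (hφ : φ ∈ IsManifold.maximalAtlas (𝓡∂ n) ∞ M) (V : VField n M) (i : Fin n) {p : M}
    (hp : p ∈ φ.source) :
    realDeriv V (fun q => (φ q).val i) p = chartComponents φ V p i := by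
  have h := ((hasMFDerivAt_coord i (φ p)).comp p
    ((mdifferentiable_of_mem_maximalAtlas hφ).mdifferentiableAt hp).hasMFDerivAt).mfderiv
  unfold realDeriv
  change (mfderiv (𝓡∂ n) 𝓘(ℝ, ℝ) ((fun w : EuclideanHalfSpace n => w.val i) ∘ φ) p) (V p) = _
  rw [h]
  rfl

/-- A vector field is the sum of its components in a chart. -/
theorem field_eq_sum_coordVec {φ : OpenPartialHomeomorph M (EuclideanHalfSpace n)}
    (hφ : φ ∈ IsManifold.maximalAtlas (𝓡∂ n) ∞ M) (V : VField n M) {p : M} (hp : p ∈ φ.source) :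
    V p = ∑ i, realDeriv V (fun q => (φ q).val i) p • coordVec φ i p := by
  have h := (mdifferentiable_of_mem_maximalAtlas hφ).symm_comp_deriv hp
  have h2 : (mfderiv (𝓡∂ n) (𝓡∂ n) φ.symm (φ p)) (mfderiv (𝓡∂ n) (𝓡∂ n) φ p (V p)) = V p :=
    congrArg (fun L => L (V p)) h
  have h3 : chartComponents φ V p
      = ∑ i, realDeriv V (fun q => (φ q).val i) p • stdVec i := by
    ext k
    simp only [realDeriv_chart_coord hφ V _ hp]
    simp [Finset.sum_apply, Pi.single_apply]
  have h4 := congrArg (fun w : Euc n => (mfderiv (𝓡∂ n) (𝓡∂ n) φ.symm (φ p)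
    (w : TangentSpace (𝓡∂ n) (φ p)) : Euc n)) h3
  refine h2.symm.trans (h4.trans ?_)
  refine (map_sum (mfderiv (𝓡∂ n) (𝓡∂ n) φ.symm (φ p)) _ _).trans ?_
  exact Finset.sum_congr rfl fun i _ => map_smul (mfderiv (𝓡∂ n) (𝓡∂ n) φ.symm (φ p)) _ _

theorem realDeriv_coordVec {φ : OpenPartialHomeomorph M (EuclideanHalfSpace n)}
    (hφ : φ ∈ IsManifold.maximalAtlas (𝓡∂ n) ∞ M) (i k : Fin n) {p : M} (hp : p ∈ φ.source) :
    realDeriv (coordVec φ i) (fun q => (φ q).val k) p = if k = i then 1 else 0 := by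
  rw [realDeriv_chart_coord hφ _ _ hp]
  have h := (mdifferentiable_of_mem_maximalAtlas hφ).comp_symm_deriv (φ.map_source hp)
  rw [φ.left_inv hp] at h
  have h2 : chartComponents φ (coordVec φ i) p = stdVec i := congrArg (fun L => L (stdVec i)) h
  rw [h2]
  simp

theorem vderiv_smul (a : ℝ) (V : VField n M) (ψ : M → ℂ) (p : M) {W : VField n M}
    (h : W p = a • V p) : vderiv W ψ p = a * vderiv V ψ p := by
  unfold vderiv
  rw [h, map_smul]
  exact Complex.real_smul

theorem vderiv_of_eq_sum {ι : Type*} (s : Finset ι) (a : ι → ℝ) (V : ι → VField n M) (ψ : M → ℂ)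
    (p : M) {W : VField n M} (h : W p = ∑ i ∈ s, a i • V i p) :
    vderiv W ψ p = ∑ i ∈ s, a i * vderiv (V i) ψ p := by
  unfold vderiv
  rw [h, map_sum]
  refine Finset.sum_congr rfl fun i _ => ?_
  rw [map_smul]
  exact Complex.real_smul

end Charts

section Generators

open Filter Topology

variable {n : ℕ} [NeZero n] {M : Type*} [TopologicalSpace M]
  [ChartedSpace (EuclideanHalfSpace n) M] [IsManifold (𝓡∂ n) ∞ M]
  {x : M → ℝ} {g : BilinField n M}

theorem IsBoundaryDefining.nonneg (hx : IsBoundaryDefining n x) (p : M) : 0 ≤ x p := by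
  have h : p ∈ (𝓡∂ n).interior M ∪ (𝓡∂ n).boundary M := by
    rw [ModelWithCorners.interior_union_boundary_eq_univ]; trivial
  rcases h with h | h
  · exact (hx.pos p h).le
  · exact (hx.eq_zero p h).ge

theorem IsBoundaryDefining.pos_iff (hx : IsBoundaryDefining n x) (p : M) :
    0 < x p ↔ p ∈ (𝓡∂ n).interior M := by
  refine ⟨fun h0 => ?_, hx.pos p⟩
  have h : p ∈ (𝓡∂ n).interior M ∪ (𝓡∂ n).boundary M := by
    rw [ModelWithCorners.interior_union_boundary_eq_univ]; trivial
  rcases h with h | h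
  · exact h
  · exact absurd (hx.eq_zero p h) h0.ne'

theorem IsBoundaryDefining.smoothAt (hx : IsBoundaryDefining n x) (p : M) :
    SmoothAt n (fun q => (x q : ℂ)) p :=
  SmoothAt.ofReal (hx.smooth p)

theorem IsBoundaryDefining.vderiv_eq (hx : IsBoundaryDefining n x) (V : VField n M) (p : M) :
    vderiv V (fun q => (x q : ℂ)) p = (realDeriv V x p : ℂ) :=
  vderiv_ofReal V (ContMDiffAt.mdifferentiableAt (hx.smooth p) (by simp))

namespace Generators

variable (G : Generators x g)

theorem field_smooth (j : G.MIdx) : IsSmoothVField (G.field j) := by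
  rcases j with _ | a | b
  · exact G.radial_smooth
  · exact G.angular_smooth a
  · exact G.interior_smooth b

theorem realDeriv_radial {p : M} (hp : x p ≤ G.c) : realDeriv G.radial x p = x p := by
  obtain ⟨φ, hφ, hpφ⟩ := G.collar p hp
  have h1 : realDeriv G.radial x p = x p * realDeriv (coordVec φ 0) x p := by
    unfold realDeriv
    rw [G.radial_eq φ hφ p hpφ hp, map_smul]
    rfl
  have h2 : realDeriv (coordVec φ 0) x p = realDeriv (coordVec φ 0) (fun q => (φ q).val 0) p := by
    unfold realDeriv
    have : x =ᶠ[𝓝 p] fun q => (φ q).val 0 := by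
      filter_upwards [φ.open_source.mem_nhds hpφ] with q hq
      exact (hφ.coord_zero q hq).symm
    rw [this.mfderiv_eq]
    exact congrArg _ rfl
  rw [h1, h2, realDeriv_coordVec hφ.mem_atlas 0 0 hpφ]
  simp

open Classical in
/-- The function `ε_j` with `V_j x = x ε_j`; it is `1` on the collar for the radial field, and `0`
there for the other generating fields. -/
noncomputable def logDeriv (j : G.MIdx) (p : M) : ℝ :=
  if x p < G.c then (if j = none then 1 else 0) else realDeriv (G.field j) x p / x p

theorem logDeriv_none {p : M} (hp : x p < G.c) : G.logDeriv none p = 1 := by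
  simp [logDeriv, hp]

theorem logDeriv_some {p : M} (hp : x p < G.c) (j : G.NIdx) : G.logDeriv (some j) p = 0 := by
  simp [logDeriv, hp]

theorem realDeriv_eq (j : G.MIdx) (p : M) : realDeriv (G.field j) x p = x p * G.logDeriv j p := by
  by_cases h : x p < G.c
  · rcases j with _ | a | b
    · rw [G.logDeriv_none h, mul_one]; exact G.realDeriv_radial h.le
    · rw [G.logDeriv_some h, mul_zero]; exact G.angular_tangent a p
    · rw [G.logDeriv_some h, mul_zero]
      change mfderiv (𝓡∂ n) 𝓘(ℝ, ℝ) x p (G.interior b p) = 0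
      rw [G.interior_supp b p h.le]
      exact map_zero _
  · have : x p ≠ 0 := fun h0 => h (h0 ▸ G.c_pos)
    rw [logDeriv, if_neg h]
    field_simp

/-- A smooth function vanishing on the open collar is divisible by `x`. -/
theorem smoothAt_div (hx : IsBoundaryDefining n x) {a : M → ℂ} (ha : ∀ p, SmoothAt n a p)
    (h0 : ∀ p, x p < G.c → a p = 0) (p : M) : SmoothAt n (fun q => a q / x q) p := by
  by_cases h : x p < G.c
  · refine (SmoothAt.const 0 p).congr ?_
    filter_upwards [(isOpen_lt hx.smooth.continuous continuous_const).mem_nhds h] with q hq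
    rw [h0 q hq, zero_div]
  · have : (x p : ℂ) ≠ 0 := by
      intro h1
      exact h ((Complex.ofReal_eq_zero.1 h1).symm ▸ G.c_pos)
    exact ((ha p).mul ((hx.smoothAt p).inv this)).congr (Eventually.of_forall fun q => div_eq_mul_inv _ _)

theorem logDeriv_smoothAt (hx : IsBoundaryDefining n x) (j : G.MIdx) (p : M) :
    SmoothAt n (fun q => (G.logDeriv j q : ℂ)) p := by
  by_cases h : x p < G.c
  · refine (SmoothAt.const (if j = none then 1 else 0) p).congr ?_
    filter_upwards [(isOpen_lt hx.smooth.continuous continuous_const).mem_nhds h] with q hq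
    have hq' : x q < G.c := hq
    rcases j with _ | a <;> simp [logDeriv, hq']
  · have hp : x p ≠ 0 := fun h0 => h (h0 ▸ G.c_pos)
    have : (x p : ℂ) ≠ 0 := by exact_mod_cast hp
    refine ((SmoothAt.ofReal (contMDiff_realDeriv (G.field_smooth j) hx.smooth p)).mul
      ((hx.smoothAt p).inv this)).congr ?_
    filter_upwards [(isOpen_ne_fun hx.smooth.continuous continuous_const).mem_nhds hp] with q hq
    have hq' : (x q : ℂ) ≠ 0 := by exact_mod_cast hq
    rw [G.realDeriv_eq]
    push_cast
    field_simp

theorem vderiv_x (hx : IsBoundaryDefining n x) (j : G.MIdx) (p : M) :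
    vderiv (G.field j) (fun q => (x q : ℂ)) p = x p * G.logDeriv j p := by
  rw [hx.vderiv_eq, G.realDeriv_eq]
  push_cast
  rfl

end Generators

end Generators

/-! ### Charts of the interior with values in the full coordinate space -/

section LogChart

open Filter Topology

variable {n : ℕ} [NeZero n]

/-- The map `w ↦ (e^{-w_0}, w_1, …, w_{n-1})`. -/
noncomputable def expCoord (w : Euc n) : Euc n := w + (Real.exp (-(w 0)) - w 0) • stdVec 0

/-- The map `z ↦ (- log z_0, z_1, …, z_{n-1})`. -/
noncomputable def logCoord (z : Euc n) : Euc n := z + (-Real.log (z 0) - z 0) • stdVec 0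

theorem expCoord_zero (w : Euc n) : expCoord w 0 = Real.exp (-(w 0)) := by
  simp [expCoord]

theorem expCoord_ne (w : Euc n) {i : Fin n} (hi : i ≠ 0) : expCoord w i = w i := by
  simp [expCoord, hi]

theorem logCoord_zero (z : Euc n) : logCoord z 0 = -Real.log (z 0) := by
  simp [logCoord]

theorem logCoord_ne (z : Euc n) {i : Fin n} (hi : i ≠ 0) : logCoord z i = z i := by
  simp [logCoord, hi]

theorem contDiff_expCoord : ContDiff ℝ ∞ (expCoord : Euc n → Euc n) := by
  unfold expCoord
  fun_prop

theorem contDiffAt_logCoord {z : Euc n} (hz : 0 < z 0) : ContDiffAt ℝ ∞ logCoord z := by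
  unfold logCoord
  have h : ContDiffAt ℝ ∞ (fun z : Euc n => Real.log (z 0)) z :=
    ContDiffAt.log (by fun_prop) hz.ne'
  fun_prop

theorem fderiv_expCoord_zero (w : Euc n) :
    fderiv ℝ expCoord w (stdVec 0) = (-Real.exp (-(w 0))) • stdVec 0 := by
  have h0 : HasFDerivAt (fun w : Euc n => w 0) (EuclideanSpace.proj 0 : Euc n →L[ℝ] ℝ) w :=
    (EuclideanSpace.proj (0 : Fin n) : Euc n →L[ℝ] ℝ).hasFDerivAt
  have h : HasFDerivAt (expCoord : Euc n → Euc n) _ w :=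
    (hasFDerivAt_id w).add ((h0.neg.exp.sub h0).smul_const (stdVec 0))
  rw [h.fderiv]
  ext k
  simp
  split_ifs <;> ring

theorem fderiv_expCoord_ne (w : Euc n) {i : Fin n} (hi : i ≠ 0) :
    fderiv ℝ expCoord w (stdVec i) = stdVec i := by
  have h0 : HasFDerivAt (fun w : Euc n => w 0) (EuclideanSpace.proj 0 : Euc n →L[ℝ] ℝ) w :=
    (EuclideanSpace.proj (0 : Fin n) : Euc n →L[ℝ] ℝ).hasFDerivAt
  have h : HasFDerivAt (expCoord : Euc n → Euc n) _ w :=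
    (hasFDerivAt_id w).add ((h0.neg.exp.sub h0).smul_const (stdVec 0))
  rw [h.fderiv]
  ext k
  simp [hi.symm]

variable (n) in
/-- The coordinates `(- log z_0, z_1, …, z_{n-1})` identify the open half space with the full
coordinate space. -/
noncomputable def logChart : OpenPartialHomeomorph (EuclideanHalfSpace n) (Euc n) where
  toFun z := logCoord z.val
  invFun w := ⟨expCoord w, (expCoord_zero w).symm ▸ (Real.exp_pos _).le⟩
  source := {z | 0 < z.val 0}
  target := Set.univ
  map_source' _ _ := trivial
  map_target' w _ := by
    change 0 < expCoord w 0
    rw [expCoord_zero]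
    exact Real.exp_pos _
  left_inv' z hz := by
    apply EuclideanHalfSpace.ext
    ext i
    change expCoord (logCoord z.val) i = z.val i
    by_cases hi : i = 0
    · subst hi
      rw [expCoord_zero, logCoord_zero, neg_neg, Real.exp_log hz]
    · rw [expCoord_ne _ hi, logCoord_ne _ hi]
  right_inv' w _ := by
    ext i
    change logCoord (expCoord w) i = w i
    by_cases hi : i = 0
    · subst hi
      rw [logCoord_zero, expCoord_zero, Real.log_exp, neg_neg]
    · rw [logCoord_ne _ hi, expCoord_ne _ hi]
  open_source := isOpen_lt continuous_const ((contMDiff_coord 0).continuous)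
  open_target := isOpen_univ
  continuousOn_toFun z hz :=
    ((contDiffAt_logCoord hz).continuousAt.comp continuous_subtype_val.continuousAt).continuousWithinAt
  continuousOn_invFun :=
    (Continuous.subtype_mk contDiff_expCoord.continuous _).continuousOn

theorem contMDiffOn_logChart :
    ContMDiffOn (𝓡∂ n) 𝓘(ℝ, Euc n) ∞ (logChart n) (logChart n).source := fun z hz =>
  ((contDiffAt_logCoord hz).comp_contMDiffAt ((𝓡∂ n).contMDiff z)).contMDiffWithinAt

theorem contMDiff_logChart_symm : ContMDiff 𝓘(ℝ, Euc n) (𝓡∂ n) ∞ (logChart n).symm := by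
  have h : ∀ w : Euc n, expCoord w ∈ Set.range (𝓡∂ n) := by
    intro w
    rw [range_modelWithCornersEuclideanHalfSpace]
    change 0 ≤ expCoord w 0
    rw [expCoord_zero]
    exact (Real.exp_pos _).le
  have h2 : ((logChart n).symm : Euc n → EuclideanHalfSpace n) = (𝓡∂ n).symm ∘ expCoord := by
    funext w
    obtain ⟨z, hz⟩ := h w
    have : (𝓡∂ n).symm (expCoord w) = z := by rw [← hz, ModelWithCorners.left_inv]
    rw [Function.comp_apply, this]
    exact EuclideanHalfSpace.ext _ _ hz.symm
  rw [h2]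
  exact contMDiffOn_univ.1 ((𝓡∂ n).contMDiffOn_symm.comp contDiff_expCoord.contMDiff.contMDiffOn
    fun w _ => h w)

theorem mfderiv_logChart_symm (w : Euc n) (v : Euc n) :
    (mfderiv 𝓘(ℝ, Euc n) (𝓡∂ n) (logChart n).symm w v : Euc n) = fderiv ℝ expCoord w v := by
  have h := (((𝓡∂ n).hasMFDerivAt (x := (logChart n).symm w)).comp w
    ((contMDiff_logChart_symm w).mdifferentiableAt (by simp)).hasMFDerivAt).mfderiv
  have h2 : ((𝓡∂ n) ∘ (logChart n).symm : Euc n → Euc n) = expCoord := rfl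
  rw [h2, mfderiv_eq_fderiv] at h
  rw [h]
  rfl

end LogChart

section InteriorChart

open Filter Topology

variable {n : ℕ} [NeZero n] {M : Type*} [TopologicalSpace M]
  [ChartedSpace (EuclideanHalfSpace n) M] [IsManifold (𝓡∂ n) ∞ M]

/-- A smooth chart of an open subset of the interior, with values in the full coordinate space. -/
structure IsInteriorChart (Ψ : OpenPartialHomeomorph M (Euc n)) : Prop where
  source_subset : Ψ.source ⊆ (𝓡∂ n).interior M
  smooth : ∀ p ∈ Ψ.source, ContMDiffAt (𝓡∂ n) 𝓘(ℝ, Euc n) ∞ Ψ p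
  smooth_symm : ∀ w ∈ Ψ.target, ContMDiffAt 𝓘(ℝ, Euc n) (𝓡∂ n) ∞ Ψ.symm w

/-- The coordinate vector fields of a chart with values in the full coordinate space. -/
noncomputable def eucVec (Ψ : OpenPartialHomeomorph M (Euc n)) (i : Fin n) : VField n M :=
  fun p => (mfderiv 𝓘(ℝ, Euc n) (𝓡∂ n) Ψ.symm (Ψ p) (stdVec i) : Euc n)

theorem vderiv_eucVec {Ψ : OpenPartialHomeomorph M (Euc n)} (hΨ : IsInteriorChart Ψ) (i : Fin n)
    {ψ : M → ℂ} {p : M} (hp : p ∈ Ψ.source) (hψ : SmoothAt n ψ p) :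
    vderiv (eucVec Ψ i) ψ p = fderiv ℝ (ψ ∘ Ψ.symm) (Ψ p) (stdVec i) := by
  have h1 : HasMFDerivAt (𝓡∂ n) 𝓘(ℝ, ℂ) ψ (Ψ.symm (Ψ p)) (mfderiv (𝓡∂ n) 𝓘(ℝ, ℂ) ψ p) := by
    have := hψ.mdifferentiableAt.hasMFDerivAt
    rw [Ψ.left_inv hp]
    exact this
  have h := (h1.comp (Ψ p)
    ((hΨ.smooth_symm _ (Ψ.map_source hp)).mdifferentiableAt (by simp)).hasMFDerivAt).mfderiv
  rw [mfderiv_eq_fderiv] at h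
  rw [h]
  rfl

theorem contDiffAt_comp_symm {Ψ : OpenPartialHomeomorph M (Euc n)} (hΨ : IsInteriorChart Ψ)
    {ψ : M → ℂ} {w : Euc n} (hw : w ∈ Ψ.target) (hψ : SmoothAt n ψ (Ψ.symm w)) :
    ContDiffAt ℝ ∞ (ψ ∘ Ψ.symm) w :=
  contMDiffAt_iff_contDiffAt.1 (ContMDiffAt.comp w hψ (hΨ.smooth_symm w hw))

/-- The restriction to an open set of the chart `(- log z_0, z_1, …, z_{n-1})`, where `z` are the
coordinates of the chart `φ`. -/
noncomputable def interiorChart (φ : OpenPartialHomeomorph M (EuclideanHalfSpace n)) (U : Set M)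
    (hU : IsOpen U) : OpenPartialHomeomorph M (Euc n) :=
  (φ.trans (logChart n)).restrOpen U hU

variable {φ : OpenPartialHomeomorph M (EuclideanHalfSpace n)} {U : Set M} {hU : IsOpen U}

theorem mem_interiorChart_source {p : M} :
    p ∈ (interiorChart φ U hU).source ↔ (p ∈ φ.source ∧ 0 < (φ p).val 0) ∧ p ∈ U := by
  simp only [interiorChart, OpenPartialHomeomorph.restrOpen_source,
    OpenPartialHomeomorph.trans_source, Set.mem_inter_iff, Set.mem_preimage]
  rfl

theorem isInteriorChart_interiorChart (hφ : φ ∈ IsManifold.maximalAtlas (𝓡∂ n) ∞ M)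
    (hUi : ∀ p ∈ φ.source, p ∈ U → 0 < (φ p).val 0 → p ∈ (𝓡∂ n).interior M) :
    IsInteriorChart (interiorChart φ U hU) where
  source_subset p hp := by
    rw [mem_interiorChart_source] at hp
    exact hUi p hp.1.1 hp.2 hp.1.2
  smooth p hp := by
    rw [mem_interiorChart_source] at hp
    have h1 : ContMDiffAt (𝓡∂ n) 𝓘(ℝ, Euc n) ∞ (logChart n) (φ p) :=
      (contMDiffOn_logChart _ hp.1.2).contMDiffAt ((logChart n).open_source.mem_nhds hp.1.2)
    exact h1.comp p (contMDiffAt_of_mem_maximalAtlas hφ hp.1.1)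
  smooth_symm w hw := by
    have h := (interiorChart φ U hU).map_target hw
    rw [mem_interiorChart_source] at h
    have hw' : (logChart n).symm w ∈ φ.target := by
      have : w ∈ (φ.trans (logChart n)).target := hw.1
      exact this.2
    exact (contMDiffAt_symm_of_mem_maximalAtlas hφ hw').comp w (contMDiff_logChart_symm w)

/-- The coordinate field of `w_0 = - log z_0` is `- z_0 ∂_{z_0}`. -/
theorem eucVec_interiorChart (hφ : φ ∈ IsManifold.maximalAtlas (𝓡∂ n) ∞ M) {p : M}
    (hp : p ∈ (interiorChart φ U hU).source) (i : Fin n) :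
    eucVec (interiorChart φ U hU) i p
      = (if i = 0 then - (φ p).val 0 else 1 : ℝ) • coordVec φ i p := by
  rw [mem_interiorChart_source] at hp
  set w := interiorChart φ U hU p with hw
  have hw1 : (logChart n).symm w = φ p := (logChart n).left_inv hp.1.2
  have h1 : HasMFDerivAt (𝓡∂ n) (𝓡∂ n) φ.symm ((logChart n).symm w)
      (mfderiv (𝓡∂ n) (𝓡∂ n) φ.symm (φ p)) := by
    rw [hw1]
    exact ((mdifferentiable_of_mem_maximalAtlas hφ).mdifferentiableAt_symm
      (φ.map_source hp.1.1)).hasMFDerivAt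
  have h := (h1.comp w ((contMDiff_logChart_symm w).mdifferentiableAt (by simp)).hasMFDerivAt).mfderiv
  have h2 : eucVec (interiorChart φ U hU) i p = mfderiv (𝓡∂ n) (𝓡∂ n) φ.symm (φ p)
      (fderiv ℝ expCoord w (stdVec i) : Euc n) := by
    rw [← mfderiv_logChart_symm]
    exact congrArg (fun L => L (stdVec i)) h
  rw [h2]
  have hw0 : Real.exp (-(w 0)) = (φ p).val 0 := by
    rw [← expCoord_zero]
    exact congrArg (fun z : EuclideanHalfSpace n => z.val 0) hw1
  split_ifs with hi
  · subst hi
    rw [fderiv_expCoord_zero, hw0]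
    exact map_smul (mfderiv (𝓡∂ n) (𝓡∂ n) φ.symm (φ p)) _ _
  · rw [fderiv_expCoord_ne _ hi, one_smul]
    rfl

end InteriorChart

/-! ### The Riemannian measure in a chart of the interior -/

section Density

open Filter Topology

variable {n : ℕ} [NeZero n] {M : Type*} [TopologicalSpace M]
  [ChartedSpace (EuclideanHalfSpace n) M] [IsManifold (𝓡∂ n) ∞ M]

/-- The coefficients of a metric in a chart with values in the full coordinate space. -/
noncomputable def eucGram (g : BilinField n M) (Ψ : OpenPartialHomeomorph M (Euc n)) (p : M) :
    Matrix (Fin n) (Fin n) ℝ :=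
  Matrix.of fun i j => g p (eucVec Ψ i p) (eucVec Ψ j p)

/-- The density of the Riemannian measure in a chart with values in the full coordinate space. -/
noncomputable def eucDensity (g : BilinField n M) (Ψ : OpenPartialHomeomorph M (Euc n)) (p : M) :
    ℝ :=
  √ (eucGram g Ψ p).det

/-- The change of coordinates from the chart `Ψ` to the preferred chart at `q`. -/
noncomputable def toPreferred (Ψ : OpenPartialHomeomorph M (Euc n)) (q : M) (w : Euc n) : Euc n :=
  extChartAt (𝓡∂ n) q (Ψ.symm w)

variable {g : BilinField n M} {Ψ : OpenPartialHomeomorph M (Euc n)}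

theorem differentiableAt_toPreferred (hΨ : IsInteriorChart Ψ) (q : M) {w : Euc n}
    (hw : w ∈ Ψ.target) (hq : Ψ.symm w ∈ (chartAt (EuclideanHalfSpace n) q).source) :
    DifferentiableAt ℝ (toPreferred Ψ q) w := by
  have h := (contMDiffAt_extChartAt' (I := 𝓡∂ n) (n := ∞) hq).comp w (hΨ.smooth_symm w hw)
  exact (contMDiffAt_iff_contDiffAt.1 h).differentiableAt (by simp)

theorem eucVec_eq_sum (hΨ : IsInteriorChart Ψ) (q : M) {p : M} (hp : p ∈ Ψ.source)
    (hq : p ∈ (chartAt (EuclideanHalfSpace n) q).source) (i : Fin n) :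
    eucVec Ψ i p = ∑ k, (fderiv ℝ (toPreferred Ψ q) (Ψ p) (stdVec i)) k •
      coordVec (chartAt (EuclideanHalfSpace n) q) k p := by
  have hφ := IsManifold.chart_mem_maximalAtlas (I := 𝓡∂ n) (n := ∞) q
  rw [field_eq_sum_coordVec hφ (eucVec Ψ i) hq]
  refine Finset.sum_congr rfl fun k _ => ?_
  congr 1
  have h1 : HasMFDerivAt (𝓡∂ n) 𝓘(ℝ, ℝ) (fun r => ((chartAt (EuclideanHalfSpace n) q) r).val k)
      (Ψ.symm (Ψ p)) (mfderiv (𝓡∂ n) 𝓘(ℝ, ℝ)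
        (fun r => ((chartAt (EuclideanHalfSpace n) q) r).val k) p) := by
    have := ((contMDiffAt_chart_coord hφ k hq).mdifferentiableAt (by simp)).hasMFDerivAt
    rw [Ψ.left_inv hp]
    exact this
  have hw := Ψ.map_source hp
  have h := (h1.comp (Ψ p) ((hΨ.smooth_symm _ hw).mdifferentiableAt (by simp)).hasMFDerivAt).mfderiv
  rw [mfderiv_eq_fderiv] at h
  have h2 : HasFDerivAt (toPreferred Ψ q) _ (Ψ p) :=
    (differentiableAt_toPreferred hΨ q hw (by rwa [Ψ.left_inv hp])).hasFDerivAt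
  have h3 := ((EuclideanSpace.proj k : Euc n →L[ℝ] ℝ).hasFDerivAt.comp (Ψ p) h2).fderiv
  have h4 : (EuclideanSpace.proj k : Euc n →L[ℝ] ℝ) ∘ toPreferred Ψ q
    = (fun r => ((chartAt (EuclideanHalfSpace n) q) r).val k) ∘ Ψ.symm := rfl
  rw [h4, h] at h3
  exact congrArg (fun L : Euc n →L[ℝ] ℝ => L (stdVec i)) h3

/-- The change of variables for the determinant of the metric. -/
theorem det_eucGram_eq (hΨ : IsInteriorChart Ψ) (q : M) {p : M} (hp : p ∈ Ψ.source)
    (hq : p ∈ (chartAt (EuclideanHalfSpace n) q).source) :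
    (eucGram g Ψ p).det = (fderiv ℝ (toPreferred Ψ q) (Ψ p)).det ^ 2 *
      (gram g (chartAt (EuclideanHalfSpace n) q) p).det := by
  set J : Matrix (Fin n) (Fin n) ℝ := Matrix.of fun k i =>
    (fderiv ℝ (toPreferred Ψ q) (Ψ p) (stdVec i)) k with hJ
  have h1 : eucGram g Ψ p = J.transpose * gram g (chartAt (EuclideanHalfSpace n) q) p * J := by
    ext i j
    simp only [eucGram, Matrix.of_apply]
    rw [eucVec_eq_sum hΨ q hp hq i, eucVec_eq_sum hΨ q hp hq j]
    simp only [map_sum, map_smul, sum_apply, smul_apply,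
      Matrix.mul_apply, Matrix.transpose_apply, hJ, Matrix.of_apply, gram, smul_eq_mul,
      Finset.sum_mul, Finset.mul_sum]
    refine Finset.sum_congr rfl fun k _ => Finset.sum_congr rfl fun l _ => ?_
    ring
  have h2 : (fderiv ℝ (toPreferred Ψ q) (Ψ p)).det = J.det := by
    rw [ContinuousLinearMap.det, ← LinearMap.det_toMatrix (EuclideanSpace.basisFun (Fin n) ℝ).toBasis]
    rfl
  rw [h1, h2, Matrix.det_mul, Matrix.det_mul, Matrix.det_transpose]
  ring

variable [CompactSpace M] [T2Space M] [MeasurableSpace M] [BorelSpace M]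

theorem chartPartition_finite : {q : M | ∃ p, chartPartition n M q p ≠ 0}.Finite := by
  have h := (chartPartition n M).locallyFinite.finite_nonempty_of_compact
  refine h.subset fun q ⟨p, hp⟩ => ⟨p, hp⟩

theorem chartPartition_eq_zero {q p : M} (h : p ∉ (chartAt (EuclideanHalfSpace n) q).source) :
    chartPartition n M q p = 0 := by
  have hs := (SmoothPartitionOfUnity.exists_isSubordinate_chartAt_source (𝓡∂ n) M).choose_spec q
  by_contra h0
  exact h (hs (subset_tsupport _ h0))

theorem measurableSet_inter_preimage {X Y : Type*} [TopologicalSpace X] [MeasurableSpace X]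
    [BorelSpace X] [TopologicalSpace Y] [MeasurableSpace Y] [BorelSpace Y] {f : X → Y} {s : Set X}
    {t : Set Y} (hf : ContinuousOn f s) (hs : MeasurableSet s) (ht : MeasurableSet t) :
    MeasurableSet (s ∩ f ⁻¹' t) := by
  have h := hs.subtype_image ((continuousOn_iff_continuous_domRestrict.1 hf).measurable ht)
  convert h using 1
  ext y
  simp [and_comm]

/-- The contribution of one preferred chart to the measure of a set in the domain of `Ψ`. -/
theorem preferred_measure_eq (hΨ : IsInteriorChart Ψ) (q : M) {A : Set M} (hA : MeasurableSet A)
    (hAs : A ⊆ Ψ.source) :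
    (((volume : Measure (Euc n)).restrict (extChartAt (𝓡∂ n) q).target).withDensity fun z =>
        ENNReal.ofReal (chartPartition n M q ((extChartAt (𝓡∂ n) q).symm z) *
          √ (gram g (chartAt (EuclideanHalfSpace n) q) ((extChartAt (𝓡∂ n) q).symm z)).det)).map
      (extChartAt (𝓡∂ n) q).symm A
    = ∫⁻ w in Ψ.target ∩ Ψ.symm ⁻¹' A,
        ENNReal.ofReal (chartPartition n M q (Ψ.symm w) * eucDensity g Ψ (Ψ.symm w)) := by
  set φ := extChartAt (𝓡∂ n) q with hφ
  set S := (chartAt (EuclideanHalfSpace n) q).source with hS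
  have htm : MeasurableSet φ.target := by
    rw [hφ, extChartAt_target]
    refine ((chartAt _ q).open_target.preimage (𝓡∂ n).continuous_symm).measurableSet.inter ?_
    exact (𝓡∂ n).isClosed_range.measurableSet
  have hc : ContinuousOn φ.symm φ.target := continuousOn_extChartAt_symm q
  have ham : AEMeasurable φ.symm (((volume : Measure (Euc n)).restrict φ.target).withDensity fun z =>
        ENNReal.ofReal (chartPartition n M q (φ.symm z) *
          √ (gram g (chartAt (EuclideanHalfSpace n) q) (φ.symm z)).det)) :=
    (hc.aemeasurable htm).mono_ac (withDensity_absolutelyContinuous _ _)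
  have hpm : MeasurableSet (φ.target ∩ φ.symm ⁻¹' A) := measurableSet_inter_preimage hc htm hA
  have hTm : MeasurableSet (Ψ.target ∩ Ψ.symm ⁻¹' (A ∩ S)) :=
    measurableSet_inter_preimage Ψ.continuousOn_symm Ψ.open_target.measurableSet
      (hA.inter (chartAt _ q).open_source.measurableSet)
  rw [Measure.map_apply_of_aemeasurable ham hA, withDensity_apply', Measure.restrict_restrict' htm,
    Set.inter_comm]
  have himg : φ.target ∩ φ.symm ⁻¹' A = toPreferred Ψ q '' (Ψ.target ∩ Ψ.symm ⁻¹' (A ∩ S)) := by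
    ext z
    constructor
    · rintro ⟨hz, hzA⟩
      have hzA' : φ.symm z ∈ Ψ.source := hAs hzA
      refine ⟨Ψ (φ.symm z), ⟨Ψ.map_source hzA', ?_⟩, ?_⟩
      · change Ψ.symm (Ψ (φ.symm z)) ∈ A ∩ S
        rw [Ψ.left_inv hzA']
        refine ⟨hzA, ?_⟩
        have := φ.map_target hz
        rwa [hφ, extChartAt_source] at this
      · rw [toPreferred, Ψ.left_inv hzA']
        exact φ.right_inv hz
    · rintro ⟨w, ⟨hw, hwA, hwS⟩, rfl⟩
      have hs : Ψ.symm w ∈ φ.source := by rwa [hφ, extChartAt_source]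
      refine ⟨φ.map_source hs, ?_⟩
      change φ.symm (φ (Ψ.symm w)) ∈ A
      rwa [φ.left_inv hs]
  have hinj : Set.InjOn (toPreferred Ψ q) (Ψ.target ∩ Ψ.symm ⁻¹' (A ∩ S)) := by
    rintro w ⟨hw, -, hwS⟩ w' ⟨hw', -, hwS'⟩ h
    have h1 : Ψ.symm w = Ψ.symm w' := φ.injOn (by rwa [hφ, extChartAt_source])
      (by rwa [hφ, extChartAt_source]) h
    exact Ψ.symm.injOn hw hw' h1
  rw [himg, lintegral_image_eq_lintegral_abs_det_fderiv_mul volume hTm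
    (fun w hw => (differentiableAt_toPreferred hΨ q hw.1 hw.2.2).hasFDerivAt.hasFDerivWithinAt) hinj]
  have hset : Ψ.target ∩ Ψ.symm ⁻¹' (A ∩ S) ⊆ Ψ.target ∩ Ψ.symm ⁻¹' A :=
    fun w hw => ⟨hw.1, hw.2.1⟩
  have hext : ∫⁻ w in Ψ.target ∩ Ψ.symm ⁻¹' A,
        ENNReal.ofReal (chartPartition n M q (Ψ.symm w) * eucDensity g Ψ (Ψ.symm w))
      = ∫⁻ w in Ψ.target ∩ Ψ.symm ⁻¹' (A ∩ S),
        ENNReal.ofReal (chartPartition n M q (Ψ.symm w) * eucDensity g Ψ (Ψ.symm w)) := by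
    rw [← Set.inter_eq_self_of_subset_left hset, ← setLIntegral_indicator hTm]
    refine setLIntegral_congr_fun
      (measurableSet_inter_preimage Ψ.continuousOn_symm Ψ.open_target.measurableSet hA)
      fun w hw => ?_
    by_cases h : w ∈ Ψ.target ∩ Ψ.symm ⁻¹' (A ∩ S)
    · simp only [Set.indicator_of_mem h]
    · simp only [Set.indicator_of_notMem h]
      have : Ψ.symm w ∉ S := fun h' => h ⟨hw.1, hw.2, h'⟩
      rw [chartPartition_eq_zero this, zero_mul, ENNReal.ofReal_zero]
  rw [hext]
  · refine setLIntegral_congr_fun hTm fun w hw => ?_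
    have hp : Ψ.symm w ∈ Ψ.source := Ψ.map_target hw.1
    have hs : Ψ.symm w ∈ φ.source := by rw [hφ, extChartAt_source]; exact hw.2.2
    have hw' : φ.symm (toPreferred Ψ q w) = Ψ.symm w := φ.left_inv hs
    change _ * ENNReal.ofReal _ = _
    rw [hw', ← ENNReal.ofReal_mul (abs_nonneg _), eucDensity, det_eucGram_eq hΨ q hp hw.2.2,
      Ψ.right_inv hw.1, Real.sqrt_mul (sq_nonneg _), Real.sqrt_sq_eq_abs]
    congr 1
    ring

/-- In a chart of the interior the Riemannian measure has the expected density. -/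
theorem riemannianMeasure_apply (hΨ : IsInteriorChart Ψ)
    (hd : ContinuousOn (eucDensity g Ψ) Ψ.source) {A : Set M} (hA : MeasurableSet A)
    (hAs : A ⊆ Ψ.source) :
    riemannianMeasure g A
      = ∫⁻ w in Ψ.target ∩ Ψ.symm ⁻¹' A, ENNReal.ofReal (eucDensity g Ψ (Ψ.symm w)) := by
  have hm : MeasurableSet (Ψ.target ∩ Ψ.symm ⁻¹' A) :=
    measurableSet_inter_preimage Ψ.continuousOn_symm Ψ.open_target.measurableSet hA
  have hmaps : Set.MapsTo Ψ.symm (Ψ.target ∩ Ψ.symm ⁻¹' A) Ψ.source :=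
    fun w hw => Ψ.map_target hw.1
  have hcs : ContinuousOn Ψ.symm (Ψ.target ∩ Ψ.symm ⁻¹' A) :=
    Ψ.continuousOn_symm.mono Set.inter_subset_left
  rw [riemannianMeasure, Measure.sum_apply _ hA]
  simp_rw [preferred_measure_eq (g := g) hΨ _ hA hAs]
  set Q := (chartPartition_finite (n := n) (M := M)).toFinset with hQ
  rw [tsum_eq_sum (s := Q)]
  · rw [← lintegral_finsetSum' Q]
    · refine setLIntegral_congr_fun hm fun w hw => ?_
      change ∑ q ∈ Q, ENNReal.ofReal (chartPartition n M q (Ψ.symm w) * eucDensity g Ψ (Ψ.symm w)) = _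
      rw [← ENNReal.ofReal_sum_of_nonneg (fun q _ =>
        mul_nonneg ((chartPartition n M).nonneg q _) (by exact Real.sqrt_nonneg _)), ← Finset.sum_mul]
      congr 1
      have h1 := (chartPartition n M).sum_eq_one (Set.mem_univ (Ψ.symm w))
      rw [finsum_eq_sum_of_support_subset (s := Q)] at h1
      · rw [h1, one_mul]
      · intro q hq
        rw [hQ, Set.Finite.coe_toFinset]
        exact ⟨_, hq⟩
    · intro q _
      refine ContinuousOn.aemeasurable ?_ hm
      refine ENNReal.continuous_ofReal.comp_continuousOn (ContinuousOn.mul ?_ (hd.comp hcs hmaps))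
      exact (chartPartition n M q).contMDiff.continuous.comp_continuousOn hcs
  · intro q hq
    have : ∀ p, chartPartition n M q p = 0 := by
      intro p
      by_contra h
      exact hq ((chartPartition_finite (n := n) (M := M)).mem_toFinset.2 ⟨p, h⟩)
    simp [this]

/-- The Riemannian measure on the domain of a chart of the interior is the image of the coordinate
measure with the density of the chart. -/
theorem riemannianMeasure_restrict (hΨ : IsInteriorChart Ψ)
    (hd : ContinuousOn (eucDensity g Ψ) Ψ.source) :
    (riemannianMeasure g).restrict Ψ.source = ((((volume : Measure (Euc n)).restrict
      Ψ.target).withDensity fun w => ENNReal.ofReal (eucDensity g Ψ (Ψ.symm w))).map Ψ.symm) := by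
  have ham : AEMeasurable Ψ.symm (((volume : Measure (Euc n)).restrict
      Ψ.target).withDensity fun w => ENNReal.ofReal (eucDensity g Ψ (Ψ.symm w))) :=
    (Ψ.continuousOn_symm.aemeasurable Ψ.open_target.measurableSet).mono_ac
      (withDensity_absolutelyContinuous _ _)
  ext A hA
  rw [Measure.restrict_apply hA, Measure.map_apply_of_aemeasurable ham hA, withDensity_apply',
    Measure.restrict_restrict' Ψ.open_target.measurableSet,
    riemannianMeasure_apply hΨ hd (hA.inter Ψ.open_source.measurableSet) Set.inter_subset_right]
  congr 2
  ext w
  constructor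
  · rintro ⟨h1, h2, -⟩
    exact ⟨h2, h1⟩
  · rintro ⟨h1, h2⟩
    exact ⟨h2, h1, Ψ.map_target h2⟩

end Density

/-! ### Local frames made of the generating fields -/

section SmoothMatrices

open Filter Topology

variable {n : ℕ} [NeZero n] {M : Type*} [TopologicalSpace M]
  [ChartedSpace (EuclideanHalfSpace n) M]

theorem SmoothAt.prod {ι : Type*} {s : Finset ι} {a : ι → M → ℂ} {p : M}
    (h : ∀ i ∈ s, SmoothAt n (a i) p) : SmoothAt n (fun q => ∏ i ∈ s, a i q) p := by
  classical
  induction s using Finset.induction_on with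
  | empty => simpa using SmoothAt.const 1 p
  | insert i s his ih =>
    simp only [Finset.prod_insert his]
    exact (h i (Finset.mem_insert_self i s)).mul
      (ih fun j hj => h j (Finset.mem_insert_of_mem hj))

theorem SmoothAt.det {S : Type*} [Fintype S] [DecidableEq S] {A : M → Matrix S S ℂ} {p : M}
    (h : ∀ i j, SmoothAt n (fun q => A q i j) p) : SmoothAt n (fun q => (A q).det) p := by
  simp only [Matrix.det_apply']
  exact SmoothAt.sum fun σ _ => (SmoothAt.const _ p).mul (SmoothAt.prod fun i _ => h _ _)

theorem SmoothAt.matrix_inv {S : Type*} [Fintype S] [DecidableEq S] {A : M → Matrix S S ℂ} {p : M}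
    (h : ∀ i j, SmoothAt n (fun q => A q i j) p) (hd : (A p).det ≠ 0) (i j : S) :
    SmoothAt n (fun q => (A q)⁻¹ i j) p := by
  have h2 : SmoothAt n (fun q => (A q).adjugate i j) p := by
    simp only [Matrix.adjugate_apply]
    refine SmoothAt.det fun k l => ?_
    by_cases hk : k = j
    · subst hk
      simp only [Matrix.updateRow_self]
      exact SmoothAt.const _ p
    · simp only [Matrix.updateRow_ne hk]
      exact h k l
  refine (((SmoothAt.det h).inv hd).mul h2).congr (Eventually.of_forall fun q => ?_)
  simp [Matrix.inv_def, Ring.inverse_eq_inv']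

/-- A smooth family of matrices that is injective at a point has a smooth left inverse nearby. -/
theorem exists_smooth_leftInverse {J S : Type*} [Fintype J] [Fintype S] [DecidableEq S]
    {v : J → S → M → ℂ} {p : M} (hv : ∀ j i, ∀ᶠ q in 𝓝 p, SmoothAt n (v j i) q)
    (hinj : ∀ w : S → ℂ, (∀ j, ∑ i, v j i p * w i = 0) → w = 0) :
    ∃ c : S → J → M → ℂ, (∀ i j, ∀ᶠ q in 𝓝 p, SmoothAt n (c i j) q) ∧
      ∀ᶠ q in 𝓝 p, ∀ i k, ∑ j, c i j q * v j k q = if i = k then 1 else 0 := by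
  classical
  let B : M → Matrix J S ℂ := fun q => Matrix.of fun j i => v j i q
  have hker : LinearMap.ker (Matrix.toLin' (B p)) = ⊥ := by
    refine LinearMap.ker_eq_bot'.2 fun w hw => hinj w fun j => ?_
    exact congrFun hw j
  obtain ⟨L, hL⟩ := (Matrix.toLin' (B p)).exists_leftInverse_of_injective hker
  let A : Matrix S J ℂ := LinearMap.toMatrix' L
  have hA : A * B p = 1 := by
    have := congrArg LinearMap.toMatrix' hL
    rwa [LinearMap.toMatrix'_comp, LinearMap.toMatrix'_toLin', LinearMap.toMatrix'_id] at this
  let N : M → Matrix S S ℂ := fun q => A * B q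
  have hN : ∀ᶠ q in 𝓝 p, ∀ i j, SmoothAt n (fun r => N r i j) q := by
    rw [eventually_all]; intro i
    rw [eventually_all]; intro k
    have : ∀ᶠ q in 𝓝 p, ∀ j, SmoothAt n (v j k) q := eventually_all.2 fun j => hv j k
    filter_upwards [this] with q hq
    simp only [N, Matrix.mul_apply]
    exact SmoothAt.sum fun j _ => (SmoothAt.const _ q).mul (hq j)
  have hdet : ∀ᶠ q in 𝓝 p, (N q).det ≠ 0 := by
    have h1 : ContinuousAt (fun q => (N q).det) p := (SmoothAt.det hN.self_of_nhds).continuousAt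
    refine h1.eventually_ne ?_
    simp only [N, hA, Matrix.det_one]
    exact one_ne_zero
  refine ⟨fun i j q => ((N q)⁻¹ * A) i j, fun i j => ?_, ?_⟩
  · filter_upwards [hN, hdet] with q hq hq'
    simp only [Matrix.mul_apply]
    exact SmoothAt.sum fun k _ => (SmoothAt.matrix_inv hq hq' i k).mul (SmoothAt.const _ q)
  · filter_upwards [hdet] with q hq i k
    have h1 : (N q)⁻¹ * A * B q = 1 := by
      rw [Matrix.mul_assoc]
      exact Matrix.nonsing_inv_mul _ (Ne.isUnit hq)
    have := congrFun (congrFun h1 i) k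
    rwa [Matrix.mul_apply, Matrix.one_apply] at this

end SmoothMatrices

section Frames

open Filter Topology

variable {n : ℕ} [NeZero n] {M : Type*} [TopologicalSpace M]
  [ChartedSpace (EuclideanHalfSpace n) M] [IsManifold (𝓡∂ n) ∞ M]

/-- If vector fields span the coordinate directions `s i` at a point, the matrix of the
corresponding components is injective there. -/
theorem injective_of_mem_span {J S : Type*} [Fintype S] [DecidableEq S]
    {φ : OpenPartialHomeomorph M (EuclideanHalfSpace n)}
    (hφ : φ ∈ IsManifold.maximalAtlas (𝓡∂ n) ∞ M) {p : M} (hp : p ∈ φ.source)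
    (V : J → VField n M) (s : S → Fin n) (hs : Function.Injective s)
    (hspan : ∀ i, coordVec φ (s i) p ∈ Submodule.span ℝ (Set.range fun j => V j p))
    (w : S → ℂ)
    (hw : ∀ j, ∑ i, (realDeriv (V j) (fun q => (φ q).val (s i)) p : ℂ) * w i = 0) : w = 0 := by
  let comp : Fin n → TangentSpace (𝓡∂ n) p →L[ℝ] ℝ := fun k =>
    mfderiv (𝓡∂ n) 𝓘(ℝ, ℝ) (fun q => (φ q).val k) p
  let lam : TangentSpace (𝓡∂ n) p →ₗ[ℝ] ℂ := ∑ i, (comp (s i) : _ →ₗ[ℝ] ℝ).smulRight (w i)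
  have hlam : ∀ v, lam v = ∑ i, ((comp (s i) v : ℝ) : ℂ) * w i := by
    intro v
    simp [lam, LinearMap.sum_apply]
  have h0 : ∀ v ∈ Submodule.span ℝ (Set.range fun j => V j p), lam v = 0 := by
    intro v hv
    have : Submodule.span ℝ (Set.range fun j => V j p) ≤ LinearMap.ker lam := by
      rw [Submodule.span_le]
      rintro _ ⟨j, rfl⟩
      rw [SetLike.mem_coe, LinearMap.mem_ker, hlam]
      exact hw j
    exact this hv
  funext i
  have h := h0 _ (hspan i)
  rw [hlam] at h
  have h2 : ∀ k, comp (s k) (coordVec φ (s i) p) = if k = i then 1 else 0 := by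
    intro k
    have := realDeriv_coordVec hφ (s i) (s k) hp
    simp only [hs.eq_iff] at this
    exact this
  have h3 : ∀ k, ((comp (s k) (coordVec φ (s i) p) : ℝ) : ℂ) = if k = i then 1 else 0 := by
    intro k
    rw [h2 k]
    split_ifs <;> simp
  simp only [h3] at h
  simpa using h

end Frames

section DensityBounds

open Filter Topology

variable {n : ℕ} [NeZero n] {M : Type*} [TopologicalSpace M]
  [ChartedSpace (EuclideanHalfSpace n) M] [IsManifold (𝓡∂ n) ∞ M]
  {x : M → ℝ} {g : BilinField n M}

theorem det_gram_pos (hg : IsInteriorMetric g) {φ : OpenPartialHomeomorph M (EuclideanHalfSpace n)}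
    (hφ : φ ∈ IsManifold.maximalAtlas (𝓡∂ n) ∞ M) {p : M} (hp : p ∈ φ.source)
    (hpi : p ∈ (𝓡∂ n).interior M) : 0 < (gram g φ p).det := by
  refine Matrix.PosDef.det_pos (Matrix.PosDef.of_dotProduct_mulVec_pos ?_ fun v hv => ?_)
  · ext i j
    simp [gram, hg.symm p hpi (coordVec φ i p)]
  · let W : TangentSpace (𝓡∂ n) p := ∑ i, v i • coordVec φ i p
    have hW : W ≠ 0 := by
      intro h0
      apply hv
      funext k
      have h1 : mfderiv (𝓡∂ n) 𝓘(ℝ, ℝ) (fun q => (φ q).val k) p W = v k := by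
        have h2 : ∀ i, mfderiv (𝓡∂ n) 𝓘(ℝ, ℝ) (fun q => (φ q).val k) p (coordVec φ i p)
            = if k = i then (1 : ℝ) else 0 := fun i => realDeriv_coordVec hφ i k hp
        simp only [W, map_sum, map_smul]
        refine (Finset.sum_congr rfl fun i _ => congrArg (v i • ·) (h2 i)).trans ?_
        change ∑ i, v i * (if k = i then (1 : ℝ) else 0) = v k
        simp
      rw [h0] at h1
      exact h1.symm.trans (map_zero _)
    have h := hg.pos p hpi W hW
    have h2 : g p W W = star v ⬝ᵥ (gram g φ p).mulVec v := by
      simp only [W, map_sum, map_smul, sum_apply, smul_apply, dotProduct, Matrix.mulVec, gram,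
        Matrix.of_apply, smul_eq_mul, Finset.mul_sum, star_trivial]
      rw [Finset.sum_comm]
      refine Finset.sum_congr rfl fun i _ => Finset.sum_congr rfl fun j _ => ?_
      ring
    rw [← h2]
    exact h

variable {φ : OpenPartialHomeomorph M (EuclideanHalfSpace n)} {U : Set M} {hU : IsOpen U}

/-- The factor `z_0` is the Jacobian of the logarithmic coordinate. -/
theorem eucDensity_interiorChart (hφ : φ ∈ IsManifold.maximalAtlas (𝓡∂ n) ∞ M) {p : M}
    (hp : p ∈ (interiorChart φ U hU).source) :
    eucDensity g (interiorChart φ U hU) p = (φ p).val 0 * √ (gram g φ p).det := by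
  have hpos : 0 < (φ p).val 0 := (mem_interiorChart_source.1 hp).1.2
  let d : Fin n → ℝ := fun i => if i = 0 then - (φ p).val 0 else 1
  have h1 : eucGram g (interiorChart φ U hU) p
      = Matrix.diagonal d * gram g φ p * Matrix.diagonal d := by
    ext i j
    simp only [eucGram, Matrix.of_apply, Matrix.mul_diagonal, Matrix.diagonal_mul, gram]
    rw [eucVec_interiorChart hφ hp i, eucVec_interiorChart hφ hp j]
    simp only [map_smul, smul_apply, smul_eq_mul, d]
    ring
  have h2 : ∏ i, d i = - (φ p).val 0 := by
    simp [d, Finset.prod_ite_eq']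
  rw [eucDensity, h1, Matrix.det_mul, Matrix.det_mul, Matrix.det_diagonal, h2,
    show - (φ p).val 0 * (gram g φ p).det * - (φ p).val 0 = (φ p).val 0 ^ 2 * (gram g φ p).det by ring,
    Real.sqrt_mul (sq_nonneg _), Real.sqrt_sq hpos.le]

theorem eucDensity_pos (hg : IsInteriorMetric g) (hφ : φ ∈ IsManifold.maximalAtlas (𝓡∂ n) ∞ M)
    (hΨ : IsInteriorChart (interiorChart φ U hU)) {p : M}
    (hp : p ∈ (interiorChart φ U hU).source) : 0 < eucDensity g (interiorChart φ U hU) p := by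
  rw [eucDensity_interiorChart hφ hp]
  exact mul_pos (mem_interiorChart_source.1 hp).1.2 (Real.sqrt_pos.2
    (det_gram_pos hg hφ (mem_interiorChart_source.1 hp).1.1 (hΨ.source_subset hp)))

theorem contMDiffAt_det {S : Type*} [Fintype S] [DecidableEq S] {A : M → Matrix S S ℝ} {p : M}
    (h : ∀ i j, ContMDiffAt (𝓡∂ n) 𝓘(ℝ, ℝ) ∞ (fun q => A q i j) p) :
    ContMDiffAt (𝓡∂ n) 𝓘(ℝ, ℝ) ∞ (fun q => (A q).det) p := by
  simp only [Matrix.det_apply']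
  refine contMDiffAt_finsetSum fun σ _ => contMDiffAt_const.mul ?_
  exact contMDiffAt_finsetProd fun i _ => h _ _

theorem contMDiffAt_eucDensity (hg : IsInteriorMetric g)
    (hφ : φ ∈ IsManifold.maximalAtlas (𝓡∂ n) ∞ M)
    (hΨ : IsInteriorChart (interiorChart φ U hU)) {p : M}
    (hp : p ∈ (interiorChart φ U hU).source) :
    ContMDiffAt (𝓡∂ n) 𝓘(ℝ, ℝ) ∞ (eucDensity g (interiorChart φ U hU)) p := by
  have hp' := (mem_interiorChart_source.1 hp).1
  have hpi := hΨ.source_subset hp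
  have h1 : ContMDiffAt (𝓡∂ n) 𝓘(ℝ, ℝ) ∞ (fun q => (gram g φ q).det) p :=
    contMDiffAt_det fun i j => ((hg.smooth φ hφ i j) p ⟨hp'.1, hpi⟩).contMDiffAt
      ((φ.open_source.inter isOpen_interior).mem_nhds ⟨hp'.1, hpi⟩)
  have h2 : ContMDiffAt (𝓡∂ n) 𝓘(ℝ, ℝ) ∞ (fun q => √ (gram g φ q).det) p :=
    ContDiffAt.comp_contMDiffAt (f := fun q => (gram g φ q).det)
      (Real.contDiffAt_sqrt (det_gram_pos hg hφ hp'.1 hpi).ne') h1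
  refine ((contMDiffAt_chart_coord hφ 0 hp'.1).mul h2).congr_of_eventuallyEq ?_
  filter_upwards [(interiorChart φ U hU).open_source.mem_nhds hp] with q hq
  exact eucDensity_interiorChart hφ hq

/-- Near an interior point, `x^n` times the density of a logarithmic chart is the square root of
a positive continuous function. -/
theorem exists_density_root_interior (hx : IsBoundaryDefining n x) (hg : IsInteriorMetric g)
    (hφ : φ ∈ IsManifold.maximalAtlas (𝓡∂ n) ∞ M) {p : M} (hp : p ∈ φ.source)
    (hpi : p ∈ (𝓡∂ n).interior M) (hz : 0 < (φ p).val 0) :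
    ∃ Θ : M → ℝ, ContinuousAt Θ p ∧ Θ p ≠ 0 ∧ ∀ q ∈ φ.source, 0 < (φ q).val 0 → 0 < x q →
      x q ^ n * ((φ q).val 0 * √ (gram g φ q).det) = √ (Θ q) := by
  have h1 : ContMDiffAt (𝓡∂ n) 𝓘(ℝ, ℝ) ∞ (fun q => (gram g φ q).det) p :=
    contMDiffAt_det fun i j => ((hg.smooth φ hφ i j) p ⟨hp, hpi⟩).contMDiffAt
      ((φ.open_source.inter isOpen_interior).mem_nhds ⟨hp, hpi⟩)
  refine ⟨fun q => (x q ^ n * (φ q).val 0) ^ 2 * (gram g φ q).det, ?_, ?_, ?_⟩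
  · exact (((hx.smooth.continuous.continuousAt.pow n).mul
      (contMDiffAt_chart_coord hφ 0 hp).continuousAt).pow 2).mul h1.continuousAt
  · have := det_gram_pos hg hφ hp hpi
    have := hx.pos p hpi
    positivity
  · intro q _ hz hxq
    rw [Real.sqrt_mul (sq_nonneg _), Real.sqrt_sq (by positivity)]
    ring

/-- The corresponding fact at a boundary point, in an adapted chart. -/
theorem exists_density_root_boundary (hx : IsBoundaryDefining n x) (hg : IsInteriorMetric g)
    (hφ : IsAdaptedChart x g φ) {p : M} (hp : p ∈ φ.source) (hxp : x p = 0) :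
    ∃ Θ : M → ℝ, ContinuousAt Θ p ∧ Θ p ≠ 0 ∧ ∀ q ∈ φ.source, 0 < (φ q).val 0 → 0 < x q →
      x q ^ n * ((φ q).val 0 * √ (gram g φ q).det) = √ (Θ q) := by
  obtain ⟨h, hsm, hpos, hform⟩ := hφ.metric_form
  let H : M → Matrix (Fin n) (Fin n) ℝ := fun q => Matrix.of fun i j =>
    if i = 0 then (if j = 0 then 1 else 0) else (if j = 0 then 0 else h q i j)
  refine ⟨fun q => (H q).det, ?_, ?_, ?_⟩
  · have hH : ContMDiffAt (𝓡∂ n) 𝓘(ℝ, ℝ) ∞ (fun q => (H q).det) p := contMDiffAt_det fun i j => ?_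
    · exact hH.continuousAt
    simp only [H, Matrix.of_apply]
    split_ifs
    · exact contMDiffAt_const
    · exact contMDiffAt_const
    · exact contMDiffAt_const
    · exact ((hsm i j) p hp).contMDiffAt (φ.open_source.mem_nhds hp)
  · intro hdet
    obtain ⟨v, hv, hv0⟩ := Matrix.exists_mulVec_eq_zero_iff.2 hdet
    have h0 : v 0 = 0 := by
      have := congrFun hv0 0
      simpa [Matrix.mulVec, dotProduct, H] using this
    have h1 := hpos p hp hxp v h0 hv
    have h2 : ∑ i, ∑ j, h p i j * v i * v j = ∑ i, v i * (H p).mulVec v i := by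
      refine Finset.sum_congr rfl fun i _ => ?_
      rw [Matrix.mulVec, dotProduct, Finset.mul_sum]
      refine Finset.sum_congr rfl fun j _ => ?_
      by_cases hi : i = 0
      · simp [hi, h0]
      by_cases hj : j = 0
      · simp [hj, h0]
      simp only [H, Matrix.of_apply, hi, hj, if_false]
      ring
    rw [h2, hv0] at h1
    simp at h1
  · intro q hq hz hxq
    have hz0 := hφ.coord_zero q hq
    obtain ⟨h00, h0j, hij⟩ := hform q hq hxq
    let d : Fin n → ℝ := fun i => if i = 0 then x q ^ 2 else x q
    have hH : H q = Matrix.diagonal d * gram g φ q * Matrix.diagonal d := by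
      ext i j
      rw [Matrix.mul_diagonal, Matrix.diagonal_mul]
      simp only [H, Matrix.of_apply, d]
      by_cases hi : i = 0
      · by_cases hj : j = 0
        · subst hi hj
          rw [h00]
          simp only [if_true]
          field_simp
        · subst hi
          simp [hj, h0j j hj]
      · by_cases hj : j = 0
        · subst hj
          have hs : gram g φ q i 0 = 0 := by
            rw [← h0j i hi]
            exact hg.symm q ((hx.pos_iff q).1 hxq) _ _
          simp [hi, hs]
        · simp only [hi, hj, if_false, hij i j hi hj]
          field_simp
    have hd : ∏ i, d i = x q ^ (n + 1) := by
      have h1 : ∀ i, d i = x q * (if i = 0 then x q else 1) := by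
        intro i
        simp only [d]
        split_ifs <;> ring
      simp only [h1, Finset.prod_mul_distrib]
      simp [Finset.prod_ite_eq', pow_succ]
    change _ = √ (H q).det
    rw [hz0, hH, Matrix.det_mul, Matrix.det_mul, Matrix.det_diagonal, hd,
      show x q ^ (n + 1) * (gram g φ q).det * x q ^ (n + 1)
        = (x q ^ (n + 1)) ^ 2 * (gram g φ q).det by ring,
      Real.sqrt_mul (sq_nonneg _), Real.sqrt_sq (by positivity)]
    ring

end DensityBounds

section LocalModel

open Filter Topology

variable {n : ℕ} [NeZero n] {M : Type*} [TopologicalSpace M]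
  [ChartedSpace (EuclideanHalfSpace n) M] [IsManifold (𝓡∂ n) ∞ M]
  {x : M → ℝ} {g : BilinField n M}

/-- An open set `U` of `M`, coordinates `Ψ` with values in the full coordinate space on the interior
part of `U`, and the coefficients `c` and `v`, smooth on all of `M`, that express the coordinate
fields by the generating fields and conversely. The coordinate `0` is like `- log x`, so that the
coordinate fields generate the b-vector fields. -/
structure LocalModel (G : Generators x g) where
  /-- the open set -/
  U : Set M
  isOpen_U : IsOpen U
  /-- the coordinates -/
  Ψ : OpenPartialHomeomorph M (Euc n)
  chart : IsInteriorChart Ψ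
  mem_source : ∀ q, q ∈ Ψ.source ↔ q ∈ U ∧ q ∈ (𝓡∂ n).interior M
  /-- coefficients of the coordinate fields -/
  c : Fin n → G.MIdx → M → ℂ
  /-- components of the generating fields -/
  v : G.MIdx → Fin n → M → ℂ
  c_smooth : ∀ i j p, SmoothAt n (c i j) p
  v_smooth : ∀ j i p, SmoothAt n (v j i) p
  left_inv : ∀ q ∈ U, ∀ i k, ∑ j, c i j q * v j k q = if i = k then 1 else 0
  field_eq : ∀ q ∈ Ψ.source, ∀ j (ψ : M → ℂ),
    vderiv (G.field j) ψ q = ∑ i, v j i q * vderiv (eucVec Ψ i) ψ q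
  /-- the tangential coordinate fields do not involve the radial field -/
  c_none : ∀ i, i ≠ 0 → ∀ q, c i none q = 0
  /-- the components along the coordinate `0` are those of `- log x` -/
  v_zero : ∀ q ∈ U, x q < G.c → ∀ j, v j 0 q = - (G.logDeriv j q : ℂ)
  density_pos : ∀ q ∈ Ψ.source, 0 < eucDensity g Ψ q
  density_smooth : ∀ q ∈ Ψ.source, ContMDiffAt (𝓡∂ n) 𝓘(ℝ, ℝ) ∞ (eucDensity g Ψ) q
  /-- lower bound of `x ^ n` times the density -/
  lo : ℝ
  /-- upper bound of `x ^ n` times the density -/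
  hi : ℝ
  lo_pos : 0 < lo
  density_lower : ∀ q ∈ Ψ.source, lo ≤ x q ^ n * eucDensity g Ψ q
  density_upper : ∀ q ∈ Ψ.source, x q ^ n * eucDensity g Ψ q ≤ hi
  /-- bounded values of the coordinate `0` stay away from the boundary -/
  proper : ∀ r : ℝ, ∃ e, 0 < e ∧ ∀ q ∈ Ψ.source, |Ψ q 0| ≤ r → e ≤ x q
  /-- bound of the tangential coordinates -/
  rad : ℝ
  coord_le : ∀ q ∈ Ψ.source, ∀ i, i ≠ 0 → |Ψ q i| ≤ rad

theorem Generators.logDeriv_angular (G : Generators x g) (a : Fin G.numAngular) (q : M) :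
    G.logDeriv (some (.inl a)) q = 0 := by
  by_cases h : x q < G.c
  · exact G.logDeriv_some h _
  · rw [Generators.logDeriv, if_neg h]
    have : realDeriv (G.field (some (.inl a))) x q = 0 := G.angular_tangent a q
    rw [this, zero_div]

theorem Generators.logDeriv_none' (G : Generators x g) {q : M} (h : x q ≤ G.c) :
    G.logDeriv none q = 1 := by
  rcases h.lt_or_eq with h | h
  · exact G.logDeriv_none h
  · rw [Generators.logDeriv, if_neg h.not_lt]
    have h1 : realDeriv (G.field none) x q = x q := G.realDeriv_radial h.le
    rw [h1, h, div_self G.c_pos.ne']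

/-- The data of a local model follow from a chart and local components of the fields. -/
theorem exists_localModel_of_chart [CompactSpace M] [T2Space M] (hg : IsAsymptoticallyConic x g)
    (G : Generators x g) {φ : OpenPartialHomeomorph M (EuclideanHalfSpace n)}
    (hφ : φ ∈ IsManifold.maximalAtlas (𝓡∂ n) ∞ M) {p : M} (hp : p ∈ φ.source)
    (hint : ∀ᶠ q in 𝓝 p, 0 < (φ q).val 0 ↔ q ∈ (𝓡∂ n).interior M)
    (hΘ : ∃ Θ : M → ℝ, ContinuousAt Θ p ∧ Θ p ≠ 0 ∧ ∀ q ∈ φ.source, 0 < (φ q).val 0 → 0 < x q →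
      x q ^ n * ((φ q).val 0 * √ (gram g φ q).det) = √ (Θ q))
    (v : G.MIdx → Fin n → M → ℂ) (hv : ∀ j i, ∀ᶠ q in 𝓝 p, SmoothAt n (v j i) q)
    (hvB : ∀ᶠ q in 𝓝 p, ∀ j i, v j i q * (if i = 0 then - (φ q).val 0 else 1 : ℝ)
      = (realDeriv (G.field j) (fun r => (φ r).val i) q : ℂ))
    (hv0 : ∀ᶠ q in 𝓝 p, x q < G.c → ∀ j, v j 0 q = - (G.logDeriv j q : ℂ))
    (c : Fin n → G.MIdx → M → ℂ) (hc : ∀ i j, ∀ᶠ q in 𝓝 p, SmoothAt n (c i j) q)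
    (hcv : ∀ᶠ q in 𝓝 p, ∀ i k, ∑ j, c i j q * v j k q = if i = k then 1 else 0)
    (hcn : ∀ i, i ≠ 0 → ∀ q, c i none q = 0)
    (hprop : ∀ᶠ q in 𝓝 p, ∀ r : ℝ, 0 < (φ q).val 0 → |Real.log ((φ q).val 0)| ≤ r →
      min (Real.exp (-r)) G.c ≤ x q) :
    ∃ m : LocalModel G, p ∈ m.U := by
  obtain ⟨Θ, hΘc, hΘ0, hΘ⟩ := hΘ
  choose v' hv's hv'e using fun j i => exists_smooth_extension (hv j i)
  choose c' hc's hc'e using fun i j => exists_smooth_extension (hc i j)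
  -- the coefficients that have to vanish are taken to be `0` everywhere
  let c'' : Fin n → G.MIdx → M → ℂ := fun i j => if i ≠ 0 ∧ j = none then fun _ => 0 else c' i j
  have hc''e : ∀ i j, ∀ᶠ q in 𝓝 p, c'' i j q = c i j q := by
    intro i j
    by_cases h : i ≠ 0 ∧ j = none
    · simp only [c'', if_pos h]
      obtain ⟨h1, rfl⟩ := h
      exact Eventually.of_forall fun q => (hcn i h1 q).symm
    · simp only [c'', if_neg h]
      exact hc'e i j
  have hcoord : ∀ᶠ q in 𝓝 p, ∀ i, |(φ q).val i| ≤ |(φ p).val i| + 1 := by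
    rw [eventually_all]
    intro i
    have h1 : ContinuousAt (fun q => |(φ q).val i|) p := (contMDiffAt_chart_coord hφ i hp).continuousAt.abs
    exact (h1.eventually_lt_const (lt_add_one _)).mono fun q hq => hq.le
  have hΘb : ∀ᶠ q in 𝓝 p, |Θ p| / 2 ≤ |Θ q| ∧ |Θ q| ≤ 2 * |Θ p| := by
    have h1 : ContinuousAt (fun q => |Θ q|) p := hΘc.abs
    have h2 : 0 < |Θ p| := abs_pos.2 hΘ0
    filter_upwards [h1.eventually_lt_const (show |Θ p| < 2 * |Θ p| by linarith),
      h1.eventually_const_lt (show |Θ p| / 2 < |Θ p| by linarith)] with q h3 h4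
    exact ⟨h4.le, h3.le⟩
  have hall : ∀ᶠ q in 𝓝 p, q ∈ φ.source ∧ (0 < (φ q).val 0 ↔ q ∈ (𝓡∂ n).interior M) ∧
      (∀ j i, v' j i q = v j i q) ∧ (∀ i j, c'' i j q = c i j q) ∧
      (∀ j i, v j i q * (if i = 0 then - (φ q).val 0 else 1 : ℝ)
        = (realDeriv (G.field j) (fun r => (φ r).val i) q : ℂ)) ∧
      (x q < G.c → ∀ j, v j 0 q = - (G.logDeriv j q : ℂ)) ∧
      (∀ i k, ∑ j, c i j q * v j k q = if i = k then 1 else 0) ∧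
      (∀ r : ℝ, 0 < (φ q).val 0 → |Real.log ((φ q).val 0)| ≤ r → min (Real.exp (-r)) G.c ≤ x q) ∧
      (∀ i, |(φ q).val i| ≤ |(φ p).val i| + 1) ∧ (|Θ p| / 2 ≤ |Θ q| ∧ |Θ q| ≤ 2 * |Θ p|) := by
    have e1 : ∀ᶠ q in 𝓝 p, ∀ j i, v' j i q = v j i q :=
      eventually_all.2 fun j => eventually_all.2 fun i => hv'e j i
    have e2 : ∀ᶠ q in 𝓝 p, ∀ i j, c'' i j q = c i j q :=
      eventually_all.2 fun j => eventually_all.2 fun i => hc''e j i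
    filter_upwards [φ.open_source.mem_nhds hp, hint, e1, e2, hvB, hv0, hcv, hprop, hcoord, hΘb] with
      q h1 h2 h3 h4 h5 h6 h7 h8 h9 h10
    exact ⟨h1, h2, h3, h4, h5, h6, h7, h8, h9, h10⟩
  obtain ⟨U, hU, hUo, hpU⟩ := mem_nhds_iff.1 hall
  have hmem : ∀ q, q ∈ (interiorChart φ U hUo).source ↔ q ∈ U ∧ q ∈ (𝓡∂ n).interior M := by
    intro q
    rw [mem_interiorChart_source]
    constructor
    · rintro ⟨⟨-, h2⟩, h3⟩
      exact ⟨h3, (hU h3).2.1.1 h2⟩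
    · rintro ⟨h1, h2⟩
      exact ⟨⟨(hU h1).1, (hU h1).2.1.2 h2⟩, h1⟩
  have hchart : IsInteriorChart (interiorChart φ U hUo) :=
    isInteriorChart_interiorChart hφ fun q _ hqU hq => (hU hqU).2.1.1 hq
  have hbd : ∀ q ∈ (interiorChart φ U hUo).source,
      √ (|Θ p| / 2) ≤ x q ^ n * eucDensity g (interiorChart φ U hUo) q ∧
      x q ^ n * eucDensity g (interiorChart φ U hUo) q ≤ √ (2 * |Θ p|) := by
    intro q hq
    have h1 := (mem_interiorChart_source.1 hq)
    have hxq : 0 < x q := hg.boundaryDefining.pos q (hchart.source_subset hq)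
    obtain ⟨h2, h3⟩ := (hU h1.2).2.2.2.2.2.2.2.2.2
    rw [eucDensity_interiorChart hφ hq, hΘ q h1.1.1 h1.1.2 hxq]
    have hpos : 0 < √ (Θ q) := by
      rw [← hΘ q h1.1.1 h1.1.2 hxq, ← eucDensity_interiorChart (g := g) hφ hq]
      exact mul_pos (pow_pos hxq n) (eucDensity_pos hg.metric hφ hchart hq)
    rw [abs_of_pos (Real.sqrt_pos.1 hpos)] at h2 h3
    exact ⟨Real.sqrt_le_sqrt h2, Real.sqrt_le_sqrt h3⟩
  refine ⟨{
    U := U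
    isOpen_U := hUo
    Ψ := interiorChart φ U hUo
    chart := hchart
    mem_source := hmem
    c := c''
    v := v'
    c_smooth := fun i j q => ?_
    v_smooth := fun j i q => hv's j i q
    left_inv := fun q hq i k => ?_
    field_eq := fun q hq j ψ => ?_
    c_none := fun i hi q => ?_
    v_zero := fun q hq hx j => ?_
    density_pos := fun q hq => eucDensity_pos hg.metric hφ hchart hq
    density_smooth := fun q hq => contMDiffAt_eucDensity hg.metric hφ hchart hq
    lo := √ (|Θ p| / 2)
    hi := √ (2 * |Θ p|)
    lo_pos := Real.sqrt_pos.2 (by have := abs_pos.2 hΘ0; linarith)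
    density_lower := fun q hq => (hbd q hq).1
    density_upper := fun q hq => (hbd q hq).2
    proper := fun r => ⟨min (Real.exp (-r)) G.c, lt_min (Real.exp_pos _) G.c_pos, fun q hq hr => ?_⟩
    rad := ∑ i, (|(φ p).val i| + 1)
    coord_le := fun q hq i hi => ?_ }, hpU⟩
  · simp only [c'']
    split_ifs
    · exact SmoothAt.const 0 q
    · exact hc's i j q
  · obtain ⟨-, -, h3, h4, -, -, h7, -, -, -⟩ := hU hq
    simp only [h3, h4, h7]
  · have h1 := mem_interiorChart_source.1 hq
    obtain ⟨-, -, h3, -, h5, -, -, -, -, -⟩ := hU h1.2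
    rw [vderiv_of_eq_sum Finset.univ _ (fun i => coordVec φ i) ψ q
      (field_eq_sum_coordVec hφ (G.field j) h1.1.1)]
    refine Finset.sum_congr rfl fun i _ => ?_
    rw [vderiv_smul _ (coordVec φ i) ψ q (eucVec_interiorChart hφ hq i), ← h5 j i, h3 j i, mul_assoc]
  · simp only [c'', if_pos (⟨hi, rfl⟩ : i ≠ 0 ∧ (none : G.MIdx) = none)]
  · obtain ⟨-, -, h3, -, -, h6, -, -, -, -⟩ := hU hq
    rw [h3, h6 hx j]
  · have h1 := mem_interiorChart_source.1 hq
    obtain ⟨-, -, -, -, -, -, -, h8, -, -⟩ := hU h1.2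
    refine h8 r h1.1.2 ?_
    have h2 : interiorChart φ U hUo q 0 = - Real.log ((φ q).val 0) := logCoord_zero _
    rwa [h2, abs_neg] at hr
  · have h1 := mem_interiorChart_source.1 hq
    obtain ⟨-, -, -, -, -, -, -, -, h9, -⟩ := hU h1.2
    have h2 : interiorChart φ U hUo q i = (φ q).val i := logCoord_ne _ hi
    rw [h2]
    exact (h9 i).trans (Finset.single_le_sum (f := fun i => |(φ p).val i| + 1)
      (fun i _ => by positivity) (Finset.mem_univ i))

end LocalModel

section LocalModelExistence

open Filter Topology

variable {n : ℕ} [NeZero n] {M : Type*} [TopologicalSpace M]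
  [ChartedSpace (EuclideanHalfSpace n) M] [IsManifold (𝓡∂ n) ∞ M]
  {x : M → ℝ} {g : BilinField n M}

theorem eventually_smoothAt_component [CompactSpace M] [T2Space M] {V : VField n M}
    (hV : IsSmoothVField V) {φ : OpenPartialHomeomorph M (EuclideanHalfSpace n)}
    (hφ : φ ∈ IsManifold.maximalAtlas (𝓡∂ n) ∞ M) {p : M} (hp : p ∈ φ.source) (i : Fin n) :
    ∀ᶠ q in 𝓝 p, SmoothAt n (fun q => (realDeriv V (fun r => (φ r).val i) q : ℂ)) q := by
  have hs : ∀ᶠ q in 𝓝 p, q ∈ φ.source := φ.open_source.mem_nhds hp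
  have h1 : ∀ᶠ q in 𝓝 p, SmoothAt n (fun r => ((φ r).val i : ℂ)) q :=
    hs.mono fun q hq => SmoothAt.ofReal (contMDiffAt_chart_coord hφ i hq)
  filter_upwards [eventually_smoothAt_vderiv hV h1, hs] with q hq hqs
  refine hq.congr ?_
  filter_upwards [φ.open_source.mem_nhds hqs] with r hr
  exact (vderiv_ofReal V ((contMDiffAt_chart_coord hφ i hr).mdifferentiableAt (by simp))).symm

/-- Near a point of the collar, an adapted chart gives a local model: the coordinate `0` is `- log x`,
the tangential coordinate fields are combinations of the angular fields alone, and the radial field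
supplies the remaining direction. -/
theorem exists_localModel_collar [CompactSpace M] [T2Space M] (hg : IsAsymptoticallyConic x g)
    (G : Generators x g) {p : M} (hxp : x p ≤ G.c) : ∃ m : LocalModel G, p ∈ m.U := by
  classical
  have hx := hg.boundaryDefining
  obtain ⟨φ, hφa, hp⟩ := G.collar p hxp
  have hφ := hφa.mem_atlas
  have hs : ∀ᶠ q in 𝓝 p, q ∈ φ.source := φ.open_source.mem_nhds hp
  have hx0 : ∀ᶠ q in 𝓝 p, x =ᶠ[𝓝 q] fun r => (φ r).val 0 := by
    filter_upwards [hs] with q hq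
    filter_upwards [φ.open_source.mem_nhds hq] with r hr
    exact (hφa.coord_zero r hr).symm
  have hder : ∀ V : VField n M, ∀ q, x =ᶠ[𝓝 q] (fun r => (φ r).val 0) →
      realDeriv V (fun r => (φ r).val 0) q = realDeriv V x q := by
    intro V q h
    unfold realDeriv
    rw [h.mfderiv_eq]
    exact congrArg _ rfl
  let B : G.MIdx → Fin n → M → ℂ := fun j i q => (realDeriv (G.field j) (fun r => (φ r).val i) q : ℂ)
  have hB : ∀ j i, ∀ᶠ q in 𝓝 p, SmoothAt n (B j i) q := fun j i =>
    eventually_smoothAt_component (G.field_smooth j) hφ hp i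
  let v : G.MIdx → Fin n → M → ℂ := fun j i => if i = 0 then fun q => - (G.logDeriv j q : ℂ) else B j i
  have hv : ∀ j i, ∀ᶠ q in 𝓝 p, SmoothAt n (v j i) q := by
    intro j i
    by_cases hi : i = 0
    · simp only [v, if_pos hi]
      exact Eventually.of_forall fun q => (G.logDeriv_smoothAt hx j q).neg
    · simp only [v, if_neg hi]
      exact hB j i
  -- the angular fields frame the tangential directions
  have hinj : ∀ w : {i : Fin n // i ≠ 0} → ℂ,
      (∀ a, ∑ i, v (some (.inl a)) i.1 p * w i = 0) → w = 0 := by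
    intro w hw
    refine injective_of_mem_span hφ hp (fun a : Fin G.numAngular => G.angular a)
      (fun i : {i : Fin n // i ≠ 0} => i.1) Subtype.val_injective (fun i => ?_) w fun a => ?_
    · refine G.angular_span p hxp _ ?_
      have h1 := hder (coordVec φ i.1) p hx0.self_of_nhds
      rw [realDeriv_coordVec hφ i.1 0 hp, if_neg i.2.symm] at h1
      exact h1.symm
    · rw [← hw a]
      refine Finset.sum_congr rfl fun i _ => ?_
      simp only [v, if_neg i.2, B]
      rfl
  obtain ⟨cS, hcS, hcSv⟩ := exists_smooth_leftInverse
    (v := fun a (i : {i : Fin n // i ≠ 0}) => v (some (.inl a)) i.1) (fun a i => hv _ _) hinj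
  -- `cS` inverts the angular components; the direction `0` is the radial field minus its tangential
  -- part, divided by its component along that direction
  let c : Fin n → G.MIdx → M → ℂ := fun i j q =>
    if h : i ≠ 0 then
      match j with
      | some (.inl a) => cS ⟨i, h⟩ a q
      | _ => 0
    else
      match j with
      | none => (v none 0 q)⁻¹
      | some (.inl a) => - ((v none 0 q)⁻¹ * ∑ k : {i : Fin n // i ≠ 0}, v none k.1 q * cS k a q)
      | some (.inr _) => 0
  have hv00 : ∀ᶠ q in 𝓝 p, v none 0 q ≠ 0 := by
    refine (hv none 0).self_of_nhds.continuousAt.eventually_ne ?_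
    simp only [v, if_true, G.logDeriv_none' hxp]
    simp
  have hva : ∀ a q, v (some (.inl a)) 0 q = 0 := by
    intro a q
    simp [v, G.logDeriv_angular]
  refine exists_localModel_of_chart hg G hφ hp ?_ ?_ v hv ?_ ?_ c ?_ ?_ ?_ ?_
  · filter_upwards [hs] with q hq
    rw [hφa.coord_zero q hq]
    exact hx.pos_iff q
  · by_cases h0 : x p = 0
    · exact exists_density_root_boundary hx hg.metric hφa hp h0
    · have hpos : 0 < x p := lt_of_le_of_ne (hx.nonneg p) (Ne.symm h0)
      exact exists_density_root_interior hx hg.metric hφ hp ((hx.pos_iff p).1 hpos)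
        (by rwa [hφa.coord_zero p hp])
  · filter_upwards [hs, hx0] with q hq hq0 j i
    by_cases hi : i = 0
    · subst hi
      simp only [v, if_true]
      rw [hder _ q hq0, G.realDeriv_eq, hφa.coord_zero q hq]
      push_cast
      ring
    · simp only [v, if_neg hi, B]
      simp
  · exact Eventually.of_forall fun q _ j => by simp [v]
  · intro i j
    by_cases hi : i = 0
    · have hvs : ∀ᶠ q in 𝓝 p, ∀ k, SmoothAt n (v none k) q := eventually_all.2 fun k => hv none k
      have hcs : ∀ᶠ q in 𝓝 p, ∀ k a, SmoothAt n (cS k a) q :=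
        eventually_all.2 fun k => eventually_all.2 fun a => hcS k a
      filter_upwards [hvs, hcs, hv00] with q h1 h2 h3
      rcases j with _ | a | b
      · simp only [c, hi, ne_eq, not_true_eq_false, dite_false]
        exact (h1 0).inv h3
      · simp only [c, hi, ne_eq, not_true_eq_false, dite_false]
        exact (((h1 0).inv h3).mul (SmoothAt.sum fun k _ => (h1 _).mul (h2 k a))).neg
      · simp only [c, hi, ne_eq, not_true_eq_false, dite_false]
        exact SmoothAt.const 0 q
    · rcases j with _ | a | b
      · simp only [c, ne_eq, hi, not_false_eq_true, dite_true]
        exact Eventually.of_forall fun q => SmoothAt.const 0 q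
      · simp only [c, ne_eq, hi, not_false_eq_true, dite_true]
        exact hcS _ a
      · simp only [c, ne_eq, hi, not_false_eq_true, dite_true]
        exact Eventually.of_forall fun q => SmoothAt.const 0 q
  · filter_upwards [hcSv, hv00] with q hq hq0 i k
    rw [Fintype.sum_option, Fintype.sum_sum_type]
    have hS : ∀ i : {i : Fin n // i ≠ 0}, ∀ k, ∑ a, cS i a q * v (some (.inl a)) k q
        = if i.1 = k then 1 else 0 := by
      intro i k
      by_cases hk : k = 0
      · subst hk
        simp [hva, i.2]
      · have := hq i ⟨k, hk⟩
        simp only [Subtype.ext_iff] at this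
        exact this
    by_cases hi : i = 0
    · subst hi
      simp only [c, ne_eq, not_true_eq_false, dite_false, zero_mul, Finset.sum_const_zero, add_zero]
      have h1 : ∑ a, - ((v none 0 q)⁻¹ * ∑ l : {i : Fin n // i ≠ 0}, v none l.1 q * cS l a q)
          * v (some (.inl a)) k q
          = - ((v none 0 q)⁻¹ * ∑ l : {i : Fin n // i ≠ 0}, v none l.1 q
            * (if l.1 = k then 1 else 0)) := by
        simp only [← hS, Finset.mul_sum, Finset.sum_mul, neg_mul, Finset.sum_neg_distrib]
        rw [Finset.sum_comm]
        simp only [mul_assoc]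
      rw [h1]
      by_cases hk : k = 0
      · subst hk
        have h2 : ∑ l : {i : Fin n // i ≠ 0}, v none l.1 q * (if l.1 = 0 then (1 : ℂ) else 0) = 0 :=
          Finset.sum_eq_zero fun l _ => by rw [if_neg l.2, mul_zero]
        rw [h2, if_pos rfl]
        simp [hq0]
      · have h2 : ∑ l : {i : Fin n // i ≠ 0}, v none l.1 q * (if l.1 = k then (1 : ℂ) else 0)
            = v none k q := by
          rw [Finset.sum_eq_single (⟨k, hk⟩ : {i : Fin n // i ≠ 0})]
          · simp
          · intro l _ hl
            rw [if_neg (fun h => hl (Subtype.ext h)), mul_zero]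
          · intro h; exact absurd (Finset.mem_univ _) h
        rw [h2, if_neg (Ne.symm hk)]
        ring
    · simp only [c, ne_eq, hi, not_false_eq_true, dite_true, zero_mul, Finset.sum_const_zero,
        add_zero, zero_add]
      exact hS ⟨i, hi⟩ k
  · intro i hi q
    simp [c, hi]
  · filter_upwards [hs] with q hq r h0 hr
    rw [hφa.coord_zero q hq] at h0 hr
    refine (min_le_left _ _).trans ?_
    rw [← Real.exp_log h0]
    exact Real.exp_le_exp.2 (abs_le.1 (by simpa using hr)).1

/-- Away from the collar the interior fields span the tangent spaces. The first coordinate of a chart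
is positive on the interior, so that its logarithm can be used here too. -/
theorem exists_localModel_interior [CompactSpace M] [T2Space M] (hg : IsAsymptoticallyConic x g)
    (G : Generators x g) {p : M} (hxp : G.c < x p) : ∃ m : LocalModel G, p ∈ m.U := by
  classical
  have hx := hg.boundaryDefining
  set φ := chartAt (EuclideanHalfSpace n) p with hφd
  have hφ : φ ∈ IsManifold.maximalAtlas (𝓡∂ n) ∞ M := IsManifold.chart_mem_maximalAtlas p
  have hp : p ∈ φ.source := mem_chart_source _ p
  have hs : ∀ᶠ q in 𝓝 p, q ∈ φ.source := φ.open_source.mem_nhds hp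
  have hxc : ∀ᶠ q in 𝓝 p, G.c < x q := hx.smooth.continuous.continuousAt.eventually_const_lt hxp
  have hpi : p ∈ (𝓡∂ n).interior M := (hx.pos_iff p).1 (G.c_pos.trans hxp)
  have hz : 0 < (φ p).val 0 := by
    have h1 : extChartAt (𝓡∂ n) p p ∈ interior (Set.range (𝓡∂ n)) := hpi
    rw [interior_range_modelWithCornersEuclideanHalfSpace] at h1
    exact h1
  have hzs : ∀ᶠ q in 𝓝 p, 0 < (φ q).val 0 :=
    (contMDiffAt_chart_coord hφ 0 hp).continuousAt.eventually_const_lt hz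
  let d : Fin n → M → ℝ := fun i q => if i = 0 then - (φ q).val 0 else 1
  let B : G.MIdx → Fin n → M → ℂ := fun j i q => (realDeriv (G.field j) (fun r => (φ r).val i) q : ℂ)
  have hB : ∀ j i, ∀ᶠ q in 𝓝 p, SmoothAt n (B j i) q := fun j i =>
    eventually_smoothAt_component (G.field_smooth j) hφ hp i
  have hd0 : ∀ q, 0 < (φ q).val 0 → ∀ i, (d i q : ℂ) ≠ 0 := by
    intro q hq i
    have : d i q ≠ 0 := by
      simp only [d]
      split_ifs
      · linarith
      · exact one_ne_zero
    exact_mod_cast this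
  let v : G.MIdx → Fin n → M → ℂ := fun j i q => B j i q * (d i q : ℂ)⁻¹
  have hv : ∀ j i, ∀ᶠ q in 𝓝 p, SmoothAt n (v j i) q := by
    intro j i
    filter_upwards [hB j i, hzs, hs] with q h1 h2 h3
    refine h1.mul (SmoothAt.inv (SmoothAt.ofReal ?_) (hd0 q h2 i))
    by_cases hi : i = 0
    · simp only [d, if_pos hi]
      exact (contMDiffAt_chart_coord hφ 0 h3).neg
    · simp only [d, if_neg hi]
      exact contMDiffAt_const
  have hinj : ∀ w : Fin n → ℂ, (∀ b, ∑ i, v (some (.inr b)) i p * w i = 0) → w = 0 := by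
    intro w hw
    have h1 : (fun i => (d i p : ℂ)⁻¹ * w i) = 0 := by
      refine injective_of_mem_span hφ hp (fun b : Fin G.numInterior => G.interior b)
        (fun i : Fin n => i) Function.injective_id (fun i => ?_) _ fun b => ?_
      · rw [G.interior_span p hxp]; trivial
      · rw [← hw b]
        refine Finset.sum_congr rfl fun i _ => ?_
        simp only [v, B, mul_assoc]
        rfl
    funext i
    have h2 := congrFun h1 i
    simpa [hd0 p hz i] using h2
  obtain ⟨cS, hcS, hcSv⟩ := exists_smooth_leftInverse
    (v := fun b (i : Fin n) => v (some (.inr b)) i) (fun b i => hv _ _) hinj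
  let c : Fin n → G.MIdx → M → ℂ := fun i j q =>
    match j with
    | some (.inr b) => cS i b q
    | _ => 0
  refine exists_localModel_of_chart hg G hφ hp ?_
    (exists_density_root_interior hx hg.metric hφ hp hpi hz) v hv ?_ ?_ c ?_ ?_ ?_ ?_
  · filter_upwards [hzs, hxc] with q h1 h2
    exact ⟨fun _ => (hx.pos_iff q).1 (G.c_pos.trans h2), fun _ => h1⟩
  · filter_upwards [hzs] with q hq j i
    have := hd0 q hq i
    simp only [v, B]
    change _ * (d i q : ℂ)⁻¹ * (d i q : ℂ) = _
    rw [inv_mul_cancel_right₀ this]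
  · filter_upwards [hxc] with q h1 h2
    exact absurd h1 h2.not_gt
  · intro i j
    rcases j with _ | a | b
    · exact Eventually.of_forall fun q => SmoothAt.const 0 q
    · exact Eventually.of_forall fun q => SmoothAt.const 0 q
    · exact hcS i b
  · filter_upwards [hcSv] with q hq i k
    rw [Fintype.sum_option, Fintype.sum_sum_type]
    simp only [c, zero_mul, Finset.sum_const_zero, zero_add]
    exact hq i k
  · intro i _ q
    rfl
  · filter_upwards [hxc] with q hq r _ _
    exact (min_le_right _ _).trans hq.le

/-- Every point has a local model. -/
theorem exists_localModel [CompactSpace M] [T2Space M] (hg : IsAsymptoticallyConic x g)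
    (G : Generators x g) (p : M) : ∃ m : LocalModel G, p ∈ m.U := by
  rcases le_or_gt (x p) G.c with h | h
  · exact exists_localModel_collar hg G h
  · exact exists_localModel_interior hg G h

end LocalModelExistence

/-! ### Weak actions of operators -/

section WeakAction

open Filter Topology

variable {n : ℕ} [NeZero n] {M : Type*} [TopologicalSpace M]
  [ChartedSpace (EuclideanHalfSpace n) M] [IsManifold (𝓡∂ n) ∞ M] [CompactSpace M] [T2Space M]
  [MeasurableSpace M] [BorelSpace M] {μ : Measure M}

/-- `Q u = f` in the sense of distributions, for an operator `Q` on test functions. -/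
def WeakAct (μ : Measure M) (Q : TestOp n M) (u f : M → ℂ) : Prop :=
  LocallyIntegrableOn u ((𝓡∂ n).interior M) μ ∧ LocallyIntegrableOn f ((𝓡∂ n).interior M) μ ∧
  ∀ φ η : testSpace n M, (∀ ψ : testSpace n M, ∫ p, φ.1 p * (Q ψ).1 p ∂μ = ∫ p, η.1 p * ψ.1 p ∂μ) →
    ∫ p, f p * φ.1 p ∂μ = ∫ p, u p * η.1 p ∂μ

theorem isWeakAction_iff {P : (M → ℂ) → M → ℂ} {Q : TestOp n M}
    (h : ∀ ψ : testSpace n M, P ψ.1 = (Q ψ).1) (u f : M → ℂ) :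
    IsWeakAction (n := n) μ P u f ↔ WeakAct μ Q u f := by
  refine and_congr_right fun _ => and_congr_right fun _ => ⟨fun H φ η hη => ?_, fun H φ η hφ hη hT => ?_⟩
  · refine H φ.1 η.1 φ.2 η.2 fun ψ hψ => ?_
    rw [h ⟨ψ, hψ⟩]
    exact hη ⟨ψ, hψ⟩
  · refine H ⟨φ, hφ⟩ ⟨η, hη⟩ fun ψ => ?_
    have := hT ψ.1 ψ.2
    rwa [h ψ] at this

/-- The operator `Q` has a formal transpose. -/
def HasTranspose (μ : Measure M) (Q : TestOp n M) : Prop :=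
  ∀ φ : testSpace n M, ∃ η : testSpace n M,
    ∀ ψ : testSpace n M, ∫ p, φ.1 p * (Q ψ).1 p ∂μ = ∫ p, η.1 p * ψ.1 p ∂μ

/-- Compact subsets of the interior have finite measure. -/
def FiniteInside (n : ℕ) [NeZero n] {M : Type*} [TopologicalSpace M]
    [ChartedSpace (EuclideanHalfSpace n) M] [MeasurableSpace M] (μ : Measure M) : Prop :=
  ∀ K : Set M, IsCompact K → K ⊆ (𝓡∂ n).interior M → μ K < ⊤

theorem isCompact_tsupport_test (φ : testSpace n M) : IsCompact (tsupport φ.1) :=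
  (isClosed_tsupport _).isCompact

theorem continuous_test (φ : testSpace n M) : Continuous φ.1 := φ.2.1.continuous

theorem locallyIntegrableOn_interior_iff {f : M → ℂ} :
    LocallyIntegrableOn f ((𝓡∂ n).interior M) μ ↔
      ∀ K : Set M, K ⊆ (𝓡∂ n).interior M → IsCompact K → IntegrableOn f K μ := by
  exact locallyIntegrableOn_iff isOpen_interior.isLocallyClosed

theorem integrable_mul_test {f : M → ℂ} (hf : LocallyIntegrableOn f ((𝓡∂ n).interior M) μ)
    (φ : testSpace n M) : Integrable (fun p => f p * φ.1 p) μ := by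
  have h1 := (locallyIntegrableOn_interior_iff.1 hf _ φ.2.2 (isCompact_tsupport_test φ))
  have h2 := h1.mul_continuousOn (continuous_test φ).continuousOn (isCompact_tsupport_test φ)
  refine (integrableOn_iff_integrable_of_support_subset fun p hp => ?_).1 h2
  exact subset_tsupport _ (right_ne_zero_of_mul hp)

theorem locallyIntegrableOn_of_continuousOn (hμ : FiniteInside n μ) {f : M → ℂ}
    (hf : ContinuousOn f ((𝓡∂ n).interior M)) :
    LocallyIntegrableOn f ((𝓡∂ n).interior M) μ := by
  rw [locallyIntegrableOn_interior_iff]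
  intro K hK hKc
  have : IsFiniteMeasure (μ.restrict K) := ⟨by simpa using hμ K hKc hK⟩
  obtain ⟨C, hC⟩ := hKc.exists_bound_of_continuousOn (hf.mono hK)
  exact Integrable.of_bound ((hf.mono hK).aestronglyMeasurable_of_isCompact hKc hKc.measurableSet) C
    ((ae_restrict_iff' hKc.measurableSet).2 (Eventually.of_forall hC))

theorem integrable_test_mul_test (hμ : FiniteInside n μ) (φ ψ : testSpace n M) :
    Integrable (fun p => φ.1 p * ψ.1 p) μ :=
  integrable_mul_test (locallyIntegrableOn_of_continuousOn hμ (continuous_test φ).continuousOn) ψ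

/-- The pairing of test functions is nondegenerate. -/
theorem ae_eq_zero_of_pairing (hμ : FiniteInside n μ) {η : testSpace n M}
    (h : ∀ ψ : testSpace n M, ∫ p, η.1 p * ψ.1 p ∂μ = 0) : η.1 =ᵐ[μ] 0 := by
  have hs : IsTest (n := n) (fun p => (starRingEnd ℂ) (η.1 p)) := by
    refine ⟨fun p => ContDiffAt.comp_contMDiffAt (Complex.conjCLE.contDiff.contDiffAt) (η.2.1 p), ?_⟩
    refine (closure_mono fun p hp => ?_).trans η.2.2
    rw [Function.mem_support] at hp ⊢
    intro h0
    simp [h0] at hp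
  have h1 := h ⟨_, hs⟩
  have hint := integrable_test_mul_test hμ η ⟨_, hs⟩
  have h2 : ∀ p, η.1 p * (starRingEnd ℂ) (η.1 p) = ((‖η.1 p‖ ^ 2 : ℝ) : ℂ) := by
    intro p
    rw [Complex.mul_conj, Complex.normSq_eq_norm_sq]
  simp only [h2] at h1 hint
  rw [integral_complex_ofReal] at h1
  have h3 : Integrable (fun p => ‖η.1 p‖ ^ 2) μ := by
    have h4 : (fun p => ‖η.1 p‖ ^ 2) = fun p => RCLike.re ((‖η.1 p‖ ^ 2 : ℝ) : ℂ) :=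
      funext fun p => (Complex.ofReal_re _).symm
    rw [h4]
    exact hint.re
  have h4 := (integral_eq_zero_iff_of_nonneg (fun p => by positivity) h3).1 (by exact_mod_cast h1)
  filter_upwards [h4] with p hp
  simpa using hp

theorem ae_eq_of_pairing (hμ : FiniteInside n μ) {η η' : testSpace n M}
    (h : ∀ ψ : testSpace n M, ∫ p, η.1 p * ψ.1 p ∂μ = ∫ p, η'.1 p * ψ.1 p ∂μ) :
    η.1 =ᵐ[μ] η'.1 := by
  have h1 : (η - η').1 =ᵐ[μ] 0 := ae_eq_zero_of_pairing hμ fun ψ => by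
    have : ∀ p, (η - η').1 p * ψ.1 p = η.1 p * ψ.1 p - η'.1 p * ψ.1 p := fun p => sub_mul _ _ _
    simp only [this]
    rw [integral_sub (integrable_test_mul_test hμ _ _) (integrable_test_mul_test hμ _ _), h, sub_self]
  filter_upwards [h1] with p hp
  exact sub_eq_zero.1 hp

theorem integral_congr_of_pairing (hμ : FiniteInside n μ) {η η' : testSpace n M}
    (h : ∀ ψ : testSpace n M, ∫ p, η.1 p * ψ.1 p ∂μ = ∫ p, η'.1 p * ψ.1 p ∂μ) (u : M → ℂ) :
    ∫ p, u p * η.1 p ∂μ = ∫ p, u p * η'.1 p ∂μ :=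
  integral_congr_ae ((ae_eq_of_pairing hμ h).mono fun p hp => congrArg (u p * ·) hp)

/-- A weak action can be checked on one choice of transposes. -/
theorem weakAct_of_transpose (hμ : FiniteInside n μ) {Q : TestOp n M} {u f : M → ℂ}
    (hu : LocallyIntegrableOn u ((𝓡∂ n).interior M) μ)
    (hf : LocallyIntegrableOn f ((𝓡∂ n).interior M) μ)
    (h : ∀ φ : testSpace n M, ∃ η : testSpace n M,
      (∀ ψ : testSpace n M, ∫ p, φ.1 p * (Q ψ).1 p ∂μ = ∫ p, η.1 p * ψ.1 p ∂μ) ∧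
      ∫ p, f p * φ.1 p ∂μ = ∫ p, u p * η.1 p ∂μ) : WeakAct μ Q u f := by
  refine ⟨hu, hf, fun φ η hη => ?_⟩
  obtain ⟨η', h1, h2⟩ := h φ
  rw [h2]
  exact integral_congr_of_pairing hμ (fun ψ => by rw [← h1, hη]) u

theorem WeakAct.comp {P Q : TestOp n M} {u f h : M → ℂ} (hP : HasTranspose μ P)
    (hQ : WeakAct μ Q u f) (hf : WeakAct μ P f h) : WeakAct μ (P * Q) u h := by
  refine ⟨hQ.1, hf.2.1, fun φ η hη => ?_⟩
  obtain ⟨η', hη'⟩ := hP φ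
  rw [hf.2.2 φ η' hη']
  refine hQ.2.2 η' η fun ψ => ?_
  rw [← hη' (Q ψ), ← hη ψ]
  rfl

theorem WeakAct.cancel {P Q : TestOp n M} {u f h : M → ℂ} (hQt : HasTranspose μ Q)
    (hPQ : WeakAct μ (P * Q) u h) (hQ : WeakAct μ Q u f) : WeakAct μ P f h := by
  refine ⟨hQ.2.1, hPQ.2.1, fun φ η hη => ?_⟩
  obtain ⟨η', hη'⟩ := hQt η
  rw [hQ.2.2 η η' hη']
  refine hPQ.2.2 φ η' fun ψ => ?_
  rw [← hη' ψ, ← hη (Q ψ)]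
  rfl

theorem HasTranspose.mul {P Q : TestOp n M} (hP : HasTranspose μ P) (hQ : HasTranspose μ Q) :
    HasTranspose μ (P * Q) := by
  intro φ
  obtain ⟨η, hη⟩ := hP φ
  obtain ⟨η', hη'⟩ := hQ η
  exact ⟨η', fun ψ => (hη (Q ψ)).trans (hη' ψ)⟩

theorem HasTranspose.add (hμ : FiniteInside n μ) {P Q : TestOp n M} (hP : HasTranspose μ P)
    (hQ : HasTranspose μ Q) : HasTranspose μ (P + Q) := by
  intro φ
  obtain ⟨η, hη⟩ := hP φ
  obtain ⟨η', hη'⟩ := hQ φ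
  refine ⟨η + η', fun ψ => ?_⟩
  have h1 : ∀ p, φ.1 p * ((P + Q) ψ).1 p = φ.1 p * (P ψ).1 p + φ.1 p * (Q ψ).1 p :=
    fun p => mul_add _ _ _
  have h2 : ∀ p, (η + η').1 p * ψ.1 p = η.1 p * ψ.1 p + η'.1 p * ψ.1 p := fun p => add_mul _ _ _
  simp only [h1, h2]
  rw [integral_add (integrable_test_mul_test hμ _ _) (integrable_test_mul_test hμ _ _),
    integral_add (integrable_test_mul_test hμ _ _) (integrable_test_mul_test hμ _ _), hη, hη']

theorem hasTranspose_mulOp {a : M → ℂ} (ha : IntSmooth n a) : HasTranspose μ (mulOp a ha) := by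
  intro φ
  refine ⟨mulOp a ha φ, fun ψ => integral_congr_ae (Eventually.of_forall fun p => ?_)⟩
  simp only [mulOp_apply]
  ring

theorem hasTranspose_one : HasTranspose μ (1 : TestOp n M) := fun φ => ⟨φ, fun _ => rfl⟩

theorem hasTranspose_zero : HasTranspose μ (0 : TestOp n M) := fun φ => ⟨0, fun _ => by simp⟩

theorem HasTranspose.sum (hμ : FiniteInside n μ) {ι : Type*} {s : Finset ι} {Q : ι → TestOp n M}
    (h : ∀ i ∈ s, HasTranspose μ (Q i)) : HasTranspose μ (∑ i ∈ s, Q i) := by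
  classical
  induction s using Finset.induction_on with
  | empty => simpa using hasTranspose_zero
  | insert i s his ih =>
    rw [Finset.sum_insert his]
    exact (h i (Finset.mem_insert_self i s)).add hμ
      (ih fun j hj => h j (Finset.mem_insert_of_mem hj))

theorem hasTranspose_of_mem_coeffRing {Q : TestOp n M} (h : Q ∈ coeffRing n M) :
    HasTranspose μ Q := by
  obtain ⟨a, ha, rfl⟩ := h
  exact hasTranspose_mulOp _

theorem WeakAct.add (hμ : FiniteInside n μ) {P Q : TestOp n M} {u f f' : M → ℂ}
    (hPt : HasTranspose μ P) (hQt : HasTranspose μ Q)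
    (hP : WeakAct μ P u f) (hQ : WeakAct μ Q u f') : WeakAct μ (P + Q) u fun p => f p + f' p := by
  refine weakAct_of_transpose hμ hP.1 (hP.2.1.add hQ.2.1) fun φ => ?_
  obtain ⟨η, hη⟩ := hPt φ
  obtain ⟨η', hη'⟩ := hQt φ
  refine ⟨η + η', fun ψ => ?_, ?_⟩
  · have h1 : ∀ p, φ.1 p * ((P + Q) ψ).1 p = φ.1 p * (P ψ).1 p + φ.1 p * (Q ψ).1 p :=
      fun p => mul_add _ _ _
    have h2 : ∀ p, (η + η').1 p * ψ.1 p = η.1 p * ψ.1 p + η'.1 p * ψ.1 p := fun p => add_mul _ _ _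
    simp only [h1, h2]
    rw [integral_add (integrable_test_mul_test hμ _ _) (integrable_test_mul_test hμ _ _),
      integral_add (integrable_test_mul_test hμ _ _) (integrable_test_mul_test hμ _ _), hη, hη']
  · have h2 : ∀ p, u p * (η + η').1 p = u p * η.1 p + u p * η'.1 p := fun p => mul_add _ _ _
    simp only [h2, add_mul]
    rw [integral_add (integrable_mul_test hP.2.1 _) (integrable_mul_test hQ.2.1 _),
      integral_add (integrable_mul_test hP.1 _) (integrable_mul_test hP.1 _),
      hP.2.2 φ η hη, hQ.2.2 φ η' hη']

theorem WeakAct.add_right {Q : TestOp n M} {u u' f f' : M → ℂ}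
    (h : WeakAct μ Q u f) (h' : WeakAct μ Q u' f') :
    WeakAct μ Q (fun p => u p + u' p) fun p => f p + f' p := by
  refine ⟨h.1.add h'.1, h.2.1.add h'.2.1, fun φ η hη => ?_⟩
  simp only [add_mul]
  rw [integral_add (integrable_mul_test h.2.1 _) (integrable_mul_test h'.2.1 _),
    integral_add (integrable_mul_test h.1 _) (integrable_mul_test h'.1 _),
    h.2.2 φ η hη, h'.2.2 φ η hη]

theorem locallyIntegrableOn_mul_of_intSmooth {a : M → ℂ} (ha : IntSmooth n a) {u : M → ℂ}
    (hu : LocallyIntegrableOn u ((𝓡∂ n).interior M) μ) :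
    LocallyIntegrableOn (fun p => a p * u p) ((𝓡∂ n).interior M) μ := by
  rw [locallyIntegrableOn_interior_iff] at hu ⊢
  intro K hK hKc
  have hc : ContinuousOn a K := fun p hp => (ha p (hK hp)).continuousAt.continuousWithinAt
  exact (hu K hK hKc).continuousOn_mul hc hKc

theorem weakAct_mulOp (hμ : FiniteInside n μ) {a : M → ℂ} (ha : IntSmooth n a) {u : M → ℂ}
    (hu : LocallyIntegrableOn u ((𝓡∂ n).interior M) μ) :
    WeakAct μ (mulOp a ha) u fun p => a p * u p := by
  refine weakAct_of_transpose hμ hu (locallyIntegrableOn_mul_of_intSmooth ha hu) fun φ => ?_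
  refine ⟨mulOp a ha φ, fun ψ => integral_congr_ae (Eventually.of_forall fun p => ?_),
    integral_congr_ae (Eventually.of_forall fun p => ?_)⟩
  · simp only [mulOp_apply]
    ring
  · simp only [mulOp_apply]
    ring

theorem weakAct_one (hμ : FiniteInside n μ) {u : M → ℂ}
    (hu : LocallyIntegrableOn u ((𝓡∂ n).interior M) μ) : WeakAct μ (1 : TestOp n M) u u :=
  weakAct_of_transpose hμ hu hu fun φ => ⟨φ, fun _ => rfl, rfl⟩

theorem weakAct_zero (hμ : FiniteInside n μ) {u : M → ℂ}
    (hu : LocallyIntegrableOn u ((𝓡∂ n).interior M) μ) :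
    WeakAct μ (0 : TestOp n M) u fun _ => 0 :=
  weakAct_of_transpose hμ hu (locallyIntegrableOn_zero) fun φ => ⟨0, fun _ => by simp, by simp⟩

theorem WeakAct.congr {Q : TestOp n M} {u u' f f' : M → ℂ} (h : WeakAct μ Q u f)
    (hu : u =ᵐ[μ.restrict ((𝓡∂ n).interior M)] u') (hf : f =ᵐ[μ.restrict ((𝓡∂ n).interior M)] f') :
    WeakAct μ Q u' f' := by
  have hm : MeasurableSet ((𝓡∂ n).interior M) := isOpen_interior.measurableSet
  have aux : ∀ {a b : M → ℂ}, a =ᵐ[μ.restrict ((𝓡∂ n).interior M)] b →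
      (LocallyIntegrableOn a ((𝓡∂ n).interior M) μ → LocallyIntegrableOn b ((𝓡∂ n).interior M) μ) ∧
      ∀ φ : testSpace n M, ∫ p, a p * φ.1 p ∂μ = ∫ p, b p * φ.1 p ∂μ := by
    intro a b hab
    refine ⟨fun ha => ?_, fun φ => integral_congr_ae ?_⟩
    · rw [locallyIntegrableOn_interior_iff] at ha ⊢
      intro K hK hKc
      exact (ha K hK hKc).congr (ae_restrict_of_ae_restrict_of_subset hK hab)
    · filter_upwards [(ae_restrict_iff' hm).1 hab] with p hp
      by_cases hpi : p ∈ (𝓡∂ n).interior M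
      · rw [hp hpi]
      · rw [testSpace_eq_zero φ hpi, mul_zero, mul_zero]
  refine ⟨(aux hu).1 h.1, (aux hf).1 h.2.1, fun φ η hη => ?_⟩
  rw [← (aux hu).2, ← (aux hf).2]
  exact h.2.2 φ η hη

/-- A locally integrable function on an open subset of the interior is determined by its
integrals against test functions. -/
theorem ae_eq_of_integral_test {U : Set M} (hU : IsOpen U) (hUi : U ⊆ (𝓡∂ n).interior M)
    {f f' : M → ℂ} (hf : LocallyIntegrableOn f ((𝓡∂ n).interior M) μ)
    (hf' : LocallyIntegrableOn f' ((𝓡∂ n).interior M) μ)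
    (h : ∀ φ : testSpace n M, tsupport φ.1 ⊆ U →
      ∫ p, f p * φ.1 p ∂μ = ∫ p, f' p * φ.1 p ∂μ) : f =ᵐ[μ.restrict U] f' := by
  have h1 : ∀ᵐ p ∂μ, p ∈ U → f p - f' p = 0 := by
    refine hU.ae_eq_zero_of_integral_contMDiff_smul_eq_zero (𝓡∂ n)
      ((hf.sub hf').mono_set hUi) fun θ hθ hθc hθs => ?_
    have hsub : tsupport (fun p => (θ p : ℂ)) ⊆ tsupport θ := closure_mono fun p hp => by
      rw [Function.mem_support] at hp ⊢
      intro h0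
      simp [h0] at hp
    let φ : testSpace n M := ⟨fun p => (θ p : ℂ), fun p => SmoothAt.ofReal (hθ p),
      (hsub.trans hθs).trans hUi⟩
    have h2 := h φ (hsub.trans hθs)
    have h3 : ∀ p, θ p • (f p - f' p) = f p * φ.1 p - f' p * φ.1 p := by
      intro p
      rw [Complex.real_smul]
      change (θ p : ℂ) * _ = f p * (θ p : ℂ) - f' p * (θ p : ℂ)
      ring
    simp only [h3]
    rw [integral_sub (integrable_mul_test hf φ) (integrable_mul_test hf' φ), h2, sub_self]
  rw [Filter.EventuallyEq, ae_restrict_iff' hU.measurableSet]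
  filter_upwards [h1] with p hp hpU
  exact sub_eq_zero.1 (hp hpU)

theorem WeakAct.unique {Q : TestOp n M} (hQ : HasTranspose μ Q) {u f f' : M → ℂ}
    (h : WeakAct μ Q u f) (h' : WeakAct μ Q u f') :
    f =ᵐ[μ.restrict ((𝓡∂ n).interior M)] f' := by
  refine ae_eq_of_integral_test isOpen_interior subset_rfl h.2.1 h'.2.1 fun φ _ => ?_
  obtain ⟨η, hη⟩ := hQ φ
  rw [h.2.2 φ η hη, h'.2.2 φ η hη]

theorem WeakAct.aestronglyMeasurable {Q : TestOp n M} {u f : M → ℂ} (h : WeakAct μ Q u f) :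
    AEStronglyMeasurable f (μ.restrict ((𝓡∂ n).interior M)) := by
  have := (𝓡∂ n).secondCountableTopology
  have := ChartedSpace.secondCountable_of_sigmaCompact (EuclideanHalfSpace n) M
  exact h.2.1.aestronglyMeasurable

end WeakAction

/-! ### Calculus in a local model -/

section LocalCalculus

open Filter Topology

variable {n : ℕ} [NeZero n] {M : Type*} [TopologicalSpace M]
  [ChartedSpace (EuclideanHalfSpace n) M] [IsManifold (𝓡∂ n) ∞ M]
  {x : M → ℝ} {g : BilinField n M} {G : Generators x g}

theorem isTest_mul_of_tsupport {a φ : M → ℂ} (hφ : IsTest (n := n) φ)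
    (ha : ∀ p ∈ tsupport φ, SmoothAt n a p) : IsTest (n := n) fun q => a q * φ q := by
  have hs : tsupport (fun q => a q * φ q) ⊆ tsupport φ := tsupport_mul_subset_right
  exact ⟨contMDiff_of_tsupport fun p hp => SmoothAt.mul (ha p (hs hp)) (hφ.1 p), hs.trans hφ.2⟩

namespace LocalModel

variable (m : LocalModel G)

/-- The coordinate derivative `∂_i` of a local model, extended to all of `M` by means of its
coefficients. -/
noncomputable def dv (i : Fin n) (a : M → ℂ) (q : M) : ℂ :=
  ∑ j, m.c i j q * vderiv (G.field j) a q

theorem dv_eq_vderiv {q : M} (hq : q ∈ m.Ψ.source) (i : Fin n) (a : M → ℂ) :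
    m.dv i a q = vderiv (eucVec m.Ψ i) a q := by
  unfold dv
  simp only [m.field_eq q hq, Finset.mul_sum]
  rw [Finset.sum_comm]
  have h : ∀ k, ∑ j, m.c i j q * (m.v j k q * vderiv (eucVec m.Ψ k) a q)
      = (if i = k then 1 else 0) * vderiv (eucVec m.Ψ k) a q := by
    intro k
    rw [← m.left_inv q ((m.mem_source q).1 hq).1 i k, Finset.sum_mul]
    exact Finset.sum_congr rfl fun j _ => by ring
  simp [h]

theorem vderiv_eq_dv {q : M} (hq : q ∈ m.Ψ.source) (j : G.MIdx) (a : M → ℂ) :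
    vderiv (G.field j) a q = ∑ i, m.v j i q * m.dv i a q := by
  rw [m.field_eq q hq]
  simp only [m.dv_eq_vderiv hq]

theorem dv_mul (i : Fin n) {a b : M → ℂ} {q : M} (ha : SmoothAt n a q) (hb : SmoothAt n b q) :
    m.dv i (fun r => a r * b r) q = m.dv i a q * b q + a q * m.dv i b q := by
  unfold dv
  rw [Finset.sum_mul, Finset.mul_sum, ← Finset.sum_add_distrib]
  refine Finset.sum_congr rfl fun j _ => ?_
  rw [vderiv_mul _ ha hb]
  ring

theorem dv_congr (i : Fin n) {a b : M → ℂ} {q : M} (h : a =ᶠ[𝓝 q] b) :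
    m.dv i a q = m.dv i b q := by
  unfold dv
  simp only [vderiv_congr _ h]

theorem dv_smoothAt (i : Fin n) {a : M → ℂ} (ha : ∀ p, SmoothAt n a p) (q : M) :
    SmoothAt n (m.dv i a) q :=
  SmoothAt.sum fun j _ => (m.c_smooth i j q).mul (contMDiff_vderiv (G.field_smooth j) ha q)

theorem tsupport_dv_subset (i : Fin n) (a : M → ℂ) : tsupport (m.dv i a) ⊆ tsupport a := by
  refine closure_minimal (fun p hp => ?_) (isClosed_tsupport a)
  by_contra h
  apply hp
  have h0 : a =ᶠ[𝓝 p] fun _ => 0 := notMem_tsupport_iff_eventuallyEq.1 h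
  rw [m.dv_congr i h0]
  simp [dv, vderiv_const]

/-- The coordinate derivative as an operator on test functions. -/
noncomputable def dvOp (i : Fin n) : TestOp n M :=
  ∑ j, mulOp (m.c i j) (fun p _ => m.c_smooth i j p) * fieldOp (G.field j) (G.field_smooth j)

theorem dvOp_apply (i : Fin n) (φ : testSpace n M) (q : M) :
    (m.dvOp i φ).1 q = m.dv i φ.1 q := by
  simp [dvOp, dv, LinearMap.sum_apply, Finset.sum_apply]

/-- A function on the domain of the chart, read in the coordinates and extended by `0`. -/
noncomputable def push (h : M → ℂ) : Euc n → ℂ :=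
  m.Ψ.target.indicator fun w => h (m.Ψ.symm w)

theorem push_of_mem {h : M → ℂ} {w : Euc n} (hw : w ∈ m.Ψ.target) : m.push h w = h (m.Ψ.symm w) :=
  Set.indicator_of_mem hw _

theorem push_of_notMem {h : M → ℂ} {w : Euc n} (hw : w ∉ m.Ψ.target) : m.push h w = 0 :=
  Set.indicator_of_notMem hw _

theorem push_mul (a b : M → ℂ) (w : Euc n) :
    m.push (fun q => a q * b q) w = m.push a w * m.push b w := by
  by_cases hw : w ∈ m.Ψ.target
  · simp only [m.push_of_mem hw]
  · simp only [m.push_of_notMem hw, mul_zero]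

theorem push_add (a b : M → ℂ) (w : Euc n) :
    m.push (fun q => a q + b q) w = m.push a w + m.push b w := by
  by_cases hw : w ∈ m.Ψ.target
  · simp only [m.push_of_mem hw]
  · simp only [m.push_of_notMem hw, add_zero]

section Compact

variable [CompactSpace M]

theorem support_push_subset {h : M → ℂ} : Function.support (m.push h) ⊆
    m.Ψ '' (tsupport h ∩ m.Ψ.source) := by
  intro w hw
  by_cases hwt : w ∈ m.Ψ.target
  · rw [Function.mem_support, m.push_of_mem hwt] at hw
    exact ⟨m.Ψ.symm w, ⟨subset_tsupport _ hw, m.Ψ.map_target hwt⟩, m.Ψ.right_inv hwt⟩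
  · exact absurd (m.push_of_notMem hwt) hw

theorem tsupport_subset_source {h : testSpace n M} (hU : tsupport h.1 ⊆ m.U) :
    tsupport h.1 ⊆ m.Ψ.source := fun q hq => (m.mem_source q).2 ⟨hU hq, h.2.2 hq⟩

theorem isCompact_image_tsupport {h : testSpace n M} (hU : tsupport h.1 ⊆ m.U) :
    IsCompact (m.Ψ '' tsupport h.1) :=
  (isClosed_tsupport h.1).isCompact.image_of_continuousOn
    (m.Ψ.continuousOn.mono (m.tsupport_subset_source hU))

theorem tsupport_push_subset {h : testSpace n M} (hU : tsupport h.1 ⊆ m.U) :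
    tsupport (m.push h.1) ⊆ m.Ψ '' tsupport h.1 :=
  closure_minimal (m.support_push_subset.trans (Set.image_mono Set.inter_subset_left))
    (m.isCompact_image_tsupport hU).isClosed

theorem image_tsupport_subset_target {h : testSpace n M} (hU : tsupport h.1 ⊆ m.U) :
    m.Ψ '' tsupport h.1 ⊆ m.Ψ.target := by
  rintro _ ⟨q, hq, rfl⟩
  exact m.Ψ.map_source (m.tsupport_subset_source hU hq)

theorem hasCompactSupport_push {h : testSpace n M} (hU : tsupport h.1 ⊆ m.U) :
    HasCompactSupport (m.push h.1) :=
  (m.isCompact_image_tsupport hU).of_isClosed_subset (isClosed_tsupport _) (m.tsupport_push_subset hU)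

theorem push_eventuallyEq {h : M → ℂ} {w : Euc n} (hw : w ∈ m.Ψ.target) :
    m.push h =ᶠ[𝓝 w] h ∘ m.Ψ.symm := by
  filter_upwards [m.Ψ.open_target.mem_nhds hw] with z hz
  exact m.push_of_mem hz

theorem contDiff_push {h : testSpace n M} (hU : tsupport h.1 ⊆ m.U) :
    ContDiff ℝ ∞ (m.push h.1) := by
  rw [contDiff_iff_contDiffAt]
  intro w
  by_cases hw : w ∈ tsupport (m.push h.1)
  · have hwt := m.image_tsupport_subset_target hU (m.tsupport_push_subset hU hw)
    exact (contDiffAt_comp_symm m.chart hwt (testSpace_smoothAt h _)).congr_of_eventuallyEq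
      (m.push_eventuallyEq hwt)
  · exact contDiffAt_const.congr_of_eventuallyEq (notMem_tsupport_iff_eventuallyEq.1 hw)

theorem fderiv_push {h : testSpace n M} (hU : tsupport h.1 ⊆ m.U) (i : Fin n) (w : Euc n) :
    fderiv ℝ (m.push h.1) w (stdVec i) = m.push (m.dv i h.1) w := by
  by_cases hwt : w ∈ m.Ψ.target
  · have hq := m.Ψ.map_target hwt
    rw [(m.push_eventuallyEq hwt).fderiv_eq, m.push_of_mem hwt, m.dv_eq_vderiv hq,
      vderiv_eucVec m.chart i hq (testSpace_smoothAt h _), m.Ψ.right_inv hwt]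
  · have hw : w ∉ tsupport (m.push h.1) := fun hw =>
      hwt (m.image_tsupport_subset_target hU (m.tsupport_push_subset hU hw))
    rw [m.push_of_notMem hwt, (notMem_tsupport_iff_eventuallyEq.1 hw).fderiv_eq]
    simp

end Compact

section Measure

theorem continuousOn_density : ContinuousOn (eucDensity g m.Ψ) m.Ψ.source := fun q hq =>
  (m.density_smooth q hq).continuousAt.continuousWithinAt

theorem continuousOn_density_symm :
    ContinuousOn (fun w => eucDensity g m.Ψ (m.Ψ.symm w)) m.Ψ.target :=
  m.continuousOn_density.comp m.Ψ.continuousOn_symm fun _ hw => m.Ψ.map_target hw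

variable [CompactSpace M] [T2Space M] [MeasurableSpace M] [BorelSpace M]

theorem aemeasurable_density : AEMeasurable
    (fun w => ENNReal.ofReal (eucDensity g m.Ψ (m.Ψ.symm w))) (volume.restrict m.Ψ.target) :=
  (m.continuousOn_density_symm.aemeasurable m.Ψ.open_target.measurableSet).ennreal_ofReal

theorem restrict_source : (riemannianMeasure g).restrict m.Ψ.source =
    ((((volume : Measure (Euc n)).restrict m.Ψ.target).withDensity fun w =>
      ENNReal.ofReal (eucDensity g m.Ψ (m.Ψ.symm w))).map m.Ψ.symm) :=
  riemannianMeasure_restrict m.chart m.continuousOn_density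

theorem aemeasurable_symm : AEMeasurable m.Ψ.symm
    (((volume : Measure (Euc n)).restrict m.Ψ.target).withDensity fun w =>
      ENNReal.ofReal (eucDensity g m.Ψ (m.Ψ.symm w))) :=
  (m.Ψ.continuousOn_symm.aemeasurable m.Ψ.open_target.measurableSet).mono_ac
    (withDensity_absolutelyContinuous _ _)

theorem setLIntegral_source {F : M → ℝ≥0∞}
    (hF : AEMeasurable F ((riemannianMeasure g).restrict m.Ψ.source)) :
    ∫⁻ q in m.Ψ.source, F q ∂(riemannianMeasure g) = ∫⁻ w in m.Ψ.target,
      ENNReal.ofReal (eucDensity g m.Ψ (m.Ψ.symm w)) * F (m.Ψ.symm w) := by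
  rw [m.restrict_source] at hF ⊢
  rw [lintegral_map' hF m.aemeasurable_symm]
  exact lintegral_withDensity_eq_lintegral_mul₀' m.aemeasurable_density
    (hF.comp_aemeasurable m.aemeasurable_symm)

theorem aestronglyMeasurable_symm {f : M → ℂ}
    (hf : AEStronglyMeasurable f ((riemannianMeasure g).restrict m.Ψ.source)) :
    AEStronglyMeasurable (fun w => f (m.Ψ.symm w)) (volume.restrict m.Ψ.target) := by
  rw [m.restrict_source] at hf
  refine (hf.comp_aemeasurable m.aemeasurable_symm).mono_ac ?_
  refine withDensity_absolutelyContinuous' m.aemeasurable_density ?_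
  rw [ae_restrict_iff' m.Ψ.open_target.measurableSet]
  refine Eventually.of_forall fun w hw => ?_
  rw [ne_eq, ENNReal.ofReal_eq_zero, not_le]
  exact m.density_pos _ (m.Ψ.map_target hw)

theorem aestronglyMeasurable_push {f : M → ℂ}
    (hf : AEStronglyMeasurable f ((riemannianMeasure g).restrict m.Ψ.source)) :
    AEStronglyMeasurable (m.push f) volume :=
  (aestronglyMeasurable_indicator_iff m.Ψ.open_target.measurableSet).2 (m.aestronglyMeasurable_symm hf)

theorem integral_eq_integral_push {f : M → ℂ} (h0 : ∀ q, q ∉ m.Ψ.source → f q = 0)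
    (hf : AEStronglyMeasurable f ((riemannianMeasure g).restrict m.Ψ.source)) :
    ∫ q, f q ∂(riemannianMeasure g)
      = ∫ w, m.push (fun q => (eucDensity g m.Ψ q : ℂ) * f q) w := by
  rw [← setIntegral_eq_integral_of_forall_compl_eq_zero h0]
  rw [m.restrict_source] at hf ⊢
  rw [integral_map m.aemeasurable_symm hf, integral_withDensity_eq_integral_toReal_smul₀
    m.aemeasurable_density (Eventually.of_forall fun w => ENNReal.ofReal_lt_top)]
  unfold push
  rw [integral_indicator m.Ψ.open_target.measurableSet]
  refine setIntegral_congr_fun m.Ψ.open_target.measurableSet fun w hw => ?_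
  simp only
  rw [ENNReal.toReal_ofReal (m.density_pos _ (m.Ψ.map_target hw)).le, Complex.real_smul]

end Measure

end LocalModel

end LocalCalculus

/-! ### Formal transposes of the generating fields -/

section Transposes

open Filter Topology

variable {n : ℕ} [NeZero n] {M : Type*} [TopologicalSpace M]
  [ChartedSpace (EuclideanHalfSpace n) M] [IsManifold (𝓡∂ n) ∞ M]
  [CompactSpace M] [T2Space M] [MeasurableSpace M] [BorelSpace M]
  {x : M → ℝ} {g : BilinField n M} {G : Generators x g}

/-- The measure is locally finite, since its density in a local model is continuous. -/
theorem LocalModel.exists_nhds_measure_lt_top (m : LocalModel G) {p : M} (hp : p ∈ m.Ψ.source) :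
    ∃ V ∈ 𝓝 p, riemannianMeasure g V < ⊤ := by
  have := (𝓡∂ n).locallyCompactSpace
  have := ChartedSpace.locallyCompactSpace (EuclideanHalfSpace n) M
  obtain ⟨K, hK, hpK, hKs⟩ := exists_compact_subset m.Ψ.open_source hp
  refine ⟨K, mem_interior_iff_mem_nhds.1 hpK, ?_⟩
  rw [riemannianMeasure_apply m.chart m.continuousOn_density hK.measurableSet hKs]
  obtain ⟨C, hC⟩ := hK.exists_bound_of_continuousOn (m.continuousOn_density.mono hKs)
  have hsub : m.Ψ.target ∩ m.Ψ.symm ⁻¹' K ⊆ m.Ψ '' K := by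
    rintro w ⟨h1, h2⟩
    exact ⟨m.Ψ.symm w, h2, m.Ψ.right_inv h1⟩
  have hm : MeasurableSet (m.Ψ.target ∩ m.Ψ.symm ⁻¹' K) :=
    measurableSet_inter_preimage m.Ψ.continuousOn_symm m.Ψ.open_target.measurableSet hK.measurableSet
  calc ∫⁻ w in m.Ψ.target ∩ m.Ψ.symm ⁻¹' K, ENNReal.ofReal (eucDensity g m.Ψ (m.Ψ.symm w))
      ≤ ∫⁻ _ in m.Ψ.target ∩ m.Ψ.symm ⁻¹' K, ENNReal.ofReal C :=
        setLIntegral_mono' hm fun w hw =>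
          ENNReal.ofReal_le_ofReal ((le_abs_self _).trans (hC _ hw.2))
    _ = ENNReal.ofReal C * volume (m.Ψ.target ∩ m.Ψ.symm ⁻¹' K) := by
        rw [lintegral_const, Measure.restrict_apply MeasurableSet.univ, Set.univ_inter]
    _ < ⊤ := ENNReal.mul_lt_top ENNReal.ofReal_lt_top ((measure_mono hsub).trans_lt
        (hK.image_of_continuousOn (m.Ψ.continuousOn.mono hKs)).measure_lt_top)

theorem finiteInside_riemannianMeasure (hg : IsAsymptoticallyConic x g) (G : Generators x g) :
    FiniteInside n (riemannianMeasure g) := by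
  intro K hK hKi
  refine hK.measure_lt_top_of_nhdsWithin fun p hp => ?_
  obtain ⟨m, hm⟩ := exists_localModel hg G p
  obtain ⟨V, hV, hV'⟩ := m.exists_nhds_measure_lt_top ((m.mem_source p).2 ⟨hm, hKi hp⟩)
  exact ⟨V, mem_nhdsWithin_of_mem_nhds hV, hV'⟩

theorem aestronglyMeasurable_test (φ : testSpace n M) {μ : Measure M} :
    AEStronglyMeasurable φ.1 μ := by
  have := (𝓡∂ n).secondCountableTopology
  have := ChartedSpace.secondCountable_of_sigmaCompact (EuclideanHalfSpace n) M
  exact (continuous_test φ).aestronglyMeasurable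

namespace LocalModel

variable (m : LocalModel G)

theorem integral_fderiv_push {h : testSpace n M} (hU : tsupport h.1 ⊆ m.U) (i : Fin n) :
    ∫ w, fderiv ℝ (m.push h.1) w (stdVec i) = 0 := by
  have hc := m.hasCompactSupport_push hU
  have hs := m.contDiff_push hU
  have hi : Integrable (fun w => fderiv ℝ (m.push h.1) w (stdVec i)) volume := by
    refine (continuous_fderiv_apply' hs _).integrable_of_hasCompactSupport ?_
    exact (hc.fderiv (𝕜 := ℝ)).comp_left (g := fun L : Euc n →L[ℝ] ℂ => L (stdVec i)) rfl
  have h1 := integral_mul_fderiv_eq_neg_fderiv_mul_of_integrable (μ := volume) (v := stdVec i)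
    (f := fun _ : Euc n => (1 : ℂ)) (g := m.push h.1) (by simp) (by simpa using hi)
    (by simpa using hs.continuous.integrable_of_hasCompactSupport hc)
    (fun _ _ => differentiableAt_const _) (fun w _ => hs.differentiable (by simp) w)
  simpa using h1

/-- The density as a complex function. -/
noncomputable def dens (q : M) : ℂ := (eucDensity g m.Ψ q : ℂ)

theorem dens_smoothAt {q : M} (hq : q ∈ m.Ψ.source) : SmoothAt n m.dens q :=
  SmoothAt.ofReal (m.density_smooth q hq)

theorem dens_ne_zero {q : M} (hq : q ∈ m.Ψ.source) : m.dens q ≠ 0 := by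
  exact Complex.ofReal_ne_zero.2 (m.density_pos q hq).ne'

/-- The divergence theorem for the coordinate derivatives. -/
theorem integral_dv_div {h : testSpace n M} (hU : tsupport h.1 ⊆ m.U) (i : Fin n) :
    ∫ q, (m.dens q)⁻¹ * m.dv i h.1 q ∂(riemannianMeasure g) = 0 := by
  have hs := m.tsupport_subset_source hU
  have h0 : ∀ q, q ∉ m.Ψ.source → m.dv i h.1 q = 0 := fun q hq =>
    image_eq_zero_of_notMem_tsupport fun h' => hq (hs (m.tsupport_dv_subset i _ h'))
  have htest : IsTest (n := n) fun q => (m.dens q)⁻¹ * m.dv i h.1 q := by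
    refine isTest_mul_of_tsupport ?_ fun q hq => ?_
    · have := (m.dvOp i h).2
      have h1 : (m.dvOp i h).1 = m.dv i h.1 := funext (m.dvOp_apply i h)
      rwa [h1] at this
    · have := hs (m.tsupport_dv_subset i _ hq)
      exact (m.dens_smoothAt this).inv (m.dens_ne_zero this)
  rw [m.integral_eq_integral_push (f := fun q => (m.dens q)⁻¹ * m.dv i h.1 q)
    (fun q hq => by rw [h0 q hq, mul_zero])
    (aestronglyMeasurable_test (⟨_, htest⟩ : testSpace n M))]
  rw [← m.integral_fderiv_push hU i]
  refine integral_congr_ae (Eventually.of_forall fun w => ?_)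
  simp only
  rw [m.fderiv_push hU]
  by_cases hw : w ∈ m.Ψ.target
  · rw [m.push_of_mem hw, m.push_of_mem hw]
    have := m.dens_ne_zero (m.Ψ.map_target hw)
    change m.dens _ * _ = _
    field_simp
  · rw [m.push_of_notMem hw, m.push_of_notMem hw]

/-- The product of a test function supported in the model with the density. -/
noncomputable def densMul {φ : testSpace n M} (hU : tsupport φ.1 ⊆ m.U) : testSpace n M :=
  ⟨fun q => m.dens q * φ.1 q, isTest_mul_of_tsupport φ.2 fun _ hq =>
    m.dens_smoothAt (m.tsupport_subset_source hU hq)⟩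

theorem tsupport_densMul {φ : testSpace n M} (hU : tsupport φ.1 ⊆ m.U) :
    tsupport (m.densMul hU).1 ⊆ tsupport φ.1 := tsupport_mul_subset_right

/-- The formal transpose of a coordinate derivative, on test functions supported in the model. -/
theorem exists_adjoint (hμ : FiniteInside n (riemannianMeasure g)) {φ : testSpace n M} (hU : tsupport φ.1 ⊆ m.U) (i : Fin n) :
    ∃ η : testSpace n M, tsupport η.1 ⊆ tsupport φ.1 ∧
      (∀ q, η.1 q = - ((m.dens q)⁻¹ * m.dv i (m.densMul hU).1 q)) ∧
      ∀ ψ : testSpace n M, ∫ q, φ.1 q * m.dv i ψ.1 q ∂(riemannianMeasure g)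
        = ∫ q, η.1 q * ψ.1 q ∂(riemannianMeasure g) := by
  have hs := m.tsupport_subset_source hU
  have hts : tsupport (m.dv i (m.densMul hU).1) ⊆ tsupport φ.1 :=
    (m.tsupport_dv_subset i _).trans (m.tsupport_densMul hU)
  have htest : IsTest (n := n) fun q => (m.dens q)⁻¹ * m.dv i (m.densMul hU).1 q := by
    refine isTest_mul_of_tsupport ?_ fun q hq => ?_
    · have := (m.dvOp i (m.densMul hU)).2
      have h1 : (m.dvOp i (m.densMul hU)).1 = m.dv i (m.densMul hU).1 := funext (m.dvOp_apply i _)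
      rwa [h1] at this
    · have := hs (hts hq)
      exact (m.dens_smoothAt this).inv (m.dens_ne_zero this)
  refine ⟨- ⟨_, htest⟩, ?_, fun q => rfl, fun ψ => ?_⟩
  · have : (- (⟨_, htest⟩ : testSpace n M)).1
        = - fun q => (m.dens q)⁻¹ * m.dv i (m.densMul hU).1 q := rfl
    rw [this, tsupport, Function.support_neg]
    exact (closure_mono (Function.support_mul_subset_right _ _)).trans hts
  · let h : testSpace n M := ⟨fun q => (m.densMul hU).1 q * ψ.1 q,
      isTest_mul (fun p _ => testSpace_smoothAt _ p) ψ.2⟩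
    have hhs : tsupport h.1 ⊆ tsupport φ.1 := tsupport_mul_subset_left.trans (m.tsupport_densMul hU)
    have h1 := m.integral_dv_div (h := h) (hhs.trans hU) i
    have h2 : ∀ q, (m.dens q)⁻¹ * m.dv i h.1 q
        = φ.1 q * m.dv i ψ.1 q - (- (⟨_, htest⟩ : testSpace n M)).1 q * ψ.1 q := by
      intro q
      change (m.dens q)⁻¹ * m.dv i (fun q => (m.densMul hU).1 q * ψ.1 q) q
        = φ.1 q * m.dv i ψ.1 q - -((m.dens q)⁻¹ * m.dv i (m.densMul hU).1 q) * ψ.1 q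
      rw [m.dv_mul i (testSpace_smoothAt _ q) (testSpace_smoothAt _ q)]
      change (m.dens q)⁻¹ * (_ + m.dens q * φ.1 q * _) = _
      by_cases hq : q ∈ m.Ψ.source
      · have := m.dens_ne_zero hq
        field_simp
        ring
      · have : φ.1 q = 0 := image_eq_zero_of_notMem_tsupport fun h' => hq (hs h')
        rw [this]
        ring
    simp only [h2] at h1
    rw [integral_sub ?_ (integrable_test_mul_test hμ _ _), sub_eq_zero] at h1
    · exact h1
    · have := integrable_test_mul_test hμ φ (m.dvOp i ψ)
      simpa only [m.dvOp_apply] using this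

end LocalModel

/-- A finite cover of `M` by local models, with a partition of unity. -/
structure ModelCover (G : Generators x g) where
  /-- number of models -/
  N : ℕ
  /-- the models -/
  model : Fin N → LocalModel G
  /-- the partition of unity -/
  χ : Fin N → M → ℝ
  χ_smooth : ∀ k, ContMDiff (𝓡∂ n) 𝓘(ℝ, ℝ) ∞ (χ k)
  χ_supp : ∀ k, tsupport (χ k) ⊆ (model k).U
  χ_sum : ∀ p, ∑ k, χ k p = 1

theorem exists_modelCover (hg : IsAsymptoticallyConic x g) (G : Generators x g) :
    Nonempty (ModelCover G) := by
  choose m hm using exists_localModel hg G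
  obtain ⟨t, ht⟩ := isCompact_univ.elim_finite_subcover (fun p => (m p).U) (fun p => (m p).isOpen_U)
    fun p _ => Set.mem_iUnion.2 ⟨p, hm p⟩
  let e : Fin t.card ≃ t := t.equivFin.symm
  have hcov : (Set.univ : Set M) ⊆ ⋃ k : Fin t.card, (m (e k)).U := by
    intro p hp
    obtain ⟨q, hq, hpq⟩ := Set.mem_iUnion₂.1 (ht hp)
    exact Set.mem_iUnion.2 ⟨e.symm ⟨q, hq⟩, by simpa using hpq⟩
  obtain ⟨f, hf⟩ := SmoothPartitionOfUnity.exists_isSubordinate (𝓡∂ n) isClosed_univ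
    (fun k : Fin t.card => (m (e k)).U) (fun k => (m (e k)).isOpen_U) hcov
  refine ⟨⟨t.card, fun k => m (e k), fun k => f k, fun k => (f k).contMDiff,
    fun k => hf k, fun p => ?_⟩⟩
  rw [← finsum_eq_sum_of_fintype]
  exact f.sum_eq_one (Set.mem_univ p)

namespace ModelCover

variable (𝒞 : ModelCover G)

/-- The functions of the partition of unity, as complex functions. -/
noncomputable def part (k : Fin 𝒞.N) (p : M) : ℂ := (𝒞.χ k p : ℂ)

theorem part_smoothAt (k : Fin 𝒞.N) (p : M) : SmoothAt n (𝒞.part k) p :=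
  SmoothAt.ofReal (𝒞.χ_smooth k p)

theorem part_sum (p : M) : ∑ k, 𝒞.part k p = 1 := by
  have := congrArg (fun t : ℝ => (t : ℂ)) (𝒞.χ_sum p)
  simpa [part] using this

theorem tsupport_part (k : Fin 𝒞.N) : tsupport (𝒞.part k) ⊆ (𝒞.model k).U := by
  refine (closure_mono fun p hp => ?_).trans (𝒞.χ_supp k)
  rw [Function.mem_support] at hp ⊢
  intro h
  exact hp (by simp [part, h])

/-- The part of a test function in one of the models. -/
noncomputable def cut (k : Fin 𝒞.N) (φ : testSpace n M) : testSpace n M :=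
  mulOp (𝒞.part k) (fun p _ => 𝒞.part_smoothAt k p) φ

theorem tsupport_cut (k : Fin 𝒞.N) (φ : testSpace n M) :
    tsupport (𝒞.cut k φ).1 ⊆ (𝒞.model k).U :=
  (tsupport_mul_subset_left (f := 𝒞.part k) (g := φ.1)).trans (𝒞.tsupport_part k)

theorem sum_cut (φ : testSpace n M) (p : M) : ∑ k, (𝒞.cut k φ).1 p = φ.1 p := by
  change ∑ k, 𝒞.part k p * φ.1 p = φ.1 p
  rw [← Finset.sum_mul, 𝒞.part_sum, one_mul]

end ModelCover

/-- The transpose of a generating field on test functions supported in one model, by integration by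
parts along the coordinate fields. -/
theorem LocalModel.hasTranspose_cutField (m : LocalModel G)
    (hμ : FiniteInside n (riemannianMeasure g)) (j : G.MIdx) {φ : testSpace n M}
    (hU : tsupport φ.1 ⊆ m.U) : ∃ η : testSpace n M, ∀ ψ : testSpace n M,
      ∫ q, φ.1 q * vderiv (G.field j) ψ.1 q ∂(riemannianMeasure g)
        = ∫ q, η.1 q * ψ.1 q ∂(riemannianMeasure g) := by
  let φ' : Fin n → testSpace n M := fun i => mulOp (m.v j i) (fun p _ => m.v_smooth j i p) φ
  have hφ' : ∀ i, tsupport (φ' i).1 ⊆ m.U := fun i =>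
    (tsupport_mul_subset_right (f := m.v j i) (g := φ.1)).trans hU
  choose η _ _ hη using fun i => m.exists_adjoint hμ (hφ' i) i
  refine ⟨∑ i, η i, fun ψ => ?_⟩
  have h1 : ∀ q, φ.1 q * vderiv (G.field j) ψ.1 q = ∑ i, (φ' i).1 q * m.dv i ψ.1 q := by
    intro q
    by_cases hq : q ∈ m.Ψ.source
    · rw [m.vderiv_eq_dv hq, Finset.mul_sum]
      refine Finset.sum_congr rfl fun i _ => ?_
      simp only [φ', mulOp_apply]
      ring
    · have h0 : φ.1 q = 0 := image_eq_zero_of_notMem_tsupport fun h' =>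
        hq (m.tsupport_subset_source hU h')
      simp [φ', h0]
  have h2 : ∀ q, (∑ i, η i : testSpace n M).1 q * ψ.1 q = ∑ i, (η i).1 q * ψ.1 q := by
    intro q
    rw [← Finset.sum_mul]
    congr 1
    simp
  simp only [h1, h2]
  rw [integral_finsetSum, integral_finsetSum]
  · exact Finset.sum_congr rfl fun i _ => hη i ψ
  · exact fun i _ => integrable_test_mul_test hμ _ _
  · intro i _
    have := integrable_test_mul_test hμ (φ' i) (m.dvOp i ψ)
    simpa only [m.dvOp_apply] using this

/-- The generating fields have formal transposes. -/
theorem hasTranspose_field (𝒞 : ModelCover G) (hμ : FiniteInside n (riemannianMeasure g))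
    (j : G.MIdx) :
    HasTranspose (riemannianMeasure g) (fieldOp (G.field j) (G.field_smooth j)) := by
  intro φ
  choose η hη using fun k => (𝒞.model k).hasTranspose_cutField hμ j (𝒞.tsupport_cut k φ)
  refine ⟨∑ k, η k, fun ψ => ?_⟩
  have h1 : ∀ q, φ.1 q * (fieldOp (G.field j) (G.field_smooth j) ψ).1 q
      = ∑ k, (𝒞.cut k φ).1 q * vderiv (G.field j) ψ.1 q := by
    intro q
    rw [← Finset.sum_mul, 𝒞.sum_cut]
    rfl
  have h2 : ∀ q, (∑ k, η k : testSpace n M).1 q * ψ.1 q = ∑ k, (η k).1 q * ψ.1 q := by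
    intro q
    rw [← Finset.sum_mul]
    congr 1
    simp
  simp only [h1, h2]
  rw [integral_finsetSum, integral_finsetSum]
  · exact Finset.sum_congr rfl fun k _ => hη k ψ
  · exact fun i _ => integrable_test_mul_test hμ _ _
  · exact fun k _ => integrable_test_mul_test hμ (𝒞.cut k φ) (fieldOp (G.field j) (G.field_smooth j) ψ)

end Transposes

/-! ### Commutators of the generators -/

section Commutators

open Filter Topology

variable {n : ℕ} [NeZero n] {M : Type*} [TopologicalSpace M]
  [ChartedSpace (EuclideanHalfSpace n) M] [IsManifold (𝓡∂ n) ∞ M]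
  [CompactSpace M] [T2Space M] [MeasurableSpace M] [BorelSpace M]
  {x : M → ℝ} {g : BilinField n M} {G : Generators x g}

namespace LocalModel

variable (m : LocalModel G)

theorem dv_comm {ψ : M → ℂ} (hψ : ∀ p, SmoothAt n ψ p) {q : M} (hq : q ∈ m.Ψ.source)
    (i l : Fin n) : m.dv i (m.dv l ψ) q = m.dv l (m.dv i ψ) q := by
  set F : Euc n → ℂ := ψ ∘ m.Ψ.symm with hF
  have hw := m.Ψ.map_source hq
  have hsm : ContDiffAt ℝ ∞ F (m.Ψ q) := contDiffAt_comp_symm m.chart hw (hψ _)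
  have hsnd : ∀ i l, m.dv i (m.dv l ψ) q
      = fderiv ℝ (fun w => fderiv ℝ F w) (m.Ψ q) (stdVec i) (stdVec l) := by
    intro i l
    rw [m.dv_eq_vderiv hq, vderiv_eucVec m.chart i hq (m.dv_smoothAt l hψ q)]
    have h1 : (m.dv l ψ ∘ m.Ψ.symm) =ᶠ[𝓝 (m.Ψ q)] fun w => fderiv ℝ F w (stdVec l) := by
      filter_upwards [m.Ψ.open_target.mem_nhds hw] with w hw'
      have hs := m.Ψ.map_target hw'
      simp only [Function.comp_apply]
      rw [m.dv_eq_vderiv hs, vderiv_eucVec m.chart l hs (hψ _), m.Ψ.right_inv hw']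
    rw [h1.fderiv_eq]
    have h2 : DifferentiableAt ℝ (fderiv ℝ F) (m.Ψ q) :=
      (hsm.fderiv_right (m := 1) (by norm_cast)).differentiableAt (by simp)
    rw [fderiv_clm_apply h2 (differentiableAt_const _)]
    simp
  rw [hsnd, hsnd]
  exact (hsm.isSymmSndFDerivAt (by simpa using WithTop.coe_le_coe.2 (le_top : (2 : ℕ∞) ≤ ⊤))) _ _

/-- The second derivatives cancel, and the commutator is the field with components
`V_j (v_k) - V_k (v_j)`. -/
theorem commutator_apply {ψ : M → ℂ} (hψ : ∀ p, SmoothAt n ψ p) {q : M} (hq : q ∈ m.Ψ.source)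
    (j k : G.MIdx) : vderiv (G.field j) (vderiv (G.field k) ψ) q
      - vderiv (G.field k) (vderiv (G.field j) ψ) q
      = ∑ l, (vderiv (G.field j) (m.v k l) q - vderiv (G.field k) (m.v j l) q) * m.dv l ψ q := by
  have h1 : ∀ j k : G.MIdx, vderiv (G.field j) (vderiv (G.field k) ψ) q
      = ∑ l, vderiv (G.field j) (m.v k l) q * m.dv l ψ q
        + ∑ l, ∑ i, m.v k l q * m.v j i q * m.dv i (m.dv l ψ) q := by
    intro j k
    have h2 : vderiv (G.field k) ψ =ᶠ[𝓝 q] fun r => ∑ l, m.v k l r * m.dv l ψ r := by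
      filter_upwards [m.Ψ.open_source.mem_nhds hq] with r hr
      exact m.vderiv_eq_dv hr k ψ
    rw [vderiv_congr _ h2, vderiv_sum _ fun l _ => (m.v_smooth k l q).mul (m.dv_smoothAt l hψ q),
      ← Finset.sum_add_distrib]
    refine Finset.sum_congr rfl fun l _ => ?_
    rw [vderiv_mul _ (m.v_smooth k l q) (m.dv_smoothAt l hψ q), m.vderiv_eq_dv hq j (m.dv l ψ),
      Finset.mul_sum]
    simp only [mul_assoc]
  have h3 : ∑ l, ∑ i, m.v k l q * m.v j i q * m.dv i (m.dv l ψ) q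
      = ∑ i, ∑ l, m.v j i q * m.v k l q * m.dv l (m.dv i ψ) q := by
    rw [Finset.sum_comm]
    refine Finset.sum_congr rfl fun i _ => Finset.sum_congr rfl fun l _ => ?_
    rw [m.dv_comm hψ hq i l, mul_comm (m.v k l q)]
  rw [h1 j k, h1 k j, h3]
  simp only [sub_mul, Finset.sum_sub_distrib]
  ring

/-- Near the boundary the components along `- log x` are constant, so that commutators do not have
that component. -/
theorem vderiv_v_zero (hx : IsBoundaryDefining n x) {q : M} (hq : q ∈ m.U) (hc : x q < G.c)
    (j k : G.MIdx) : vderiv (G.field j) (m.v k 0) q = 0 := by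
  have : m.v k 0 =ᶠ[𝓝 q] fun _ => - (if k = none then 1 else 0) := by
    filter_upwards [m.isOpen_U.mem_nhds hq,
      (isOpen_lt hx.smooth.continuous continuous_const).mem_nhds hc] with r hr hrc
    have hrc' : x r < G.c := hrc
    rw [m.v_zero r hr hrc']
    rcases k with _ | k
    · rw [G.logDeriv_none hrc']; simp
    · rw [G.logDeriv_some hrc']; simp
  rw [vderiv_congr _ this, vderiv_const]

end LocalModel

/-- The generating fields are closed under commutators, with coefficients smooth up to the
boundary; the radial field does not occur near the boundary. -/
theorem exists_commutator (𝒞 : ModelCover G) (hx : IsBoundaryDefining n x) (j k : G.MIdx) :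
    ∃ a : G.MIdx → M → ℂ, (∀ l p, SmoothAt n (a l) p) ∧ (∀ p, x p < G.c → a none p = 0) ∧
      ∀ (ψ : testSpace n M), ∀ q ∈ (𝓡∂ n).interior M,
        vderiv (G.field j) (vderiv (G.field k) ψ.1) q - vderiv (G.field k) (vderiv (G.field j) ψ.1) q
          = ∑ l, a l q * vderiv (G.field l) ψ.1 q := by
  refine ⟨fun l q => ∑ t, 𝒞.part t q * ∑ i, (vderiv (G.field j) ((𝒞.model t).v k i) q
      - vderiv (G.field k) ((𝒞.model t).v j i) q) * (𝒞.model t).c i l q, fun l p => ?_,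
    fun p hp => ?_, fun ψ q hq => ?_⟩
  · refine SmoothAt.sum fun t _ => (𝒞.part_smoothAt t p).mul (SmoothAt.sum fun i _ => ?_)
    exact ((contMDiff_vderiv (G.field_smooth j) ((𝒞.model t).v_smooth k i) p).sub
      (contMDiff_vderiv (G.field_smooth k) ((𝒞.model t).v_smooth j i) p)).mul
      ((𝒞.model t).c_smooth i l p)
  · refine Finset.sum_eq_zero fun t _ => ?_
    by_cases hU : p ∈ (𝒞.model t).U
    · rw [Finset.sum_eq_zero, mul_zero]
      intro i _
      by_cases hi : i = 0
      · rw [hi, (𝒞.model t).vderiv_v_zero hx hU hp, (𝒞.model t).vderiv_v_zero hx hU hp, sub_zero,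
          zero_mul]
      · rw [(𝒞.model t).c_none i hi, mul_zero]
    · rw [image_eq_zero_of_notMem_tsupport fun h => hU (𝒞.tsupport_part t h), zero_mul]
  · have h1 : ∀ t, 𝒞.part t q * (vderiv (G.field j) (vderiv (G.field k) ψ.1) q
        - vderiv (G.field k) (vderiv (G.field j) ψ.1) q)
        = ∑ l, (𝒞.part t q * ∑ i, (vderiv (G.field j) ((𝒞.model t).v k i) q
          - vderiv (G.field k) ((𝒞.model t).v j i) q) * (𝒞.model t).c i l q)
          * vderiv (G.field l) ψ.1 q := by
      intro t
      by_cases hU : q ∈ (𝒞.model t).U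
      · rw [(𝒞.model t).commutator_apply (testSpace_smoothAt ψ)
          (((𝒞.model t).mem_source q).2 ⟨hU, hq⟩)]
        simp only [mul_assoc]
        rw [← Finset.mul_sum]
        congr 1
        simp only [Finset.sum_mul, LocalModel.dv, Finset.mul_sum]
        rw [Finset.sum_comm]
        simp only [mul_assoc]
      · have : 𝒞.part t q = 0 := image_eq_zero_of_notMem_tsupport fun h => hU (𝒞.tsupport_part t h)
        simp [this]
    calc _ = (∑ t, 𝒞.part t q) * (vderiv (G.field j) (vderiv (G.field k) ψ.1) q
        - vderiv (G.field k) (vderiv (G.field j) ψ.1) q) := by rw [𝒞.part_sum, one_mul]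
      _ = _ := by
        rw [Finset.sum_mul, Finset.sum_congr rfl fun t _ => h1 t, Finset.sum_comm]
        simp only [Finset.sum_mul]

theorem mem_linSpan_of_apply {ι : Type*} [Fintype ι] {P : ι → TestOp n M} {Q : TestOp n M}
    {a : ι → M → ℂ} (ha : ∀ i p, SmoothAt n (a i) p) {b : M → ℂ} (hb : ∀ p, SmoothAt n b p)
    (h : ∀ ψ : testSpace n M, ∀ q ∈ (𝓡∂ n).interior M,
      (Q ψ).1 q = ∑ i, a i q * (P i ψ).1 q + b q * ψ.1 q) : Q ∈ linSpan (coeffRing n M) P := by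
  have h1 : Q = ∑ i, mulOp (a i) (fun p _ => ha i p) * P i + mulOp b (fun p _ => hb p) := by
    refine testOp_ext fun ψ q hq => ?_
    rw [h ψ q hq]
    simp [LinearMap.sum_apply, Finset.sum_apply]
  rw [h1]
  refine add_mem (sum_mem fun i _ => ?_) ?_
  · exact AddSubgroup.subset_closure (Or.inr ⟨_, mulOp_mem_coeffRing (ha i), i, rfl⟩)
  · exact AddSubgroup.subset_closure (Or.inl (mulOp_mem_coeffRing hb))

theorem IsBoundaryDefining.ne_zero (hx : IsBoundaryDefining n x) {q : M}
    (hq : q ∈ (𝓡∂ n).interior M) : (x q : ℂ) ≠ 0 :=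
  Complex.ofReal_ne_zero.2 (hx.pos q hq).ne'

theorem IsBoundaryDefining.intSmooth_div (hx : IsBoundaryDefining n x) (c : ℝ) :
    IntSmooth n fun q : M => ((c / x q : ℝ) : ℂ) := fun q hq => by
  have := (SmoothAt.const (c : ℂ) q).mul ((hx.smoothAt q).inv (hx.ne_zero hq))
  refine this.congr (Eventually.of_forall fun r => ?_)
  push_cast
  rw [div_eq_mul_inv]

theorem IsBoundaryDefining.smoothAt_div (hx : IsBoundaryDefining n x) (c : ℝ) {q : M}
    (hq : q ∈ (𝓡∂ n).interior M) : SmoothAt n (fun r => (c : ℂ) / x r) q := by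
  simpa using hx.intSmooth_div c q hq

namespace Generators

variable (G)

/-- The generators of `ℳ_γ` as operators on test functions. -/
noncomputable def lOp (hx : IsBoundaryDefining n x) (γ : ℝ) : G.MIdx → TestOp n M
  | none => Complex.I • fieldOp G.radial G.radial_smooth
      - mulOp (fun q => ((γ / x q : ℝ) : ℂ)) (hx.intSmooth_div γ)
  | some i => fieldOp (G.field (some i)) (G.field_smooth _)

/-- The generators of the scattering fields as operators on test functions. -/
noncomputable def sOp (hx : IsBoundaryDefining n x) (j : G.MIdx) : TestOp n M :=
  mulOp (fun q => (x q : ℂ)) (fun p _ => hx.smoothAt p) * fieldOp (G.field j) (G.field_smooth j)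

variable (hx : IsBoundaryDefining n x) (γ : ℝ)

theorem lOp_none_apply (ψ : testSpace n M) (q : M) : (G.lOp hx γ none ψ).1 q
    = Complex.I * vderiv (G.field none) ψ.1 q - (γ : ℂ) / x q * ψ.1 q := by
  change Complex.I * vderiv G.radial ψ.1 q - ((γ / x q : ℝ) : ℂ) * ψ.1 q = _
  push_cast
  rfl

theorem lOp_some_apply (i : G.NIdx) (ψ : testSpace n M) (q : M) :
    (G.lOp hx γ (some i) ψ).1 q = vderiv (G.field (some i)) ψ.1 q := rfl

theorem sOp_apply (j : G.MIdx) (ψ : testSpace n M) (q : M) :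
    (G.sOp hx j ψ).1 q = x q * vderiv (G.field j) ψ.1 q := rfl

include hx in
/-- The coefficient `ε / x` is smooth for the fields that are tangent to the level sets of `x` near
the boundary. -/
theorem logDeriv_div_smoothAt (k : G.NIdx) (p : M) :
    SmoothAt n (fun q => (G.logDeriv (some k) q : ℂ) / x q) p :=
  G.smoothAt_div hx (G.logDeriv_smoothAt hx (some k))
    (fun q hq => by rw [G.logDeriv_some hq, Complex.ofReal_zero]) p

include hx in
theorem vderiv_div_x (j : G.MIdx) {q : M} (hq : q ∈ (𝓡∂ n).interior M) :
    vderiv (G.field j) (fun r => (γ : ℂ) / x r) q = - (γ * (G.logDeriv j q : ℂ) / x q) := by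
  have h0 := hx.ne_zero hq
  have h1 : (fun r => (γ : ℂ) / x r) = fun r => (γ : ℂ) * (x r : ℂ)⁻¹ :=
    funext fun r => div_eq_mul_inv _ _
  rw [h1, vderiv_const_mul _ _ ((hx.smoothAt q).inv h0), vderiv_inv _ (hx.smoothAt q) h0,
    G.vderiv_x hx]
  field_simp

theorem vderiv_lOp_none (k : G.MIdx) (ψ : testSpace n M) {q : M} (hq : q ∈ (𝓡∂ n).interior M) :
    vderiv (G.field k) (G.lOp hx γ none ψ).1 q
      = Complex.I * vderiv (G.field k) (vderiv (G.field none) ψ.1) q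
        + γ * (G.logDeriv k q : ℂ) / x q * ψ.1 q - γ / x q * vderiv (G.field k) ψ.1 q := by
  have hs := contMDiff_vderiv (G.field_smooth none) (testSpace_smoothAt ψ) q
  have h1 : (G.lOp hx γ none ψ).1 = fun r => Complex.I * vderiv (G.field none) ψ.1 r
      + (-1) * ((γ : ℂ) / x r * ψ.1 r) := by
    funext r; rw [G.lOp_none_apply]; ring
  rw [h1, vderiv_add _ ((SmoothAt.const _ q).mul hs)
    ((SmoothAt.const _ q).mul ((hx.smoothAt_div γ hq).mul (testSpace_smoothAt ψ q))),
    vderiv_const_mul _ _ hs, vderiv_const_mul _ _ ((hx.smoothAt_div γ hq).mul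
      (testSpace_smoothAt ψ q)), vderiv_mul _ (hx.smoothAt_div γ hq) (testSpace_smoothAt ψ q),
    G.vderiv_div_x hx γ k hq]
  ring

theorem vderiv_sOp (j k : G.MIdx) (ψ : testSpace n M) (q : M) :
    vderiv (G.field j) (G.sOp hx k ψ).1 q = x q * G.logDeriv j q * vderiv (G.field k) ψ.1 q
      + x q * vderiv (G.field j) (vderiv (G.field k) ψ.1) q := by
  have h1 : (G.sOp hx k ψ).1 = fun r => x r * vderiv (G.field k) ψ.1 r := rfl
  rw [h1, vderiv_mul _ (hx.smoothAt q)
    (contMDiff_vderiv (G.field_smooth k) (testSpace_smoothAt ψ) q), G.vderiv_x hx]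

theorem lOp_coeff (i : G.MIdx) (Q : TestOp n M) (hQ : Q ∈ coeffRing n M) :
    G.lOp hx γ i * Q - Q * G.lOp hx γ i ∈ coeffRing n M := by
  obtain ⟨a, ha, rfl⟩ := hQ
  have h := contMDiff_vderiv (G.field_smooth i) ha
  rcases i with _ | i
  · refine mem_coeffRing_of_apply (fun p => (SmoothAt.const Complex.I p).mul (h p)) fun ψ q _ => ?_
    change (G.lOp hx γ none (mulOp a _ ψ)).1 q - a q * (G.lOp hx γ none ψ).1 q = _
    rw [G.lOp_none_apply, G.lOp_none_apply]
    change Complex.I * vderiv _ (fun r => a r * ψ.1 r) q - _ * (a q * ψ.1 q) - _ = _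
    rw [vderiv_mul _ (ha q) (testSpace_smoothAt ψ q)]
    ring
  · refine mem_coeffRing_of_apply h fun ψ q _ => ?_
    change vderiv _ (fun r => a r * ψ.1 r) q - a q * vderiv _ ψ.1 q = _
    rw [vderiv_mul _ (ha q) (testSpace_smoothAt ψ q)]
    ring

theorem sOp_coeff (i : G.MIdx) (Q : TestOp n M) (hQ : Q ∈ coeffRing n M) :
    G.sOp hx i * Q - Q * G.sOp hx i ∈ coeffRing n M := by
  obtain ⟨a, ha, rfl⟩ := hQ
  have h := contMDiff_vderiv (G.field_smooth i) ha
  refine mem_coeffRing_of_apply (fun p => (hx.smoothAt p).mul (h p)) fun ψ q _ => ?_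
  change x q * vderiv _ (fun r => a r * ψ.1 r) q - a q * (x q * vderiv _ ψ.1 q) = _
  rw [vderiv_mul _ (ha q) (testSpace_smoothAt ψ q)]
  ring

theorem sum_mul_field_eq_sum_lOp {a : G.MIdx → M → ℂ} {ψ : testSpace n M} {q : M}
    (hq : q ∈ (𝓡∂ n).interior M) : ∑ l, a l q * vderiv (G.field l) ψ.1 q
      = ∑ l, (if l = none then - Complex.I * a none q else a l q) * (G.lOp hx γ l ψ).1 q
        + - Complex.I * γ * (a none q / x q) * ψ.1 q := by
  rw [Fintype.sum_option, Fintype.sum_option, G.lOp_none_apply]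
  simp only [if_true, reduceCtorEq, if_false, G.lOp_some_apply]
  have h0 := hx.ne_zero hq
  field_simp
  linear_combination ((x q : ℂ) * a none q * vderiv (G.field none) ψ.1 q) * Complex.I_sq

/-- The commutators of the generators of `ℳ_γ` are combinations of the generators. The term `γ / x` is
harmless: the radial generator does not occur in the commutator near the boundary, and the angular
fields annihilate `x`. -/
theorem lOp_commutator (𝒞 : ModelCover G) (j k : G.MIdx) :
    G.lOp hx γ j * G.lOp hx γ k - G.lOp hx γ k * G.lOp hx γ j
      ∈ linSpan (coeffRing n M) (G.lOp hx γ) := by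
  have hsmooth : ∀ a : G.MIdx → M → ℂ, (∀ l p, SmoothAt n (a l) p) → ∀ l p,
      SmoothAt n (fun q => if l = none then - Complex.I * a none q else a l q) p := by
    intro a ha l p
    rcases l with _ | l
    · simpa using (SmoothAt.const (-Complex.I) p).mul (ha none p)
    · simpa using ha (some l) p
  have key : ∀ k : G.NIdx, G.lOp hx γ none * G.lOp hx γ (some k)
      - G.lOp hx γ (some k) * G.lOp hx γ none ∈ linSpan (coeffRing n M) (G.lOp hx γ) := by
    intro k
    obtain ⟨a, ha, ha0, h⟩ := exists_commutator 𝒞 hx none (some k)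
    refine mem_linSpan_of_apply (a := fun l q => Complex.I *
        (if l = none then - Complex.I * a none q else a l q))
      (b := fun q => γ * (a none q / x q) - γ * (G.logDeriv (some k) q / x q))
      (fun l p => (SmoothAt.const _ p).mul (hsmooth a ha l p))
      (fun p => ((SmoothAt.const _ p).mul (G.smoothAt_div hx (ha none) ha0 p)).sub
        ((SmoothAt.const _ p).mul (G.logDeriv_div_smoothAt hx k p))) fun ψ q hq => ?_
    change (G.lOp hx γ none (G.lOp hx γ (some k) ψ)).1 q
      - vderiv (G.field (some k)) (G.lOp hx γ none ψ).1 q = _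
    rw [G.vderiv_lOp_none hx γ _ _ hq, G.lOp_none_apply]
    have h1 := h ψ q hq
    rw [G.sum_mul_field_eq_sum_lOp hx γ hq] at h1
    change Complex.I * vderiv _ (vderiv _ ψ.1) q - _ * vderiv _ ψ.1 q - _ = _
    simp only [mul_assoc, ← Finset.mul_sum] at h1 ⊢
    linear_combination Complex.I * h1 - γ * (a none q / x q * ψ.1 q) * Complex.I_sq
  rcases j with _ | j <;> rcases k with _ | k
  · have h : G.lOp hx γ none * G.lOp hx γ none - G.lOp hx γ none * G.lOp hx γ none = 0 :=
      testOp_ext fun ψ q _ => sub_self _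
    rw [h]; exact zero_mem _
  · exact key k
  · have h : G.lOp hx γ (some j) * G.lOp hx γ none - G.lOp hx γ none * G.lOp hx γ (some j)
        = -(G.lOp hx γ none * G.lOp hx γ (some j) - G.lOp hx γ (some j) * G.lOp hx γ none) :=
      testOp_ext fun ψ q _ => (neg_sub _ _).symm
    rw [h]; exact neg_mem (key j)
  · obtain ⟨a, ha, ha0, h⟩ := exists_commutator 𝒞 hx (some j) (some k)
    refine mem_linSpan_of_apply (hsmooth a ha)
      (fun p => (SmoothAt.const (-Complex.I * γ) p).mul (G.smoothAt_div hx (ha none) ha0 p))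
      fun ψ q hq => ?_
    change vderiv _ (vderiv _ ψ.1) q - vderiv _ (vderiv _ ψ.1) q = _
    rw [h ψ q hq, G.sum_mul_field_eq_sum_lOp hx γ hq]

/-- The scattering generators are stable under commutators with the generators of `ℳ_γ`, because the
factor `x` in front absorbs the term `γ / x`. -/
theorem lOp_sOp_commutator (𝒞 : ModelCover G) (j k : G.MIdx) :
    G.lOp hx γ j * G.sOp hx k - G.sOp hx k * G.lOp hx γ j
      ∈ linSpan (coeffRing n M) (G.sOp hx) := by
  obtain ⟨a, ha, -, h⟩ := exists_commutator 𝒞 hx j k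
  have hs : ∀ l p, SmoothAt n (fun q => a l q + if l = k then (G.logDeriv j q : ℂ) else 0) p := by
    intro l p
    by_cases hl : l = k
    · simpa [hl] using (ha k p).add (G.logDeriv_smoothAt hx j p)
    · simpa [hl] using ha l p
  have key : ∀ ψ : testSpace n M, ∀ q ∈ (𝓡∂ n).interior M,
      vderiv (G.field j) (G.sOp hx k ψ).1 q - x q * vderiv (G.field k) (vderiv (G.field j) ψ.1) q
        = ∑ l, (a l q + if l = k then (G.logDeriv j q : ℂ) else 0) * (G.sOp hx l ψ).1 q := by
    intro ψ q hq
    rw [G.vderiv_sOp]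
    simp only [G.sOp_apply, add_mul, ite_mul, zero_mul, Finset.sum_add_distrib,
      Finset.sum_ite_eq', Finset.mem_univ, if_true]
    have h1 : ∑ l, a l q * ((x q : ℂ) * vderiv (G.field l) ψ.1 q)
        = x q * ∑ l, a l q * vderiv (G.field l) ψ.1 q := by
      rw [Finset.mul_sum]; exact Finset.sum_congr rfl fun l _ => by ring
    rw [h1, ← h ψ q hq]
    ring
  rcases j with _ | j
  · refine mem_linSpan_of_apply (fun l p => (SmoothAt.const Complex.I p).mul (hs l p))
      (fun p => (SmoothAt.const (-(γ : ℂ)) p).mul (G.logDeriv_smoothAt hx k p)) fun ψ q hq => ?_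
    change (G.lOp hx γ none (G.sOp hx k ψ)).1 q
      - x q * vderiv (G.field k) (G.lOp hx γ none ψ).1 q = _
    rw [G.vderiv_lOp_none hx γ _ _ hq, G.lOp_none_apply]
    have h1 := key ψ q hq
    have h0 := hx.ne_zero hq
    simp only [mul_assoc, ← Finset.mul_sum]
    rw [← h1, G.sOp_apply]
    field_simp
    ring
  · refine mem_linSpan_of_apply hs (SmoothAt.const 0) fun ψ q hq => ?_
    change vderiv _ (G.sOp hx k ψ).1 q - x q * vderiv _ (vderiv _ ψ.1) q = _
    rw [key ψ q hq, zero_mul, add_zero]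

theorem small_mul_mem_words (𝒞 : ModelCover G) (i : G.NIdx) {s a b : ℕ} {Q : TestOp n M}
    (hQ : Q ∈ wordSpan (coeffRing n M) (G.lOp hx γ) (G.sOp hx) some s a b) :
    G.lOp hx γ (some i) * Q ∈ wordSpan (coeffRing n M) (G.lOp hx γ) (G.sOp hx) some s a (b + 1) :=
  small_mul_mem_wordSpan (G.lOp_coeff hx γ) (G.sOp_coeff hx) (G.lOp_commutator hx γ 𝒞)
    (G.lOp_sOp_commutator hx γ 𝒞) i hQ

theorem large_mul_mem_words (𝒞 : ModelCover G) (i : G.MIdx) {s a b : ℕ} {Q : TestOp n M}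
    (hQ : Q ∈ wordSpan (coeffRing n M) (G.lOp hx γ) (G.sOp hx) some s a b) :
    G.lOp hx γ i * Q ∈ wordSpan (coeffRing n M) (G.lOp hx γ) (G.sOp hx) some s (a + 1) b :=
  large_mul_mem_wordSpan (G.lOp_coeff hx γ) (G.sOp_coeff hx)
    (G.lOp_sOp_commutator hx γ 𝒞) i hQ

end Generators

end Commutators

/-! ### Weighted bounds on weak actions -/

section Bounds

open Filter Topology

variable {n : ℕ} [NeZero n] {M : Type*} [TopologicalSpace M]
  [ChartedSpace (EuclideanHalfSpace n) M] [IsManifold (𝓡∂ n) ∞ M]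
  [CompactSpace M] [T2Space M] [MeasurableSpace M] [BorelSpace M] {μ : Measure M}
  {x : M → ℝ} {g : BilinField n M} {G : Generators x g}

variable (n) in
/-- The norm in `x ^ ℓ L²` over the interior. -/
noncomputable def wNorm (μ : Measure M) (x : M → ℝ) (ℓ : ℝ) (f : M → ℂ) : ℝ≥0∞ :=
  eLpNorm (fun p => ((x p ^ (-ℓ) : ℝ) : ℂ) * f p) 2 (μ.restrict ((𝓡∂ n).interior M))

theorem wNorm_congr {ℓ : ℝ} {f f' : M → ℂ} (h : f =ᵐ[μ.restrict ((𝓡∂ n).interior M)] f') :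
    wNorm n μ x ℓ f = wNorm n μ x ℓ f' :=
  eLpNorm_congr_ae (h.mono fun p hp => by simp only [hp])

theorem ae_restrict_interior {P : M → Prop} (h : ∀ p ∈ (𝓡∂ n).interior M, P p) :
    ∀ᵐ p ∂(μ.restrict ((𝓡∂ n).interior M)), P p :=
  (ae_restrict_iff' isOpen_interior.measurableSet).2 (Eventually.of_forall h)

theorem wNorm_mul_le {ℓ : ℝ} {a f : M → ℂ} {C : ℝ≥0}
    (ha : ∀ p ∈ (𝓡∂ n).interior M, ‖a p‖ ≤ C) :
    wNorm n μ x ℓ (fun p => a p * f p) ≤ C * wNorm n μ x ℓ f := by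
  refine eLpNorm_le_nnreal_smul_eLpNorm_of_ae_le_mul (ae_restrict_interior fun p hp => ?_) 2
  rw [← NNReal.coe_le_coe]
  push_cast
  rw [norm_mul, norm_mul, norm_mul]
  calc _ = ‖a p‖ * (‖((x p ^ (-ℓ) : ℝ) : ℂ)‖ * ‖f p‖) := by ring
    _ ≤ _ := by gcongr; exact ha p hp

theorem aestronglyMeasurable_interior {f : M → ℂ} (hf : ContinuousOn f ((𝓡∂ n).interior M)) :
    AEStronglyMeasurable f (μ.restrict ((𝓡∂ n).interior M)) := by
  have := (𝓡∂ n).secondCountableTopology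
  have := ChartedSpace.secondCountable_of_sigmaCompact (EuclideanHalfSpace n) M
  exact hf.aestronglyMeasurable isOpen_interior.measurableSet

theorem IsBoundaryDefining.continuousOn_rpow (hx : IsBoundaryDefining n x) (ℓ : ℝ) :
    ContinuousOn (fun p => ((x p ^ ℓ : ℝ) : ℂ)) ((𝓡∂ n).interior M) := fun p hp =>
  (Complex.continuous_ofReal.continuousAt.comp
    (hx.smooth.continuous.continuousAt.rpow_const (Or.inl (hx.pos p hp).ne'))).continuousWithinAt

theorem wNorm_add_le (hx : IsBoundaryDefining n x) {ℓ : ℝ} {f f' : M → ℂ}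
    (hf : AEStronglyMeasurable f (μ.restrict ((𝓡∂ n).interior M)))
    (hf' : AEStronglyMeasurable f' (μ.restrict ((𝓡∂ n).interior M))) :
    wNorm n μ x ℓ (fun p => f p + f' p) ≤ wNorm n μ x ℓ f + wNorm n μ x ℓ f' := by
  have hm := aestronglyMeasurable_interior (μ := μ) (hx.continuousOn_rpow (-ℓ))
  unfold wNorm
  simp only [mul_add]
  exact eLpNorm_add_le (hm.mul hf) (hm.mul hf') (by norm_num)

/-- `Q u` is in `x ^ ℓ L²`, with norm at most `N`. -/
def WeakBound (μ : Measure M) (x : M → ℝ) (ℓ : ℝ) (Q : TestOp n M) (u : M → ℂ) (N : ℝ≥0) : Prop :=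
  ∃ f, WeakAct μ Q u f ∧ wNorm n μ x ℓ f ≤ N

theorem WeakBound.mono {ℓ : ℝ} {Q : TestOp n M} {u : M → ℂ} {N N' : ℝ≥0} (hN : N ≤ N')
    (h : WeakBound μ x ℓ Q u N) : WeakBound μ x ℓ Q u N' := by
  obtain ⟨f, hf, hb⟩ := h
  exact ⟨f, hf, hb.trans (by exact_mod_cast hN)⟩

theorem WeakBound.wNorm_le {ℓ : ℝ} {Q : TestOp n M} (hQ : HasTranspose μ Q) {u f : M → ℂ} {N : ℝ≥0}
    (h : WeakBound μ x ℓ Q u N) (hf : WeakAct μ Q u f) : wNorm n μ x ℓ f ≤ N := by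
  obtain ⟨f', hf', hb⟩ := h
  rwa [wNorm_congr (hf.unique hQ hf')]

theorem exists_bound_of_smooth {a : M → ℂ} (ha : ∀ p, SmoothAt n a p) :
    ∃ C : ℝ≥0, ∀ p, ‖a p‖ ≤ C := by
  have hc : Continuous a := continuous_iff_continuousAt.2 fun p => (ha p).continuousAt
  obtain ⟨C, hC⟩ := isCompact_univ.exists_bound_of_continuousOn hc.continuousOn
  exact ⟨C.toNNReal, fun p => (hC p trivial).trans (Real.le_coe_toNNReal C)⟩

theorem WeakBound.exists_coeff_mul (hμ : FiniteInside n μ) {ℓ : ℝ} {Q P : TestOp n M}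
    (hQ : Q ∈ coeffRing n M) : ∃ C : ℝ≥0, ∀ (u : M → ℂ) (N : ℝ≥0),
      WeakBound μ x ℓ P u N → WeakBound μ x ℓ (Q * P) u (C * N) := by
  have ht := hasTranspose_of_mem_coeffRing (μ := μ) hQ
  obtain ⟨a, ha, rfl⟩ := hQ
  obtain ⟨C, hC⟩ := exists_bound_of_smooth ha
  refine ⟨C, fun u N ⟨f, hf, hb⟩ => ⟨fun p => a p * f p,
    hf.comp ht (weakAct_mulOp hμ _ hf.2.1), ?_⟩⟩
  refine (wNorm_mul_le fun p _ => hC p).trans ?_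
  push_cast
  gcongr

theorem WeakBound.add (hμ : FiniteInside n μ) (hx : IsBoundaryDefining n x) {ℓ : ℝ}
    {P Q : TestOp n M} (hP : HasTranspose μ P) (hQ : HasTranspose μ Q) {u : M → ℂ} {N N' : ℝ≥0}
    (h : WeakBound μ x ℓ P u N) (h' : WeakBound μ x ℓ Q u N') :
    WeakBound μ x ℓ (P + Q) u (N + N') := by
  obtain ⟨f, hf, hb⟩ := h
  obtain ⟨f', hf', hb'⟩ := h'
  refine ⟨_, hf.add hμ hP hQ hf', (wNorm_add_le hx hf.aestronglyMeasurable
    hf'.aestronglyMeasurable).trans ?_⟩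
  push_cast
  exact add_le_add hb hb'

namespace Generators

variable (G) (hx : IsBoundaryDefining n x)

/-- Combinations of the ordered compositions of at most `s` scattering generators, at most `a`
generators of `ℳ_γ` and at most `b` generators of `𝒩`, with coefficients smooth up to the
boundary. -/
noncomputable abbrev wordOps (γ : ℝ) (s a b : ℕ) : AddSubgroup (TestOp n M) :=
  wordSpan (coeffRing n M) (G.lOp hx γ) (G.sOp hx) some s a b

/-- All ordered compositions of at most `s`, `a` and `b` generators of the three kinds map `u` into
`x ^ ℓ L²`, with norm at most `N`. -/
def ModuleBound (μ : Measure M) (γ ℓ : ℝ) (s a b : ℕ) (u : M → ℂ) (N : ℝ≥0) : Prop :=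
  ∀ s' ≤ s, ∀ a' ≤ a, ∀ b' ≤ b, ∀ Q, OrderedWord (G.lOp hx γ) (G.sOp hx) some s' a' b' Q →
    WeakBound μ x ℓ Q u N

variable {G hx}

theorem ModuleBound.locallyIntegrableOn {γ ℓ : ℝ} {s a b : ℕ} {u : M → ℂ} {N : ℝ≥0}
    (h : G.ModuleBound hx μ γ ℓ s a b u N) : LocallyIntegrableOn u ((𝓡∂ n).interior M) μ := by
  obtain ⟨f, hf, -⟩ := h 0 (Nat.zero_le _) 0 (Nat.zero_le _) 0 (Nat.zero_le _) 1 OrderedWord.one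
  exact hf.1

theorem ModuleBound.mono {γ ℓ : ℝ} {s a b s' a' b' : ℕ} {u : M → ℂ} {N N' : ℝ≥0} (hs : s' ≤ s)
    (ha : a' ≤ a) (hb : b' ≤ b) (hN : N ≤ N') (h : G.ModuleBound hx μ γ ℓ s a b u N) :
    G.ModuleBound hx μ γ ℓ s' a' b' u N' := fun s₁ h₁ a₁ h₂ b₁ h₃ Q hQ =>
  (h s₁ (h₁.trans hs) a₁ (h₂.trans ha) b₁ (h₃.trans hb) Q hQ).mono hN

variable (G hx)

theorem hasTranspose_lOp (hμ : FiniteInside n μ)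
    (hV : ∀ j, HasTranspose μ (fieldOp (G.field j) (G.field_smooth j))) (γ : ℝ) (i : G.MIdx) :
    HasTranspose μ (G.lOp hx γ i) := by
  rcases i with _ | i
  · have h1 : G.lOp hx γ none = mulOp (fun _ => Complex.I) (fun p _ => SmoothAt.const _ p)
        * fieldOp (G.field none) (G.field_smooth none)
        + mulOp (fun q => -((γ / x q : ℝ) : ℂ)) (fun p hp => (hx.intSmooth_div γ p hp).neg) :=
      testOp_ext fun ψ q _ => by
        rw [G.lOp_none_apply]
        change _ = Complex.I * vderiv _ ψ.1 q + -((γ / x q : ℝ) : ℂ) * ψ.1 q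
        push_cast
        ring
    rw [h1]
    exact ((hasTranspose_mulOp _).mul (hV none)).add hμ (hasTranspose_mulOp _)
  · exact hV (some i)

theorem hasTranspose_sOp (hV : ∀ j, HasTranspose μ (fieldOp (G.field j) (G.field_smooth j)))
    (i : G.MIdx) : HasTranspose μ (G.sOp hx i) :=
  (hasTranspose_mulOp _).mul (hV i)

theorem hasTranspose_word (hμ : FiniteInside n μ)
    (hV : ∀ j, HasTranspose μ (fieldOp (G.field j) (G.field_smooth j))) {γ : ℝ} {s a b : ℕ}
    {Q : TestOp n M} (hQ : OrderedWord (G.lOp hx γ) (G.sOp hx) some s a b Q) : HasTranspose μ Q := by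
  induction hQ with
  | one => exact hasTranspose_one
  | small i _ ih => exact (G.hasTranspose_lOp hx hμ hV γ _).mul ih
  | large i _ ih => exact (G.hasTranspose_lOp hx hμ hV γ _).mul ih
  | scat i _ ih => exact (G.hasTranspose_sOp hx hV _).mul ih

/-- Combinations of words are bounded by the words themselves. -/
theorem hasTranspose_and_exists_weakBound (hμ : FiniteInside n μ)
    (hV : ∀ j, HasTranspose μ (fieldOp (G.field j) (G.field_smooth j))) {γ : ℝ} (ℓ : ℝ)
    {s a b : ℕ} {Q : TestOp n M} (hQ : Q ∈ G.wordOps hx γ s a b) : HasTranspose μ Q ∧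
      ∃ C : ℝ≥0, ∀ (u : M → ℂ) (N : ℝ≥0), G.ModuleBound hx μ γ ℓ s a b u N →
        WeakBound μ x ℓ Q u (C * N) := by
  induction hQ using AddSubgroup.closure_induction with
  | mem Q hQ =>
    obtain ⟨c, hc, s', hs, a', ha, b', hb, w, hw, rfl⟩ := hQ
    refine ⟨(hasTranspose_of_mem_coeffRing hc).mul (G.hasTranspose_word hx hμ hV hw), ?_⟩
    obtain ⟨C, hC⟩ := WeakBound.exists_coeff_mul (x := x) (ℓ := ℓ) (P := w) hμ hc
    exact ⟨C, fun u N h => hC u N (h s' hs a' ha b' hb w hw)⟩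
  | zero =>
    refine ⟨hasTranspose_zero, 0, fun u N h => ⟨_, weakAct_zero hμ h.locallyIntegrableOn, ?_⟩⟩
    simp [wNorm]
  | add P Q _ _ hP hQ =>
    obtain ⟨hP, C, hC⟩ := hP
    obtain ⟨hQ, D, hD⟩ := hQ
    exact ⟨hP.add hμ hQ, C + D, fun u N h => by
      rw [add_mul]; exact (hC u N h).add hμ hx hP hQ (hD u N h)⟩
  | neg Q _ hQ =>
    obtain ⟨hQ, C, hC⟩ := hQ
    have hc : (-1 : TestOp n M) ∈ coeffRing n M := neg_mem (one_mem _)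
    have h1 : -Q = -1 * Q := testOp_ext fun ψ q _ => rfl
    obtain ⟨D, hD⟩ := WeakBound.exists_coeff_mul (x := x) (ℓ := ℓ) (P := Q) hμ hc
    rw [h1]
    exact ⟨(hasTranspose_of_mem_coeffRing hc).mul hQ, D * C, fun u N h => by
      rw [mul_assoc]; exact hD u _ (hC u N h)⟩

end Generators

end Bounds

/-! ### Weak actions and weak derivatives in coordinates -/

section Transfer

open Filter Topology

variable {n : ℕ} [NeZero n] {M : Type*} [TopologicalSpace M]
  [ChartedSpace (EuclideanHalfSpace n) M] [IsManifold (𝓡∂ n) ∞ M]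
  [CompactSpace M] [T2Space M] [MeasurableSpace M] [BorelSpace M]
  {x : M → ℝ} {g : BilinField n M} {G : Generators x g}

namespace LocalModel

variable (m : LocalModel G)

theorem source_subset_interior : m.Ψ.source ⊆ (𝓡∂ n).interior M := fun _ hq =>
  ((m.mem_source _).1 hq).2

theorem contMDiffAt_comp_chart {Φ : Euc n → ℂ} (hΦ : ContDiff ℝ ∞ Φ) {q : M}
    (hq : q ∈ m.Ψ.source) : SmoothAt n (fun r => Φ (m.Ψ r)) q :=
  hΦ.contDiffAt.comp_contMDiffAt (m.chart.smooth q hq)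

/-- A test function on Euclidean space, localized and transplanted to `M`. -/
theorem exists_pullback (hx : IsBoundaryDefining n x) {χ : M → ℂ} (hχ : ∀ p, SmoothAt n χ p)
    (hχU : tsupport χ ⊆ m.U) {Φ : Euc n → ℂ} (hΦ : ContDiff ℝ ∞ Φ) (hc : HasCompactSupport Φ) :
    ∃ φ : testSpace n M, tsupport φ.1 ⊆ tsupport χ ∧
      (∀ q, q ∉ m.Ψ.source → φ.1 q = 0) ∧ ∀ q ∈ m.Ψ.source, φ.1 q = χ q * Φ (m.Ψ q) := by
  classical
  obtain ⟨r, hr⟩ := hc.isCompact.exists_bound_of_continuousOn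
    (f := fun w : Euc n => w 0) (by fun_prop)
  obtain ⟨e, he, hep⟩ := m.proper r
  set φ : M → ℂ := m.Ψ.source.indicator fun q => χ q * Φ (m.Ψ q) with hφ
  have hsupp : tsupport φ ⊆ tsupport χ ∩ {q | e ≤ x q} := by
    refine closure_minimal (fun q hq => ?_) ((isClosed_tsupport χ).inter
      (isClosed_le continuous_const hx.smooth.continuous))
    have hqs : q ∈ m.Ψ.source := by
      by_contra h
      exact hq (Set.indicator_of_notMem h _)
    rw [Function.mem_support, hφ, Set.indicator_of_mem hqs] at hq
    exact ⟨subset_tsupport _ (left_ne_zero_of_mul hq),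
      hep q hqs (hr _ (subset_tsupport _ (right_ne_zero_of_mul hq)))⟩
  have hs : tsupport φ ⊆ m.Ψ.source := fun q hq =>
    (m.mem_source q).2 ⟨hχU (hsupp hq).1, (hx.pos_iff q).1 (he.trans_le (hsupp hq).2)⟩
  refine ⟨⟨φ, contMDiff_of_tsupport fun q hq => ?_, hs.trans m.source_subset_interior⟩,
    fun q hq => (hsupp hq).1, fun q hq => by simp only [hφ, Set.indicator_of_notMem hq],
    fun q hq => by simp only [hφ, Set.indicator_of_mem hq]⟩
  refine ((hχ q).mul (m.contMDiffAt_comp_chart hΦ (hs hq))).congr ?_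
  filter_upwards [m.Ψ.open_source.mem_nhds (hs hq)] with r hr
  exact Set.indicator_of_mem hr _

theorem aestronglyMeasurable_of_intSmooth {a : M → ℂ} (ha : IntSmooth n a) {μ : Measure M} :
    AEStronglyMeasurable a (μ.restrict m.Ψ.source) :=
  (aestronglyMeasurable_interior fun p hp => (ha p hp).continuousAt.continuousWithinAt).mono_measure
    (Measure.restrict_mono m.source_subset_interior le_rfl)

/-- Integration in the coordinates is integration over the manifold, up to the density. -/
theorem integral_push_mul {H : M → ℂ}
    (hH : AEStronglyMeasurable H ((riemannianMeasure g).restrict m.Ψ.source)) {Φ : Euc n → ℂ}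
    (hΦ : Continuous Φ) : ∫ w, m.push H w * Φ w = ∫ q, m.Ψ.source.indicator
      (fun q => (m.dens q)⁻¹ * (H q * Φ (m.Ψ q))) q ∂(riemannianMeasure g) := by
  have := (𝓡∂ n).secondCountableTopology
  have := ChartedSpace.secondCountable_of_sigmaCompact (EuclideanHalfSpace n) M
  have hms := m.Ψ.open_source.measurableSet
  rw [m.integral_eq_integral_push (fun q hq => Set.indicator_of_notMem hq _)]
  · refine integral_congr_ae (Eventually.of_forall fun w => ?_)
    by_cases hw : w ∈ m.Ψ.target
    · have hs := m.Ψ.map_target hw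
      have := m.dens_ne_zero hs
      simp only [m.push_of_mem hw, Set.indicator_of_mem hs, m.Ψ.right_inv hw]
      change _ = m.dens _ * _
      field_simp
    · simp only [m.push_of_notMem hw, zero_mul]
  · refine AEStronglyMeasurable.indicator ?_ hms
    refine AEStronglyMeasurable.mul ?_ (hH.mul ?_)
    · exact ContinuousOn.aestronglyMeasurable (fun q hq =>
        ((m.dens_smoothAt hq).inv (m.dens_ne_zero hq)).continuousAt.continuousWithinAt) hms
    · exact ContinuousOn.aestronglyMeasurable
        (hΦ.comp_continuousOn m.Ψ.continuousOn) hms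

variable {θ b : M → ℂ} {i : Fin n}

/-- The weak derivatives of the localizations of `θ f` are the localizations of `θ` times the
conjugated derivatives of `f`, up to the derivative of the cutoff. -/
theorem weakDeriv_push (hμ : FiniteInside n (riemannianMeasure g)) (hx : IsBoundaryDefining n x)
    (hθ : IntSmooth n θ) (hb : IntSmooth n b)
    (hθb : ∀ q ∈ m.Ψ.source, m.dv i θ q = θ q * b q) {χ : M → ℂ} (hχ : ∀ p, SmoothAt n χ p)
    (hχU : tsupport χ ⊆ m.U) {f h : M → ℂ}
    (hf : WeakAct (riemannianMeasure g) (m.dvOp i + mulOp b hb) f h) :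
    WeakDeriv i (m.push fun q => χ q * (θ q * f q))
      (m.push fun q => χ q * (θ q * h q) + m.dv i χ q * (θ q * f q)) := by
  intro Φ hΦ hc
  have hχ' : ∀ p, SmoothAt n (m.dv i χ) p := m.dv_smoothAt i hχ
  have hχ'U : tsupport (m.dv i χ) ⊆ m.U := (m.tsupport_dv_subset i χ).trans hχU
  obtain ⟨φ₀, h₀s, h₀n, h₀⟩ := m.exists_pullback hx hχ hχU hΦ hc
  obtain ⟨φ₁, h₁s, h₁n, h₁⟩ := m.exists_pullback hx hχ' hχ'U hΦ hc
  have htest : ∀ φ : testSpace n M, tsupport φ.1 ⊆ m.U →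
      IsTest (n := n) fun q => (θ q * (m.dens q)⁻¹) * φ.1 q := fun φ hφ =>
    isTest_mul_of_tsupport φ.2 fun q hq => by
      have hs := m.tsupport_subset_source hφ hq
      exact (hθ q (m.source_subset_interior hs)).mul ((m.dens_smoothAt hs).inv (m.dens_ne_zero hs))
  let ψ₀ : testSpace n M := ⟨_, htest φ₀ (h₀s.trans hχU)⟩
  let ψ₁ : testSpace n M := ⟨_, htest φ₁ (h₁s.trans hχ'U)⟩
  have hψ₀U : tsupport ψ₀.1 ⊆ m.U :=
    (tsupport_mul_subset_right (f := fun q => θ q * (m.dens q)⁻¹) (g := φ₀.1)).trans (h₀s.trans hχU)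
  -- the transpose of the conjugated derivative, on `θ φ₀ / dens`
  obtain ⟨η, -, hη, hηψ⟩ := m.exists_adjoint hμ hψ₀U i
  have hη' : ∀ q ∈ m.Ψ.source, η.1 q + b q * ψ₀.1 q
      = - (θ q * (m.dens q)⁻¹ * m.dv i φ₀.1 q) := by
    intro q hq
    have h1 : (m.densMul hψ₀U).1 =ᶠ[𝓝 q] fun r => θ r * φ₀.1 r := by
      filter_upwards [m.Ψ.open_source.mem_nhds hq] with r hr
      have := m.dens_ne_zero hr
      change m.dens r * ((θ r * (m.dens r)⁻¹) * φ₀.1 r) = _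
      field_simp
    rw [hη, m.dv_congr i h1, m.dv_mul i (hθ q (m.source_subset_interior hq))
      (testSpace_smoothAt φ₀ q), hθb q hq]
    change _ + b q * ((θ q * (m.dens q)⁻¹) * φ₀.1 q) = _
    ring
  have hact := hf.2.2 ψ₀ (η + mulOp b hb ψ₀) fun ψ => by
    have h1 : ∀ q, ψ₀.1 q * ((m.dvOp i + mulOp b hb) ψ).1 q
        = ψ₀.1 q * m.dv i ψ.1 q + (mulOp b hb ψ₀).1 q * ψ.1 q := by
      intro q
      change ψ₀.1 q * ((m.dvOp i ψ).1 q + b q * ψ.1 q) = _ + b q * ψ₀.1 q * ψ.1 q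
      rw [m.dvOp_apply]
      ring
    have h2 : ∀ q, (η + mulOp b hb ψ₀).1 q * ψ.1 q
        = η.1 q * ψ.1 q + (mulOp b hb ψ₀).1 q * ψ.1 q := fun q => add_mul _ _ _
    simp only [h1, h2]
    rw [integral_add ?_ (integrable_test_mul_test hμ _ _),
      integral_add (integrable_test_mul_test hμ _ _) (integrable_test_mul_test hμ _ _), hηψ]
    have := integrable_test_mul_test hμ ψ₀ (m.dvOp i ψ)
    simpa only [m.dvOp_apply] using this
  have hmono : (riemannianMeasure g).restrict m.Ψ.source
      ≤ (riemannianMeasure g).restrict ((𝓡∂ n).interior M) :=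
    Measure.restrict_mono m.source_subset_interior le_rfl
  have := (𝓡∂ n).secondCountableTopology
  have := ChartedSpace.secondCountable_of_sigmaCompact (EuclideanHalfSpace n) M
  have hfm : AEStronglyMeasurable f ((riemannianMeasure g).restrict m.Ψ.source) :=
    hf.1.aestronglyMeasurable.mono_measure hmono
  have hhm := hf.aestronglyMeasurable.mono_measure hmono
  have hθm := m.aestronglyMeasurable_of_intSmooth hθ (μ := riemannianMeasure g)
  have hχm := m.aestronglyMeasurable_of_intSmooth (fun p _ => hχ p) (μ := riemannianMeasure g)
  have hχ'm := m.aestronglyMeasurable_of_intSmooth (fun p _ => hχ' p) (μ := riemannianMeasure g)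
  rw [m.integral_push_mul (H := fun q => χ q * (θ q * f q)) (hχm.mul (hθm.mul hfm)) (continuous_fderiv_apply' hΦ _),
    m.integral_push_mul (H := fun q => χ q * (θ q * h q) + m.dv i χ q * (θ q * f q))
      ((hχm.mul (hθm.mul hhm)).add (hχ'm.mul (hθm.mul hfm))) hΦ.continuous]
  have e1 : ∀ q, m.Ψ.source.indicator (fun q => (m.dens q)⁻¹ *
      (χ q * (θ q * f q) * fderiv ℝ Φ (m.Ψ q) (stdVec i))) q
      = - (f q * (η + mulOp b hb ψ₀).1 q + f q * ψ₁.1 q) := by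
    intro q
    by_cases hq : q ∈ m.Ψ.source
    · rw [Set.indicator_of_mem hq]
      change _ = - (f q * (η.1 q + b q * ψ₀.1 q) + f q * (θ q * (m.dens q)⁻¹ * φ₁.1 q))
      rw [hη' q hq, h₁ q hq]
      have h2 : m.dv i φ₀.1 q = m.dv i χ q * Φ (m.Ψ q)
          + χ q * fderiv ℝ Φ (m.Ψ q) (stdVec i) := by
        have h3 : φ₀.1 =ᶠ[𝓝 q] fun r => χ r * Φ (m.Ψ r) := by
          filter_upwards [m.Ψ.open_source.mem_nhds hq] with r hr
          exact h₀ r hr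
        rw [m.dv_congr i h3, m.dv_mul i (hχ q) (m.contMDiffAt_comp_chart hΦ hq)]
        congr 2
        rw [m.dv_eq_vderiv hq, vderiv_eucVec m.chart i hq (m.contMDiffAt_comp_chart hΦ hq)]
        congr 1
        refine EventuallyEq.fderiv_eq ?_
        filter_upwards [m.Ψ.open_target.mem_nhds (m.Ψ.map_source hq)] with w hw
        simp only [Function.comp_apply, m.Ψ.right_inv hw]
      rw [h2]
      ring
    · rw [Set.indicator_of_notMem hq]
      have h2 : η.1 q = 0 := by
        rw [hη]
        have : m.dv i (m.densMul hψ₀U).1 q = 0 := image_eq_zero_of_notMem_tsupport fun h' =>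
          hq (m.tsupport_subset_source ((m.tsupport_densMul hψ₀U).trans hψ₀U)
            (m.tsupport_dv_subset i _ h'))
        rw [this, mul_zero, neg_zero]
      change 0 = - (f q * (η.1 q + b q * (θ q * (m.dens q)⁻¹ * φ₀.1 q))
        + f q * (θ q * (m.dens q)⁻¹ * φ₁.1 q))
      rw [h2, h₀n q hq, h₁n q hq]
      ring
  have e2 : ∀ q, m.Ψ.source.indicator (fun q => (m.dens q)⁻¹ *
      ((χ q * (θ q * h q) + m.dv i χ q * (θ q * f q)) * Φ (m.Ψ q))) q
      = h q * ψ₀.1 q + f q * ψ₁.1 q := by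
    intro q
    change _ = h q * (θ q * (m.dens q)⁻¹ * φ₀.1 q) + f q * (θ q * (m.dens q)⁻¹ * φ₁.1 q)
    by_cases hq : q ∈ m.Ψ.source
    · rw [Set.indicator_of_mem hq, h₀ q hq, h₁ q hq]
      ring
    · rw [Set.indicator_of_notMem hq, h₀n q hq, h₁n q hq]
      ring
  calc _ = ∫ q, - (f q * (η + mulOp b hb ψ₀).1 q + f q * ψ₁.1 q) ∂(riemannianMeasure g) :=
        integral_congr_ae (Eventually.of_forall e1)
    _ = - ∫ q, (h q * ψ₀.1 q + f q * ψ₁.1 q) ∂(riemannianMeasure g) := by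
        rw [integral_neg, integral_add (integrable_mul_test hf.1 _) (integrable_mul_test hf.1 _),
          integral_add (integrable_mul_test hf.2.1 _) (integrable_mul_test hf.1 _), hact]
    _ = _ := by
        rw [← integral_congr_ae (Eventually.of_forall e2)]

end LocalModel

end Transfer

/-! ### Removing the oscillation and the weight -/

section Twist

open Filter Topology

variable {n : ℕ} [NeZero n] {M : Type*} [TopologicalSpace M]
  [ChartedSpace (EuclideanHalfSpace n) M] [IsManifold (𝓡∂ n) ∞ M]
  [CompactSpace M] [T2Space M] [MeasurableSpace M] [BorelSpace M]
  {x : M → ℝ} {g : BilinField n M} {G : Generators x g}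

/-- The function `x ^ (-ℓ) e ^ (-iγ/x)`, conjugation by which turns `r (D_r - γ)` into the radial
derivative, up to coefficients smooth up to the boundary. -/
noncomputable def twist (x : M → ℝ) (γ ℓ : ℝ) (q : M) : ℂ :=
  Complex.exp (-ℓ * Complex.log (x q) + -(Complex.I * (γ / x q)))

theorem norm_twist (hx : IsBoundaryDefining n x) (γ ℓ : ℝ) {q : M} (hq : q ∈ (𝓡∂ n).interior M) :
    ‖twist x γ ℓ q‖ = x q ^ (-ℓ) := by
  have h0 := hx.pos q hq
  unfold twist
  rw [Complex.norm_exp, Real.rpow_def_of_pos h0, ← Complex.ofReal_log h0.le, ← Complex.ofReal_div,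
    ← Complex.ofReal_neg, ← Complex.ofReal_mul]
  congr 1
  simp only [Complex.add_re, Complex.ofReal_re, Complex.neg_re, Complex.mul_re, Complex.I_re,
    Complex.I_im, Complex.ofReal_im]
  ring

theorem IsBoundaryDefining.log_smoothAt (hx : IsBoundaryDefining n x) {q : M}
    (hq : q ∈ (𝓡∂ n).interior M) : SmoothAt n (fun r => Complex.log (x r)) q :=
  SmoothAt.comp (f := Complex.log) ((Complex.contDiffAt_log
    (Complex.ofReal_mem_slitPlane.2 (hx.pos q hq))).restrict_scalars ℝ) (hx.smoothAt q)

theorem twist_exponent_smoothAt (hx : IsBoundaryDefining n x) (γ ℓ : ℝ) {q : M}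
    (hq : q ∈ (𝓡∂ n).interior M) :
    SmoothAt n (fun r => -ℓ * Complex.log (x r) + -(Complex.I * (γ / x r))) q :=
  ((SmoothAt.const (-ℓ : ℂ) q).mul (hx.log_smoothAt hq)).add
    ((SmoothAt.const Complex.I q).mul (hx.smoothAt_div γ hq)).neg

theorem twist_intSmooth (hx : IsBoundaryDefining n x) (γ ℓ : ℝ) :
    IntSmooth n (twist x γ ℓ) := fun _ hq =>
  SmoothAt.comp (f := Complex.exp) (Complex.contDiff_exp (𝕜 := ℂ).contDiffAt.restrict_scalars ℝ)
    (twist_exponent_smoothAt hx γ ℓ hq)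

/-- Differentiating the twist gives back exactly the singular coefficient `i γ / x`. -/
theorem Generators.vderiv_twist (hx : IsBoundaryDefining n x) (γ ℓ : ℝ) (j : G.MIdx) {q : M}
    (hq : q ∈ (𝓡∂ n).interior M) : vderiv (G.field j) (twist x γ ℓ) q
      = twist x γ ℓ q * (G.logDeriv j q * (Complex.I * (γ / x q) - ℓ)) := by
  have h0 := hx.ne_zero hq
  have h1 : vderiv (G.field j) (twist x γ ℓ) q = twist x γ ℓ q * vderiv (G.field j)
      (fun r => -ℓ * Complex.log (x r) + -(Complex.I * (γ / x r))) q := by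
    have := vderiv_comp (G.field j) (f := Complex.exp) Complex.differentiableAt_exp
      (twist_exponent_smoothAt hx γ ℓ hq)
    rwa [Complex.deriv_exp] at this
  have h2 : (fun r => -(Complex.I * ((γ : ℂ) / x r))) = fun r => -Complex.I * ((γ : ℂ) / x r) :=
    funext fun r => (neg_mul _ _).symm
  have h3 : vderiv (G.field j) (fun r => Complex.log (x r)) q = G.logDeriv j q := by
    have hs := Complex.ofReal_mem_slitPlane.2 (hx.pos q hq)
    rw [vderiv_comp (G.field j) (f := Complex.log) (Complex.differentiableAt_log hs) (hx.smoothAt q),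
      (Complex.hasDerivAt_log hs).deriv, G.vderiv_x hx]
    field_simp
  rw [h1, vderiv_add _ ((SmoothAt.const (-ℓ : ℂ) q).mul (hx.log_smoothAt hq))
    ((SmoothAt.const Complex.I q).mul (hx.smoothAt_div γ hq)).neg,
    vderiv_const_mul _ _ (hx.log_smoothAt hq), h2, vderiv_const_mul _ _ (hx.smoothAt_div γ hq),
    G.vderiv_div_x hx γ j hq, h3]
  ring

namespace LocalModel

variable (m : LocalModel G)

/-- The logarithmic derivative of the twist along a coordinate derivative. -/
noncomputable def twistCoeff (γ ℓ : ℝ) (i : Fin n) (q : M) : ℂ :=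
  ∑ j, m.c i j q * (G.logDeriv j q * (Complex.I * (γ / x q) - ℓ))

theorem twistCoeff_intSmooth (hx : IsBoundaryDefining n x) (γ ℓ : ℝ) (i : Fin n) :
    IntSmooth n (m.twistCoeff γ ℓ i) := fun q hq =>
  SmoothAt.sum fun j _ => (m.c_smooth i j q).mul ((G.logDeriv_smoothAt hx j q).mul
    (((SmoothAt.const Complex.I q).mul (hx.smoothAt_div γ hq)).sub (SmoothAt.const _ q)))

theorem dv_twist (hx : IsBoundaryDefining n x) (γ ℓ : ℝ) (i : Fin n) {q : M}
    (hq : q ∈ (𝓡∂ n).interior M) :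
    m.dv i (twist x γ ℓ) q = twist x γ ℓ q * m.twistCoeff γ ℓ i q := by
  unfold dv twistCoeff
  rw [Finset.mul_sum]
  refine Finset.sum_congr rfl fun j _ => ?_
  rw [Generators.vderiv_twist hx γ ℓ j hq]
  ring

/-- The coordinate derivative, conjugated by the twist. -/
noncomputable def eOp (hx : IsBoundaryDefining n x) (γ ℓ : ℝ) (i : Fin n) : TestOp n M :=
  m.dvOp i + mulOp (m.twistCoeff γ ℓ i) (m.twistCoeff_intSmooth hx γ ℓ i)

variable (hx : IsBoundaryDefining n x) (γ ℓ : ℝ)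

theorem eOp_apply (i : Fin n) (ψ : testSpace n M) (q : M) : (m.eOp hx γ ℓ i ψ).1 q
    = ∑ j, m.c i j q * (vderiv (G.field j) ψ.1 q
      + (G.logDeriv j q * (Complex.I * (γ / x q) - ℓ)) * ψ.1 q) := by
  change (m.dvOp i ψ).1 q + m.twistCoeff γ ℓ i q * ψ.1 q = _
  rw [m.dvOp_apply]
  unfold dv twistCoeff
  rw [Finset.sum_mul, ← Finset.sum_add_distrib]
  exact Finset.sum_congr rfl fun j _ => by ring

/-- The conjugated derivatives are combinations of the generators of `ℳ_γ`, with coefficients smooth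
up to the boundary; the radial generator occurs only in that of the radial derivative. -/
theorem exists_eOp_eq (i : Fin n) : ∃ a : G.MIdx → M → ℂ, ∃ b : M → ℂ,
    ∃ ha : ∀ j p, SmoothAt n (a j) p, ∃ hb : ∀ p, SmoothAt n b p,
    (i ≠ 0 → a none = fun _ => 0) ∧
    m.eOp hx γ ℓ i = ∑ j, mulOp (a j) (fun p _ => ha j p) * G.lOp hx γ j
      + mulOp b (fun p _ => hb p) := by
  have hn : ∀ p, SmoothAt n (fun q => ((G.logDeriv none q : ℂ) - 1) / x q) p :=
    G.smoothAt_div hx (fun p => (G.logDeriv_smoothAt hx none p).sub (SmoothAt.const 1 p))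
      fun p hp => by rw [G.logDeriv_none hp]; simp
  refine ⟨fun j q => if j = none then -Complex.I * m.c i none q else m.c i j q,
    fun q => m.c i none q * (Complex.I * γ * (((G.logDeriv none q : ℂ) - 1) / x q)
        - ℓ * G.logDeriv none q)
      + ∑ k : G.NIdx, m.c i (some k) q * (Complex.I * γ * ((G.logDeriv (some k) q : ℂ) / x q)
        - ℓ * G.logDeriv (some k) q), fun j p => ?_, fun p => ?_, fun hi => ?_, ?_⟩
  · rcases j with _ | j
    · simpa using (SmoothAt.const (-Complex.I) p).mul (m.c_smooth i none p)
    · simpa using m.c_smooth i (some j) p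
  · refine SmoothAt.add ?_ (SmoothAt.sum fun k _ => ?_)
    · exact (m.c_smooth i none p).mul (((SmoothAt.const _ p).mul (hn p)).sub
        ((SmoothAt.const _ p).mul (G.logDeriv_smoothAt hx none p)))
    · exact (m.c_smooth i (some k) p).mul (((SmoothAt.const _ p).mul
        (G.logDeriv_div_smoothAt hx k p)).sub
        ((SmoothAt.const _ p).mul (G.logDeriv_smoothAt hx (some k) p)))
  · funext q
    simp [m.c_none i hi]
  · refine testOp_ext fun ψ q hq => ?_
    have h0 := hx.ne_zero hq
    rw [m.eOp_apply]
    simp only [LinearMap.add_apply, LinearMap.sum_apply, Submodule.coe_add, Submodule.coe_sum,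
      Pi.add_apply, Finset.sum_apply, mulOp_apply, Module.End.mul_apply]
    rw [Fintype.sum_option, Fintype.sum_option, G.lOp_none_apply]
    simp only [if_true, reduceCtorEq, if_false, G.lOp_some_apply]
    rw [add_mul (m.c i none q * _), add_add_add_comm, Finset.sum_mul, ← Finset.sum_add_distrib]
    congr 1
    · field_simp
      linear_combination (m.c i none q * vderiv (G.field none) ψ.1 q * x q) * Complex.I_sq
    · refine Finset.sum_congr rfl fun k _ => ?_
      ring

theorem eOp_mul_mem (𝒞 : ModelCover G) (i : Fin n) {s a b : ℕ} {Q : TestOp n M}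
    (hQ : Q ∈ G.wordOps hx γ s a b) : m.eOp hx γ ℓ i * Q ∈ G.wordOps hx γ s (a + 1) b := by
  obtain ⟨c, d, hc, hd, -, h⟩ := m.exists_eOp_eq hx γ ℓ i
  rw [h, add_mul, Finset.sum_mul]
  refine add_mem (sum_mem fun j _ => ?_) ?_
  · rw [mul_assoc]
    exact coeff_mul_mem_wordSpan (mulOp_mem_coeffRing (hc j)) (G.large_mul_mem_words hx γ 𝒞 j hQ)
  · exact coeff_mul_mem_wordSpan (mulOp_mem_coeffRing hd)
      (wordSpan_mono le_rfl (Nat.le_succ a) le_rfl hQ)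

/-- Tangential conjugated derivatives do not involve the radial generator, and cost a letter of `𝒩`. -/
theorem eOp_mul_mem_small (𝒞 : ModelCover G) {i : Fin n} (hi : i ≠ 0) {s a b : ℕ}
    {Q : TestOp n M} (hQ : Q ∈ G.wordOps hx γ s a b) :
    m.eOp hx γ ℓ i * Q ∈ G.wordOps hx γ s a (b + 1) := by
  obtain ⟨c, d, hc, hd, h0, h⟩ := m.exists_eOp_eq hx γ ℓ i
  rw [h, add_mul, Finset.sum_mul]
  refine add_mem (sum_mem fun j _ => ?_) ?_
  · rcases j with _ | j
    · have : mulOp (c none) (fun p _ => hc none p) = (0 : TestOp n M) :=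
        testOp_ext fun ψ q _ => by
          rw [mulOp_apply, h0 hi]
          exact zero_mul _
      rw [this, zero_mul, zero_mul]
      exact zero_mem _
    · rw [mul_assoc]
      exact coeff_mul_mem_wordSpan (mulOp_mem_coeffRing (hc _)) (G.small_mul_mem_words hx γ 𝒞 j hQ)
  · exact coeff_mul_mem_wordSpan (mulOp_mem_coeffRing hd)
      (wordSpan_mono le_rfl le_rfl (Nat.le_succ b) hQ)

/-- The composition of the conjugated derivatives along a list, whose head acts first. -/
noncomputable def eWord : List (Fin n) → TestOp n M
  | [] => 1
  | i :: w => eWord w * m.eOp hx γ ℓ i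

theorem eWord_append (w w' : List (Fin n)) :
    m.eWord hx γ ℓ (w ++ w') = m.eWord hx γ ℓ w' * m.eWord hx γ ℓ w := by
  induction w with
  | nil => simp [eWord]
  | cons i w ih => simp only [List.cons_append, eWord, ih, mul_assoc]

theorem eWord_replicate (k : ℕ) (i : Fin n) :
    m.eWord hx γ ℓ (List.replicate k i) = m.eOp hx γ ℓ i ^ k := by
  induction k with
  | zero => rfl
  | succ k ih => rw [List.replicate_succ, eWord, ih, pow_succ]

/-- Powers of a tangential derivative are charged first to the letters of `𝒩`, then to those of
`ℳ_γ`. -/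
theorem eOp_pow_mul_mem (𝒞 : ModelCover G) {i : Fin n} (hi : i ≠ 0) {s a b k a' b' : ℕ}
    {Q : TestOp n M} (hQ : Q ∈ G.wordOps hx γ s a b) (hk : k + a + b ≤ a' + b') (ha : a ≤ a')
    (hb : b ≤ b') : m.eOp hx γ ℓ i ^ k * Q ∈ G.wordOps hx γ s a' b' := by
  induction k generalizing a b Q with
  | zero => rw [pow_zero, one_mul]; exact wordSpan_mono le_rfl ha hb hQ
  | succ k ih =>
    rw [pow_succ, mul_assoc]
    by_cases h : b < b'
    · exact ih (m.eOp_mul_mem_small hx γ ℓ 𝒞 hi hQ) (by omega) ha (by omega)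
    · exact ih (m.eOp_mul_mem hx γ ℓ 𝒞 i hQ) (by omega) (by omega) hb

/-- Sublists of the words used in the product estimate stay within the module orders. -/
theorem eWord_mul_mem (𝒞 : ModelCover G) {s a b a' b' : ℕ} {Q : TestOp n M}
    (hQ : Q ∈ G.wordOps hx γ s a b) (ha : a ≤ a') (hb : b ≤ b') {w w' : List (Fin n)}
    (hw : w ∈ tangWords n ((a' - a) + (b' - b)) ∨
      (a + 1 ≤ a' ∧ w ∈ radialWords n ((a' - a) + (b' - b)))) (hs : w'.Sublist w) :
    m.eWord hx γ ℓ w' * Q ∈ G.wordOps hx γ s a' b' := by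
  have htan : w ∈ tangWords n ((a' - a) + (b' - b)) →
      m.eWord hx γ ℓ w' * Q ∈ G.wordOps hx γ s a' b' := by
    rintro (rfl | ⟨i, hi, rfl⟩)
    · rw [List.sublist_nil.1 hs, eWord, one_mul]
      exact wordSpan_mono le_rfl ha hb hQ
    · obtain ⟨k, hk, rfl⟩ := List.sublist_replicate_iff.1 hs
      rw [eWord_replicate]
      exact m.eOp_pow_mul_mem hx γ ℓ 𝒞 hi hQ (by omega) ha hb
  rcases hw with hw | ⟨ha1, hw | hw⟩
  · exact htan hw
  · exact htan hw
  · have key : ∀ k (i : Fin n), (k = 0 ∨ i ≠ 0) → k + 1 + a + b ≤ a' + b' → ∀ t : List (Fin n),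
        t.Sublist [0] →
        m.eWord hx γ ℓ (List.replicate k i ++ t) * Q ∈ G.wordOps hx γ s a' b' := by
      intro k i hi hk t ht
      have h1 : m.eOp hx γ ℓ i ^ k * Q ∈ G.wordOps hx γ s (a' - 1) b' := by
        rcases hi with rfl | hi
        · rw [pow_zero, one_mul]
          exact wordSpan_mono le_rfl (by omega) hb hQ
        · exact m.eOp_pow_mul_mem hx γ ℓ 𝒞 hi hQ (by omega) (by omega) hb
      rw [eWord_append, eWord_replicate, mul_assoc]
      rcases List.sublist_singleton.1 ht with rfl | rfl
      · rw [eWord, one_mul]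
        exact wordSpan_mono le_rfl (Nat.sub_le _ _) le_rfl h1
      · rw [eWord, eWord, one_mul]
        have := m.eOp_mul_mem hx γ ℓ 𝒞 0 h1
        rwa [Nat.sub_add_cancel (by omega)] at this
    rcases hw with rfl | ⟨i, hi, rfl⟩
    · exact key 0 0 (Or.inl rfl) (by omega) w' hs
    · obtain ⟨t₁, t₂, rfl, h1, h2⟩ := List.sublist_append_iff.1 hs
      obtain ⟨k, hk, rfl⟩ := List.sublist_replicate_iff.1 h1
      exact key k i (Or.inr hi) (by omega) t₂ h2

end LocalModel

end Twist

/-! ### The product estimate -/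

section ProductEstimate

open Filter Topology

/-- Finitely many bounds, each with its own constant, hold with a common constant. -/
theorem exists_uniform_of_finite {α : Type*} {S : Set α} (hS : S.Finite) {P : α → ℝ≥0 → Prop}
    (hP : ∀ w C C', C ≤ C' → P w C → P w C') (h : ∀ w ∈ S, ∃ C, P w C) :
    ∃ C, ∀ w ∈ S, P w C := by
  induction S, hS using Set.Finite.induction_on with
  | empty => exact ⟨0, by simp⟩
  | @insert a s _ _ ih =>
    obtain ⟨C, hC⟩ := ih fun w hw => h w (Set.mem_insert_of_mem _ hw)
    obtain ⟨D, hD⟩ := h a (Set.mem_insert _ _)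
    refine ⟨max C D, ?_⟩
    rintro w (rfl | hw)
    · exact hP _ _ _ (le_max_right _ _) hD
    · exact hP _ _ _ (le_max_left _ _) (hC w hw)

variable {n : ℕ} [NeZero n]

theorem tangWords_finite (b : ℕ) : (tangWords n b).Finite := by
  refine ((Set.finite_singleton []).union (Set.finite_range fun i => List.replicate b i)).subset ?_
  rintro w (rfl | ⟨i, -, rfl⟩)
  · exact Or.inl rfl
  · exact Or.inr ⟨i, rfl⟩

theorem radialWords_finite (a : ℕ) : (radialWords n a).Finite := by
  refine (tangWords_finite a).union (((Set.finite_singleton [0]).union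
    (Set.finite_range fun i => List.replicate (a - 1) i ++ [0])).subset ?_)
  rintro w (rfl | ⟨i, -, rfl⟩)
  · exact Or.inl rfl
  · exact Or.inr ⟨i, rfl⟩

variable {M : Type*} [TopologicalSpace M]
  [ChartedSpace (EuclideanHalfSpace n) M] [IsManifold (𝓡∂ n) ∞ M]
  [CompactSpace M] [T2Space M] [MeasurableSpace M] [BorelSpace M]
  {x : M → ℝ} {g : BilinField n M} {G : Generators x g}

namespace LocalModel

variable (m : LocalModel G)

theorem measure_mono_source : (riemannianMeasure g).restrict m.Ψ.source
    ≤ (riemannianMeasure g).restrict ((𝓡∂ n).interior M) :=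
  Measure.restrict_mono m.source_subset_interior le_rfl

theorem lintegral_push_sq (h : M → ℂ) :
    ∫⁻ w, ‖m.push h w‖ₑ ^ 2 = ∫⁻ w in m.Ψ.target, ‖h (m.Ψ.symm w)‖ₑ ^ 2 := by
  rw [← lintegral_indicator m.Ψ.open_target.measurableSet]
  refine lintegral_congr fun w => ?_
  by_cases hw : w ∈ m.Ψ.target
  · rw [m.push_of_mem hw, Set.indicator_of_mem hw]
  · rw [m.push_of_notMem hw, Set.indicator_of_notMem hw]
    simp

theorem sq_rpow_eq {t a b : ℝ} (ht : 0 < t) (h : b = 2 * a) : (t ^ a) ^ 2 = t ^ b := by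
  rw [h, ← Real.rpow_natCast, ← Real.rpow_mul ht.le]
  congr 1
  push_cast
  ring

theorem enorm_sq_le_of_norm {E F : Type*} [NormedAddCommGroup E] [NormedAddCommGroup F] {a b : ℝ}
    {y : E} {z : F} (ha : 0 ≤ a) (hb : 0 ≤ b) (h : a * ‖y‖ ^ 2 ≤ b * ‖z‖ ^ 2) :
    ENNReal.ofReal a * ‖y‖ₑ ^ 2 ≤ ENNReal.ofReal b * ‖z‖ₑ ^ 2 := by
  rw [← ofReal_norm, ← ofReal_norm, ← ENNReal.ofReal_pow (norm_nonneg _),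
    ← ENNReal.ofReal_pow (norm_nonneg _), ← ENNReal.ofReal_mul ha, ← ENNReal.ofReal_mul hb]
  exact ENNReal.ofReal_le_ofReal h

/-- The twist absorbs the weight and the density. -/
theorem eLpNorm_push_le (hx : IsBoundaryDefining n x) (γ ℓ : ℝ) {χ : M → ℂ} {C : ℝ≥0}
    (hC : ∀ p, ‖χ p‖ ≤ C) {f : M → ℂ}
    (hf : AEStronglyMeasurable f ((riemannianMeasure g).restrict ((𝓡∂ n).interior M))) :
    eLpNorm (m.push fun q => χ q * (twist x γ (ℓ + n / 2) q * f q)) 2 volume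
      ≤ (C * NNReal.sqrt (m.lo⁻¹).toNNReal : ℝ≥0) * wNorm n (riemannianMeasure g) x ℓ f := by
  set D : ℝ := C ^ 2 * m.lo⁻¹ with hD
  have hD0 : 0 ≤ D := by have := m.lo_pos; positivity
  set F : M → ℝ≥0∞ := fun q => ENNReal.ofReal D * ‖((x q ^ (-ℓ) : ℝ) : ℂ) * f q‖ₑ ^ 2 with hF
  have hm := aestronglyMeasurable_interior (μ := riemannianMeasure g) (hx.continuousOn_rpow (-ℓ))
  have hFm : AEMeasurable F ((riemannianMeasure g).restrict m.Ψ.source) :=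
    ((((hm.mul hf).mono_measure m.measure_mono_source).enorm.pow_const 2).const_mul _)
  refine (ENNReal.pow_le_pow_left_iff two_ne_zero).1 ?_
  rw [mul_pow, eLpNorm_two_sq, m.lintegral_push_sq]
  have hDe : ((C * NNReal.sqrt (m.lo⁻¹).toNNReal : ℝ≥0) : ℝ≥0∞) ^ 2 = ENNReal.ofReal D := by
    rw [← ENNReal.coe_pow, mul_pow, NNReal.sq_sqrt, ← ENNReal.ofReal_coe_nnreal]
    congr 1
    push_cast
    rw [Real.coe_toNNReal _ (inv_nonneg.2 m.lo_pos.le)]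
  calc ∫⁻ w in m.Ψ.target, ‖χ (m.Ψ.symm w) * (twist x γ (ℓ + n / 2) (m.Ψ.symm w)
        * f (m.Ψ.symm w))‖ₑ ^ 2
      ≤ ∫⁻ w in m.Ψ.target, ENNReal.ofReal (eucDensity g m.Ψ (m.Ψ.symm w)) * F (m.Ψ.symm w) := by
        refine setLIntegral_mono' m.Ψ.open_target.measurableSet fun w hw => ?_
        have hq := m.Ψ.map_target hw
        set q := m.Ψ.symm w
        have hx0 := hx.pos q (m.source_subset_interior hq)
        have hd := m.density_pos q hq
        have h1 : (1 : ℝ) * ‖χ q * (twist x γ (ℓ + n / 2) q * f q)‖ ^ 2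
            ≤ (eucDensity g m.Ψ q * D) * ‖((x q ^ (-ℓ) : ℝ) : ℂ) * f q‖ ^ 2 := by
          rw [norm_mul, norm_mul, norm_mul, norm_twist hx _ _ (m.source_subset_interior hq),
            Complex.norm_real, Real.norm_eq_abs, abs_of_pos (Real.rpow_pos_of_pos hx0 _)]
          simp only [mul_pow]
          rw [sq_rpow_eq hx0 (b := -(2 * ℓ) - n) (by ring), sq_rpow_eq hx0 (b := -(2 * ℓ)) (by ring),
            Real.rpow_sub hx0, Real.rpow_natCast, hD]
          have h2 : (x q ^ n)⁻¹ ≤ eucDensity g m.Ψ q * m.lo⁻¹ := by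
            rw [← div_eq_mul_inv, le_div_iff₀ m.lo_pos, inv_mul_le_iff₀ (by positivity)]
            exact m.density_lower q hq
          calc 1 * (‖χ q‖ ^ 2 * (x q ^ (-(2 * ℓ)) / x q ^ n * ‖f q‖ ^ 2))
              = ‖χ q‖ ^ 2 * ((x q ^ n)⁻¹ * (x q ^ (-(2 * ℓ)) * ‖f q‖ ^ 2)) := by ring
            _ ≤ (C : ℝ) ^ 2 * ((eucDensity g m.Ψ q * m.lo⁻¹) * (x q ^ (-(2 * ℓ)) * ‖f q‖ ^ 2)) := by
                have h3 := Real.rpow_pos_of_pos hx0 (-(2 * ℓ))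
                gcongr
                exact hC q
            _ = _ := by ring
        have h4 := enorm_sq_le_of_norm zero_le_one (by positivity) h1
        rw [ENNReal.ofReal_one, one_mul, ENNReal.ofReal_mul hd.le, mul_assoc] at h4
        exact h4
    _ = ∫⁻ q in m.Ψ.source, F q ∂(riemannianMeasure g) := (m.setLIntegral_source hFm).symm
    _ ≤ ∫⁻ q in (𝓡∂ n).interior M, F q ∂(riemannianMeasure g) :=
        lintegral_mono_set m.source_subset_interior
    _ = _ := by
        rw [hDe, wNorm, eLpNorm_two_sq, lintegral_const_mul']
        exact ENNReal.ofReal_ne_top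

/-- The twists of two functions absorb the weight and the density of their product. -/
theorem wNorm_mul_le_push (hx : IsBoundaryDefining n x) (γ₁ γ₂ ℓ₁ ℓ₂ : ℝ) {χ : M → ℂ}
    (hχU : tsupport χ ⊆ m.U) (hχ : ∀ p, SmoothAt n χ p) {f h : M → ℂ}
    (hf : AEStronglyMeasurable f ((riemannianMeasure g).restrict ((𝓡∂ n).interior M)))
    (hh : AEStronglyMeasurable h ((riemannianMeasure g).restrict ((𝓡∂ n).interior M))) :
    wNorm n (riemannianMeasure g) x (ℓ₁ + ℓ₂ + n / 2) (fun q => χ q ^ 2 * (f q * h q))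
      ≤ (NNReal.sqrt |m.hi|.toNNReal : ℝ≥0) *
        eLpNorm (fun w => m.push (fun q => χ q * (twist x γ₁ (ℓ₁ + n / 2) q * f q)) w *
          m.push (fun q => χ q * (twist x γ₂ (ℓ₂ + n / 2) q * h q)) w) 2 volume := by
  set L := ℓ₁ + ℓ₂ + n / 2 with hL
  set F : M → ℝ≥0∞ := fun q => ‖((x q ^ (-L) : ℝ) : ℂ) * (χ q ^ 2 * (f q * h q))‖ₑ ^ 2 with hF
  have hm := aestronglyMeasurable_interior (μ := riemannianMeasure g) (hx.continuousOn_rpow (-L))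
  have hχm := aestronglyMeasurable_interior (n := n) (μ := riemannianMeasure g)
    (f := χ) fun p _ => (hχ p).continuousAt.continuousWithinAt
  have hFm : AEMeasurable F ((riemannianMeasure g).restrict m.Ψ.source) :=
    (((hm.mul ((hχm.pow 2).mul (hf.mul hh))).mono_measure m.measure_mono_source).enorm.pow_const 2)
  refine (ENNReal.pow_le_pow_left_iff two_ne_zero).1 ?_
  have hDe : ((NNReal.sqrt |m.hi|.toNNReal : ℝ≥0) : ℝ≥0∞) ^ 2 = ENNReal.ofReal |m.hi| := by
    rw [← ENNReal.coe_pow, NNReal.sq_sqrt]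
    rfl
  simp only [← m.push_mul]
  rw [mul_pow, hDe, eLpNorm_two_sq, m.lintegral_push_sq, wNorm, eLpNorm_two_sq]
  calc ∫⁻ q in (𝓡∂ n).interior M, F q ∂(riemannianMeasure g)
      = ∫⁻ q in m.Ψ.source, F q ∂(riemannianMeasure g) := by
        rw [← lintegral_indicator isOpen_interior.measurableSet,
          ← lintegral_indicator m.Ψ.open_source.measurableSet]
        refine lintegral_congr fun q => ?_
        by_cases hq : q ∈ m.Ψ.source
        · rw [Set.indicator_of_mem hq, Set.indicator_of_mem (m.source_subset_interior hq)]
        · rw [Set.indicator_of_notMem hq]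
          by_cases hi : q ∈ (𝓡∂ n).interior M
          · rw [Set.indicator_of_mem hi]
            have : χ q = 0 := image_eq_zero_of_notMem_tsupport fun h' =>
              hq ((m.mem_source q).2 ⟨hχU h', hi⟩)
            simp [hF, this]
          · rw [Set.indicator_of_notMem hi]
    _ = ∫⁻ w in m.Ψ.target, ENNReal.ofReal (eucDensity g m.Ψ (m.Ψ.symm w)) * F (m.Ψ.symm w) :=
        m.setLIntegral_source hFm
    _ ≤ ∫⁻ w in m.Ψ.target, ENNReal.ofReal |m.hi| *
          ‖χ (m.Ψ.symm w) * (twist x γ₁ (ℓ₁ + n / 2) (m.Ψ.symm w) * f (m.Ψ.symm w)) *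
            (χ (m.Ψ.symm w) * (twist x γ₂ (ℓ₂ + n / 2) (m.Ψ.symm w) * h (m.Ψ.symm w)))‖ₑ ^ 2 := by
        refine setLIntegral_mono' m.Ψ.open_target.measurableSet fun w hw => ?_
        have hq := m.Ψ.map_target hw
        set q := m.Ψ.symm w
        have hi := m.source_subset_interior hq
        have hx0 := hx.pos q hi
        refine enorm_sq_le_of_norm (m.density_pos q hq).le (abs_nonneg _) ?_
        simp only [norm_mul, norm_pow, norm_twist hx _ _ hi, Complex.norm_real, Real.norm_eq_abs,
          abs_of_pos (Real.rpow_pos_of_pos hx0 _), mul_pow]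
        rw [sq_rpow_eq hx0 (a := -(ℓ₁ + n / 2)) (b := -(2 * ℓ₁) - n) (by ring),
          sq_rpow_eq hx0 (a := -(ℓ₂ + n / 2)) (b := -(2 * ℓ₂) - n) (by ring),
          sq_rpow_eq hx0 (a := -L) (b := -(2 * ℓ₁) - n + (-(2 * ℓ₂) - n) + n) (by rw [hL]; ring),
          Real.rpow_add hx0, Real.rpow_add hx0, Real.rpow_natCast]
        have h1 := m.density_upper q hq
        have h2 : x q ^ n * eucDensity g m.Ψ q ≤ |m.hi| := h1.trans (le_abs_self _)
        calc _ = (x q ^ n * eucDensity g m.Ψ q) * ((x q ^ (-(2 * ℓ₁) - n : ℝ)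
              * x q ^ (-(2 * ℓ₂) - n : ℝ)) * ((‖χ q‖ ^ 2) ^ 2 * (‖f q‖ ^ 2 * ‖h q‖ ^ 2))) := by ring
          _ ≤ |m.hi| * ((x q ^ (-(2 * ℓ₁) - n : ℝ)
              * x q ^ (-(2 * ℓ₂) - n : ℝ)) * ((‖χ q‖ ^ 2) ^ 2 * (‖f q‖ ^ 2 * ‖h q‖ ^ 2))) := by
              have h3 := Real.rpow_pos_of_pos hx0 (-(2 * ℓ₁) - n)
              have h4 := Real.rpow_pos_of_pos hx0 (-(2 * ℓ₂) - n)
              gcongr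
          _ = _ := by ring
    _ = _ := by
        rw [lintegral_const_mul' _ _ ENNReal.ofReal_ne_top]

/-- Module regularity bounds the iterated weak derivatives of the localized and twisted function. -/
theorem exists_weakSobolev (hμ : FiniteInside n (riemannianMeasure g)) (hx : IsBoundaryDefining n x)
    (hV : ∀ j, HasTranspose (riemannianMeasure g) (fieldOp (G.field j) (G.field_smooth j)))
    (γ ℓ : ℝ) {s a b : ℕ} (w : List (Fin n)) {χ : M → ℂ} (hχ : ∀ p, SmoothAt n χ p)
    (hχU : tsupport χ ⊆ m.U) {Q : TestOp n M}
    (hQ : ∀ w' : List (Fin n), w'.Sublist w →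
      m.eWord hx γ (ℓ + n / 2) w' * Q ∈ G.wordOps hx γ s a b) :
    ∃ C : ℝ≥0, ∀ (u f : M → ℂ) (N : ℝ≥0), G.ModuleBound hx (riemannianMeasure g) γ ℓ s a b u N →
      WeakAct (riemannianMeasure g) Q u f →
      WeakSobolev w (m.push fun q => χ q * (twist x γ (ℓ + n / 2) q * f q)) (C * N : ℝ≥0) := by
  have base : ∀ {χ : M → ℂ}, (∀ p, SmoothAt n χ p) → ∀ {Q : TestOp n M}, Q ∈ G.wordOps hx γ s a b →
      ∃ C : ℝ≥0, ∀ (u f : M → ℂ) (N : ℝ≥0), G.ModuleBound hx (riemannianMeasure g) γ ℓ s a b u N →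
      WeakAct (riemannianMeasure g) Q u f →
      MemLp (m.push fun q => χ q * (twist x γ (ℓ + n / 2) q * f q)) 2 volume ∧
      eLpNorm (m.push fun q => χ q * (twist x γ (ℓ + n / 2) q * f q)) 2 volume
        ≤ (C * N : ℝ≥0) := by
    intro χ hχ Q hQ
    obtain ⟨B, hB⟩ := exists_bound_of_smooth hχ
    obtain ⟨hQt, C, hC⟩ := G.hasTranspose_and_exists_weakBound hx hμ hV ℓ hQ
    refine ⟨B * NNReal.sqrt (m.lo⁻¹).toNNReal * C, fun u f N hu hf => ?_⟩
    have h1 := (m.eLpNorm_push_le hx γ ℓ hB hf.aestronglyMeasurable).trans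
      (mul_le_mul_right ((hC u N hu).wNorm_le hQt hf) _)
    have h2 : eLpNorm (m.push fun q => χ q * (twist x γ (ℓ + n / 2) q * f q)) 2 volume
        ≤ (B * NNReal.sqrt (m.lo⁻¹).toNNReal * C * N : ℝ≥0) := by
      refine h1.trans (le_of_eq ?_)
      push_cast
      ring
    refine ⟨⟨m.aestronglyMeasurable_push ?_, h2.trans_lt ENNReal.coe_lt_top⟩, h2⟩
    exact (m.aestronglyMeasurable_of_intSmooth fun p _ => hχ p).mul
      ((m.aestronglyMeasurable_of_intSmooth (twist_intSmooth hx _ _)).mul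
        (hf.aestronglyMeasurable.mono_measure m.measure_mono_source))
  induction w generalizing χ Q with
  | nil =>
    have := hQ [] (List.Sublist.refl _)
    rw [eWord, one_mul] at this
    exact base hχ this
  | cons i w ih =>
    have hQ0 : Q ∈ G.wordOps hx γ s a b := by
      have := hQ [] (List.nil_sublist _)
      rwa [eWord, one_mul] at this
    obtain ⟨C₁, h₁⟩ := base hχ hQ0
    obtain ⟨C₂, h₂⟩ := ih hχ hχU (Q := m.eOp hx γ (ℓ + n / 2) i * Q) fun w' hw' => by
      have := hQ (i :: w') (hw'.cons_cons i)
      rwa [eWord, mul_assoc] at this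
    obtain ⟨C₃, h₃⟩ := ih (m.dv_smoothAt i hχ) ((m.tsupport_dv_subset i χ).trans hχU) (Q := Q)
      fun w' hw' => hQ w' (hw'.cons i)
    have hQ1 : m.eOp hx γ (ℓ + n / 2) i * Q ∈ G.wordOps hx γ s a b := by
      have := hQ [i] (List.singleton_sublist.2 (List.mem_cons_self))
      rwa [eWord, eWord, one_mul] at this
    obtain ⟨-, C₄, h₄⟩ := G.hasTranspose_and_exists_weakBound hx hμ hV ℓ hQ1
    have hQt := (G.hasTranspose_and_exists_weakBound hx hμ hV ℓ hQ0).1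
    refine ⟨C₁ + (C₂ + C₃), fun u f N hu hf => ?_⟩
    obtain ⟨h, hh, -⟩ := h₄ u N hu
    have hle : ((C₁ * N : ℝ≥0) : ℝ≥0∞) ≤ ((C₁ + (C₂ + C₃)) * N : ℝ≥0) := by
      exact_mod_cast mul_le_mul_left (le_add_of_nonneg_right (zero_le)) N
    have hle' : ((C₂ * N : ℝ≥0) : ℝ≥0∞) + ((C₃ * N : ℝ≥0) : ℝ≥0∞)
        ≤ ((C₁ + (C₂ + C₃)) * N : ℝ≥0) := by
      rw [← ENNReal.coe_add, ← add_mul]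
      exact_mod_cast mul_le_mul_left (le_add_of_nonneg_left (zero_le)) N
    refine ⟨⟨(h₁ u f N hu hf).1, (h₁ u f N hu hf).2.trans hle⟩, _,
      m.weakDeriv_push hμ hx (twist_intSmooth hx γ (ℓ + n / 2)) (m.twistCoeff_intSmooth hx _ _ i)
        (fun q hq => m.dv_twist hx _ _ i (m.source_subset_interior hq)) hχ hχU
        (hh.cancel hQt hf), ?_⟩
    have h5 := ((h₂ u h N hu hh).add (h₃ u f N hu hf)).mono hle'
    convert h5 using 1
    funext w
    exact m.push_add _ _ w

end LocalModel

end ProductEstimate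

section ProductBound

open Filter Topology

variable {n : ℕ} [NeZero n] {M : Type*} [TopologicalSpace M]
  [ChartedSpace (EuclideanHalfSpace n) M] [IsManifold (𝓡∂ n) ∞ M]
  [CompactSpace M] [T2Space M] [MeasurableSpace M] [BorelSpace M]
  {x : M → ℝ} {g : BilinField n M} {G : Generators x g}

/-- The product estimate in one model. The first factor is the one with a radial derivative
to spare. -/
theorem LocalModel.exists_product_bound (m : LocalModel G) (𝒞 : ModelCover G)
    (hμ : FiniteInside n (riemannianMeasure g))
    (hx : IsBoundaryDefining n x)
    (hV : ∀ j, HasTranspose (riemannianMeasure g) (fieldOp (G.field j) (G.field_smooth j)))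
    (γ₁ γ₂ ℓ₁ ℓ₂ : ℝ) {s κ k a₁ a₂ b₁ b₂ : ℕ} (hk : n ≤ 2 * k + 1) (ha : a₁ + a₂ ≤ κ)
    (ha₁ : a₁ + 1 ≤ κ) (hb : b₁ + b₂ ≤ k) {Q₁ Q₂ : TestOp n M} (hQ₁ : Q₁ ∈ G.wordOps hx γ₁ s a₁ b₁)
    (hQ₂ : Q₂ ∈ G.wordOps hx γ₂ s a₂ b₂) {χ : M → ℂ} (hχ : ∀ p, SmoothAt n χ p)
    (hχU : tsupport χ ⊆ m.U) :
    ∃ C : ℝ≥0, ∀ (u v f h : M → ℂ) (N N' : ℝ≥0),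
      G.ModuleBound hx (riemannianMeasure g) γ₁ ℓ₁ s κ k u N →
      G.ModuleBound hx (riemannianMeasure g) γ₂ ℓ₂ s κ k v N' →
      WeakAct (riemannianMeasure g) Q₁ u f → WeakAct (riemannianMeasure g) Q₂ v h →
      wNorm n (riemannianMeasure g) x (ℓ₁ + ℓ₂ + n / 2) (fun q => χ q ^ 2 * (f q * h q))
        ≤ (C * (N * N') : ℝ≥0) := by
  -- the orders left to the two factors add up to at least `κ + k ≥ (n + 1) / 2`
  obtain ⟨C₀, h₀⟩ := exists_bilinear_weak (n := n) (a := (κ - a₁) + (k - b₁))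
    (b := (κ - a₂) + (k - b₂)) (by omega) (by omega)
  obtain ⟨C₁, h₁⟩ := exists_uniform_of_finite (radialWords_finite (n := n) ((κ - a₁) + (k - b₁)))
    (P := fun w C => ∀ (u f : M → ℂ) (N : ℝ≥0), G.ModuleBound hx (riemannianMeasure g) γ₁ ℓ₁ s κ k u N →
      WeakAct (riemannianMeasure g) Q₁ u f →
      WeakSobolev w (m.push fun q => χ q * (twist x γ₁ (ℓ₁ + n / 2) q * f q)) (C * N : ℝ≥0))
    (fun w C C' hC h u f N hu hf => (h u f N hu hf).mono
      (by exact_mod_cast mul_le_mul_left hC N))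
    fun w hw => m.exists_weakSobolev hμ hx hV γ₁ ℓ₁ w hχ hχU fun w' hw' =>
      m.eWord_mul_mem hx γ₁ _ 𝒞 hQ₁ (by omega) (by omega) (Or.inr ⟨ha₁, hw⟩) hw'
  obtain ⟨C₂, h₂⟩ := exists_uniform_of_finite (tangWords_finite (n := n) ((κ - a₂) + (k - b₂)))
    (P := fun w C => ∀ (u f : M → ℂ) (N : ℝ≥0), G.ModuleBound hx (riemannianMeasure g) γ₂ ℓ₂ s κ k u N →
      WeakAct (riemannianMeasure g) Q₂ u f →
      WeakSobolev w (m.push fun q => χ q * (twist x γ₂ (ℓ₂ + n / 2) q * f q)) (C * N : ℝ≥0))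
    (fun w C C' hC h u f N hu hf => (h u f N hu hf).mono
      (by exact_mod_cast mul_le_mul_left hC N))
    fun w hw => m.exists_weakSobolev hμ hx hV γ₂ ℓ₂ w hχ hχU fun w' hw' =>
      m.eWord_mul_mem hx γ₂ _ 𝒞 hQ₂ (by omega) (by omega) (Or.inl hw) hw'
  have hsupp : ∀ (H : M → ℂ) (z : Euc n), m.push H z ≠ 0 → ∀ i, i ≠ 0 → |z i| ≤ m.rad := by
    intro H z hz i hi
    have hzt : z ∈ m.Ψ.target := by
      by_contra h
      exact hz (m.push_of_notMem h)
    have := m.coord_le _ (m.Ψ.map_target hzt) i hi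
    rwa [m.Ψ.right_inv hzt] at this
  refine ⟨NNReal.sqrt |m.hi|.toNNReal * (C₀ * (C₁ * C₂)), fun u v f h N N' hu hv hf hh => ?_⟩
  refine (m.wNorm_mul_le_push hx γ₁ γ₂ ℓ₁ ℓ₂ hχU hχ hf.aestronglyMeasurable
    hh.aestronglyMeasurable).trans ?_
  refine (mul_le_mul_right (h₀ _ _ _ _ m.rad (fun w hw => h₁ w hw u f N hu hf)
    (fun w hw => h₂ w hw v h N' hv hh) (hsupp _) (hsupp _)) _).trans (le_of_eq ?_)
  push_cast
  ring

/-- The squares of the partition of unity do not sum to `1`, but are bounded below by `1 / N`. -/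
theorem ModelCover.one_le_norm_sum (𝒞 : ModelCover G) (p : M) :
    1 ≤ (𝒞.N : ℝ) * ‖∑ k, 𝒞.part k p ^ 2‖ := by
  have h1 : (∑ k, 𝒞.part k p ^ 2) = ((∑ k, 𝒞.χ k p ^ 2 : ℝ) : ℂ) := by
    push_cast
    rfl
  rw [h1, Complex.norm_real, Real.norm_eq_abs, abs_of_nonneg (by positivity)]
  have h2 := sq_sum_le_card_mul_sum_sq (s := Finset.univ) (f := fun k => 𝒞.χ k p)
  rw [𝒞.χ_sum] at h2
  simpa using h2

/-- The product estimate: the orders of the two factors add up to at most those of the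
module. -/
theorem exists_product_bound (𝒞 : ModelCover G) (hμ : FiniteInside n (riemannianMeasure g))
    (hx : IsBoundaryDefining n x)
    (hV : ∀ j, HasTranspose (riemannianMeasure g) (fieldOp (G.field j) (G.field_smooth j)))
    (γ₁ γ₂ ℓ₁ ℓ₂ : ℝ) {s κ k a₁ a₂ b₁ b₂ : ℕ} (hk : n ≤ 2 * k + 1) (hκ : 1 ≤ κ) (ha : a₁ + a₂ ≤ κ)
    (hb : b₁ + b₂ ≤ k) {Q₁ Q₂ : TestOp n M} (hQ₁ : Q₁ ∈ G.wordOps hx γ₁ s a₁ b₁)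
    (hQ₂ : Q₂ ∈ G.wordOps hx γ₂ s a₂ b₂) :
    ∃ C : ℝ≥0, ∀ (u v f h : M → ℂ) (N N' : ℝ≥0),
      G.ModuleBound hx (riemannianMeasure g) γ₁ ℓ₁ s κ k u N →
      G.ModuleBound hx (riemannianMeasure g) γ₂ ℓ₂ s κ k v N' →
      WeakAct (riemannianMeasure g) Q₁ u f → WeakAct (riemannianMeasure g) Q₂ v h →
      wNorm n (riemannianMeasure g) x (ℓ₁ + ℓ₂ + n / 2) (fun q => f q * h q)
        ≤ (C * (N * N') : ℝ≥0) := by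
  have key : ∀ t : Fin 𝒞.N, ∃ C : ℝ≥0, ∀ (u v f h : M → ℂ) (N N' : ℝ≥0),
      G.ModuleBound hx (riemannianMeasure g) γ₁ ℓ₁ s κ k u N →
      G.ModuleBound hx (riemannianMeasure g) γ₂ ℓ₂ s κ k v N' →
      WeakAct (riemannianMeasure g) Q₁ u f → WeakAct (riemannianMeasure g) Q₂ v h →
      wNorm n (riemannianMeasure g) x (ℓ₁ + ℓ₂ + n / 2) (fun q => 𝒞.part t q ^ 2 * (f q * h q))
        ≤ (C * (N * N') : ℝ≥0) := by
    intro t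
    -- one of the two factors has a letter of `ℳ_γ` to spare, as `a₁ + a₂ ≤ κ` and `1 ≤ κ`
    by_cases ha₁ : a₁ + 1 ≤ κ
    · exact (𝒞.model t).exists_product_bound 𝒞 hμ hx hV γ₁ γ₂ ℓ₁ ℓ₂ hk ha ha₁ hb hQ₁ hQ₂
        (𝒞.part_smoothAt t) (𝒞.tsupport_part t)
    · obtain ⟨C, hC⟩ := (𝒞.model t).exists_product_bound 𝒞 hμ hx hV γ₂ γ₁ ℓ₂ ℓ₁ hk
        (by omega : a₂ + a₁ ≤ κ) (by omega) (by omega : b₂ + b₁ ≤ k) hQ₂ hQ₁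
        (𝒞.part_smoothAt t) (𝒞.tsupport_part t)
      refine ⟨C, fun u v f h N N' hu hv hf hh => ?_⟩
      have := hC v u h f N' N hv hu hh hf
      rw [mul_comm N, add_comm ℓ₁]
      simpa only [mul_comm (f _)] using this
  choose C hC using key
  refine ⟨𝒞.N * ∑ t, C t, fun u v f h N N' hu hv hf hh => ?_⟩
  set L := ℓ₁ + ℓ₂ + n / 2 with hL
  have hm := aestronglyMeasurable_interior (μ := riemannianMeasure g) (hx.continuousOn_rpow (-L))
  have hfm := hf.aestronglyMeasurable
  have hhm := hh.aestronglyMeasurable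
  have hterm : ∀ t, AEStronglyMeasurable (fun q => ((x q ^ (-L) : ℝ) : ℂ) *
      (𝒞.part t q ^ 2 * (f q * h q))) ((riemannianMeasure g).restrict ((𝓡∂ n).interior M)) :=
    fun t => hm.mul (((aestronglyMeasurable_interior fun p _ =>
      (𝒞.part_smoothAt t p).continuousAt.continuousWithinAt).pow 2).mul (hfm.mul hhm))
  calc wNorm n (riemannianMeasure g) x L (fun q => f q * h q)
      ≤ (𝒞.N : ℝ≥0) • eLpNorm (∑ t, fun q => ((x q ^ (-L) : ℝ) : ℂ) *
          (𝒞.part t q ^ 2 * (f q * h q))) 2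
          ((riemannianMeasure g).restrict ((𝓡∂ n).interior M)) := by
        refine eLpNorm_le_nnreal_smul_eLpNorm_of_ae_le_mul (Eventually.of_forall fun q => ?_) 2
        rw [← NNReal.coe_le_coe]
        push_cast
        have h1 : (∑ t, fun q => ((x q ^ (-L) : ℝ) : ℂ) * (𝒞.part t q ^ 2 * (f q * h q))) q
            = (∑ t, 𝒞.part t q ^ 2) * (((x q ^ (-L) : ℝ) : ℂ) * (f q * h q)) := by
          rw [Finset.sum_apply, Finset.sum_mul]
          exact Finset.sum_congr rfl fun t _ => by ring
        rw [h1, norm_mul (∑ t, 𝒞.part t q ^ 2)]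
        have h2 := mul_le_mul_of_nonneg_right (𝒞.one_le_norm_sum q)
          (norm_nonneg (((x q ^ (-L) : ℝ) : ℂ) * (f q * h q)))
        rwa [one_mul, mul_assoc] at h2
    _ ≤ (𝒞.N : ℝ≥0) • ∑ t, ((C t * (N * N') : ℝ≥0) : ℝ≥0∞) := by
        simp only [ENNReal.smul_def, smul_eq_mul]
        refine mul_le_mul_right ?_ _
        refine (eLpNorm_sum_le (fun t _ => hterm t) one_le_two).trans ?_
        exact Finset.sum_le_sum fun t _ => hC t u v f h N N' hu hv hf hh
    _ = _ := by
        rw [ENNReal.smul_def, smul_eq_mul, ← ENNReal.ofNNReal_finsetSum, ← ENNReal.coe_mul,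
          ← Finset.sum_mul, mul_assoc]

end ProductBound

/-! ### The Leibniz rule for weak actions -/

section Leibniz

open Filter Topology

variable {n : ℕ} [NeZero n] {M : Type*} [TopologicalSpace M]
  [ChartedSpace (EuclideanHalfSpace n) M] [IsManifold (𝓡∂ n) ∞ M]
  [CompactSpace M] [T2Space M] [MeasurableSpace M] [BorelSpace M]
  {x : M → ℝ} {g : BilinField n M} {G : Generators x g} {μ : Measure M}

theorem WeakAct.sum (hμ : FiniteInside n μ) {ι : Type*} {s : Finset ι} {Q : ι → TestOp n M}
    {u : M → ℂ} {f : ι → M → ℂ} (hu : LocallyIntegrableOn u ((𝓡∂ n).interior M) μ)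
    (hQ : ∀ i ∈ s, HasTranspose μ (Q i)) (h : ∀ i ∈ s, WeakAct μ (Q i) u (f i)) :
    WeakAct μ (∑ i ∈ s, Q i) u fun p => ∑ i ∈ s, f i p := by
  classical
  induction s using Finset.induction_on with
  | empty => simpa using weakAct_zero hμ hu
  | insert i s his ih =>
    simp only [Finset.sum_insert his]
    exact (h i (Finset.mem_insert_self i s)).add hμ (hQ i (Finset.mem_insert_self i s))
      (HasTranspose.sum hμ fun k hk => hQ k (Finset.mem_insert_of_mem hk))
      (ih (fun k hk => hQ k (Finset.mem_insert_of_mem hk))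
        fun k hk => h k (Finset.mem_insert_of_mem hk))

/-- Weighted square integrability, with some weight. -/
def SqWeighted (μ : Measure M) (x : M → ℝ) (f : M → ℂ) : Prop :=
  AEStronglyMeasurable f (μ.restrict ((𝓡∂ n).interior M)) ∧ ∃ ℓ : ℝ, wNorm n μ x ℓ f < ⊤

/-- Weights do not matter on compact subsets of the interior. -/
theorem SqWeighted.locallyIntegrableOn_mul (hx : IsBoundaryDefining n x) {f h : M → ℂ}
    (hf : SqWeighted (n := n) μ x f) (hh : SqWeighted (n := n) μ x h) :
    LocallyIntegrableOn (fun p => f p * h p) ((𝓡∂ n).interior M) μ := by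
  obtain ⟨hfm, a, ha⟩ := hf
  obtain ⟨hhm, b, hb⟩ := hh
  have hma := aestronglyMeasurable_interior (μ := μ) (hx.continuousOn_rpow (-a))
  have hmb := aestronglyMeasurable_interior (μ := μ) (hx.continuousOn_rpow (-b))
  have h1 : Integrable _ (μ.restrict ((𝓡∂ n).interior M)) :=
    MemLp.integrable_mul (p := 2) (q := 2) ⟨hma.mul hfm, ha⟩ ⟨hmb.mul hhm, hb⟩
  rw [locallyIntegrableOn_interior_iff]
  intro K hK hKc
  have h2 : IntegrableOn _ K μ := h1.mono_measure (Measure.restrict_mono hK le_rfl)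
  have h3 := h2.continuousOn_mul (((hx.continuousOn_rpow a).mul (hx.continuousOn_rpow b)).mono hK) hKc
  refine h3.congr_fun (fun p hp => ?_) hKc.measurableSet
  have h0 := hx.pos p (hK hp)
  have h4 : ∀ t : ℝ, ((x p ^ t : ℝ) : ℂ) * ((x p ^ (-t) : ℝ) : ℂ) = 1 := fun t => by
    rw [← Complex.ofReal_mul, ← Real.rpow_add h0, add_neg_cancel, Real.rpow_zero,
      Complex.ofReal_one]
  change ((x p ^ a : ℝ) : ℂ) * ((x p ^ b : ℝ) : ℂ) * (((x p ^ (-a) : ℝ) : ℂ) * f p *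
    (((x p ^ (-b) : ℝ) : ℂ) * h p)) = f p * h p
  linear_combination (((x p ^ b : ℝ) : ℂ) * ((x p ^ (-b) : ℝ) : ℂ) * f p * h p) * h4 a
    + f p * h p * h4 b

theorem SqWeighted.add (hx : IsBoundaryDefining n x) {f h : M → ℂ}
    (hf : SqWeighted (n := n) μ x f) (hh : SqWeighted (n := n) μ x h) :
    SqWeighted (n := n) μ x fun p => f p + h p := by
  obtain ⟨hfm, a, ha⟩ := hf
  obtain ⟨hhm, b, hb⟩ := hh
  obtain ⟨B, hB⟩ := exists_bound_of_smooth hx.smoothAt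
  -- a smaller power of `x` is a weaker weight, as `x` is bounded
  have key : ∀ {c : ℝ} {f : M → ℂ}, min a b ≤ c → wNorm n μ x c f < ⊤ →
      wNorm n μ x (min a b) f < ⊤ := by
    intro c f hc hf
    have h1 : wNorm n μ x (min a b) f ≤ (B ^ (c - min a b) : ℝ≥0) * wNorm n μ x c f := by
      refine eLpNorm_le_nnreal_smul_eLpNorm_of_ae_le_mul (ae_restrict_interior fun p hp => ?_) 2
      have h0 := hx.pos p hp
      have hxB : x p ≤ B := by
        have := hB p
        rwa [Complex.norm_real, Real.norm_eq_abs, abs_of_pos h0] at this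
      rw [← NNReal.coe_le_coe]
      push_cast
      rw [norm_mul, norm_mul, Complex.norm_real, Complex.norm_real, Real.norm_eq_abs,
        Real.norm_eq_abs, abs_of_pos (Real.rpow_pos_of_pos h0 _),
        abs_of_pos (Real.rpow_pos_of_pos h0 _), ← mul_assoc]
      gcongr
      calc x p ^ (-min a b) = x p ^ (c - min a b) * x p ^ (-c) := by
            rw [← Real.rpow_add h0]; ring_nf
        _ ≤ (B : ℝ) ^ (c - min a b) * x p ^ (-c) := by
            have := Real.rpow_pos_of_pos h0 (-c)
            have h2 : 0 ≤ c - min a b := sub_nonneg.2 hc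
            gcongr
    exact h1.trans_lt (ENNReal.mul_lt_top ENNReal.coe_lt_top hf)
  exact ⟨hfm.add hhm, min a b, (wNorm_add_le hx hfm hhm).trans_lt
    (ENNReal.add_lt_top.2 ⟨key (min_le_left _ _) ha, key (min_le_right _ _) hb⟩)⟩

theorem SqWeighted.smooth_mul {a f : M → ℂ} (ha : ∀ p, SmoothAt n a p)
    (hf : SqWeighted (n := n) μ x f) : SqWeighted (n := n) μ x fun p => a p * f p := by
  obtain ⟨hfm, ℓ, hℓ⟩ := hf
  obtain ⟨B, hB⟩ := exists_bound_of_smooth ha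
  exact ⟨(aestronglyMeasurable_interior fun p _ => (ha p).continuousAt.continuousWithinAt).mul hfm, ℓ,
    (wNorm_mul_le fun p _ => hB p).trans_lt (ENNReal.mul_lt_top ENNReal.coe_lt_top hℓ)⟩

theorem SqWeighted.sum (hx : IsBoundaryDefining n x) {ι : Type*} {s : Finset ι} {f : ι → M → ℂ}
    (h : ∀ i ∈ s, SqWeighted (n := n) μ x (f i)) :
    SqWeighted (n := n) μ x fun p => ∑ i ∈ s, f i p := by
  classical
  induction s using Finset.induction_on with
  | empty =>
    refine ⟨?_, 0, ?_⟩
    · simpa using aestronglyMeasurable_const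
    · simp [wNorm]
  | insert i s his ih =>
    simp only [Finset.sum_insert his]
    exact (h i (Finset.mem_insert_self i s)).add hx (ih fun k hk => h k (Finset.mem_insert_of_mem hk))

namespace LocalModel

variable (m : LocalModel G)

theorem exists_cutoff {φ : testSpace n M} (hU : tsupport φ.1 ⊆ m.U) : ∃ χ : testSpace n M,
    tsupport χ.1 ⊆ m.U ∧ ∀ p ∈ tsupport φ.1, ∀ᶠ q in 𝓝 p, χ.1 q = 1 := by
  have := (𝓡∂ n).secondCountableTopology
  have hs := m.tsupport_subset_source hU
  obtain ⟨f, hf0, hf1, -⟩ := exists_contMDiffMap_zero_one_nhds_of_isClosed (𝓡∂ n) (n := ⊤)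
    m.Ψ.open_source.isClosed_compl (isClosed_tsupport φ.1)
    (Set.disjoint_left.2 fun q hq hq' => hq (hs hq'))
  have hsupp : tsupport (fun q => (f q : ℂ)) ⊆ m.Ψ.source := by
    intro q hq
    by_contra hqs
    refine (notMem_tsupport_iff_eventuallyEq.2 ?_) hq
    filter_upwards [(eventually_nhdsSet_iff_forall.1 hf0) q hqs] with r hr
    simp [hr]
  refine ⟨⟨fun q => (f q : ℂ), fun p => SmoothAt.ofReal (f.contMDiff p),
    hsupp.trans m.source_subset_interior⟩, fun q hq => ((m.mem_source q).1 (hsupp hq)).1,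
    fun p hp => ?_⟩
  filter_upwards [(eventually_nhdsSet_iff_forall.1 hf1) p hp] with r hr
  simp [hr]

/-- The cutoff has compact support in the interior, where all weights are comparable. -/
theorem memLp_push (hx : IsBoundaryDefining n x) {χ : testSpace n M} {f : M → ℂ}
    (hf : SqWeighted (n := n) (riemannianMeasure g) x f) :
    MemLp (m.push fun q => χ.1 q * f q) 2 volume := by
  obtain ⟨hfm, ℓ, hℓ⟩ := hf
  have hne : ∀ q, twist x 0 (ℓ + n / 2) q ≠ 0 := fun q => Complex.exp_ne_zero _
  have ht : IsTest (n := n) fun q => (twist x 0 (ℓ + n / 2) q)⁻¹ * χ.1 q :=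
    isTest_mul (fun p hp => (twist_intSmooth hx 0 _ p hp).inv (hne p)) χ.2
  obtain ⟨C, hC⟩ := exists_bound_of_smooth ht.1
  have h1 := m.eLpNorm_push_le hx 0 ℓ hC hfm
  have h2 : (fun q => (twist x 0 (ℓ + n / 2) q)⁻¹ * χ.1 q * (twist x 0 (ℓ + n / 2) q * f q))
      = fun q => χ.1 q * f q := by
    funext q
    have := hne q
    generalize twist x 0 (ℓ + n / 2) q = t at this
    field_simp
  rw [h2] at h1
  refine ⟨m.aestronglyMeasurable_push ?_, h1.trans_lt (ENNReal.mul_lt_top ENNReal.coe_lt_top hℓ)⟩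
  exact (m.aestronglyMeasurable_of_intSmooth fun p _ => testSpace_smoothAt χ p).mul
    (hfm.mono_measure m.measure_mono_source)

theorem weakDeriv_push_dvOp (hμ : FiniteInside n (riemannianMeasure g))
    (hx : IsBoundaryDefining n x) {χ : testSpace n M} (hχU : tsupport χ.1 ⊆ m.U) {i : Fin n}
    {f h : M → ℂ} (hf : WeakAct (riemannianMeasure g) (m.dvOp i) f h) :
    WeakDeriv i (m.push fun q => χ.1 q * f q)
      (m.push fun q => χ.1 q * h q + m.dv i χ.1 q * f q) := by
  have h0 : m.dvOp i + mulOp (fun _ => 0) (fun p _ => SmoothAt.const 0 p) = m.dvOp i :=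
    testOp_ext fun ψ q _ => by
      change (m.dvOp i ψ).1 q + 0 * ψ.1 q = _
      ring
  have h1 := m.weakDeriv_push (θ := fun _ => 1) (b := fun _ => 0) (i := i) hμ hx
    (fun p _ => SmoothAt.const 1 p) (fun p _ => SmoothAt.const 0 p)
    (fun q _ => by simp [dv, vderiv_const]) (testSpace_smoothAt χ) hχU (f := f) (h := h)
    (by rwa [h0])
  simpa only [one_mul] using h1

theorem hasTranspose_dvOp (hμ : FiniteInside n μ)
    (hV : ∀ j, HasTranspose μ (fieldOp (G.field j) (G.field_smooth j))) (i : Fin n) :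
    HasTranspose μ (m.dvOp i) :=
  HasTranspose.sum hμ fun j _ => (hasTranspose_mulOp _).mul (hV j)

theorem weakAct_dvOp (hμ : FiniteInside n μ)
    (hV : ∀ j, HasTranspose μ (fieldOp (G.field j) (G.field_smooth j))) {f : M → ℂ}
    {f' : G.MIdx → M → ℂ} (hf : ∀ j, WeakAct μ (fieldOp (G.field j) (G.field_smooth j)) f (f' j))
    (i : Fin n) : WeakAct μ (m.dvOp i) f fun q => ∑ j, m.c i j q * f' j q :=
  WeakAct.sum hμ (hf none).1 (fun j _ => (hasTranspose_mulOp _).mul (hV j)) fun j _ =>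
    (hf j).comp (hasTranspose_mulOp _) (weakAct_mulOp hμ _ (hf j).2.1)

/-- The weak derivatives along the generating fields are those along the coordinates. -/
theorem ae_eq_sum_dvOp (hμ : FiniteInside n μ)
    (hV : ∀ j, HasTranspose μ (fieldOp (G.field j) (G.field_smooth j))) {f : M → ℂ}
    {f' : G.MIdx → M → ℂ} (hf : ∀ j, WeakAct μ (fieldOp (G.field j) (G.field_smooth j)) f (f' j))
    (j : G.MIdx) : f' j =ᵐ[μ.restrict m.Ψ.source]
      fun q => ∑ i, m.v j i q * ∑ l, m.c i l q * f' l q := by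
  have h1 : WeakAct μ (∑ i, mulOp (m.v j i) (fun p _ => m.v_smooth j i p) * m.dvOp i) f
      fun q => ∑ i, m.v j i q * ∑ l, m.c i l q * f' l q :=
    WeakAct.sum hμ (hf none).1
      (fun i _ => (hasTranspose_mulOp _).mul (m.hasTranspose_dvOp hμ hV i)) fun i _ =>
      (m.weakAct_dvOp hμ hV hf i).comp (hasTranspose_mulOp _)
        (weakAct_mulOp hμ _ (m.weakAct_dvOp hμ hV hf i).2.1)
  refine ae_eq_of_integral_test m.Ψ.open_source m.source_subset_interior (hf j).2.1 h1.2.1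
    fun φ hφ => ?_
  obtain ⟨η, hη⟩ := hV j φ
  rw [(hf j).2.2 φ η hη, h1.2.2 φ η fun ψ => ?_]
  rw [← hη ψ]
  refine integral_congr_ae (Eventually.of_forall fun q => ?_)
  by_cases hq : q ∈ tsupport φ.1
  · simp only [fieldOp_apply]
    rw [m.vderiv_eq_dv (hφ hq)]
    simp [LinearMap.sum_apply, Finset.sum_apply, m.dvOp_apply]
  · simp only [image_eq_zero_of_notMem_tsupport hq, zero_mul]

/-- Integration by parts for a product of weakly differentiable functions. -/
theorem integral_mul_adjoint (hμ : FiniteInside n (riemannianMeasure g))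
    (hx : IsBoundaryDefining n x) {φ η : testSpace n M} (hU : tsupport φ.1 ⊆ m.U) {i : Fin n}
    (hη : ∀ q, η.1 q = - ((m.dens q)⁻¹ * m.dv i (m.densMul hU).1 q)) {f h f' h' : M → ℂ}
    (hf : WeakAct (riemannianMeasure g) (m.dvOp i) f f')
    (hh : WeakAct (riemannianMeasure g) (m.dvOp i) h h')
    (hf2 : SqWeighted (n := n) (riemannianMeasure g) x f)
    (hh2 : SqWeighted (n := n) (riemannianMeasure g) x h)
    (hf'2 : SqWeighted (n := n) (riemannianMeasure g) x f')
    (hh'2 : SqWeighted (n := n) (riemannianMeasure g) x h') :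
    ∫ q, (f' q * h q + f q * h' q) * φ.1 q ∂(riemannianMeasure g)
      = ∫ q, (f q * h q) * η.1 q ∂(riemannianMeasure g) := by
  have hs := m.tsupport_subset_source hU
  obtain ⟨χ, hχU, hχ1⟩ := m.exists_cutoff hU
  have hdvχ : ∀ {a : M → ℂ}, SqWeighted (n := n) (riemannianMeasure g) x a →
      MemLp (m.push fun q => m.dv i χ.1 q * a q) 2 volume := fun {a} ha => by
    have := m.memLp_push hx (χ := m.dvOp i χ) ha
    simpa only [m.dvOp_apply] using this
  have hsum : ∀ {a a' : M → ℂ}, SqWeighted (n := n) (riemannianMeasure g) x a →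
      SqWeighted (n := n) (riemannianMeasure g) x a' →
      MemLp (m.push fun q => χ.1 q * a' q + m.dv i χ.1 q * a q) 2 volume := fun {a a'} ha ha' => by
    have := (m.memLp_push hx (χ := χ) ha').add (hdvχ ha)
    refine this.congr_norm ?_ ?_
    · exact m.aestronglyMeasurable_push (((m.aestronglyMeasurable_of_intSmooth
        fun p _ => testSpace_smoothAt χ p).mul (ha'.1.mono_measure m.measure_mono_source)).add
        ((m.aestronglyMeasurable_of_intSmooth
        fun p _ => m.dv_smoothAt i (testSpace_smoothAt χ) p).mul
        (ha.1.mono_measure m.measure_mono_source)))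
    · exact Eventually.of_forall fun w => by rw [m.push_add]; rfl
  have key := WeakDeriv.mul (m.memLp_push hx (χ := χ) hf2) (hsum hf2 hf'2)
    (m.memLp_push hx (χ := χ) hh2) (hsum hh2 hh'2) (m.weakDeriv_push_dvOp hμ hx hχU hf)
    (m.weakDeriv_push_dvOp hμ hx hχU hh)
  have htU : tsupport (m.densMul hU).1 ⊆ m.U := (m.tsupport_densMul hU).trans hU
  have h1 := key (m.push (m.densMul hU).1) (m.contDiff_push htU) (m.hasCompactSupport_push htU)
  simp only [m.fderiv_push htU] at h1
  have hsub : tsupport (m.dv i (m.densMul hU).1) ⊆ tsupport φ.1 :=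
    (m.tsupport_dv_subset i _).trans (m.tsupport_densMul hU)
  have hfm := hf2.1.mono_measure m.measure_mono_source
  have hhm := hh2.1.mono_measure m.measure_mono_source
  have hf'm := hf'2.1.mono_measure m.measure_mono_source
  have hh'm := hh'2.1.mono_measure m.measure_mono_source
  rw [m.integral_eq_integral_push (f := fun q => (f' q * h q + f q * h' q) * φ.1 q)
      (fun q hq => by rw [image_eq_zero_of_notMem_tsupport fun h' => hq (hs h'), mul_zero])
      (((hf'm.mul hhm).add (hfm.mul hh'm)).mul (aestronglyMeasurable_test φ)),
    m.integral_eq_integral_push (f := fun q => f q * h q * η.1 q)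
      (fun q hq => by
        rw [hη, image_eq_zero_of_notMem_tsupport fun h' => hq (hs (hsub h')), mul_zero, neg_zero,
          mul_zero])
      ((hfm.mul hhm).mul (aestronglyMeasurable_test η))]
  have e1 : ∀ w, m.push (fun q => (eucDensity g m.Ψ q : ℂ) * (f q * h q * η.1 q)) w
      = -(m.push (fun q => χ.1 q * f q) w * m.push (fun q => χ.1 q * h q) w
        * m.push (m.dv i (m.densMul hU).1) w) := by
    intro w
    by_cases hw : w ∈ m.Ψ.target
    · simp only [m.push_of_mem hw]
      set q := m.Ψ.symm w
      by_cases hq : q ∈ tsupport φ.1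
      · have hd := m.dens_ne_zero (hs hq)
        rw [(hχ1 q hq).self_of_nhds, hη]
        change m.dens q * _ = _
        field_simp
      · rw [hη, image_eq_zero_of_notMem_tsupport fun h' => hq (hsub h')]
        simp
    · simp only [m.push_of_notMem hw, mul_zero, neg_zero]
  have e2 : ∀ w, m.push (fun q => (eucDensity g m.Ψ q : ℂ)
        * ((f' q * h q + f q * h' q) * φ.1 q)) w
      = (m.push (fun q => χ.1 q * f q) w * m.push (fun q => χ.1 q * h' q + m.dv i χ.1 q * h q) w
        + m.push (fun q => χ.1 q * f' q + m.dv i χ.1 q * f q) w * m.push (fun q => χ.1 q * h q) w)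
        * m.push (m.densMul hU).1 w := by
    intro w
    by_cases hw : w ∈ m.Ψ.target
    · simp only [m.push_of_mem hw]
      set q := m.Ψ.symm w
      change _ = _ * (m.dens q * φ.1 q)
      by_cases hq : q ∈ tsupport φ.1
      · have h0 : m.dv i χ.1 q = 0 := by
          rw [m.dv_congr i (hχ1 q hq)]
          simp [dv, vderiv_const]
        rw [(hχ1 q hq).self_of_nhds, h0]
        change m.dens q * _ = _
        ring
      · rw [image_eq_zero_of_notMem_tsupport hq]
        ring
    · simp only [m.push_of_notMem hw, mul_zero]
  simp only [e1, e2, integral_neg]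
  rw [h1, neg_neg]

end LocalModel

/-- The Leibniz rule. -/
theorem weakAct_field_mul (𝒞 : ModelCover G) (hμ : FiniteInside n (riemannianMeasure g))
    (hx : IsBoundaryDefining n x)
    (hV : ∀ j, HasTranspose (riemannianMeasure g) (fieldOp (G.field j) (G.field_smooth j)))
    {f h : M → ℂ} {f' h' : G.MIdx → M → ℂ}
    (hf : ∀ j, WeakAct (riemannianMeasure g) (fieldOp (G.field j) (G.field_smooth j)) f (f' j))
    (hh : ∀ j, WeakAct (riemannianMeasure g) (fieldOp (G.field j) (G.field_smooth j)) h (h' j))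
    (hf2 : SqWeighted (n := n) (riemannianMeasure g) x f)
    (hh2 : SqWeighted (n := n) (riemannianMeasure g) x h)
    (hf'2 : ∀ j, SqWeighted (n := n) (riemannianMeasure g) x (f' j))
    (hh'2 : ∀ j, SqWeighted (n := n) (riemannianMeasure g) x (h' j)) (j : G.MIdx) :
    WeakAct (riemannianMeasure g) (fieldOp (G.field j) (G.field_smooth j))
      (fun q => f q * h q) (fun q => f' j q * h q + f q * h' j q) := by
  have hloc := hf2.locallyIntegrableOn_mul hx hh2
  have hloc' : LocallyIntegrableOn (fun q => f' j q * h q + f q * h' j q) ((𝓡∂ n).interior M)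
      (riemannianMeasure g) :=
    ((hf'2 j).locallyIntegrableOn_mul hx hh2).add (hf2.locallyIntegrableOn_mul hx (hh'2 j))
  have key : ∀ (m : LocalModel G) (φ : testSpace n M), tsupport φ.1 ⊆ m.U →
      ∃ η : testSpace n M, (∀ ψ : testSpace n M,
        ∫ q, φ.1 q * vderiv (G.field j) ψ.1 q ∂(riemannianMeasure g)
          = ∫ q, η.1 q * ψ.1 q ∂(riemannianMeasure g)) ∧
        ∫ q, (f' j q * h q + f q * h' j q) * φ.1 q ∂(riemannianMeasure g)
          = ∫ q, f q * h q * η.1 q ∂(riemannianMeasure g) := by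
    intro m φ hU
    let φ' : Fin n → testSpace n M := fun i => mulOp (m.v j i) (fun p _ => m.v_smooth j i p) φ
    have hφ' : ∀ i, tsupport (φ' i).1 ⊆ m.U := fun i =>
      (tsupport_mul_subset_right (f := m.v j i) (g := φ.1)).trans hU
    choose η _ hη hηψ using fun i => m.exists_adjoint hμ (hφ' i) i
    have hηq : ∀ q, (∑ i, η i : testSpace n M).1 q = ∑ i, (η i).1 q := fun q => by simp
    refine ⟨∑ i, η i, fun ψ => ?_, ?_⟩
    · have h1 : ∀ q, φ.1 q * vderiv (G.field j) ψ.1 q = ∑ i, (φ' i).1 q * m.dv i ψ.1 q := by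
        intro q
        by_cases hq : q ∈ m.Ψ.source
        · rw [m.vderiv_eq_dv hq, Finset.mul_sum]
          refine Finset.sum_congr rfl fun i _ => ?_
          simp only [φ', mulOp_apply]
          ring
        · have h0 : φ.1 q = 0 := image_eq_zero_of_notMem_tsupport fun h' =>
            hq (m.tsupport_subset_source hU h')
          simp [φ', h0]
      simp only [h1, hηq, Finset.sum_mul]
      rw [integral_finsetSum, integral_finsetSum]
      · exact Finset.sum_congr rfl fun i _ => hηψ i ψ
      · exact fun i _ => integrable_test_mul_test hμ _ _
      · intro i _
        have := integrable_test_mul_test hμ (φ' i) (m.dvOp i ψ)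
        simpa only [m.dvOp_apply] using this
    · have hae : (fun q => (f' j q * h q + f q * h' j q) * φ.1 q) =ᵐ[riemannianMeasure g]
          fun q => ∑ i, ((∑ l, m.c i l q * f' l q) * h q + f q * ∑ l, m.c i l q * h' l q)
            * (φ' i).1 q := by
        have h1 := (ae_restrict_iff' m.Ψ.open_source.measurableSet).1 (m.ae_eq_sum_dvOp hμ hV hf j)
        have h2 := (ae_restrict_iff' m.Ψ.open_source.measurableSet).1 (m.ae_eq_sum_dvOp hμ hV hh j)
        filter_upwards [h1, h2] with q hq1 hq2
        by_cases hq : q ∈ m.Ψ.source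
        · rw [hq1 hq, hq2 hq, Finset.sum_mul, Finset.mul_sum, ← Finset.sum_add_distrib,
            Finset.sum_mul]
          refine Finset.sum_congr rfl fun i _ => ?_
          simp only [φ', mulOp_apply]
          ring
        · have h0 : φ.1 q = 0 := image_eq_zero_of_notMem_tsupport fun h' =>
            hq (m.tsupport_subset_source hU h')
          simp [φ', h0]
      have hcf : ∀ i, SqWeighted (n := n) (riemannianMeasure g) x
          fun q => ∑ l, m.c i l q * f' l q := fun i =>
        SqWeighted.sum hx fun l _ => (hf'2 l).smooth_mul (m.c_smooth i l)
      have hch : ∀ i, SqWeighted (n := n) (riemannianMeasure g) x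
          fun q => ∑ l, m.c i l q * h' l q := fun i =>
        SqWeighted.sum hx fun l _ => (hh'2 l).smooth_mul (m.c_smooth i l)
      have hηsum : ∀ q, f q * h q * (∑ i, η i : testSpace n M).1 q
          = ∑ i, f q * h q * (η i).1 q := fun q => by rw [hηq, Finset.mul_sum]
      rw [integral_congr_ae hae, integral_congr_ae (Eventually.of_forall hηsum)]
      rw [integral_finsetSum, integral_finsetSum]
      · exact Finset.sum_congr rfl fun i _ => m.integral_mul_adjoint hμ hx (hφ' i) (hη i)
          (m.weakAct_dvOp hμ hV hf i) (m.weakAct_dvOp hμ hV hh i) hf2 hh2 (hcf i) (hch i)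
      · exact fun i _ => integrable_mul_test hloc _
      · exact fun i _ => integrable_mul_test
          (((hcf i).locallyIntegrableOn_mul hx hh2).add
            (hf2.locallyIntegrableOn_mul hx (hch i))) _
  refine weakAct_of_transpose hμ hloc hloc' fun φ => ?_
  choose η hη1 hη2 using fun k => key (𝒞.model k) (𝒞.cut k φ) (𝒞.tsupport_cut k φ)
  have hηq : ∀ q, (∑ k, η k : testSpace n M).1 q = ∑ k, (η k).1 q := fun q => by simp
  refine ⟨∑ k, η k, fun ψ => ?_, ?_⟩
  · simp only [hηq, fieldOp_apply, ← 𝒞.sum_cut φ, Finset.sum_mul]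
    rw [integral_finsetSum, integral_finsetSum]
    · exact Finset.sum_congr rfl fun k _ => hη1 k ψ
    · exact fun i _ => integrable_test_mul_test hμ _ _
    · exact fun k _ => integrable_test_mul_test hμ (𝒞.cut k φ)
        (fieldOp (G.field j) (G.field_smooth j) ψ)
  · simp only [hηq, ← 𝒞.sum_cut φ, Finset.mul_sum]
    rw [integral_finsetSum, integral_finsetSum]
    · exact Finset.sum_congr rfl fun k _ => hη2 k
    · exact fun k _ => integrable_mul_test hloc _
    · exact fun k _ => integrable_mul_test hloc' _

end Leibniz

/-! ### Words applied to products -/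

section FiniteWords

variable {R ι ν : Type*} [Ring R] {L σ : ι → R} {j : ν → ι}

/-- Ordered words are products of three lists of letters. -/
theorem OrderedWord.exists_lists {m a b : ℕ} {Q : R} (h : OrderedWord L σ j m a b Q) :
    ∃ w₀ w₁ : List ι, ∃ w₂ : List ν, w₀.length = m ∧ w₁.length = a ∧ w₂.length = b ∧
      Q = (w₀.map σ).prod * ((w₁.map L).prod * (w₂.map fun i => L (j i)).prod) := by
  induction h with
  | one => exact ⟨[], [], [], rfl, rfl, rfl, by simp⟩
  | small i _ ih =>
    obtain ⟨w₀, w₁, w₂, h0, h1, h2, rfl⟩ := ih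
    rw [List.length_eq_zero_iff] at h0 h1
    subst h0 h1
    exact ⟨[], [], i :: w₂, rfl, rfl, by simp [h2], by simp⟩
  | large i _ ih =>
    obtain ⟨w₀, w₁, w₂, h0, h1, h2, rfl⟩ := ih
    rw [List.length_eq_zero_iff] at h0
    subst h0
    exact ⟨[], i :: w₁, w₂, rfl, by simp [h1], h2, by simp [mul_assoc]⟩
  | scat i _ ih =>
    obtain ⟨w₀, w₁, w₂, h0, h1, h2, rfl⟩ := ih
    exact ⟨i :: w₀, w₁, w₂, by simp [h0], h1, h2, by simp [mul_assoc]⟩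

theorem orderedWord_of_lists (w₀ w₁ : List ι) (w₂ : List ν) :
    OrderedWord L σ j w₀.length w₁.length w₂.length
      ((w₀.map σ).prod * ((w₁.map L).prod * (w₂.map fun i => L (j i)).prod)) := by
  induction w₀ with
  | nil =>
    rw [List.map_nil, List.prod_nil, one_mul]
    induction w₁ with
    | nil =>
      rw [List.map_nil, List.prod_nil, one_mul]
      induction w₂ with
      | nil => exact OrderedWord.one
      | cons i w₂ ih => rw [List.map_cons, List.prod_cons]; exact OrderedWord.small i ih
    | cons i w₁ ih =>
      rw [List.map_cons, List.prod_cons, mul_assoc]; exact OrderedWord.large i ih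
  | cons i w₀ ih =>
    rw [List.map_cons, List.prod_cons, mul_assoc]; exact OrderedWord.scat i ih

theorem finite_orderedWord [Finite ι] [Finite ν] (m a b : ℕ) :
    {Q | OrderedWord L σ j m a b Q}.Finite := by
  refine (((List.finite_length_eq ι m).prod
    ((List.finite_length_eq ι a).prod (List.finite_length_eq ν b))).image fun w =>
      (w.1.map σ).prod * ((w.2.1.map L).prod * (w.2.2.map fun i => L (j i)).prod)).subset ?_
  rintro Q hQ
  obtain ⟨w₀, w₁, w₂, h0, h1, h2, rfl⟩ := OrderedWord.exists_lists hQ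
  exact ⟨(w₀, w₁, w₂), ⟨h0, h1, h2⟩, rfl⟩

theorem finite_orderedWord_le [Finite ι] [Finite ν] (m a b : ℕ) :
    {Q | ∃ m' ≤ m, ∃ a' ≤ a, ∃ b' ≤ b, OrderedWord L σ j m' a' b' Q}.Finite := by
  refine ((Set.finite_Iic m).biUnion fun m' _ => (Set.finite_Iic a).biUnion fun a' _ =>
    (Set.finite_Iic b).biUnion fun b' _ =>
      finite_orderedWord (L := L) (σ := σ) (j := j) m' a' b').subset ?_
  rintro Q ⟨m', hm, a', ha, b', hb, hQ⟩
  simp only [Set.mem_iUnion]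
  exact ⟨m', hm, a', ha, b', hb, hQ⟩

end FiniteWords

section Words

open Filter Topology

variable {n : ℕ} [NeZero n] {M : Type*} [TopologicalSpace M]
  [ChartedSpace (EuclideanHalfSpace n) M] [IsManifold (𝓡∂ n) ∞ M]
  [CompactSpace M] [T2Space M] [MeasurableSpace M] [BorelSpace M]
  {x : M → ℝ} {g : BilinField n M} {G : Generators x g} {μ : Measure M}

theorem WeakAct.sum_right {ι : Type*} {s : Finset ι} {Q : TestOp n M} {u f : ι → M → ℂ}
    (h : ∀ i ∈ s, WeakAct μ Q (u i) (f i)) :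
    WeakAct μ Q (fun p => ∑ i ∈ s, u i p) fun p => ∑ i ∈ s, f i p := by
  classical
  induction s using Finset.induction_on with
  | empty =>
    simp only [Finset.sum_empty]
    exact ⟨locallyIntegrableOn_zero, locallyIntegrableOn_zero, fun φ η _ => by simp⟩
  | insert i s his ih =>
    simp only [Finset.sum_insert his]
    exact (h i (Finset.mem_insert_self i s)).add_right
      (ih fun k hk => h k (Finset.mem_insert_of_mem hk))

theorem SqWeighted.div (hx : IsBoundaryDefining n x) (c : ℂ) {f : M → ℂ}
    (hf : SqWeighted (n := n) μ x f) : SqWeighted (n := n) μ x fun p => c / x p * f p := by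
  obtain ⟨hfm, ℓ, hℓ⟩ := hf
  refine ⟨(aestronglyMeasurable_interior fun p hp => ?_).mul hfm, ℓ - 1, ?_⟩
  · exact (continuousAt_const.div (hx.smoothAt p).continuousAt
      (hx.ne_zero hp)).continuousWithinAt
  · refine lt_of_le_of_lt (eLpNorm_le_nnreal_smul_eLpNorm_of_ae_le_mul (c := ‖c‖₊)
      (g := fun p => ((x p ^ (-ℓ) : ℝ) : ℂ) * f p)
      (ae_restrict_interior fun p hp => ?_) 2) (ENNReal.mul_lt_top ENNReal.coe_lt_top hℓ)
    have h0 := hx.pos p hp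
    have h1 : ((x p ^ (-(ℓ - 1)) : ℝ) : ℂ) * (c / x p * f p) = c * (((x p ^ (-ℓ) : ℝ) : ℂ) * f p) := by
      have h2 : x p ^ (-(ℓ - 1)) = x p ^ (-ℓ) * x p := by
        rw [← Real.rpow_add_one h0.ne']
        ring_nf
      have h3 := hx.ne_zero hp
      rw [h2]
      push_cast
      field_simp
    rw [h1, nnnorm_mul]

namespace Generators

variable (G) (hx : IsBoundaryDefining n x)

theorem lOp_none_eq (γ : ℝ) : G.lOp hx γ none
    = mulOp (fun _ => Complex.I) (fun p _ => SmoothAt.const _ p)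
        * fieldOp (G.field none) (G.field_smooth none)
      + mulOp (fun q => -((γ : ℂ) / x q)) (fun _ hp => (hx.smoothAt_div γ hp).neg) :=
  testOp_ext fun ψ q _ => by
    rw [G.lOp_none_apply]
    change _ = Complex.I * vderiv _ ψ.1 q + -((γ : ℂ) / x q) * ψ.1 q
    ring

theorem field_none_eq (γ : ℝ) : fieldOp (G.field none) (G.field_smooth none)
    = mulOp (fun _ => -Complex.I) (fun p _ => SmoothAt.const _ p) * G.lOp hx γ none
      + mulOp (fun q => -Complex.I * ((γ : ℂ) / x q))
        (fun p hp => (SmoothAt.const _ p).mul (hx.smoothAt_div γ hp)) :=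
  testOp_ext fun ψ q _ => by
    change vderiv (G.field none) ψ.1 q = -Complex.I * (G.lOp hx γ none ψ).1 q
      + -Complex.I * ((γ : ℂ) / x q) * ψ.1 q
    rw [G.lOp_none_apply]
    linear_combination (vderiv (G.field none) ψ.1 q) * Complex.I_sq

theorem field_eq_sOp (j : G.MIdx) : fieldOp (G.field j) (G.field_smooth j)
    = mulOp (fun q => ((1 : ℝ) : ℂ) / x q) (fun _ hp => hx.smoothAt_div 1 hp) * G.sOp hx j :=
  testOp_ext fun ψ q hq => by
    have := hx.ne_zero hq
    change vderiv (G.field j) ψ.1 q = ((1 : ℝ) : ℂ) / x q * (x q * vderiv (G.field j) ψ.1 q)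
    push_cast
    field_simp

theorem weakAct_lOp_none (hμ : FiniteInside n μ)
    (hV : ∀ j, HasTranspose μ (fieldOp (G.field j) (G.field_smooth j))) (γ : ℝ) {f f' : M → ℂ}
    (h : WeakAct μ (fieldOp (G.field none) (G.field_smooth none)) f f') :
    WeakAct μ (G.lOp hx γ none) f fun q => Complex.I * f' q + -((γ : ℂ) / x q) * f q := by
  rw [G.lOp_none_eq]
  exact (h.comp (hasTranspose_mulOp _) (weakAct_mulOp hμ _ h.2.1)).add hμ
    ((hasTranspose_mulOp _).mul (hV none)) (hasTranspose_mulOp _) (weakAct_mulOp hμ _ h.1)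

theorem weakAct_sOp (hμ : FiniteInside n μ) (j : G.MIdx) {f f' : M → ℂ}
    (h : WeakAct μ (fieldOp (G.field j) (G.field_smooth j)) f f') :
    WeakAct μ (G.sOp hx j) f fun q => x q * f' q :=
  h.comp (hasTranspose_mulOp _) (weakAct_mulOp hμ _ h.2.1)

theorem exists_weakAct_field_of_lOp (hμ : FiniteInside n μ)
    (hV : ∀ j, HasTranspose μ (fieldOp (G.field j) (G.field_smooth j))) (γ : ℝ) (j : G.MIdx)
    {f f' : M → ℂ} (h : WeakAct μ (G.lOp hx γ j) f f') (hf : SqWeighted (n := n) μ x f)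
    (hf' : SqWeighted (n := n) μ x f') : ∃ f'', SqWeighted (n := n) μ x f'' ∧
      WeakAct μ (fieldOp (G.field j) (G.field_smooth j)) f f'' := by
  rcases j with _ | j
  · refine ⟨fun q => -Complex.I * f' q + -Complex.I * ((γ : ℂ) / x q) * f q, ?_, ?_⟩
    · refine (hf'.smooth_mul (SmoothAt.const _)).add hx ?_
      simpa only [mul_assoc] using (hf.div hx γ).smooth_mul (SmoothAt.const (-Complex.I))
    · rw [G.field_none_eq hx γ]
      exact (h.comp (hasTranspose_mulOp _) (weakAct_mulOp hμ _ h.2.1)).add hμ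
        ((hasTranspose_mulOp _).mul (G.hasTranspose_lOp hx hμ hV γ none)) (hasTranspose_mulOp _)
        (weakAct_mulOp hμ _ h.1)
  · exact ⟨f', hf', h⟩

theorem exists_weakAct_field_of_sOp (hμ : FiniteInside n μ) (j : G.MIdx)
    {f f' : M → ℂ} (h : WeakAct μ (G.sOp hx j) f f')
    (hf' : SqWeighted (n := n) μ x f') : ∃ f'', SqWeighted (n := n) μ x f'' ∧
      WeakAct μ (fieldOp (G.field j) (G.field_smooth j)) f f'' := by
  refine ⟨_, hf'.div hx ((1 : ℝ) : ℂ), ?_⟩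
  rw [G.field_eq_sOp hx]
  exact h.comp (hasTranspose_mulOp _) (weakAct_mulOp hμ _ h.2.1)

/-- The function is differentiable along the generating fields, in weighted spaces. -/
def FieldDiff (G : Generators x g) (μ : Measure M) (f : M → ℂ) : Prop :=
  SqWeighted (n := n) μ x f ∧ ∀ j, ∃ f', SqWeighted (n := n) μ x f' ∧
    WeakAct μ (fieldOp (G.field j) (G.field_smooth j)) f f'

variable {G hx}

theorem ModuleBound.sqWeighted {γ ℓ : ℝ} {s κ k s' a b : ℕ} {u f : M → ℂ} {N : ℝ≥0}
    (hμ : FiniteInside n μ)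
    (hV : ∀ j, HasTranspose μ (fieldOp (G.field j) (G.field_smooth j)))
    (h : G.ModuleBound hx μ γ ℓ s κ k u N) (hs : s' ≤ s) (ha : a ≤ κ) (hb : b ≤ k) {P : TestOp n M}
    (hP : OrderedWord (G.lOp hx γ) (G.sOp hx) some s' a b P) (hf : WeakAct μ P u f) :
    SqWeighted (n := n) μ x f :=
  ⟨hf.aestronglyMeasurable, ℓ, ((h s' hs a ha b hb P hP).wNorm_le
    (G.hasTranspose_word hx hμ hV hP) hf).trans_lt ENNReal.coe_lt_top⟩

theorem ModuleBound.fieldDiff_of_large {γ ℓ : ℝ} {s κ k a b : ℕ} {u f : M → ℂ} {N : ℝ≥0}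
    (hμ : FiniteInside n μ)
    (hV : ∀ j, HasTranspose μ (fieldOp (G.field j) (G.field_smooth j)))
    (h : G.ModuleBound hx μ γ ℓ s κ k u N) (ha : a + 1 ≤ κ) (hb : b ≤ k) {P : TestOp n M}
    (hP : OrderedWord (G.lOp hx γ) (G.sOp hx) some 0 a b P) (hf : WeakAct μ P u f) :
    G.FieldDiff μ f := by
  have hf2 := h.sqWeighted hμ hV (Nat.zero_le s) (by omega) hb hP hf
  refine ⟨hf2, fun j => ?_⟩
  have hP' := OrderedWord.large j hP
  obtain ⟨f', hf', -⟩ := h 0 (Nat.zero_le s) (a + 1) ha b hb _ hP'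
  exact G.exists_weakAct_field_of_lOp hx hμ hV γ j
    (hf'.cancel (G.hasTranspose_word hx hμ hV hP) hf) hf2
    (h.sqWeighted hμ hV (Nat.zero_le s) ha hb hP' hf')

theorem ModuleBound.fieldDiff_of_scat {γ ℓ : ℝ} {s κ k s' a b : ℕ} {u f : M → ℂ} {N : ℝ≥0}
    (hμ : FiniteInside n μ)
    (hV : ∀ j, HasTranspose μ (fieldOp (G.field j) (G.field_smooth j)))
    (h : G.ModuleBound hx μ γ ℓ s κ k u N) (hs : s' + 1 ≤ s) (ha : a ≤ κ) (hb : b ≤ k)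
    {P : TestOp n M} (hP : OrderedWord (G.lOp hx γ) (G.sOp hx) some s' a b P)
    (hf : WeakAct μ P u f) : G.FieldDiff μ f := by
  refine ⟨h.sqWeighted hμ hV (by omega) ha hb hP hf, fun j => ?_⟩
  have hP' := OrderedWord.scat j hP
  obtain ⟨f', hf', -⟩ := h (s' + 1) hs a ha b hb _ hP'
  exact G.exists_weakAct_field_of_sOp hx hμ j
    (hf'.cancel (G.hasTranspose_word hx hμ hV hP) hf) (h.sqWeighted hμ hV hs ha hb hP' hf')

variable (hx)

include hx in
theorem FieldDiff.weakAct_mul (𝒞 : ModelCover G) (hμ : FiniteInside n (riemannianMeasure g))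
    (hV : ∀ j, HasTranspose (riemannianMeasure g) (fieldOp (G.field j) (G.field_smooth j)))
    {f h f' h' : M → ℂ} (hf : G.FieldDiff (riemannianMeasure g) f)
    (hh : G.FieldDiff (riemannianMeasure g) h) {j : G.MIdx}
    (hf' : WeakAct (riemannianMeasure g) (fieldOp (G.field j) (G.field_smooth j)) f f')
    (hh' : WeakAct (riemannianMeasure g) (fieldOp (G.field j) (G.field_smooth j)) h h') :
    WeakAct (riemannianMeasure g) (fieldOp (G.field j) (G.field_smooth j))
      (fun q => f q * h q) (fun q => f' q * h q + f q * h' q) := by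
  obtain ⟨hf2, hfd⟩ := hf
  obtain ⟨hh2, hhd⟩ := hh
  choose F hF2 hF using hfd
  choose H hH2 hH using hhd
  refine (weakAct_field_mul 𝒞 hμ hx hV hF hH hf2 hh2 hF2 hH2 j).congr EventuallyEq.rfl ?_
  filter_upwards [(hF j).unique (hV j) hf', (hH j).unique (hV j) hh'] with q h1 h2
  rw [h1, h2]

/-- The Leibniz rule for the generators of `ℳ_γ`: the parameters add up. -/
theorem FieldDiff.weakAct_lOp_mul (𝒞 : ModelCover G) (hμ : FiniteInside n (riemannianMeasure g))
    (hV : ∀ j, HasTranspose (riemannianMeasure g) (fieldOp (G.field j) (G.field_smooth j)))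
    {f h f' h' : M → ℂ} (hf : G.FieldDiff (riemannianMeasure g) f)
    (hh : G.FieldDiff (riemannianMeasure g) h) (γ₁ γ₂ : ℝ) (j : G.MIdx)
    (hf' : WeakAct (riemannianMeasure g) (G.lOp hx γ₁ j) f f')
    (hh' : WeakAct (riemannianMeasure g) (G.lOp hx γ₂ j) h h') :
    WeakAct (riemannianMeasure g) (G.lOp hx (γ₁ + γ₂) j)
      (fun q => f q * h q) (fun q => f' q * h q + f q * h' q) := by
  rcases j with _ | j
  · obtain ⟨F, -, hF⟩ := hf.2 none
    obtain ⟨H, -, hH⟩ := hh.2 none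
    refine (G.weakAct_lOp_none hx hμ hV (γ₁ + γ₂) (hf.weakAct_mul hx 𝒞 hμ hV hh hF hH)).congr
      EventuallyEq.rfl ?_
    filter_upwards [hf'.unique (G.hasTranspose_lOp hx hμ hV γ₁ none)
      (G.weakAct_lOp_none hx hμ hV γ₁ hF), hh'.unique (G.hasTranspose_lOp hx hμ hV γ₂ none)
      (G.weakAct_lOp_none hx hμ hV γ₂ hH)] with q h1 h2
    rw [h1, h2]
    push_cast
    ring
  · exact hf.weakAct_mul hx 𝒞 hμ hV hh hf' hh'

theorem FieldDiff.weakAct_sOp_mul (𝒞 : ModelCover G) (hμ : FiniteInside n (riemannianMeasure g))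
    (hV : ∀ j, HasTranspose (riemannianMeasure g) (fieldOp (G.field j) (G.field_smooth j)))
    {f h f' h' : M → ℂ} (hf : G.FieldDiff (riemannianMeasure g) f)
    (hh : G.FieldDiff (riemannianMeasure g) h) (j : G.MIdx)
    (hf' : WeakAct (riemannianMeasure g) (G.sOp hx j) f f')
    (hh' : WeakAct (riemannianMeasure g) (G.sOp hx j) h h') :
    WeakAct (riemannianMeasure g) (G.sOp hx j)
      (fun q => f q * h q) (fun q => f' q * h q + f q * h' q) := by
  obtain ⟨F, -, hF⟩ := hf.2 j
  obtain ⟨H, -, hH⟩ := hh.2 j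
  refine (G.weakAct_sOp hx hμ j (hf.weakAct_mul hx 𝒞 hμ hV hh hF hH)).congr EventuallyEq.rfl ?_
  filter_upwards [hf'.unique (G.hasTranspose_sOp hx hV j) (G.weakAct_sOp hx hμ j hF),
    hh'.unique (G.hasTranspose_sOp hx hV j) (G.weakAct_sOp hx hμ j hH)] with q h1 h2
  rw [h1, h2]
  ring

end Generators

end Words

/-! ### Products of two module elements -/

section Splitting

open Filter Topology

variable {n : ℕ} [NeZero n] {M : Type*} [TopologicalSpace M]
  [ChartedSpace (EuclideanHalfSpace n) M] [IsManifold (𝓡∂ n) ∞ M]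
  [CompactSpace M] [T2Space M] [MeasurableSpace M] [BorelSpace M]
  {x : M → ℝ} {g : BilinField n M} {G : Generators x g} {μ : Measure M}

namespace Generators

variable (G) (hx : IsBoundaryDefining n x)

/-- The operator `Q`, applied to a product `u v` of elements of the modules of parameters `γ₁` and
`γ₂`, is a finite sum of products `(P₁ u) (P₂ v)`, where the `s`, `a` and `b` letters of the three
kinds are distributed among the words `P₁` and `P₂`. -/
def SplitsProduct (μ : Measure M) (γ₁ γ₂ : ℝ) (S κ k s a b : ℕ) (Q : TestOp n M) : Prop :=
  ∃ (ι : Type) (_ : Fintype ι) (P₁ P₂ : ι → TestOp n M),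
    (∀ i, ∃ s₁ s₂ a₁ a₂ b₁ b₂, s₁ + s₂ = s ∧ a₁ + a₂ = a ∧ b₁ + b₂ = b ∧
      OrderedWord (G.lOp hx γ₁) (G.sOp hx) some s₁ a₁ b₁ (P₁ i) ∧
      OrderedWord (G.lOp hx γ₂) (G.sOp hx) some s₂ a₂ b₂ (P₂ i)) ∧
    ∀ (ℓ₁ ℓ₂ : ℝ) (u v : M → ℂ) (N N' : ℝ≥0), G.ModuleBound hx μ γ₁ ℓ₁ S κ k u N →
      G.ModuleBound hx μ γ₂ ℓ₂ S κ k v N' → ∀ f h : ι → M → ℂ,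
        (∀ i, WeakAct μ (P₁ i) u (f i)) → (∀ i, WeakAct μ (P₂ i) v (h i)) →
        WeakAct μ Q (fun q => u q * v q) fun q => ∑ i, f i q * h i q

variable {G hx}

/-- Adding a letter that satisfies the Leibniz rule. -/
theorem SplitsProduct.mul (hμ : FiniteInside n μ)
    (hV : ∀ j, HasTranspose μ (fieldOp (G.field j) (G.field_smooth j)))
    {γ₁ γ₂ : ℝ} {S κ k s a b s' a' b' : ℕ} {Q X X₁ X₂ : TestOp n M}
    (h : G.SplitsProduct hx μ γ₁ γ₂ S κ k s a b Q) (hX : HasTranspose μ X)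
    (hX₁ : ∀ s₁ s₂ a₁ a₂ b₁ b₂ P, s₁ + s₂ = s → a₁ + a₂ = a → b₁ + b₂ = b →
      OrderedWord (G.lOp hx γ₁) (G.sOp hx) some s₁ a₁ b₁ P → ∃ s₁' a₁' b₁',
        s₁' + s₂ = s' ∧ a₁' + a₂ = a' ∧ b₁' + b₂ = b' ∧
        OrderedWord (G.lOp hx γ₁) (G.sOp hx) some s₁' a₁' b₁' (X₁ * P))
    (hX₂ : ∀ s₁ s₂ a₁ a₂ b₁ b₂ P, s₁ + s₂ = s → a₁ + a₂ = a → b₁ + b₂ = b →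
      OrderedWord (G.lOp hx γ₂) (G.sOp hx) some s₂ a₂ b₂ P → ∃ s₂' a₂' b₂',
        s₁ + s₂' = s' ∧ a₁ + a₂' = a' ∧ b₁ + b₂' = b' ∧
        OrderedWord (G.lOp hx γ₂) (G.sOp hx) some s₂' a₂' b₂' (X₂ * P))
    (hfd : ∀ γ ℓ s₁ a₁ b₁ P u f N, s₁ ≤ s → a₁ ≤ a → b₁ ≤ b →
      OrderedWord (G.lOp hx γ) (G.sOp hx) some s₁ a₁ b₁ P → G.ModuleBound hx μ γ ℓ S κ k u N →
      WeakAct μ P u f → G.FieldDiff μ f)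
    (hL : ∀ f h f' h' : M → ℂ, G.FieldDiff μ f → G.FieldDiff μ h → WeakAct μ X₁ f f' →
      WeakAct μ X₂ h h' → WeakAct μ X (fun q => f q * h q) fun q => f' q * h q + f q * h' q) :
    G.SplitsProduct hx μ γ₁ γ₂ S κ k s' a' b' (X * Q) := by
  obtain ⟨ι, _, P₁, P₂, hP, hw⟩ := h
  refine ⟨ι ⊕ ι, inferInstance, Sum.elim (fun i => X₁ * P₁ i) P₁, Sum.elim P₂ fun i => X₂ * P₂ i,
    ?_, ?_⟩
  · rintro (i | i)
    · obtain ⟨s₁, s₂, a₁, a₂, b₁, b₂, hs, ha, hb, h1, h2⟩ := hP i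
      obtain ⟨s₁', a₁', b₁', h3, h4, h5, h6⟩ := hX₁ s₁ s₂ a₁ a₂ b₁ b₂ _ hs ha hb h1
      exact ⟨s₁', s₂, a₁', a₂, b₁', b₂, h3, h4, h5, h6, h2⟩
    · obtain ⟨s₁, s₂, a₁, a₂, b₁, b₂, hs, ha, hb, h1, h2⟩ := hP i
      obtain ⟨s₁', a₁', b₁', h3, h4, h5, h6⟩ := hX₂ s₁ s₂ a₁ a₂ b₁ b₂ _ hs ha hb h2
      exact ⟨s₁, s₁', a₁, a₁', b₁, b₁', h3, h4, h5, h1, h6⟩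
  · intro ℓ₁ ℓ₂ u v N N' hu hv f h hf hh
    have hf0 : ∀ i, WeakAct μ (P₁ i) u (f (.inr i)) := fun i => hf (.inr i)
    have hh0 : ∀ i, WeakAct μ (P₂ i) v (h (.inl i)) := fun i => hh (.inl i)
    have key := hw ℓ₁ ℓ₂ u v N N' hu hv _ _ hf0 hh0
    have h1 : WeakAct μ X (fun q => ∑ i, f (.inr i) q * h (.inl i) q)
        fun q => ∑ i, (f (.inl i) q * h (.inl i) q + f (.inr i) q * h (.inr i) q) := by
      refine WeakAct.sum_right fun i _ => ?_
      obtain ⟨s₁, s₂, a₁, a₂, b₁, b₂, hs, ha, hb, hP₁, hP₂⟩ := hP i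
      exact hL _ _ _ _
        (hfd γ₁ ℓ₁ s₁ a₁ b₁ _ u _ N (by omega) (by omega) (by omega) hP₁ hu (hf0 i))
        (hfd γ₂ ℓ₂ s₂ a₂ b₂ _ v _ N' (by omega) (by omega) (by omega) hP₂ hv (hh0 i))
        (WeakAct.cancel (G.hasTranspose_word hx hμ hV hP₁) (hf (.inl i)) (hf0 i))
        (WeakAct.cancel (G.hasTranspose_word hx hμ hV hP₂) (hh (.inr i)) (hh0 i))
    have h2 := key.comp hX h1
    simpa only [Fintype.sum_sum_type, Finset.sum_add_distrib] using h2

variable (G hx)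

/-- The Leibniz rule for words. Differentiability of the factors of each term comes from the module
regularity to spare: with fewer than `κ` large letters, or with `κ ≥ 1` and small letters only, one
more large letter is allowed. -/
theorem splitsProduct_of_orderedWord (𝒞 : ModelCover G)
    (hμ : FiniteInside n (riemannianMeasure g))
    (hV : ∀ j, HasTranspose (riemannianMeasure g) (fieldOp (G.field j) (G.field_smooth j)))
    (γ₁ γ₂ : ℝ) {S κ k s a b : ℕ} (hκ : 1 ≤ κ) (hs : s ≤ S) (ha : a ≤ κ) (hb : b ≤ k)
    {Q : TestOp n M} (hQ : OrderedWord (G.lOp hx (γ₁ + γ₂)) (G.sOp hx) some s a b Q) :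
    G.SplitsProduct hx (riemannianMeasure g) γ₁ γ₂ S κ k s a b Q := by
  have hT := fun γ j => G.hasTranspose_lOp hx hμ hV γ j
  induction hQ with
  | one =>
    refine ⟨Unit, inferInstance, fun _ => 1, fun _ => 1, fun _ => ⟨0, 0, 0, 0, 0, 0, rfl, rfl, rfl,
      OrderedWord.one, OrderedWord.one⟩, fun ℓ₁ ℓ₂ u v N N' hu hv f h hf hh => ?_⟩
    have h1 := hu.sqWeighted hμ hV (Nat.zero_le _) (Nat.zero_le _) (Nat.zero_le _) OrderedWord.one
      (hf ())
    have h2 := hv.sqWeighted hμ hV (Nat.zero_le _) (Nat.zero_le _) (Nat.zero_le _) OrderedWord.one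
      (hh ())
    have h3 := (hf ()).unique hasTranspose_one (weakAct_one hμ hu.locallyIntegrableOn)
    have h4 := (hh ()).unique hasTranspose_one (weakAct_one hμ hv.locallyIntegrableOn)
    refine (weakAct_one hμ (h1.locallyIntegrableOn_mul hx h2)).congr ?_ ?_
    · filter_upwards [h3, h4] with q h3 h4
      rw [h3, h4]
    · exact Eventually.of_forall fun q => by simp
  | small i hw ih =>
    refine (ih hs ha (by omega)).mul (X₁ := G.lOp hx γ₁ (some i)) (X₂ := G.lOp hx γ₂ (some i))
      hμ hV (hT _ _) ?_ ?_ ?_ fun f h f' h' hf hh hf' hh' =>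
        hf.weakAct_lOp_mul hx 𝒞 hμ hV hh γ₁ γ₂ _ hf' hh'
    · intro s₁ s₂ a₁ a₂ b₁ b₂ P h1 h2 h3 hP
      obtain rfl : s₁ = 0 := by omega
      obtain rfl : a₁ = 0 := by omega
      exact ⟨0, 0, b₁ + 1, h1, h2, by omega, OrderedWord.small i hP⟩
    · intro s₁ s₂ a₁ a₂ b₁ b₂ P h1 h2 h3 hP
      obtain rfl : s₂ = 0 := by omega
      obtain rfl : a₂ = 0 := by omega
      exact ⟨0, 0, b₂ + 1, h1, h2, by omega, OrderedWord.small i hP⟩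
    · intro γ ℓ s₁ a₁ b₁ P u f N h1 h2 h3 hP hu hf
      obtain rfl : s₁ = 0 := by omega
      exact hu.fieldDiff_of_large hμ hV (by omega) (by omega) hP hf
  | large i hw ih =>
    refine (ih hs (by omega) hb).mul (X₁ := G.lOp hx γ₁ i) (X₂ := G.lOp hx γ₂ i)
      hμ hV (hT _ _) ?_ ?_ ?_ fun f h f' h' hf hh hf' hh' =>
        hf.weakAct_lOp_mul hx 𝒞 hμ hV hh γ₁ γ₂ _ hf' hh'
    · intro s₁ s₂ a₁ a₂ b₁ b₂ P h1 h2 h3 hP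
      obtain rfl : s₁ = 0 := by omega
      exact ⟨0, a₁ + 1, b₁, h1, by omega, h3, OrderedWord.large i hP⟩
    · intro s₁ s₂ a₁ a₂ b₁ b₂ P h1 h2 h3 hP
      obtain rfl : s₂ = 0 := by omega
      exact ⟨0, a₂ + 1, b₂, h1, by omega, h3, OrderedWord.large i hP⟩
    · intro γ ℓ s₁ a₁ b₁ P u f N h1 h2 h3 hP hu hf
      obtain rfl : s₁ = 0 := by omega
      exact hu.fieldDiff_of_large hμ hV (by omega) (by omega) hP hf
  | scat i hw ih =>
    refine (ih (by omega) ha hb).mul (X₁ := G.sOp hx i) (X₂ := G.sOp hx i)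
      hμ hV (G.hasTranspose_sOp hx hV i) ?_ ?_ ?_ fun f h f' h' hf hh hf' hh' =>
        hf.weakAct_sOp_mul hx 𝒞 hμ hV hh _ hf' hh'
    · intro s₁ s₂ a₁ a₂ b₁ b₂ P h1 h2 h3 hP
      exact ⟨s₁ + 1, a₁, b₁, by omega, h2, h3, OrderedWord.scat i hP⟩
    · intro s₁ s₂ a₁ a₂ b₁ b₂ P h1 h2 h3 hP
      exact ⟨s₂ + 1, a₂, b₂, by omega, h2, h3, OrderedWord.scat i hP⟩
    · intro γ ℓ s₁ a₁ b₁ P u f N h1 h2 h3 hP hu hf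
      exact hu.fieldDiff_of_scat hμ hV (by omega) (by omega) (by omega) hP hf

theorem wNorm_sum_le {ι : Type*} (t : Finset ι) {ℓ : ℝ} {f : ι → M → ℂ}
    (hx : IsBoundaryDefining n x)
    (hf : ∀ i ∈ t, AEStronglyMeasurable (f i) (μ.restrict ((𝓡∂ n).interior M))) :
    wNorm n μ x ℓ (fun p => ∑ i ∈ t, f i p) ≤ ∑ i ∈ t, wNorm n μ x ℓ (f i) := by
  classical
  induction t using Finset.induction_on with
  | empty => simp [wNorm]
  | insert i t hi ih =>
    simp only [Finset.sum_insert hi]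
    have h1 : AEStronglyMeasurable (fun p => ∑ i ∈ t, f i p) (μ.restrict ((𝓡∂ n).interior M)) :=
      Finset.aestronglyMeasurable_fun_sum t fun k hk => hf k (Finset.mem_insert_of_mem hk)
    exact (wNorm_add_le hx (hf i (Finset.mem_insert_self i t)) h1).trans
      (add_le_add le_rfl (ih fun k hk => hf k (Finset.mem_insert_of_mem hk)))

/-- Products of two elements: the parameters and the weights add up, and the weight gains `n / 2`. -/
theorem exists_moduleBound_mul (𝒞 : ModelCover G) (hμ : FiniteInside n (riemannianMeasure g))
    (hV : ∀ j, HasTranspose (riemannianMeasure g) (fieldOp (G.field j) (G.field_smooth j)))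
    (γ₁ γ₂ ℓ₁ ℓ₂ : ℝ) (s : ℕ) {κ k : ℕ} (hk : n ≤ 2 * k + 1) (hκ : 1 ≤ κ) :
    ∃ C : ℝ≥0, ∀ (u v : M → ℂ) (N N' : ℝ≥0),
      G.ModuleBound hx (riemannianMeasure g) γ₁ ℓ₁ s κ k u N →
      G.ModuleBound hx (riemannianMeasure g) γ₂ ℓ₂ s κ k v N' →
      G.ModuleBound hx (riemannianMeasure g) (γ₁ + γ₂) (ℓ₁ + ℓ₂ + n / 2) s κ k
        (fun q => u q * v q) (C * (N * N')) := by
  suffices h : ∀ Q ∈ {Q | ∃ s' ≤ s, ∃ a' ≤ κ, ∃ b' ≤ k,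
      OrderedWord (G.lOp hx (γ₁ + γ₂)) (G.sOp hx) some s' a' b' Q}, ∃ C : ℝ≥0,
      ∀ (u v : M → ℂ) (N N' : ℝ≥0), G.ModuleBound hx (riemannianMeasure g) γ₁ ℓ₁ s κ k u N →
        G.ModuleBound hx (riemannianMeasure g) γ₂ ℓ₂ s κ k v N' →
        WeakBound (riemannianMeasure g) x (ℓ₁ + ℓ₂ + n / 2) Q (fun q => u q * v q)
          (C * (N * N')) by
    obtain ⟨C, hC⟩ := exists_uniform_of_finite (finite_orderedWord_le s κ k)
      (fun Q C C' hC h u v N N' hu hv => (h u v N N' hu hv).mono (mul_le_mul_left hC _)) h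
    exact ⟨C, fun u v N N' hu hv s' hs a' ha b' hb Q hQ =>
      hC Q ⟨s', hs, a', ha, b', hb, hQ⟩ u v N N' hu hv⟩
  rintro Q ⟨s', hs, a', ha, b', hb, hQ⟩
  obtain ⟨ι, _, P₁, P₂, hP, hw⟩ :=
    G.splitsProduct_of_orderedWord hx 𝒞 hμ hV γ₁ γ₂ (S := s) (k := k) hκ hs ha hb hQ
  have h1 : ∀ i, ∃ C : ℝ≥0, ∀ (u v f h : M → ℂ) (N N' : ℝ≥0),
      G.ModuleBound hx (riemannianMeasure g) γ₁ ℓ₁ s κ k u N →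
      G.ModuleBound hx (riemannianMeasure g) γ₂ ℓ₂ s κ k v N' →
      WeakAct (riemannianMeasure g) (P₁ i) u f → WeakAct (riemannianMeasure g) (P₂ i) v h →
      wNorm n (riemannianMeasure g) x (ℓ₁ + ℓ₂ + n / 2) (fun q => f q * h q)
        ≤ (C * (N * N') : ℝ≥0) := fun i => by
    obtain ⟨s₁, s₂, a₁, a₂, b₁, b₂, h1, h2, h3, hP₁, hP₂⟩ := hP i
    exact exists_product_bound 𝒞 hμ hx hV γ₁ γ₂ ℓ₁ ℓ₂ hk hκ (by omega) (by omega)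
      (wordSpan_mono (by omega : s₁ ≤ s) le_rfl le_rfl hP₁.mem_wordSpan)
      (wordSpan_mono (by omega : s₂ ≤ s) le_rfl le_rfl hP₂.mem_wordSpan)
  choose C hC using h1
  refine ⟨∑ i, C i, fun u v N N' hu hv => ?_⟩
  have hf : ∀ i, ∃ f, WeakAct (riemannianMeasure g) (P₁ i) u f := fun i => by
    obtain ⟨s₁, s₂, a₁, a₂, b₁, b₂, h1, h2, h3, hP₁, -⟩ := hP i
    obtain ⟨f, hf, -⟩ := hu s₁ (by omega) a₁ (by omega) b₁ (by omega) _ hP₁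
    exact ⟨f, hf⟩
  have hh : ∀ i, ∃ h, WeakAct (riemannianMeasure g) (P₂ i) v h := fun i => by
    obtain ⟨s₁, s₂, a₁, a₂, b₁, b₂, h1, h2, h3, -, hP₂⟩ := hP i
    obtain ⟨f, hf, -⟩ := hv s₂ (by omega) a₂ (by omega) b₂ (by omega) _ hP₂
    exact ⟨f, hf⟩
  choose f hf using hf
  choose h hh using hh
  refine ⟨_, hw ℓ₁ ℓ₂ u v N N' hu hv f h hf hh, ?_⟩
  refine (wNorm_sum_le Finset.univ hx fun i _ =>
    (hf i).aestronglyMeasurable.mul (hh i).aestronglyMeasurable).trans ?_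
  rw [Finset.sum_mul, ENNReal.ofNNReal_finsetSum]
  exact Finset.sum_le_sum fun i _ => hC i u v _ _ N N' hu hv (hf i) (hh i)

end Generators

end Splitting

/-! ### Change of the parameter of the module -/

section ChangeParameter

open Filter Topology

variable {n : ℕ} [NeZero n] {M : Type*} [TopologicalSpace M]
  [ChartedSpace (EuclideanHalfSpace n) M] [IsManifold (𝓡∂ n) ∞ M]
  [CompactSpace M] [T2Space M] [MeasurableSpace M] [BorelSpace M]
  {x : M → ℝ} {g : BilinField n M} {μ : Measure M}

theorem coeffRing_mul_comm {P Q : TestOp n M} (hP : P ∈ coeffRing n M) (hQ : Q ∈ coeffRing n M) :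
    P * Q = Q * P := by
  obtain ⟨a, ha, rfl⟩ := hP
  obtain ⟨b, hb, rfl⟩ := hQ
  exact testOp_ext fun ψ q _ => mul_left_comm (a q) (b q) (ψ.1 q)

theorem SmoothAt.pow {a : M → ℂ} {p : M} (ha : SmoothAt n a p) (k : ℕ) :
    SmoothAt n (fun q => a q ^ k) p := by
  induction k with
  | zero => simpa using SmoothAt.const 1 p
  | succ k ih => simpa only [pow_succ] using ih.mul ha

/-- Multiplication by the boundary defining function. -/
noncomputable def xOp (hx : IsBoundaryDefining n x) : TestOp n M :=
  mulOp (fun q => (x q : ℂ)) fun p _ => hx.smoothAt p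

theorem xOp_pow_apply (hx : IsBoundaryDefining n x) (a : ℕ) (ψ : testSpace n M) (q : M) :
    ((xOp hx ^ a) ψ).1 q = (x q : ℂ) ^ a * ψ.1 q := by
  induction a with
  | zero => simp
  | succ a ih =>
    rw [pow_succ']
    change (x q : ℂ) * ((xOp hx ^ a) ψ).1 q = _
    rw [ih]
    ring

theorem xOp_mem (hx : IsBoundaryDefining n x) : xOp hx ∈ coeffRing n M :=
  mulOp_mem_coeffRing hx.smoothAt

namespace Generators

variable (G : Generators x g) (hx : IsBoundaryDefining n x)

/-- Powers of `x` commute with the scattering generators up to coefficients. -/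
theorem exists_xOp_mul_sOp (i : G.MIdx) (a : ℕ) : ∃ c ∈ coeffRing n M,
    xOp hx ^ a * G.sOp hx i = G.sOp hx i * xOp hx ^ a + c * xOp hx ^ a := by
  induction a with
  | zero => exact ⟨0, zero_mem _, by simp⟩
  | succ a ih =>
    obtain ⟨c, hc, h⟩ := ih
    have hs : ∀ p, SmoothAt n (fun q => -((x q : ℂ) * G.logDeriv i q)) p := fun p =>
      ((hx.smoothAt p).mul (G.logDeriv_smoothAt hx i p)).neg
    have h1 : xOp hx * G.sOp hx i
        = G.sOp hx i * xOp hx + mulOp _ (fun p _ => hs p) * xOp hx := testOp_ext fun ψ q _ => by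
      change x q * (x q * vderiv _ ψ.1 q) = x q * vderiv _ (fun r => x r * ψ.1 r) q
        + -((x q : ℂ) * G.logDeriv i q) * (x q * ψ.1 q)
      rw [vderiv_mul _ (hx.smoothAt q) (testSpace_smoothAt ψ q), G.vderiv_x hx]
      ring
    refine ⟨mulOp _ (fun p _ => hs p) + c, add_mem (mulOp_mem_coeffRing hs) hc, ?_⟩
    calc xOp hx ^ (a + 1) * G.sOp hx i
        = xOp hx * G.sOp hx i * xOp hx ^ a + xOp hx * c * xOp hx ^ a := by
          rw [pow_succ', mul_assoc, h]; noncomm_ring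
      _ = _ := by
          rw [h1, coeffRing_mul_comm (xOp_mem hx) hc, pow_succ']; noncomm_ring

/-- A power of `x` trades a generator of parameter `γ'` for one of parameter `γ`. -/
theorem exists_xOp_mul_lOp (γ γ' : ℝ) (i : G.MIdx) (a : ℕ) : ∃ c ∈ coeffRing n M,
    xOp hx ^ (a + 1) * G.lOp hx γ' i = G.lOp hx γ i * xOp hx ^ (a + 1) + c * xOp hx ^ a := by
  have base : ∃ c ∈ coeffRing n M,
      xOp hx * G.lOp hx γ' i = G.lOp hx γ i * xOp hx + c := by
    have he := G.logDeriv_smoothAt hx i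
    rcases i with _ | i
    · have hs : ∀ p, SmoothAt n (fun q => -(Complex.I * ((x q : ℂ) * G.logDeriv none q))
          + ((γ : ℂ) - γ')) p := fun p =>
        (((SmoothAt.const _ p).mul ((hx.smoothAt p).mul (he p))).neg).add (SmoothAt.const _ p)
      refine ⟨mulOp _ fun p _ => hs p, mulOp_mem_coeffRing hs, testOp_ext fun ψ q hq => ?_⟩
      change x q * (G.lOp hx γ' none ψ).1 q = (G.lOp hx γ none (xOp hx ψ)).1 q + _ * ψ.1 q
      rw [G.lOp_none_apply, G.lOp_none_apply]
      change _ = Complex.I * vderiv _ (fun r => x r * ψ.1 r) q - _ * (x q * ψ.1 q) + _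
      rw [vderiv_mul _ (hx.smoothAt q) (testSpace_smoothAt ψ q), G.vderiv_x hx]
      have h0 := hx.ne_zero hq
      field_simp
      ring
    · have hs : ∀ p, SmoothAt n (fun q => -((x q : ℂ) * G.logDeriv (some i) q)) p := fun p =>
        ((hx.smoothAt p).mul (he p)).neg
      refine ⟨mulOp _ fun p _ => hs p, mulOp_mem_coeffRing hs, testOp_ext fun ψ q hq => ?_⟩
      change x q * vderiv _ ψ.1 q = vderiv _ (fun r => x r * ψ.1 r) q + _ * ψ.1 q
      rw [vderiv_mul _ (hx.smoothAt q) (testSpace_smoothAt ψ q), G.vderiv_x hx]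
      ring
  have comm : ∃ c ∈ coeffRing n M,
      xOp hx * G.lOp hx γ i = G.lOp hx γ i * xOp hx + c * xOp hx := by
    have he := G.logDeriv_smoothAt hx i
    rcases i with _ | i
    · have hs : ∀ p, SmoothAt n (fun q => -(Complex.I * (G.logDeriv none q : ℂ))) p := fun p =>
        ((SmoothAt.const _ p).mul (he p)).neg
      refine ⟨mulOp _ fun p _ => hs p, mulOp_mem_coeffRing hs, testOp_ext fun ψ q hq => ?_⟩
      change x q * (G.lOp hx γ none ψ).1 q = (G.lOp hx γ none (xOp hx ψ)).1 q + _ * (x q * ψ.1 q)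
      rw [G.lOp_none_apply, G.lOp_none_apply]
      change _ = Complex.I * vderiv _ (fun r => x r * ψ.1 r) q - _ * (x q * ψ.1 q) + _
      rw [vderiv_mul _ (hx.smoothAt q) (testSpace_smoothAt ψ q), G.vderiv_x hx]
      ring
    · have hs : ∀ p, SmoothAt n (fun q => -(G.logDeriv (some i) q : ℂ)) p := fun p => (he p).neg
      refine ⟨mulOp _ fun p _ => hs p, mulOp_mem_coeffRing hs, testOp_ext fun ψ q hq => ?_⟩
      change x q * vderiv _ ψ.1 q = vderiv _ (fun r => x r * ψ.1 r) q + _ * (x q * ψ.1 q)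
      rw [vderiv_mul _ (hx.smoothAt q) (testSpace_smoothAt ψ q), G.vderiv_x hx]
      ring
  obtain ⟨d, hd, hcomm⟩ := comm
  induction a with
  | zero =>
    obtain ⟨c, hc, h⟩ := base
    exact ⟨c, hc, by simpa using h⟩
  | succ a ih =>
    obtain ⟨c, hc, h⟩ := ih
    refine ⟨d * xOp hx + c, add_mem (mul_mem hd (xOp_mem hx)) hc, ?_⟩
    calc xOp hx ^ (a + 1 + 1) * G.lOp hx γ' i
        = xOp hx * G.lOp hx γ i * xOp hx ^ (a + 1) + xOp hx * c * xOp hx ^ a := by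
          rw [pow_succ' _ (a + 1), mul_assoc, h]; noncomm_ring
      _ = _ := by
          rw [hcomm, coeffRing_mul_comm (xOp_mem hx) hc, pow_succ' _ (a + 1), pow_succ' _ a]
          noncomm_ring

/-- Every generator of `ℳ_{γ'}` is, up to a factor `1 / x`, in the module `ℳ_γ`. -/
theorem xOp_pow_mul_mem_wordOps (𝒞 : ModelCover G) (γ γ' : ℝ) {s a b : ℕ} {Q : TestOp n M}
    (hQ : OrderedWord (G.lOp hx γ') (G.sOp hx) some s a b Q) :
    xOp hx ^ a * Q ∈ G.wordOps hx γ s a b := by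
  induction hQ with
  | one => simpa using OrderedWord.one.mem_wordSpan
  | small i hw ih =>
    rw [pow_zero, one_mul] at ih ⊢
    exact G.small_mul_mem_words hx γ 𝒞 i ih
  | @large i a b w hw ih =>
    obtain ⟨c, hc, h⟩ := G.exists_xOp_mul_lOp hx γ γ' i a
    have h1 : xOp hx ^ (a + 1) * (G.lOp hx γ' i * w)
        = G.lOp hx γ i * (xOp hx * (xOp hx ^ a * w)) + c * (xOp hx ^ a * w) := by
      rw [← mul_assoc, h, pow_succ']; noncomm_ring
    rw [h1]
    exact add_mem (G.large_mul_mem_words hx γ 𝒞 i (coeff_mul_mem_wordSpan (xOp_mem hx) ih))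
      (coeff_mul_mem_wordSpan hc (wordSpan_mono le_rfl (Nat.le_succ a) le_rfl ih))
  | @scat i s a b w hw ih =>
    obtain ⟨c, hc, h⟩ := G.exists_xOp_mul_sOp hx i a
    have h1 : xOp hx ^ a * (G.sOp hx i * w)
        = G.sOp hx i * (xOp hx ^ a * w) + c * (xOp hx ^ a * w) := by
      rw [← mul_assoc, h]; noncomm_ring
    rw [h1]
    exact add_mem (scat_mul_mem_wordSpan (G.sOp_coeff hx) i ih)
      (coeff_mul_mem_wordSpan hc (wordSpan_mono (Nat.le_succ s) le_rfl le_rfl ih))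

/-- Changing the parameter costs the weight `x ^ κ`. -/
theorem exists_moduleBound_change (𝒞 : ModelCover G) (hμ : FiniteInside n μ)
    (hV : ∀ j, HasTranspose μ (fieldOp (G.field j) (G.field_smooth j)))
    (γ γ' ℓ : ℝ) (s κ k : ℕ) : ∃ C : ℝ≥0, ∀ (u : M → ℂ) (N : ℝ≥0),
      G.ModuleBound hx μ γ ℓ s κ k u N → G.ModuleBound hx μ γ' (ℓ - κ) s κ k u (C * N) := by
  suffices h : ∀ Q ∈ {Q | ∃ s' ≤ s, ∃ a' ≤ κ, ∃ b' ≤ k,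
      OrderedWord (G.lOp hx γ') (G.sOp hx) some s' a' b' Q}, ∃ C : ℝ≥0,
      ∀ (u : M → ℂ) (N : ℝ≥0), G.ModuleBound hx μ γ ℓ s κ k u N →
        WeakBound μ x (ℓ - κ) Q u (C * N) by
    obtain ⟨C, hC⟩ := exists_uniform_of_finite (finite_orderedWord_le s κ k)
      (fun Q C C' hC h u N hu => (h u N hu).mono (mul_le_mul_left hC _)) h
    exact ⟨C, fun u N hu s' hs a' ha b' hb Q hQ => hC Q ⟨s', hs, a', ha, b', hb, hQ⟩ u N hu⟩
  rintro Q ⟨s', hs, a, ha, b', hb, hQ⟩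
  obtain ⟨-, C, hC⟩ := G.hasTranspose_and_exists_weakBound hx hμ hV ℓ
    (G.xOp_pow_mul_mem_wordOps hx 𝒞 γ γ' hQ)
  obtain ⟨B, hB⟩ := exists_bound_of_smooth hx.smoothAt
  refine ⟨B ^ (κ - a) * C, fun u N hu => ?_⟩
  obtain ⟨f, hf, hfb⟩ := hC u N (hu.mono hs ha hb le_rfl)
  have hinv : IntSmooth n fun q : M => ((x q : ℂ) ^ a)⁻¹ := fun p hp => by
    exact ((hx.smoothAt p).pow a).inv (pow_ne_zero _ (hx.ne_zero hp))
  have hQ' : Q = mulOp _ hinv * (xOp hx ^ a * Q) := testOp_ext fun ψ q hq => by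
    change _ = ((x q : ℂ) ^ a)⁻¹ * ((xOp hx ^ a) (Q ψ)).1 q
    rw [xOp_pow_apply, inv_mul_cancel_left₀ (pow_ne_zero _ (hx.ne_zero hq))]
  refine ⟨fun q => ((x q : ℂ) ^ a)⁻¹ * f q, ?_, ?_⟩
  · rw [hQ']
    exact hf.comp (hasTranspose_mulOp _) (weakAct_mulOp hμ _ hf.2.1)
  have h1 : wNorm n μ x (ℓ - κ) (fun q => ((x q : ℂ) ^ a)⁻¹ * f q)
      = wNorm n μ x ℓ (fun q => (x q : ℂ) ^ (κ - a) * f q) := by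
    refine eLpNorm_congr_ae (ae_restrict_interior fun q hq => ?_)
    have h0 := hx.pos q hq
    have h2 : x q ^ (-(ℓ - κ)) = x q ^ (-ℓ) * (x q ^ (κ - a) * x q ^ a) := by
      rw [← pow_add, Nat.sub_add_cancel ha, ← Real.rpow_natCast, ← Real.rpow_add h0]
      ring_nf
    have h3 := hx.ne_zero hq
    simp only [h2]
    push_cast
    field_simp
  rw [h1]
  refine (wNorm_mul_le (C := B ^ (κ - a)) fun p _ => ?_).trans ?_
  · rw [norm_pow]
    push_cast
    exact pow_le_pow_left₀ (norm_nonneg _) (hB p) _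
  · rw [mul_assoc, ENNReal.coe_mul]
    gcongr

/-- Products of several elements. -/
theorem exists_moduleBound_prod (𝒞 : ModelCover G) (hμ : FiniteInside n (riemannianMeasure g))
    (hV : ∀ j, HasTranspose (riemannianMeasure g) (fieldOp (G.field j) (G.field_smooth j)))
    (s : ℕ) {κ k : ℕ} (hk : n ≤ 2 * k + 1) (hκ : 1 ≤ κ) (p : ℕ) (γ ℓ : Fin (p + 1) → ℝ) :
    ∃ C : ℝ≥0, ∀ (u : Fin (p + 1) → M → ℂ) (N : Fin (p + 1) → ℝ≥0),
      (∀ j, G.ModuleBound hx (riemannianMeasure g) (γ j) (ℓ j) s κ k (u j) (N j)) →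
      G.ModuleBound hx (riemannianMeasure g) (∑ j, γ j) (∑ j, ℓ j + p * n / 2) s κ k
        (fun z => ∏ j, u j z) (C * ∏ j, N j) := by
  induction p with
  | zero => exact ⟨1, fun u N h => by simpa using h 0⟩
  | succ p ih =>
    obtain ⟨C, hC⟩ := ih (fun j => γ j.castSucc) (fun j => ℓ j.castSucc)
    obtain ⟨D, hD⟩ := G.exists_moduleBound_mul hx 𝒞 hμ hV (∑ j : Fin (p + 1), γ j.castSucc)
      (γ (Fin.last _)) (∑ j : Fin (p + 1), ℓ j.castSucc + p * n / 2) (ℓ (Fin.last _)) s hk hκ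
    refine ⟨D * C, fun u N h => ?_⟩
    have h1 := hD _ _ _ _ (hC (fun j => u j.castSucc) (fun j => N j.castSucc)
      fun j => h j.castSucc) (h (Fin.last _))
    simp only [Fin.prod_univ_castSucc, Fin.sum_univ_castSucc (n := p + 1)] at h1 ⊢
    convert h1 using 1
    · push_cast; ring
    · ring

end Generators

end ChangeParameter

/-! ### The module norm and bounds on words -/

section ModuleNorm

open Filter Topology

variable {n : ℕ} [NeZero n] {M : Type*} [TopologicalSpace M]
  [ChartedSpace (EuclideanHalfSpace n) M] [IsManifold (𝓡∂ n) ∞ M]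
  [CompactSpace M] [T2Space M] [MeasurableSpace M] [BorelSpace M]
  {x : M → ℝ} {g : BilinField n M} {μ : Measure M}

/-- On test functions, compositions of maps are products of operators. -/
theorem foldr_test {ι : Type*} {P : ι → (M → ℂ) → M → ℂ} {T : ι → TestOp n M}
    (h : ∀ i (ψ : testSpace n M), P i ψ.1 = (T i ψ).1) (w : List ι) (ψ : testSpace n M) :
    w.foldr P ψ.1 = ((w.map T).prod ψ).1 := by
  induction w with
  | nil => simp
  | cons i w ih => rw [List.foldr_cons, ih, h, List.map_cons, List.prod_cons]; rfl

/-- The infimum in the weak norm is over functions that agree in the interior. -/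
theorem weakBound_of_weakNorm_le {ℓ : ℝ} {P : (M → ℂ) → M → ℂ} {Q : TestOp n M}
    (hQ : HasTranspose μ Q) (h : ∀ ψ : testSpace n M, P ψ.1 = (Q ψ).1) {u : M → ℂ} {N : ℝ≥0}
    (hN : weakNorm (n := n) μ x ℓ P u ≤ N) : WeakBound μ x ℓ Q u N := by
  obtain ⟨f, hf⟩ : ∃ f, WeakAct μ Q u f := by
    by_contra! hne
    have h1 : weakNorm (n := n) μ x ℓ P u = ⊤ := by
      refine iInf₂_eq_top.2 fun f hf => (hne f ((isWeakAction_iff h u f).1 hf)).elim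
    rw [h1] at hN
    exact ENNReal.coe_ne_top (top_le_iff.1 hN)
  refine ⟨f, hf, le_trans (le_iInf₂ fun f' hf' => ?_) hN⟩
  rw [wNorm_congr (hf.unique hQ ((isWeakAction_iff h u f').1 hf'))]
  exact eLpNorm_mono_measure _ Measure.restrict_le_self

theorem WeakBound.weakNorm_le {ℓ : ℝ} {P : (M → ℂ) → M → ℂ} {Q : TestOp n M}
    (h : ∀ ψ : testSpace n M, P ψ.1 = (Q ψ).1) {u : M → ℂ} {N : ℝ≥0}
    (hN : WeakBound μ x ℓ Q u N) : weakNorm (n := n) μ x ℓ P u ≤ N := by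
  obtain ⟨f, hf, hfN⟩ := hN
  have hm : MeasurableSet ((𝓡∂ n).interior M) := isOpen_interior.measurableSet
  -- the values on the boundary do not matter for the weak action, and can be taken to be zero
  refine (iInf₂_le (((𝓡∂ n).interior M).indicator f) ((isWeakAction_iff h u _).2
    (hf.congr EventuallyEq.rfl (indicator_ae_eq_restrict hm).symm))).trans ?_
  have h1 : (fun p => ((x p ^ (-ℓ) : ℝ) : ℂ) * ((𝓡∂ n).interior M).indicator f p)
      = ((𝓡∂ n).interior M).indicator fun p => ((x p ^ (-ℓ) : ℝ) : ℂ) * f p := by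
    funext p
    by_cases hp : p ∈ (𝓡∂ n).interior M <;> simp [hp]
  rw [h1, eLpNorm_indicator_eq_eLpNorm_restrict hm]
  exact hfN

namespace Generators

variable (G : Generators x g) (hx : IsBoundaryDefining n x)

theorem compWord_test (γ : ℝ) {a b d : ℕ} (w₀ : Fin a → G.MIdx) (w₁ : Fin b → G.MIdx)
    (w₂ : Fin d → G.NIdx) (ψ : testSpace n M) :
    compWord G.opSc w₀ (compWord (G.opM γ) w₁ (compWord G.opN w₂ ψ.1))
      = ((((List.ofFn w₀).map (G.sOp hx)).prod * (((List.ofFn w₁).map (G.lOp hx γ)).prod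
          * ((List.ofFn w₂).map fun i => G.lOp hx γ (some i)).prod)) ψ).1 := by
  have h0 : ∀ i (ψ : testSpace n M), G.opSc i ψ.1 = (G.sOp hx i ψ).1 := fun _ _ => rfl
  have h1 : ∀ i (ψ : testSpace n M), G.opM γ i ψ.1 = (G.lOp hx γ i ψ).1 := by
    rintro (_ | i) ψ <;> rfl
  have h2 : ∀ i (ψ : testSpace n M), G.opN i ψ.1 = (G.lOp hx γ (some i) ψ).1 := fun _ _ => rfl
  unfold compWord
  rw [foldr_test h2, foldr_test h1, foldr_test h0]
  rfl

theorem weakNorm_le_moduleNorm (γ ℓ : ℝ) {s κ k : ℕ} (a : Fin (s + 1)) (w₀ : Fin a → G.MIdx)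
    (b : Fin (κ + 1)) (w₁ : Fin b → G.MIdx) (d : Fin (k + 1)) (w₂ : Fin d → G.NIdx) (u : M → ℂ) :
    weakNorm (n := n) (riemannianMeasure g) x ℓ
      (fun ψ => compWord G.opSc w₀ (compWord (G.opM γ) w₁ (compWord G.opN w₂ ψ))) u
      ≤ moduleNorm G s ℓ κ k γ u := by
  set W := weakNorm (n := n) (riemannianMeasure g) x ℓ
      (fun ψ => compWord G.opSc w₀ (compWord (G.opM γ) w₁ (compWord G.opN w₂ ψ))) u
  have h1 : (W ^ 2) ^ (1 / 2 : ℝ) = W := by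
    rw [← ENNReal.rpow_natCast, ← ENNReal.rpow_mul]
    norm_num
  rw [← h1]
  refine ENNReal.rpow_le_rpow ?_ (by norm_num)
  have key : ∀ {ι : Type} [Fintype ι] (f : ι → ℝ≥0∞) (i : ι), f i ≤ ∑ i, f i := fun f i =>
    Finset.single_le_sum (fun _ _ => bot_le) (Finset.mem_univ i)
  refine le_trans ?_ (key _ a)
  refine le_trans ?_ (key _ w₀)
  refine le_trans ?_ (key _ b)
  refine le_trans ?_ (key _ w₁)
  refine le_trans ?_ (key _ d)
  exact key (fun w₂ : Fin d → G.NIdx => weakNorm (n := n) (riemannianMeasure g) x ℓ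
      (fun ψ => compWord G.opSc w₀ (compWord (G.opM γ) w₁ (compWord G.opN w₂ ψ))) u ^ 2) w₂

/-- A finite module norm bounds all the words. -/
theorem moduleBound_of_moduleNorm_le (hμ : FiniteInside n (riemannianMeasure g))
    (hV : ∀ j, HasTranspose (riemannianMeasure g) (fieldOp (G.field j) (G.field_smooth j)))
    {γ ℓ : ℝ} {s κ k : ℕ} {u : M → ℂ} {N : ℝ≥0} (h : moduleNorm G s ℓ κ k γ u ≤ N) :
    G.ModuleBound hx (riemannianMeasure g) γ ℓ s κ k u N := by
  intro s' hs a ha b hb Q hQ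
  obtain ⟨w₀, w₁, w₂, rfl, rfl, rfl, rfl⟩ := hQ.exists_lists
  refine weakBound_of_weakNorm_le (G.hasTranspose_word hx hμ hV hQ) (fun ψ => ?_)
    ((G.weakNorm_le_moduleNorm γ ℓ ⟨w₀.length, by omega⟩ w₀.get ⟨w₁.length, by omega⟩ w₁.get
      ⟨w₂.length, by omega⟩ w₂.get u).trans h)
  have := G.compWord_test hx γ w₀.get w₁.get w₂.get ψ
  rwa [List.ofFn_get, List.ofFn_get, List.ofFn_get] at this

/-- Bounds on all the words bound the module norm. -/
theorem exists_moduleNorm_le (s κ k : ℕ) : ∃ C : ℝ≥0, ∀ (γ ℓ : ℝ) (u : M → ℂ) (N : ℝ≥0),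
    G.ModuleBound hx (riemannianMeasure g) γ ℓ s κ k u N →
      moduleNorm G s ℓ κ k γ u ≤ (C * N : ℝ≥0) := by
  set K : ℕ := ∑ a : Fin (s + 1), ∑ _w₀ : Fin a → G.MIdx, ∑ b : Fin (κ + 1),
    ∑ _w₁ : Fin b → G.MIdx, ∑ d : Fin (k + 1), ∑ _w₂ : Fin d → G.NIdx, 1 with hK
  refine ⟨(K : ℝ≥0) ^ (1 / 2 : ℝ), fun γ ℓ u N h => ?_⟩
  have h1 : (((K : ℝ≥0) ^ (1 / 2 : ℝ) * N : ℝ≥0) : ℝ≥0∞) = ((K : ℝ≥0∞) * N ^ 2) ^ (1 / 2 : ℝ) := by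
    rw [ENNReal.mul_rpow_of_nonneg _ _ (by norm_num), ← ENNReal.rpow_natCast, ← ENNReal.rpow_mul,
      ENNReal.coe_mul, ENNReal.coe_rpow_of_nonneg _ (by norm_num)]
    norm_num
  rw [h1]
  refine ENNReal.rpow_le_rpow ?_ (by norm_num)
  rw [hK]
  push_cast
  simp only [Finset.sum_mul, one_mul]
  refine Finset.sum_le_sum fun a _ => Finset.sum_le_sum fun w₀ _ => Finset.sum_le_sum fun b _ =>
    Finset.sum_le_sum fun w₁ _ => Finset.sum_le_sum fun d _ => Finset.sum_le_sum fun w₂ _ => ?_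
  have hw := orderedWord_of_lists (L := G.lOp hx γ) (σ := G.sOp hx) (j := some)
    (List.ofFn w₀) (List.ofFn w₁) (List.ofFn w₂)
  simp only [List.length_ofFn] at hw
  exact pow_le_pow_left' (WeakBound.weakNorm_le (G.compWord_test hx γ w₀ w₁ w₂)
    (h a (by omega) b (by omega) d (by omega) _ hw)) 2

end Generators

end ModuleNorm

end ScatteringProduct

theorem corollary2p7 {n : ℕ} [NeZero n] {M : Type*} [TopologicalSpace M]
    [ChartedSpace (EuclideanHalfSpace n) M] [IsManifold (𝓡∂ n) ∞ M] [CompactSpace M] [T2Space M]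
    [MeasurableSpace M] [BorelSpace M]
    {x : M → ℝ} {g : ScatteringProduct.BilinField n M}
    (hg : ScatteringProduct.IsAsymptoticallyConic x g)
    (G : ScatteringProduct.Generators x g)
    (p : ℕ) (hp : 1 ≤ p) (s κ k : ℕ) (hκ : 1 ≤ κ) (hk : ((n : ℝ) - 1) / 2 ≤ k)
    (γ : Fin (p + 1) → ℝ) (ℓ : Fin p → ℝ) :
    ∃ C : ℝ≥0, ∀ u : Fin p → M → ℂ,
      (∀ j, ScatteringProduct.MemModule G s (ℓ j) κ k (γ j.castSucc) (u j)) →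
      ScatteringProduct.MemModule G s ((∑ j, ℓ j) + ((p : ℝ) - 1) * n / 2 - κ) κ k (γ (Fin.last p))
          (fun z => ∏ j, u j z) ∧
        ScatteringProduct.moduleNorm G s ((∑ j, ℓ j) + ((p : ℝ) - 1) * n / 2 - κ) κ k
            (γ (Fin.last p)) (fun z => ∏ j, u j z) ≤
          C * ∏ j, ScatteringProduct.moduleNorm G s (ℓ j) κ k (γ j.castSucc) (u j) := by
  have hx := hg.boundaryDefining
  obtain ⟨𝒞⟩ := ScatteringProduct.exists_modelCover hg G
  have hμ := ScatteringProduct.finiteInside_riemannianMeasure hg G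
  have hV := ScatteringProduct.hasTranspose_field 𝒞 hμ
  have hn : n ≤ 2 * k + 1 := by
    have : (n : ℝ) ≤ 2 * k + 1 := by linarith
    exact_mod_cast this
  obtain ⟨q, rfl⟩ : ∃ q, p = q + 1 := ⟨p - 1, by omega⟩
  obtain ⟨C₁, h₁⟩ := G.exists_moduleBound_prod hx 𝒞 hμ hV s hn hκ q (fun j => γ j.castSucc) ℓ
  obtain ⟨C₂, h₂⟩ := G.exists_moduleBound_change hx 𝒞 hμ hV (∑ j, γ (Fin.castSucc j))
    (γ (Fin.last _)) (∑ j, ℓ j + q * n / 2) s κ k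
  obtain ⟨C₃, h₃⟩ := G.exists_moduleNorm_le hx s κ k
  refine ⟨C₃ * (C₂ * C₁), fun u hu => ?_⟩
  have hN : ∀ j, ScatteringProduct.moduleNorm G s (ℓ j) κ k (γ j.castSucc) (u j)
      = (ScatteringProduct.moduleNorm G s (ℓ j) κ k (γ j.castSucc) (u j)).toNNReal := fun j =>
    (ENNReal.coe_toNNReal (hu j).ne).symm
  have key := h₃ _ _ _ _ (h₂ _ _ (h₁ u _ fun j =>
    G.moduleBound_of_moduleNorm_le hx hμ hV (hN j).le))
  have hℓ : (∑ j, ℓ j) + (((q + 1 : ℕ) : ℝ) - 1) * n / 2 = ∑ j, ℓ j + q * n / 2 := by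
    push_cast
    ring
  rw [hℓ]
  refine ⟨key.trans_lt ENNReal.coe_lt_top, key.trans (le_of_eq ?_)⟩
  rw [Finset.prod_congr rfl fun j _ => hN j]
  push_cast
  ring
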